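/- **Theorem 6.1.** Let $n\ge 1$ and $0<p,q<\infty$. For measurable $f$ on $\mathbb R^n$ let $Mf(x)=\sup_{B}\frac1{|B|}\int_B|f|$, the supremum being over all balls $B$ centred at $x$; let $f^*(t)=\inf\{s>0:|\{|f|>s\}|\le t\}$, $f^{**}(x)=\frac1x\int_0^x f^*$. For measurable $v:(0,\infty)\to[0,\infty]$ let $\|f\|_{\Gamma^p(v)}=\big(\int_0^\infty (f^{**})^p v\big)^{1/p}$, $\Gamma^p(v)=\{f:\|f\|_{\Gamma^p(v)}<\infty\}$, and $$\|M\|_{\Gamma^p(v)\to\Gamma^q(u)}=\sup_{0\ne f\in\Gamma^p(v)}\frac{\|Mf\|_{\Gamma^q(u)}}{\|f\|_{\Gamma^p(v)}},$$ where $f=0$ is understood almost everywhere. Put $$V(z)=\int_0^\infty\frac{v(y)\,dy}{y^p+z^p},\qquad U(t)=\int_t^\infty s^{-q}u(s)\,ds,$$ $$\zeta(x)=\sup\{y>0:U(y)\ge\tfrac12U(x)\},\qquad \zeta^{-1}(x)=\sup\{y>0:U(y)\ge 2U(x)\}\qquad(\sup\varnothing=0),$$ $\zeta^2=\zeta\circ\zeta$,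 $\zeta^{-2}=\zeta^{-1}\circ\zeta^{-1}$, and $\omega(x)=x^{-q}u(x)\big(\log\frac{x}{\zeta^{-2}(x)}\big)^q$. All expressions are taken in $[0,\infty]$, with $0\cdot\infty=\frac\infty\infty=\frac00=0$, $\frac a0=\infty$ for $a>0$ and $\log\infty=\infty$. If $p\le q$, define $$\mathcal A_0^p=\sup_{t>0}\frac{\big(\int_0^t u\big)^{p/q}}{t^pV(t)},\qquad \mathbf A_0^p=\sup_{t>0}\frac{\big(\int_{\zeta^2(t)}^\infty\omega\big)^{p/q}}{V(t)},$$ and, for $p\le1$, $$\mathcal A_2=\sup_{t>0}U(t)^{1/q}V(t)^{-1/p},\qquad \mathbf A_2=\sup_{t>0}U(t)^{1/q}\sup_{0<s<t}V(s)^{-1/p}\log\tfrac ts,$$ while for $p>1$ $$\mathcal A_2=\sup_{t>0}U(t)^{1/q}\Big(\int_0^tV(x)^{\frac1{1-p}}\frac{dx}x\Big)^{\frac{p-1}p},\qquad \mathbf A_2=\sup_{t>0}U(t)^{1/q}\Big(\int_0^tV(x)^{\frac1{1-p}}\big(\log\tfrac tx\big)^{\frac1{p-1}}\frac{dx}x\Big)^{\frac{p-1}p}.$$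 If $q<p$, define $$\mathcal A_0^p=\Big(\int_0^\infty[t^pV(t)]^{\frac q{q-p}}\Big(\int_0^tu\Big)^{\frac q{p-q}}u(t)\,dt\Big)^{\frac{p-q}q},\qquad \mathbf A_0^p=\Big(\int_0^\infty\Big(\frac{\int_x^\infty\omega}{V(\zeta^{-2}(x))}\Big)^{\frac q{p-q}}\omega(x)\,dx\Big)^{\frac{p-q}q},$$ and, for $p\le1$, $$\mathcal A_2=\Big(\int_0^\infty x^{-q}u(x)U(x)^{\frac q{p-q}}\Big[\frac{\zeta(x)-\zeta^{-1}(x)}{\zeta(x)V(\zeta(x))^{1/p}}\Big]^{\frac{pq}{p-q}}dx\Big)^{\frac{p-q}{pq}},$$ $$\mathbf A_2=\Big(\int_0^\infty x^{-q}u(x)U(x)^{\frac q{p-q}}\Big[\sup_{s\in(\zeta^{-1}(x),\zeta(x))}\frac{\big(\log\frac{\zeta(x)}s\big)^p}{V(s)}\Big]^{\frac q{p-q}}dx\Big)^{\frac{p-q}{pq}},$$ while for $p>1$ $$\mathcal A_2=\Big(\int_0^\infty x^{-q}u(x)U(x)^{\frac q{p-q}}\Big(\int_{\zeta^{-1}(x)}^{\zeta(x)}\Big(\frac{t-\zeta^{-1}(x)}{t^pV(t)}\Big)^{\frac1{p-1}}dt\Big)^{\frac{q(p-1)}{p-q}}dx\Big)^{\frac{p-q}{pq}},$$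 $$\mathbf A_2=\Big(\int_0^\infty x^{-q}u(x)U(x)^{\frac q{p-q}}\Big(\int_{\zeta^{-1}(x)}^{\zeta(x)}\Big(\frac{\log\frac{\zeta(x)}t}{V(t)}\Big)^{\frac1{p-1}}\frac{dt}t\Big)^{\frac{q(p-1)}{p-q}}dx\Big)^{\frac{p-q}{pq}}.$$ Then there are constants $0<c\le C<\infty$, depending only on $n,p,q$, such that for all measurable $u,v:(0,\infty)\to[0,\infty]$ with $0<U(t)<\infty$ for every $t>0$, $$c\,(\mathcal A_0+\mathcal A_2+\mathbf A_0+\mathbf A_2)\le\|M\|_{\Gamma^p(v)\to\Gamma^q(u)}\le C\,(\mathcal A_0+\mathcal A_2+\mathbf A_0+\mathbf A_2).$$ -/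

import Mathlib

open MeasureTheory Set
open scoped ENNReal

noncomputable section

namespace GammaMaximal

/-- The centred Hardy-Littlewood maximal function of `f : ℝⁿ → ℝ`, with values in `[0, ∞]`. -/
def maximal {n : ℕ} (f : EuclideanSpace ℝ (Fin n) → ℝ) (x : EuclideanSpace ℝ (Fin n)) : ℝ≥0∞ :=
  ⨆ (r : ℝ) (_ : 0 < r),
    (∫⁻ y in Metric.ball x r, ‖f y‖ₑ) / volume (Metric.ball x r)

/-- The decreasing rearrangement `g^*(t) = inf {s > 0 : mes {g > s} ≤ t}` of a function
with values in `[0, ∞]`. -/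
def rearr {n : ℕ} (g : EuclideanSpace ℝ (Fin n) → ℝ≥0∞) (t : ℝ) : ℝ≥0∞ :=
  sInf {s : ℝ≥0∞ | 0 < s ∧ volume {x | s < g x} ≤ ENNReal.ofReal t}

/-- The averaged rearrangement `g^{**}(x) = (1/x) ∫_0^x g^*(t) dt`. -/
def rearrAvg {n : ℕ} (g : EuclideanSpace ℝ (Fin n) → ℝ≥0∞) (x : ℝ) : ℝ≥0∞ :=
  (∫⁻ t in Ioo 0 x, rearr g t) / ENNReal.ofReal x

/-- The functional `‖g‖_{Γ^p(v)} = (∫_0^∞ g^{**}(x)^p v(x) dx)^{1/p}`. -/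
def gammaNorm {n : ℕ} (p : ℝ) (v : ℝ → ℝ≥0∞) (g : EuclideanSpace ℝ (Fin n) → ℝ≥0∞) : ℝ≥0∞ :=
  (∫⁻ x in Ioi (0 : ℝ), rearrAvg g x ^ p * v x) ^ (1 / p)

/-- The Lorentz space `Γ^p(v)` of (Lebesgue) measurable functions on `ℝⁿ`. -/
def gammaSpace (n : ℕ) (p : ℝ) (v : ℝ → ℝ≥0∞) : Set (EuclideanSpace ℝ (Fin n) → ℝ) :=
  {f | AEMeasurable f volume ∧ gammaNorm p v (fun x => ‖f x‖ₑ) < ∞}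

/-- `‖M‖_{Γ^p(v) → Γ^q(u)}`: the supremum of `‖M f‖_{Γ^q(u)} / ‖f‖_{Γ^p(v)}` over the
`f ∈ Γ^p(v)` that are not almost everywhere zero. -/
def maximalNorm (n : ℕ) (p q : ℝ) (v u : ℝ → ℝ≥0∞) : ℝ≥0∞ :=
  ⨆ (f : EuclideanSpace ℝ (Fin n) → ℝ) (_ : f ∈ gammaSpace n p v) (_ : ¬ f =ᵐ[volume] 0),
    gammaNorm q u (maximal f) / gammaNorm p v (fun x => ‖f x‖ₑ)

/-- `V(z) = ∫_0^∞ v(y) / (y^p + z^p) dy`. -/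
def bigV (p : ℝ) (v : ℝ → ℝ≥0∞) (z : ℝ) : ℝ≥0∞ :=
  ∫⁻ y in Ioi (0 : ℝ), v y / (ENNReal.ofReal y ^ p + ENNReal.ofReal z ^ p)

/-- The weight `x^{-q} u(x)`. -/
def wt (q : ℝ) (u : ℝ → ℝ≥0∞) (x : ℝ) : ℝ≥0∞ :=
  ENNReal.ofReal x ^ (-q) * u x

/-- `U(t) = ∫_t^∞ s^{-q} u(s) ds`. -/
def tail (q : ℝ) (u : ℝ → ℝ≥0∞) (t : ℝ) : ℝ≥0∞ :=
  ∫⁻ s in Ioi t, wt q u s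

/-- `ζ(x) = sup {y > 0 : U(y) ≥ U(x) / 2}`; here `sSup ∅ = 0`, as wanted. -/
def zeta (q : ℝ) (u : ℝ → ℝ≥0∞) (x : ℝ) : ℝ :=
  sSup {y : ℝ | 0 < y ∧ tail q u x / 2 ≤ tail q u y}

/-- `ζ^{-1}(x) = sup {y > 0 : U(y) ≥ 2 U(x)}`; here `sSup ∅ = 0`, as wanted. -/
def zetaInv (q : ℝ) (u : ℝ → ℝ≥0∞) (x : ℝ) : ℝ :=
  sSup {y : ℝ | 0 < y ∧ 2 * tail q u x ≤ tail q u y}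

/-- `ζ^2 = ζ ∘ ζ`. -/
def zeta2 (q : ℝ) (u : ℝ → ℝ≥0∞) (x : ℝ) : ℝ := zeta q u (zeta q u x)

/-- `ζ^{-2} = ζ^{-1} ∘ ζ^{-1}`. -/
def zetaInv2 (q : ℝ) (u : ℝ → ℝ≥0∞) (x : ℝ) : ℝ := zetaInv q u (zetaInv q u x)

/-- `log (x / y) ∈ [0, ∞]` for `0 ≤ y ≤ x`, `0 < x`, with `log (x / 0) = ∞`. -/
def logRatio (x y : ℝ) : ℝ≥0∞ :=
  if y = 0 then ∞ else ENNReal.ofReal (Real.log (x / y))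

/-- The weight `x^{-q} u(x) (log (x / ζ^{-2}(x)))^q`. -/
def logWt (q : ℝ) (u : ℝ → ℝ≥0∞) (x : ℝ) : ℝ≥0∞ :=
  wt q u x * logRatio x (zetaInv2 q u x) ^ q

/-- The constant `𝒜₀`. -/
def calA0 (p q : ℝ) (v u : ℝ → ℝ≥0∞) : ℝ≥0∞ :=
  if p ≤ q then
    (⨆ (t : ℝ) (_ : 0 < t),
      (∫⁻ x in Ioo 0 t, u x) ^ (p / q) / (ENNReal.ofReal t ^ p * bigV p v t)) ^ (1 / p)
  else
    ((∫⁻ t in Ioi (0 : ℝ),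
      (ENNReal.ofReal t ^ p * bigV p v t) ^ (q / (q - p)) *
        (∫⁻ x in Ioo 0 t, u x) ^ (q / (p - q)) * u t) ^ ((p - q) / q)) ^ (1 / p)

/-- The constant `𝐀₀`. -/
def bfA0 (p q : ℝ) (v u : ℝ → ℝ≥0∞) : ℝ≥0∞ :=
  if p ≤ q then
    (⨆ (t : ℝ) (_ : 0 < t),
      (∫⁻ x in Ioi (zeta2 q u t), logWt q u x) ^ (p / q) / bigV p v t) ^ (1 / p)
  else
    ((∫⁻ x in Ioi (0 : ℝ),
      ((∫⁻ s in Ioi x, logWt q u s) / bigV p v (zetaInv2 q u x)) ^ (q / (p - q)) *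
        logWt q u x) ^ ((p - q) / q)) ^ (1 / p)

/-- The constant `𝒜₂`. -/
def calA2 (p q : ℝ) (v u : ℝ → ℝ≥0∞) : ℝ≥0∞ :=
  if p ≤ q then
    if p ≤ 1 then
      ⨆ (t : ℝ) (_ : 0 < t), tail q u t ^ (1 / q) * bigV p v t ^ (-1 / p)
    else
      ⨆ (t : ℝ) (_ : 0 < t), tail q u t ^ (1 / q) *
        (∫⁻ x in Ioo 0 t, bigV p v x ^ (1 / (1 - p)) / ENNReal.ofReal x) ^ ((p - 1) / p)
  else
    if p ≤ 1 then
      (∫⁻ x in Ioi (0 : ℝ), wt q u x * tail q u x ^ (q / (p - q)) *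
        (ENNReal.ofReal (zeta q u x - zetaInv q u x) /
          (ENNReal.ofReal (zeta q u x) * bigV p v (zeta q u x) ^ (1 / p))) ^ (p * q / (p - q)))
        ^ ((p - q) / (p * q))
    else
      (∫⁻ x in Ioi (0 : ℝ), wt q u x * tail q u x ^ (q / (p - q)) *
        (∫⁻ t in Ioo (zetaInv q u x) (zeta q u x),
          (ENNReal.ofReal (t - zetaInv q u x) /
            (ENNReal.ofReal t ^ p * bigV p v t)) ^ (1 / (p - 1))) ^ (q * (p - 1) / (p - q)))
        ^ ((p - q) / (p * q))

/-- The constant `𝐀₂`. -/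
def bfA2 (p q : ℝ) (v u : ℝ → ℝ≥0∞) : ℝ≥0∞ :=
  if p ≤ q then
    if p ≤ 1 then
      ⨆ (t : ℝ) (_ : 0 < t), tail q u t ^ (1 / q) *
        ⨆ (s : ℝ) (_ : s ∈ Ioo 0 t), bigV p v s ^ (-1 / p) * logRatio t s
    else
      ⨆ (t : ℝ) (_ : 0 < t), tail q u t ^ (1 / q) *
        (∫⁻ x in Ioo 0 t, bigV p v x ^ (1 / (1 - p)) * logRatio t x ^ (1 / (p - 1)) /
          ENNReal.ofReal x) ^ ((p - 1) / p)
  else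
    if p ≤ 1 then
      (∫⁻ x in Ioi (0 : ℝ), wt q u x * tail q u x ^ (q / (p - q)) *
        (⨆ (s : ℝ) (_ : s ∈ Ioo (zetaInv q u x) (zeta q u x)),
          logRatio (zeta q u x) s ^ p / bigV p v s) ^ (q / (p - q)))
        ^ ((p - q) / (p * q))
    else
      (∫⁻ x in Ioi (0 : ℝ), wt q u x * tail q u x ^ (q / (p - q)) *
        (∫⁻ t in Ioo (zetaInv q u x) (zeta q u x),
          (logRatio (zeta q u x) t / bigV p v t) ^ (1 / (p - 1)) / ENNReal.ofReal t)
            ^ (q * (p - 1) / (p - q)))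
        ^ ((p - q) / (p * q))

end GammaMaximal

end

namespace GammaMaximal

section

/-! ### Hardy inequalities for monotone weights -/

/-! The theorem is a weighted Hardy inequality in disguise. By Herz's equivalence `(Mf)^*` is
comparable to `f^{**}`: the upper bound is `rearr_maximal_le`, and the lower bound is needed only
for radial step functions (`exists_radial_step`). So `(Mf)^{**}(x)` is comparable to `(1/x) ∫_0^x
f^{**}`, and the norm of `M` is the best constant in a Hardy inequality restricted to functions `g`
such that `g` decreases and `y g(y)` increases.

For such `g` the function `z ↦ z g(z^{1/p})^p` is quasi-concave. By `exists_grid` it is comparable,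
on any compact range, to a positive combination of functions `min(1, z/c)`; hence `g^p` is
comparable to `∫ max(s,y)^{-p} dσ(s)` for some measure `σ`, that is, `g` is comparable to `gKer p
σ`. Since `∫ max(s,y)^{-p} v(y) dy` is comparable to `V(s)`, the norm of `g` becomes `(∫ V
dσ)^{1/p}`. What remains is the inequality `TestBound`, in which the unknown is a measure.

To analyse it, `(0,∞)` is cut into blocks at the points `pt k` where the tail `U` equals `2^{-k/3}`.
The levels being geometric, `lintegral_rpow_mul_wt_le` replaces the left side by the sum of `τ_k
(∫_{block k} gKer p σ)^q`. On block `k` the measure splits into three parts. Mass far to the left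
contributes a logarithm times a power of `σ(Iic _)`, and mass far to the right contributes a length
times a power of `∫ s^{-p} dσ`; summed over `k`, these are Hardy inequalities governed by `bfA0` and
`calA0`. The mass near the block obeys a local inequality with constants `innerA` and `innerB`, from
which `calA2` and `bfA2` are built; the local terms are summed by `∑ β^{q/p} ≤ (∑ β)^{q/p}` if `p ≤
q` and by Hölder's inequality if `q < p` (`tsum_local_le`).

Every Hardy inequality here has the form `∫ σ(Iic (ψ x))^r dρ ≤ C (∫ V dσ)^r`, with `ψ` increasing
and `V` decreasing, or its mirror image; `r = 1/p` in the local and `r = q/p` in the global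
estimates. For `r ≥ 1` the condition is the one obtained from point masses (`hardy_one_le`), for `r
< 1` it is an integral condition (`hardy_lt_one`, `hardy_lt_one_necessity`). Measures may have
atoms, so integration by parts is replaced by half-mass arguments.

Conversely, each constant is bounded by inserting test measures in `TestBound`: point masses, the
extremal measures of the Hardy inequalities and, for the second pair with `q < p`, a superposition
of nearly extremal local measures (`TestBound.sum_le`). The cases `V = 0` and `V = ∞` are treated
separately. -/

theorem measure_upperSet_le {ρ : Measure ℝ} {D : Set ℝ} (hD : IsUpperSet D) {c : ℝ≥0∞}
    (h : ∀ z ∈ D, ρ (Ici z) ≤ c) : ρ D ≤ c := by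
  -- With a least element the set lies in a closed half-line. Without one it is covered by a
  -- directed countable family of half-lines with rational endpoints, and continuity from below
  -- needs no finiteness.
  by_cases hm : ∃ z ∈ D, ∀ y ∈ D, z ≤ y
  · obtain ⟨z, hz, hzD⟩ := hm
    exact (measure_mono fun y hy => hzD y hy).trans (h z hz)
  push Not at hm
  have hU : D ⊆ ⋃ i : {q : ℚ // (q : ℝ) ∈ D}, Ici ((i : ℚ) : ℝ) := by
    intro z hz
    obtain ⟨y, hy, hyz⟩ := hm z hz
    obtain ⟨q, hq1, hq2⟩ := exists_rat_btwn hyz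
    exact mem_iUnion.2 ⟨⟨q, hD hq1.le hy⟩, hq2.le⟩
  have hdir : Directed (fun x1 x2 => x1 ⊆ x2)
      (fun i : {q : ℚ // (q : ℝ) ∈ D} => Ici ((i : ℚ) : ℝ)) := by
    intro i j
    rcases le_total (i : ℚ) (j : ℚ) with hij | hij
    · exact ⟨i, subset_rfl, Ici_subset_Ici.2 (by exact_mod_cast hij)⟩
    · exact ⟨j, Ici_subset_Ici.2 (by exact_mod_cast hij), subset_rfl⟩
  refine (measure_mono hU).trans ?_
  rw [hdir.measure_iUnion]
  exact iSup_le fun i => h _ i.2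

theorem measure_lowerSet_le {ρ : Measure ℝ} {D : Set ℝ} (hD : IsLowerSet D) {c : ℝ≥0∞}
    (h : ∀ z ∈ D, ρ (Iic z) ≤ c) : ρ D ≤ c := by
  have key := measure_upperSet_le (ρ := ρ.map (MeasurableEquiv.neg ℝ)) (D := Neg.neg ⁻¹' D) (c := c)
    (fun a b hab ha => hD (neg_le_neg hab) ha) (by
      intro z hz
      rw [MeasurableEquiv.map_apply]
      refine le_trans (measure_mono ?_) (h _ hz)
      intro y hy
      simp only [MeasurableEquiv.neg_apply, mem_preimage, mem_Ici] at hy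
      exact le_neg.1 hy)
  rw [MeasurableEquiv.map_apply] at key
  refine le_trans (measure_mono ?_) key
  intro y hy
  simpa using hy

theorem lintegral_setLIntegral_swap {ρ σ : Measure ℝ} [SFinite ρ] [SFinite σ]
    {R : ℝ → ℝ → Prop} (hR : MeasurableSet {z : ℝ × ℝ | R z.1 z.2}) {f g : ℝ → ℝ≥0∞}
    (hf : Measurable f) (hg : Measurable g) :
    ∫⁻ x, g x * ∫⁻ s in {s | R x s}, f s ∂σ ∂ρ =
      ∫⁻ s, f s * ∫⁻ x in {x | R x s}, g x ∂ρ ∂σ := by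
  have h1 : ∀ x, g x * ∫⁻ s in {s | R x s}, f s ∂σ =
      ∫⁻ s, {z : ℝ × ℝ | R z.1 z.2}.indicator (fun z => g z.1 * f z.2) (x, s) ∂σ := by
    intro x
    have hx : MeasurableSet {s | R x s} := hR.preimage measurable_prodMk_left
    rw [← lintegral_const_mul _ hf, ← lintegral_indicator hx]
    rfl
  have h2 : ∀ s, f s * ∫⁻ x in {x | R x s}, g x ∂ρ =
      ∫⁻ x, {z : ℝ × ℝ | R z.1 z.2}.indicator (fun z => g z.1 * f z.2) (x, s) ∂ρ := by
    intro s
    have hx : MeasurableSet {x | R x s} := hR.preimage measurable_prodMk_right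
    rw [← lintegral_const_mul _ hg, ← lintegral_indicator hx]
    refine lintegral_congr fun x => ?_
    simp only [indicator, mem_ofPred_eq, mul_comm]
  simp_rw [h1, h2]
  refine lintegral_lintegral_swap (Measurable.aemeasurable ?_)
  exact ((hg.comp measurable_fst).mul (hf.comp measurable_snd)).indicator hR

theorem monotone_measure_Iic (σ : Measure ℝ) : Monotone fun s => σ (Iic s) :=
  fun _ _ h => measure_mono (Iic_subset_Iic.2 h)

theorem antitone_measure_Ici (σ : Measure ℝ) : Antitone fun s => σ (Ici s) :=
  fun _ _ h => measure_mono (Ici_subset_Ici.2 h)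

/-- Stands in for integrating `d(T^r)`, an identity that atoms destroy: at least half of the mass of
`Iic S` sits at points whose cumulative mass is at least half of the total. -/
theorem rpow_measure_Iic_le {σ : Measure ℝ} {r : ℝ} (hr : 1 ≤ r) {S : ℝ} (hS : σ (Iic S) < ∞) :
    σ (Iic S) ^ r ≤ 2 ^ r * ∫⁻ s in Iic S, σ (Iic s) ^ (r - 1) ∂σ := by
  set T := σ (Iic S) with hT
  set E := {s | s ≤ S ∧ T / 2 ≤ σ (Iic s)}
  have hE : T / 2 ≤ σ E := by
    have h1 : σ {s | σ (Iic s) < T / 2} ≤ T / 2 :=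
      measure_lowerSet_le (fun a b hab ha => lt_of_le_of_lt (monotone_measure_Iic σ hab) ha)
        fun z hz => le_of_lt hz
    have h2 : T ≤ σ E + T / 2 := by
      calc T ≤ σ (E ∪ {s | σ (Iic s) < T / 2}) := measure_mono fun s hs => by
            by_cases h : T / 2 ≤ σ (Iic s)
            · exact Or.inl ⟨hs, h⟩
            · exact Or.inr (not_le.1 h)
        _ ≤ σ E + σ {s | σ (Iic s) < T / 2} := measure_union_le _ _
        _ ≤ _ := by gcongr
    have h3 : T / 2 + T / 2 ≤ σ E + T / 2 := by rwa [ENNReal.add_halves]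
    exact (ENNReal.add_le_add_iff_right (ENNReal.div_lt_top hS.ne (by simp)).ne).1 h3
  have hEm : MeasurableSet E :=
    measurableSet_Iic.inter (measurableSet_le measurable_const (monotone_measure_Iic σ).measurable)
  have h4 : (T / 2) ^ r ≤ ∫⁻ s in Iic S, σ (Iic s) ^ (r - 1) ∂σ := by
    calc (T / 2) ^ r = (T / 2) ^ (r - 1) * (T / 2) := by
          conv_lhs => rw [show r = (r - 1) + 1 by ring]
          rw [ENNReal.rpow_add_of_nonneg _ _ (by linarith) zero_le_one, ENNReal.rpow_one]
      _ ≤ (T / 2) ^ (r - 1) * σ E := by gcongr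
      _ = ∫⁻ _ in E, (T / 2) ^ (r - 1) ∂σ := by rw [setLIntegral_const]
      _ ≤ ∫⁻ s in E, σ (Iic s) ^ (r - 1) ∂σ := setLIntegral_mono' hEm fun s hs =>
          ENNReal.rpow_le_rpow hs.2 (by linarith)
      _ ≤ _ := lintegral_mono_set fun s hs => hs.1
  calc T ^ r = (2 * (T / 2)) ^ r := by rw [ENNReal.mul_div_cancel (by simp) (by simp)]
    _ = 2 ^ r * (T / 2) ^ r := ENNReal.mul_rpow_of_nonneg _ _ (by linarith)
    _ ≤ _ := by gcongr

theorem measure_Iic_mul_le {σ : Measure ℝ} {V : ℝ → ℝ≥0∞} (hV : Antitone V) (s : ℝ) :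
    σ (Iic s) * V s ≤ ∫⁻ s, V s ∂σ := by
  calc σ (Iic s) * V s = ∫⁻ _ in Iic s, V s ∂σ := by rw [setLIntegral_const, mul_comm]
    _ ≤ ∫⁻ t in Iic s, V t ∂σ := setLIntegral_mono' measurableSet_Iic fun t ht => hV ht
    _ ≤ _ := setLIntegral_le_lintegral _ _

/-- By `rpow_measure_Iic_le` and Tonelli the left side is at most `2^r ∫ σ(Iic s)^{r-1} ρ{s ≤ ψ}
dσ(s)`. The hypothesis on `ρ` turns the integrand into `K (σ(Iic s) V s)^{r-1} V s`, and `σ(Iic s) V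
s ≤ ∫ V dσ` because `V` decreases. -/
theorem hardy_one_le {ρ σ : Measure ℝ} [SFinite ρ] [SFinite σ] {r : ℝ} (hr : 1 ≤ r)
    {ψ : ℝ → ℝ} (hψ : Monotone ψ) {V : ℝ → ℝ≥0∞} (hV : Antitone V) {K : ℝ≥0∞}
    (hK : ∀ᵐ s ∂σ, ρ {x | s ≤ ψ x} ≤ K * V s ^ r) (hσ : ∀ᵐ x ∂ρ, σ (Iic (ψ x)) < ∞) :
    ∫⁻ x, σ (Iic (ψ x)) ^ r ∂ρ ≤ 2 ^ r * K * (∫⁻ s, V s ∂σ) ^ r := by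
  have hm : Measurable fun s => σ (Iic s) ^ (r - 1) :=
    (monotone_measure_Iic σ).measurable.pow_const _
  have hR : MeasurableSet {z : ℝ × ℝ | z.2 ≤ ψ z.1} :=
    measurableSet_le measurable_snd (hψ.measurable.comp measurable_fst)
  have hsw := lintegral_setLIntegral_swap (ρ := ρ) (σ := σ) (R := fun x s => s ≤ ψ x) hR hm
    (measurable_const (a := (1 : ℝ≥0∞)))
  simp only [one_mul, setLIntegral_one] at hsw
  calc ∫⁻ x, σ (Iic (ψ x)) ^ r ∂ρ
      ≤ ∫⁻ x, 2 ^ r * ∫⁻ s in {s | s ≤ ψ x}, σ (Iic s) ^ (r - 1) ∂σ ∂ρ :=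
        lintegral_mono_ae (hσ.mono fun x hx => rpow_measure_Iic_le hr hx)
    _ = 2 ^ r * ∫⁻ s, σ (Iic s) ^ (r - 1) * ρ {x | s ≤ ψ x} ∂σ := by
        rw [lintegral_const_mul' _ _ (ENNReal.rpow_ne_top_of_nonneg (by linarith) (by simp)), hsw]
    _ ≤ 2 ^ r * ∫⁻ s, K * ((∫⁻ s, V s ∂σ) ^ (r - 1)) * V s ∂σ := by
        refine mul_le_mul' le_rfl (lintegral_mono_ae (hK.mono fun s hs => ?_))
        calc σ (Iic s) ^ (r - 1) * ρ {x | s ≤ ψ x} ≤ σ (Iic s) ^ (r - 1) * (K * V s ^ r) := by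
                gcongr
          _ = K * (σ (Iic s) * V s) ^ (r - 1) * V s := by
              rw [ENNReal.mul_rpow_of_nonneg _ _ (by linarith)]
              conv_lhs => rw [show r = (r - 1) + 1 by ring]
              rw [ENNReal.rpow_add_of_nonneg _ _ (by linarith) zero_le_one, ENNReal.rpow_one]
              simp only [add_sub_cancel_right]
              ring
          _ ≤ _ := by
              gcongr
              exact measure_Iic_mul_le hV s
    _ = _ := by
        rw [lintegral_const_mul _ hV.measurable]
        nth_rw 4 [show r = (r - 1) + 1 by ring]
        rw [ENNReal.rpow_add_of_nonneg _ _ (by linarith) zero_le_one, ENNReal.rpow_one]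
        ring

/-- A mean value property of the functions `v(x) ρ[x, ∞)` with `v` increasing. -/
theorem rpow_mul_measure_Ici_le {ρ : Measure ℝ} [IsFiniteMeasure ρ] {b : ℝ} (hb : 0 < b)
    {v : ℝ → ℝ≥0∞} (hv : Monotone v) {x y : ℝ} (hyx : y ≤ x) :
    (v y * ρ (Ici y)) ^ b ≤ 2 ^ (b + 1) * ((v x * ρ (Ici x)) ^ b +
      ∫⁻ z in Iic x, (v z * ρ (Ici z)) ^ b / ρ (Ici z) ∂ρ) := by
  have h2b : (2 : ℝ≥0∞) ^ (b + 1) = 2 ^ b * 2 := by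
    rw [ENNReal.rpow_add_of_nonneg _ _ hb.le zero_le_one, ENNReal.rpow_one]
  by_cases hy0 : ρ (Ici y) = 0
  · simp [hy0, ENNReal.zero_rpow_of_pos hb]
  by_cases hx : ρ (Ici y) / 2 ≤ ρ (Ici x)
  · have h1 : ρ (Ici y) ≤ 2 * ρ (Ici x) := by
      rw [mul_comm]; exact (ENNReal.div_le_iff (by simp) (by simp)).1 hx
    calc (v y * ρ (Ici y)) ^ b ≤ (v x * (2 * ρ (Ici x))) ^ b := by
          gcongr; exact hv hyx
      _ = 2 ^ b * (v x * ρ (Ici x)) ^ b := by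
          rw [← ENNReal.mul_rpow_of_nonneg _ _ hb.le]; congr 1; ring
      _ ≤ 2 ^ (b + 1) * (v x * ρ (Ici x)) ^ b := by
          gcongr
          · norm_num
          · linarith
      _ ≤ _ := by gcongr; exact le_self_add
  -- Here at least half of the mass beyond `y` sits at points `z` with `ρ (Ici z) ≥ w / 2`. All of
  -- them are at most `x`, so the integral term alone dominates.
  · push Not at hx
    set w := ρ (Ici y) with hw
    set E := {z | y ≤ z ∧ w / 2 ≤ ρ (Ici z)}
    have hwt : w < ∞ := measure_lt_top _ _
    have hEm : MeasurableSet E := measurableSet_Ici.inter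
      (measurableSet_le measurable_const (antitone_measure_Ici ρ).measurable)
    have hE : w / 2 ≤ ρ E := by
      have h1 : ρ {s | ρ (Ici s) < w / 2} ≤ w / 2 :=
        measure_upperSet_le (fun a b hab ha => lt_of_le_of_lt (antitone_measure_Ici ρ hab) ha)
          fun z hz => le_of_lt hz
      have h2 : w ≤ ρ E + w / 2 := by
        calc w ≤ ρ (E ∪ {s | ρ (Ici s) < w / 2}) := measure_mono fun s hs => by
              by_cases h : w / 2 ≤ ρ (Ici s)
              · exact Or.inl ⟨hs, h⟩
              · exact Or.inr (not_le.1 h)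
          _ ≤ ρ E + ρ {s | ρ (Ici s) < w / 2} := measure_union_le _ _
          _ ≤ _ := by gcongr
      have h3 : w / 2 + w / 2 ≤ ρ E + w / 2 := by rwa [ENNReal.add_halves]
      exact (ENNReal.add_le_add_iff_right (ENNReal.div_lt_top hwt.ne (by simp)).ne).1 h3
    have hEx : E ⊆ Iic x := fun z hz => by
      by_contra h
      exact absurd (hz.2.trans (antitone_measure_Ici ρ (not_le.1 h).le)) (not_le.2 hx)
    have h4 : (v y * (w / 2)) ^ b / w * (w / 2) ≤
        ∫⁻ z in Iic x, (v z * ρ (Ici z)) ^ b / ρ (Ici z) ∂ρ := by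
      calc (v y * (w / 2)) ^ b / w * (w / 2) ≤ (v y * (w / 2)) ^ b / w * ρ E := by gcongr
        _ = ∫⁻ _ in E, (v y * (w / 2)) ^ b / w ∂ρ := by rw [setLIntegral_const]
        _ ≤ ∫⁻ z in E, (v z * ρ (Ici z)) ^ b / ρ (Ici z) ∂ρ :=
            setLIntegral_mono' hEm fun z hz => by
              refine ENNReal.div_le_div ?_ (antitone_measure_Ici ρ hz.1)
              exact ENNReal.rpow_le_rpow (mul_le_mul' (hv hz.1) hz.2) hb.le
        _ ≤ _ := lintegral_mono_set hEx
    calc (v y * w) ^ b = (2 * (v y * (w / 2))) ^ b := by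
          rw [mul_left_comm, ENNReal.mul_div_cancel (by simp) (by simp)]
      _ = 2 ^ (b + 1) * ((v y * (w / 2)) ^ b / w * (w / 2)) := by
          rw [ENNReal.mul_rpow_of_nonneg _ _ hb.le, h2b, mul_assoc]
          congr 1
          rw [mul_comm ((v y * (w / 2)) ^ b / w), ← mul_assoc,
            ENNReal.mul_div_cancel (by simp) (by simp), ENNReal.mul_div_cancel hy0 hwt.ne]
      _ ≤ _ := by gcongr; exact h4.trans le_add_self

/-- A Young inequality with a free parameter: the first term suffices when `a^{1-r} ≤ l`, the second
one otherwise. -/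
theorem rpow_le_rpow_add_inv_mul {r : ℝ} (hr0 : 0 < r) (hr1 : r < 1) (a l : ℝ≥0∞) :
    a ^ r ≤ l ^ (r / (1 - r)) + l⁻¹ * a := by
  have h1r : 0 < 1 - r := by linarith
  rcases le_or_gt (a ^ (1 - r)) l with h | h
  · refine le_trans ?_ le_self_add
    have h2 := ENNReal.rpow_le_rpow h (show 0 ≤ r / (1 - r) by positivity)
    rwa [← ENNReal.rpow_mul, mul_div_cancel₀ _ h1r.ne'] at h2
  · refine le_trans ?_ le_add_self
    have hl : l ≠ ∞ := ne_top_of_lt h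
    by_cases ha : a = ∞
    · rw [ha, ENNReal.mul_top (by simpa using hl)]
      exact le_top
    have ha0 : a ≠ 0 := by
      rintro rfl
      simp [ENNReal.zero_rpow_of_pos h1r] at h
    calc a ^ r = a ^ (-(1 - r)) * a := by
          nth_rw 3 [← ENNReal.rpow_one a]
          rw [← ENNReal.rpow_add _ _ ha0 ha]; congr 1; ring
      _ = (a ^ (1 - r))⁻¹ * a := by rw [ENNReal.rpow_neg]
      _ ≤ _ := by gcongr

/-- `rpow_le_rpow_add_inv_mul` is applied with `l x` the running supremum of `v y * ρ (Ici y)` over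
`y ≤ x`, where `v = 1 / V ∘ ψ`. The mean value property shows that passing to the supremum costs
only a constant in the integral of the power. Since `l` dominates `v z * ρ (Ici z)` from `z` on, the
integral of `1 / l` over `{s ≤ ψ}` is at most `V s`, which handles the second term after Tonelli. -/
theorem hardy_lt_one_add {ρ σ : Measure ℝ} [IsFiniteMeasure ρ] [SFinite σ] {r : ℝ} (hr0 : 0 < r)
    (hr1 : r < 1) {ψ : ℝ → ℝ} (hψ : Monotone ψ) {V : ℝ → ℝ≥0∞} (hV : Antitone V) :
    ∫⁻ x, σ (Iic (ψ x)) ^ r ∂ρ ≤ 2 ^ (r / (1 - r) + 2) *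
      ∫⁻ x, ((V (ψ x))⁻¹ * ρ (Ici x)) ^ (r / (1 - r)) ∂ρ + ∫⁻ s, V s ∂σ := by
  set b := r / (1 - r) with hb
  have hb0 : 0 < b := div_pos hr0 (by linarith)
  set v : ℝ → ℝ≥0∞ := fun x => (V (ψ x))⁻¹ with hvdef
  have hv : Monotone v := fun x y h => ENNReal.inv_le_inv.2 (hV (hψ h))
  set W : ℝ → ℝ≥0∞ := fun x => ρ (Ici x) with hWdef
  have hWm : Measurable W := (antitone_measure_Ici ρ).measurable
  set l : ℝ → ℝ≥0∞ := fun x => ⨆ y : Iic x, v y * W y with hl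
  have hlm : Monotone l := fun x y h => iSup_le fun z =>
    le_iSup (fun z : Iic y => v z * W z) ⟨z, le_trans z.2 h⟩
  set f : ℝ → ℝ≥0∞ := fun z => (v z * W z) ^ b / W z with hf
  have hfm : Measurable f := ((hv.measurable.mul hWm).pow_const _).div hWm
  have hgm : Measurable fun x => (v x * W x) ^ b := (hv.measurable.mul hWm).pow_const _
  have h1 : ∀ x, l x ^ b ≤ 2 ^ (b + 1) * ((v x * W x) ^ b + ∫⁻ z in Iic x, f z ∂ρ) := by
    intro x
    rw [← ENNReal.le_rpow_inv_iff hb0]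
    exact iSup_le fun y => (ENNReal.le_rpow_inv_iff hb0).2 (rpow_mul_measure_Ici_le hb0 hv y.2)
  have hR : MeasurableSet {z : ℝ × ℝ | z.2 ≤ z.1} := measurableSet_le measurable_snd measurable_fst
  have hA : ∫⁻ x, l x ^ b ∂ρ ≤ 2 ^ (b + 2) * ∫⁻ x, (v x * W x) ^ b ∂ρ := by
    have hsw := lintegral_setLIntegral_swap (ρ := ρ) (σ := ρ) (R := fun x s => s ≤ x) hR hfm
      (measurable_const (a := (1 : ℝ≥0∞)))
    simp only [one_mul, setLIntegral_one] at hsw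
    calc ∫⁻ x, l x ^ b ∂ρ
        ≤ ∫⁻ x, 2 ^ (b + 1) * ((v x * W x) ^ b + ∫⁻ z in Iic x, f z ∂ρ) ∂ρ := lintegral_mono h1
      _ = 2 ^ (b + 1) * (∫⁻ x, (v x * W x) ^ b ∂ρ + ∫⁻ s, f s * W s ∂ρ) := by
          rw [lintegral_const_mul' _ _ (ENNReal.rpow_ne_top_of_nonneg (by linarith) (by simp)),
            lintegral_add_left hgm]
          congr 2
      _ ≤ 2 ^ (b + 1) * (∫⁻ x, (v x * W x) ^ b ∂ρ + ∫⁻ x, (v x * W x) ^ b ∂ρ) := by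
          gcongr with s
          exact ENNReal.mul_le_of_le_div le_rfl
      _ = _ := by
          rw [← two_mul, ← mul_assoc]
          congr 1
          rw [show b + 2 = (b + 1) + 1 by ring,
            ENNReal.rpow_add_of_nonneg (b + 1) 1 (by linarith) zero_le_one, ENNReal.rpow_one]
  have hB : ∫⁻ x, (l x)⁻¹ * σ (Iic (ψ x)) ∂ρ ≤ ∫⁻ s, V s ∂σ := by
    have hR : MeasurableSet {z : ℝ × ℝ | z.2 ≤ ψ z.1} :=
      measurableSet_le measurable_snd (hψ.measurable.comp measurable_fst)
    have hsw := lintegral_setLIntegral_swap (ρ := ρ) (σ := σ) (R := fun x s => s ≤ ψ x) hR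
      (measurable_const (a := (1 : ℝ≥0∞))) hlm.measurable.inv
    simp only [one_mul, setLIntegral_one, Pi.inv_apply] at hsw
    change ∫⁻ x, (l x)⁻¹ * σ ({s | s ≤ ψ x}) ∂ρ ≤ _
    rw [hsw]
    refine lintegral_mono fun s => ?_
    have hup : IsUpperSet {x | s ≤ ψ x} := fun a b hab ha => le_trans ha (hψ hab)
    have hmeas : MeasurableSet {x | s ≤ ψ x} := measurableSet_le measurable_const hψ.measurable
    rw [← withDensity_apply _ hmeas]
    refine measure_upperSet_le hup fun z hz => ?_
    rw [withDensity_apply _ measurableSet_Ici]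
    have hz' : V (ψ z) ≤ V s := hV hz
    refine le_trans ?_ hz'
    by_cases hW0 : W z = 0
    · rw [Measure.restrict_eq_zero.2 hW0]; simp
    have hWt : W z ≠ ∞ := measure_ne_top _ _
    calc ∫⁻ x in Ici z, (l x)⁻¹ ∂ρ ≤ ∫⁻ _ in Ici z, (v z * W z)⁻¹ ∂ρ :=
          setLIntegral_mono' measurableSet_Ici fun x hx =>
            ENNReal.inv_le_inv.2 (le_iSup (fun y : Iic x => v y * W y) ⟨z, hx⟩)
      _ = (v z * W z)⁻¹ * W z := by rw [setLIntegral_const]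
      _ = V (ψ z) := by
          rw [ENNReal.mul_inv (Or.inr hWt) (Or.inr hW0), mul_assoc, ENNReal.inv_mul_cancel hW0 hWt,
            mul_one, inv_inv]
  calc ∫⁻ x, σ (Iic (ψ x)) ^ r ∂ρ
      ≤ ∫⁻ x, (l x ^ b + (l x)⁻¹ * σ (Iic (ψ x))) ∂ρ :=
        lintegral_mono fun x => rpow_le_rpow_add_inv_mul hr0 hr1 _ _
    _ = ∫⁻ x, l x ^ b ∂ρ + ∫⁻ x, (l x)⁻¹ * σ (Iic (ψ x)) ∂ρ :=
        lintegral_add_left (hlm.measurable.pow_const _) _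
    _ ≤ _ := add_le_add hA hB

theorem hardy_lt_one_add' {ρ σ : Measure ℝ} [SFinite ρ] [SFinite σ] {r : ℝ} (hr0 : 0 < r)
    (hr1 : r < 1) {ψ : ℝ → ℝ} (hψ : Monotone ψ) {V : ℝ → ℝ≥0∞} (hV : Antitone V) :
    ∫⁻ x, σ (Iic (ψ x)) ^ r ∂ρ ≤ 2 ^ (r / (1 - r) + 2) *
      ∫⁻ x, ((V (ψ x))⁻¹ * ρ (Ici x)) ^ (r / (1 - r)) ∂ρ + ∫⁻ s, V s ∂σ := by
  conv_lhs => rw [← sum_sfiniteSeq ρ]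
  rw [lintegral_sum_measure]
  refine ENNReal.tsum_le_of_sum_range_le fun n => ?_
  rw [← lintegral_finsetSum_measure]
  have hle : ∑ i ∈ Finset.range n, sfiniteSeq ρ i ≤ ρ := by
    conv_rhs => rw [← sum_sfiniteSeq ρ]
    refine Measure.le_iff.2 fun s hs => ?_
    rw [Measure.sum_apply _ hs, Measure.finsetSum_apply]
    exact ENNReal.sum_le_tsum _
  have hb0 : 0 < r / (1 - r) := div_pos hr0 (by linarith)
  refine (hardy_lt_one_add hr0 hr1 hψ hV).trans ?_
  gcongr

/-- The additive inequality is not homogeneous in `σ`. Applied to `(A / B) • σ` it has two terms of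
the same size `A`, and this gives the product form. -/
theorem hardy_lt_one {ρ σ : Measure ℝ} [SFinite ρ] [SFinite σ] {r : ℝ} (hr0 : 0 < r)
    (hr1 : r < 1) {ψ : ℝ → ℝ} (hψ : Monotone ψ) {V : ℝ → ℝ≥0∞} (hV : Antitone V)
    {A B : ℝ≥0∞} (hA : ∫⁻ x, ((V (ψ x))⁻¹ * ρ (Ici x)) ^ (r / (1 - r)) ∂ρ ≤ A)
    (hB : ∫⁻ s, V s ∂σ ≤ B) (hA0 : A ≠ 0) (hB0 : B ≠ 0) (hBt : B ≠ ∞) :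
    ∫⁻ x, σ (Iic (ψ x)) ^ r ∂ρ ≤ 2 ^ (r / (1 - r) + 3) * A ^ (1 - r) * B ^ r := by
  have hb0 : 0 < r / (1 - r) := div_pos hr0 (by linarith)
  have hBr0 : B ^ r ≠ 0 := by simp [ENNReal.rpow_eq_zero_iff, hB0, hBt]
  by_cases hAt : A = ∞
  · rw [hAt, ENNReal.top_rpow_of_pos (by linarith), ENNReal.mul_top, ENNReal.top_mul hBr0]
    · exact le_top
    · simp [ENNReal.rpow_eq_zero_iff]
  set c := A / B with hc
  have hc0 : c ≠ 0 := by simp [hc, ENNReal.div_eq_zero_iff, hA0, hBt]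
  have hct : c ≠ ∞ := (ENNReal.div_lt_top hAt hB0).ne
  have h := hardy_lt_one_add' (ρ := ρ) (σ := c • σ) hr0 hr1 hψ hV
  simp only [Measure.smul_apply, smul_eq_mul, lintegral_smul_measure,
    ENNReal.mul_rpow_of_nonneg _ _ hr0.le] at h
  have hcr0 : c ^ r ≠ 0 := by simp [ENNReal.rpow_eq_zero_iff, hc0, hct]
  have hcrt : c ^ r ≠ ∞ := ENNReal.rpow_ne_top_of_nonneg hr0.le hct
  rw [lintegral_const_mul' _ _ hcrt] at h
  have h2 : c ^ r * ∫⁻ x, σ (Iic (ψ x)) ^ r ∂ρ ≤ 2 ^ (r / (1 - r) + 3) * A := by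
    refine h.trans ?_
    calc _ ≤ 2 ^ (r / (1 - r) + 2) * A + c * B := by gcongr
      _ ≤ 2 ^ (r / (1 - r) + 2) * A + 2 ^ (r / (1 - r) + 2) * A := by
          rw [hc, ENNReal.div_mul_cancel hB0 hBt]
          gcongr
          refine le_mul_of_one_le_left zero_le (ENNReal.one_le_rpow (by norm_num) (by linarith))
      _ = _ := by
          rw [← two_mul, ← mul_assoc]
          congr 1
          rw [show r / (1 - r) + 3 = (r / (1 - r) + 2) + 1 by ring,
            ENNReal.rpow_add_of_nonneg (r / (1 - r) + 2) 1 (by linarith) zero_le_one,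
            ENNReal.rpow_one, mul_comm]
  have h3 : A ^ (1 - r) * B ^ r * c ^ r = A := by
    rw [mul_assoc, ← ENNReal.mul_rpow_of_nonneg _ _ hr0.le, hc, ENNReal.mul_div_cancel hB0 hBt,
      ← ENNReal.rpow_add _ _ hA0 hAt]
    simp
  rw [← h3] at h2
  rw [← ENNReal.mul_le_mul_iff_right hcr0 hcrt]
  refine h2.trans (le_of_eq ?_)
  ring

/-- The density `v^{b+1} W^b` with `W x = ρ (Ici x)` and `b = r / (1 - r)` is extremal: its cost is
at most the left side (`lintegral_inv_withDensity_le`), while its contribution to the Hardy integral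
is at least a multiple of it. For the latter, one factor `W y` is spread over the points `x ≥ y`
with `W x ≥ W y / 2`; after Tonelli the inner integral runs over points where `W` is constant up to
a factor 2, and Hölder applies. -/
theorem hardy_lt_one_extremal {ρ : Measure ℝ} [IsFiniteMeasure ρ] {r : ℝ} (hr0 : 0 < r)
    (hr1 : r < 1) {v : ℝ → ℝ≥0∞} (hv : Monotone v) :
    ∫⁻ x, (v x * ρ (Ici x)) ^ (r / (1 - r)) ∂ρ ≤ 2 ^ (r / (1 - r) + 2) *
      ∫⁻ x, (ρ.withDensity fun y => v y ^ (r / (1 - r) + 1) * ρ (Ici y) ^ (r / (1 - r)))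
        (Iic x) ^ r ∂ρ := by
  have h1r : 0 < 1 - r := by linarith
  set b := r / (1 - r) with hb
  have hb0 : 0 < b := div_pos hr0 h1r
  have hbr : b / r = b + 1 := by rw [hb]; field_simp; ring
  have hbr' : b = (b + 1) * r := by rw [hb]; field_simp; ring
  set W : ℝ → ℝ≥0∞ := fun x => ρ (Ici x) with hWdef
  have hWm : Measurable W := (antitone_measure_Ici ρ).measurable
  set κ := ρ.withDensity fun y => v y ^ (b + 1) * W y ^ b with hκ
  set f : ℝ → ℝ≥0∞ := fun z => (v z * W z) ^ b / W z with hf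
  have hfm : Measurable f := ((hv.measurable.mul hWm).pow_const _).div hWm
  have hR : MeasurableSet {z : ℝ × ℝ | z.2 ≤ z.1 ∧ W z.2 ≤ 2 * W z.1} :=
    (measurableSet_le measurable_snd measurable_fst).inter
      (measurableSet_le (hWm.comp measurable_snd) ((hWm.comp measurable_fst).const_mul _))
  have hsw := lintegral_setLIntegral_swap (ρ := ρ) (σ := ρ)
    (R := fun x s => s ≤ x ∧ W s ≤ 2 * W x) hR hfm (measurable_const (a := (1 : ℝ≥0∞)))
  simp only [one_mul, setLIntegral_one] at hsw
  have h1 : ∀ y, (v y * W y) ^ b ≤ 2 * (f y * ρ {x | y ≤ x ∧ W y ≤ 2 * W x}) := by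
    intro y
    have hWt : W y ≠ ∞ := measure_ne_top _ _
    by_cases hW0 : W y = 0
    · simp [hW0, ENNReal.zero_rpow_of_pos hb0]
    have hN : W y ≤ 2 * ρ {x | y ≤ x ∧ W y ≤ 2 * W x} := by
      have h1 : ρ {s | 2 * W s < W y} ≤ W y / 2 :=
        measure_upperSet_le (fun a c hab ha => lt_of_le_of_lt
          (mul_le_mul' le_rfl (antitone_measure_Ici ρ hab)) ha)
          fun z hz => by
            rw [ENNReal.le_div_iff_mul_le (by simp) (by simp), mul_comm]; exact le_of_lt hz
      have h2 : W y ≤ ρ {x | y ≤ x ∧ W y ≤ 2 * W x} + W y / 2 := by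
        calc W y ≤ ρ ({x | y ≤ x ∧ W y ≤ 2 * W x} ∪ {s | 2 * W s < W y}) :=
              measure_mono fun s hs => by
              by_cases h : W y ≤ 2 * W s
              · exact Or.inl ⟨hs, h⟩
              · exact Or.inr (not_le.1 h)
          _ ≤ _ := measure_union_le _ _
          _ ≤ _ := by gcongr
      have h3 : W y / 2 + W y / 2 ≤ ρ {x | y ≤ x ∧ W y ≤ 2 * W x} + W y / 2 := by
        rwa [ENNReal.add_halves]
      have h4 := (ENNReal.add_le_add_iff_right (ENNReal.div_lt_top hWt (by simp)).ne).1 h3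
      rw [ENNReal.div_le_iff (by simp) (by simp)] at h4
      rwa [mul_comm]
    calc (v y * W y) ^ b = f y * W y := (ENNReal.div_mul_cancel hW0 hWt).symm
      _ ≤ f y * (2 * ρ {x | y ≤ x ∧ W y ≤ 2 * W x}) := by gcongr
      _ = _ := by ring
  have h2 : ∀ x, ∫⁻ s in {s | s ≤ x ∧ W s ≤ 2 * W x}, f s ∂ρ ≤ 2 ^ (b + 1) * κ (Iic x) ^ r := by
    intro x
    have hYm : MeasurableSet {s | s ≤ x ∧ W s ≤ 2 * W x} :=
      measurableSet_Iic.inter (measurableSet_le hWm measurable_const)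
    set Y := {s | s ≤ x ∧ W s ≤ 2 * W x} with hY
    by_cases hW0 : W x = 0
    · have : ∫⁻ s in Y, f s ∂ρ ≤ ∫⁻ _ in Y, 0 ∂ρ := setLIntegral_mono' hYm fun s hs => by
        have h0 : W s = 0 := by simpa [hW0] using hs.2
        simp [hf, h0, ENNReal.zero_rpow_of_pos hb0]
      refine this.trans ?_
      simp
    have hWt : W x ≠ ∞ := measure_ne_top _ _
    set w := W x with hw
    set I := ∫⁻ s in Y, v s ^ (b + 1) ∂ρ with hI
    have hρY : ρ Y ≤ 2 * w := by
      refine (measure_mono fun s hs => hs.2).trans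
        (measure_upperSet_le (D := {s | W s ≤ 2 * w}) (fun a c hac ha => ?_) fun z hz => hz)
      exact (antitone_measure_Ici ρ hac).trans ha
    have hIκ : w ^ b * I ≤ κ (Iic x) := by
      rw [hκ, withDensity_apply _ measurableSet_Iic,
        ← lintegral_const_mul _ (hv.measurable.pow_const _)]
      refine le_trans (setLIntegral_mono' hYm fun s hs => ?_) (lintegral_mono_set fun s hs => hs.1)
      rw [mul_comm]
      gcongr
      exact antitone_measure_Ici ρ hs.1
    -- Hölder with exponents `1 / r` and `1 / (1 - r)`. Since `b / r = b + 1`, the power of `v`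
    -- becomes the one in the density of `κ`.
    have hH : ∫⁻ s in Y, v s ^ b ∂ρ ≤ I ^ r * (2 * w) ^ (1 - r) := by
      have hconj : (1 / r).HolderConjugate (1 / (1 - r)) := by
        rw [Real.holderConjugate_iff]
        constructor
        · rw [lt_div_iff₀ hr0]; linarith
        · simp
      have := ENNReal.lintegral_mul_le_Lp_mul_Lq (ρ.restrict Y) hconj
        (f := fun s => v s ^ b) (g := fun _ => 1) (hv.measurable.pow_const _).aemeasurable
        aemeasurable_const
      simp only [Pi.mul_apply, mul_one, ← ENNReal.rpow_mul, one_div, inv_inv, ENNReal.one_rpow,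
        lintegral_const, Measure.restrict_apply_univ, one_mul] at this
      rw [← div_eq_mul_inv, hbr] at this
      refine this.trans ?_
      gcongr
    calc ∫⁻ s in Y, f s ∂ρ ≤ ∫⁻ s in Y, ((2 * w) ^ b / w) * v s ^ b ∂ρ :=
          setLIntegral_mono' hYm fun s hs => by
            rw [hf]
            simp only
            rw [ENNReal.mul_rpow_of_nonneg _ _ hb0.le, ENNReal.div_eq_inv_mul,
              ENNReal.div_eq_inv_mul]
            calc (W s)⁻¹ * (v s ^ b * W s ^ b) ≤ w⁻¹ * (v s ^ b * (2 * w) ^ b) := by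
                  gcongr
                  · exact antitone_measure_Ici ρ hs.1
                  · exact hs.2
              _ = _ := by ring
      _ = ((2 * w) ^ b / w) * ∫⁻ s in Y, v s ^ b ∂ρ :=
          lintegral_const_mul _ (hv.measurable.pow_const _)
      _ ≤ ((2 * w) ^ b / w) * (I ^ r * (2 * w) ^ (1 - r)) := by gcongr
      _ = 2 ^ (b + (1 - r)) * (w ^ b * I) ^ r * (w ^ b / w * w ^ (1 - r) * (w ^ (b * r))⁻¹) := by
          rw [ENNReal.mul_rpow_of_nonneg _ _ hb0.le, ENNReal.mul_rpow_of_nonneg _ _ h1r.le,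
            ENNReal.mul_rpow_of_nonneg _ _ hr0.le, ENNReal.rpow_add_of_nonneg _ _ hb0.le h1r.le,
            ← ENNReal.rpow_mul, ENNReal.div_eq_inv_mul, ENNReal.div_eq_inv_mul]
          have h5 : w ^ (b * r) * (w ^ (b * r))⁻¹ = 1 := ENNReal.mul_inv_cancel
            (by simp [ENNReal.rpow_eq_zero_iff, hW0, hWt])
            (ENNReal.rpow_ne_top_of_nonneg (by positivity) hWt)
          calc _ = 2 ^ b * 2 ^ (1 - r) * I ^ r * (w⁻¹ * w ^ b * w ^ (1 - r)) *
                (w ^ (b * r) * (w ^ (b * r))⁻¹) := by rw [h5]; ring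
            _ = _ := by ring
      _ = 2 ^ (b + (1 - r)) * (w ^ b * I) ^ r := by
          rw [← ENNReal.rpow_neg, ENNReal.div_eq_inv_mul, ← ENNReal.rpow_neg_one,
            ← ENNReal.rpow_add _ _ hW0 hWt, ← ENNReal.rpow_add _ _ hW0 hWt,
            ← ENNReal.rpow_add _ _ hW0 hWt]
          have : -1 + b + (1 - r) + -(b * r) = 0 := by nlinarith
          rw [this, ENNReal.rpow_zero, mul_one]
      _ ≤ _ := by
          gcongr
          · norm_num
          · linarith
  calc ∫⁻ x, (v x * W x) ^ b ∂ρ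
      ≤ ∫⁻ y, 2 * (f y * ρ {x | y ≤ x ∧ W y ≤ 2 * W x}) ∂ρ := lintegral_mono h1
    _ = 2 * ∫⁻ x, ∫⁻ s in {s | s ≤ x ∧ W s ≤ 2 * W x}, f s ∂ρ ∂ρ := by
        rw [lintegral_const_mul' _ _ (by simp), hsw]
    _ ≤ 2 * ∫⁻ x, 2 ^ (b + 1) * κ (Iic x) ^ r ∂ρ := by
        gcongr with x
        exact h2 x
    _ = _ := by
        rw [lintegral_const_mul' _ _ (ENNReal.rpow_ne_top_of_nonneg (by linarith) (by simp)),
          ← mul_assoc]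
        congr 1
        rw [show b + 2 = (b + 1) + 1 by ring,
          ENNReal.rpow_add_of_nonneg (b + 1) 1 (by linarith) zero_le_one, ENNReal.rpow_one,
              mul_comm]

theorem lintegral_inv_withDensity_le {ρ : Measure ℝ} {b : ℝ} (hb : 0 < b) {v W : ℝ → ℝ≥0∞}
    (hv : Measurable v) (hW : Measurable W) :
    ∫⁻ x, (v x)⁻¹ ∂(ρ.withDensity fun y => v y ^ (b + 1) * W y ^ b) ≤
      ∫⁻ x, (v x * W x) ^ b ∂ρ := by
  rw [lintegral_withDensity_eq_lintegral_mul ρ (f := fun y => v y ^ (b + 1) * W y ^ b)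
    ((hv.pow_const _).mul (hW.pow_const _)) (g := fun x => (v x)⁻¹) hv.inv]
  refine lintegral_mono fun x => ?_
  simp only [Pi.mul_apply]
  rw [ENNReal.rpow_add_of_nonneg _ _ hb.le zero_le_one, ENNReal.rpow_one,
    ENNReal.mul_rpow_of_nonneg _ _ hb.le]
  calc v x ^ b * v x * W x ^ b * (v x)⁻¹ = v x ^ b * W x ^ b * (v x * (v x)⁻¹) := by ring
    _ ≤ v x ^ b * W x ^ b * 1 := by gcongr; exact ENNReal.mul_inv_le_one _
    _ = _ := mul_one _

/-- An increasing sequence of finite measures, each carried by a half-line, exhausting `ρ`. -/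
noncomputable def finiteTrunc (ρ : Measure ℝ) [SFinite ρ] (N : ℕ) : Measure ℝ :=
  (∑ i ∈ Finset.range N, sfiniteSeq ρ i).restrict (Iic (N : ℝ))

instance (ρ : Measure ℝ) [SFinite ρ] (N : ℕ) : IsFiniteMeasure (finiteTrunc ρ N) := by
  unfold finiteTrunc; infer_instance

theorem finiteTrunc_le (ρ : Measure ℝ) [SFinite ρ] (N : ℕ) : finiteTrunc ρ N ≤ ρ := by
  refine Measure.restrict_le_self.trans ?_
  conv_rhs => rw [← sum_sfiniteSeq ρ]
  refine Measure.le_iff.2 fun s hs => ?_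
  rw [Measure.sum_apply _ hs, Measure.finsetSum_apply]
  exact ENNReal.sum_le_tsum _

theorem sum_sfiniteSeq_mono (ρ : Measure ℝ) [SFinite ρ] :
    Monotone fun N => ∑ i ∈ Finset.range N, sfiniteSeq ρ i := by
  intro M N h
  refine Measure.le_iff.2 fun s hs => ?_
  rw [Measure.finsetSum_apply, Measure.finsetSum_apply]
  exact Finset.sum_le_sum_of_subset (Finset.range_mono h)

theorem finiteTrunc_mono (ρ : Measure ℝ) [SFinite ρ] : Monotone (finiteTrunc ρ) := by
  intro M N h
  exact Measure.restrict_mono (Iic_subset_Iic.2 (by exact_mod_cast h)) (sum_sfiniteSeq_mono ρ h)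

theorem lintegral_le_of_finiteTrunc {ρ : Measure ℝ} [SFinite ρ] {F : ℝ → ℝ≥0∞} {D : ℝ≥0∞}
    (h : ∀ N, ∫⁻ x, F x ∂(finiteTrunc ρ N) ≤ D) : ∫⁻ x, F x ∂ρ ≤ D := by
  conv_lhs => rw [← sum_sfiniteSeq ρ]
  rw [lintegral_sum_measure]
  refine ENNReal.tsum_le_of_sum_range_le fun n => ?_
  rw [← lintegral_finsetSum_measure, ← setLIntegral_univ]
  have hU : (univ : Set ℝ) = ⋃ k : ℕ, Iic (k : ℝ) := by
    ext x; simpa using exists_nat_ge x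
  rw [hU, setLIntegral_iUnion_of_directed]
  · refine iSup_le fun k => le_trans (lintegral_mono' ?_ le_rfl) (h (max n k))
    exact Measure.restrict_mono (Iic_subset_Iic.2 (by exact_mod_cast le_max_right n k))
      (sum_sfiniteSeq_mono ρ (le_max_left n k))
  · exact Monotone.directed_le fun a b hab => Iic_subset_Iic.2 (by exact_mod_cast hab)

theorem iSup_finiteTrunc (ρ : Measure ℝ) [SFinite ρ] {s : Set ℝ} (hs : MeasurableSet s) :
    ρ s = ⨆ N, finiteTrunc ρ N s := by
  refine le_antisymm ?_ (iSup_le fun N => finiteTrunc_le ρ N s)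
  rw [← lintegral_indicator_one hs]
  refine lintegral_le_of_finiteTrunc fun N => ?_
  rw [lintegral_indicator_one hs]
  exact le_iSup (fun N => finiteTrunc ρ N s) N

/-- The extremal measure gives `A ≤ C K A^r`, from which `A` can be extracted only if it is finite.
Replacing `ρ` by `finiteTrunc ρ N` makes the mass finite and `v` bounded by `v N`, hence `A` finite
and the test measure admissible. Exhaustion in the outer measure and monotone convergence in the
inner one remove the truncation. -/
theorem hardy_lt_one_necessity_of_ne_top {ρ : Measure ℝ} [SFinite ρ] {r : ℝ} (hr0 : 0 < r)
    (hr1 : r < 1) {v : ℝ → ℝ≥0∞} (hv : Monotone v) (hvt : ∀ x, v x ≠ ∞) {K : ℝ≥0∞}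
    (H : ∀ κ : Measure ℝ, IsFiniteMeasure κ → κ ≪ ρ → κ {x | v x = 0} = 0 →
      ∫⁻ x, (v x)⁻¹ ∂κ < ∞ → ∫⁻ x, κ (Iic x) ^ r ∂ρ ≤ K * (∫⁻ x, (v x)⁻¹ ∂κ) ^ r) :
    ∫⁻ x, (v x * ρ (Ici x)) ^ (r / (1 - r)) ∂ρ ≤
      (2 ^ (r / (1 - r) + 2) * K) ^ (1 / (1 - r)) := by
  have h1r : 0 < 1 - r := by linarith
  set b := r / (1 - r) with hb
  have hb0 : 0 < b := div_pos hr0 h1r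
  have hWm : ∀ N, Measurable fun x => finiteTrunc ρ N (Ici x) :=
    fun N => (antitone_measure_Ici _).measurable
  have key : ∀ N, ∫⁻ x, (v x * finiteTrunc ρ N (Ici x)) ^ b ∂(finiteTrunc ρ N) ≤
      (2 ^ (b + 2) * K) ^ (1 / (1 - r)) := by
    intro N
    set ρ' := finiteTrunc ρ N with hρ'
    set A := ∫⁻ x, (v x * ρ' (Ici x)) ^ b ∂ρ' with hA
    set κ := ρ'.withDensity fun y => v y ^ (b + 1) * ρ' (Ici y) ^ b with hκ
    have hae : ∀ᵐ x ∂ρ', x ∈ Iic (N : ℝ) := by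
      rw [hρ', finiteTrunc]; exact ae_restrict_mem measurableSet_Iic
    have hAt : A ≠ ∞ := by
      refine ne_of_lt (lt_of_le_of_lt (lintegral_mono_ae (g := fun _ => (v N * ρ' univ) ^ b)
        (hae.mono fun x hx => ?_)) ?_)
      · gcongr
        · exact hv hx
        · exact subset_univ _
      · rw [lintegral_const]
        exact ENNReal.mul_lt_top (ENNReal.rpow_lt_top_of_nonneg hb0.le
          (ENNReal.mul_ne_top (hvt _) (measure_ne_top _ _))) (measure_lt_top _ _)
    have hdm : Measurable fun y => v y ^ (b + 1) * ρ' (Ici y) ^ b :=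
      (hv.measurable.pow_const _).mul ((hWm N).pow_const _)
    have hκf : IsFiniteMeasure κ := by
      refine ⟨?_⟩
      rw [hκ, withDensity_apply _ MeasurableSet.univ, setLIntegral_univ]
      refine lt_of_le_of_lt (lintegral_mono_ae (g := fun _ => v N ^ (b + 1) * ρ' univ ^ b)
        (hae.mono fun x hx => ?_)) ?_
      · gcongr
        · exact hv hx
        · exact subset_univ _
      · rw [lintegral_const]
        exact ENNReal.mul_lt_top (ENNReal.mul_lt_top (ENNReal.rpow_lt_top_of_nonneg
          (by linarith) (hvt _)) (ENNReal.rpow_lt_top_of_nonneg hb0.le (measure_ne_top _ _)))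
          (measure_lt_top _ _)
    have hBA : ∫⁻ x, (v x)⁻¹ ∂κ ≤ A := lintegral_inv_withDensity_le hb0 hv.measurable (hWm N)
    have hκ0 : κ {x | v x = 0} = 0 := by
      have hm : MeasurableSet {x | v x = 0} := hv.measurable (measurableSet_singleton 0)
      rw [hκ, withDensity_apply _ hm]
      refine le_antisymm ((setLIntegral_mono' hm (g := fun _ => 0) fun x hx => ?_).trans
        (by simp)) zero_le
      have hx : v x = 0 := hx
      simp [hx, ENNReal.zero_rpow_of_pos (show 0 < b + 1 by linarith)]
    have h1 : A ≤ 2 ^ (b + 2) * K * A ^ r := by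
      calc A ≤ 2 ^ (b + 2) * ∫⁻ x, κ (Iic x) ^ r ∂ρ' := hardy_lt_one_extremal hr0 hr1 hv
        _ ≤ 2 ^ (b + 2) * ∫⁻ x, κ (Iic x) ^ r ∂ρ := by
            gcongr; exact finiteTrunc_le ρ N
        _ ≤ 2 ^ (b + 2) * (K * (∫⁻ x, (v x)⁻¹ ∂κ) ^ r) := by
            gcongr
            exact H κ hκf ((withDensity_absolutelyContinuous _ _).trans
              (finiteTrunc_le ρ N).absolutelyContinuous) hκ0 (lt_of_le_of_lt hBA hAt.lt_top)
        _ ≤ 2 ^ (b + 2) * (K * A ^ r) := by gcongr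
        _ = _ := by ring
    by_cases hA0 : A = 0
    · rw [hA0]; exact zero_le
    rw [one_div, ENNReal.le_rpow_inv_iff h1r]
    have hAr0 : A ^ r ≠ 0 := by simp [ENNReal.rpow_eq_zero_iff, hA0, hAt]
    have hArt : A ^ r ≠ ∞ := ENNReal.rpow_ne_top_of_nonneg hr0.le hAt
    rw [← ENNReal.mul_le_mul_iff_left hAr0 hArt, ← ENNReal.rpow_add _ _ hA0 hAt]
    simpa using h1
  have h2 : ∀ M, ∫⁻ x, (v x * finiteTrunc ρ M (Ici x)) ^ b ∂ρ ≤
      (2 ^ (b + 2) * K) ^ (1 / (1 - r)) := fun M =>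
    lintegral_le_of_finiteTrunc fun N => by
      refine le_trans (lintegral_mono' (finiteTrunc_mono ρ (le_max_right M N)) fun x => ?_)
        (key (max M N))
      gcongr
      exact finiteTrunc_mono ρ (le_max_left M N)
  have h3 : ∀ x, (v x * ρ (Ici x)) ^ b = ⨆ M, (v x * finiteTrunc ρ M (Ici x)) ^ b := by
    intro x
    rw [iSup_finiteTrunc ρ measurableSet_Ici, ENNReal.mul_iSup]
    exact (ENNReal.orderIsoRpow b hb0).map_iSup _
  simp_rw [h3]
  rw [lintegral_iSup (f := fun M x => (v x *
      finiteTrunc ρ M (Ici x)) ^ b) (fun M => (hv.measurable.mul (hWm M)).pow_const _)]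
  · exact iSup_le h2
  · intro M N h x
    simp only
    gcongr
    exact finiteTrunc_mono ρ h

/-- Infinite values of `v` are reached through the truncations `min v M`: since their inverses
exceed `1 / v`, they inherit the tested inequality. -/
theorem hardy_lt_one_necessity {ρ : Measure ℝ} [SFinite ρ] {r : ℝ} (hr0 : 0 < r)
    (hr1 : r < 1) {v : ℝ → ℝ≥0∞} (hv : Monotone v) {K : ℝ≥0∞}
    (H : ∀ κ : Measure ℝ, IsFiniteMeasure κ → κ ≪ ρ → κ {x | v x = 0} = 0 →
      ∫⁻ x, (v x)⁻¹ ∂κ < ∞ → ∫⁻ x, κ (Iic x) ^ r ∂ρ ≤ K * (∫⁻ x, (v x)⁻¹ ∂κ) ^ r) :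
    ∫⁻ x, (v x * ρ (Ici x)) ^ (r / (1 - r)) ∂ρ ≤
      (2 ^ (r / (1 - r) + 2) * K) ^ (1 / (1 - r)) := by
  have hb0 : 0 < r / (1 - r) := div_pos hr0 (by linarith)
  have key : ∀ M : ℕ, ∫⁻ x, (min (v x) M * ρ (Ici x)) ^ (r / (1 - r)) ∂ρ ≤
      (2 ^ (r / (1 - r) + 2) * K) ^ (1 / (1 - r)) := by
    intro M
    by_cases hM : M = 0
    · simp [hM, ENNReal.zero_rpow_of_pos hb0]
    refine hardy_lt_one_necessity_of_ne_top hr0 hr1 (v := fun x => min (v x) M)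
      (fun x y hxy => min_le_min_right _ (hv hxy)) (fun x => ?_) fun κ hκ hκρ hκ0 hκB => ?_
    · exact ne_top_of_le_ne_top (by simp) (min_le_right _ _)
    have hle : ∫⁻ x, (v x)⁻¹ ∂κ ≤ ∫⁻ x, (min (v x) M)⁻¹ ∂κ :=
      lintegral_mono fun x => ENNReal.inv_le_inv.2 (min_le_left _ _)
    refine (H κ hκ hκρ ?_ (hle.trans_lt hκB)).trans (by gcongr)
    refine measure_mono_null (fun x hx => ?_) hκ0
    have hx : v x = 0 := hx
    simp [hx]
  have hsup : ∀ x, (v x * ρ (Ici x)) ^ (r / (1 - r)) =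
      ⨆ M : ℕ, (min (v x) M * ρ (Ici x)) ^ (r / (1 - r)) := by
    intro x
    have h1 : v x = ⨆ M : ℕ, min (v x) (M : ℝ≥0∞) := by
      rw [← inf_iSup_eq (v x) (fun M : ℕ => (M : ℝ≥0∞)), ENNReal.iSup_natCast, inf_top_eq]
    conv_lhs => rw [h1, ENNReal.iSup_mul]
    exact (ENNReal.orderIsoRpow _ hb0).map_iSup _
  simp_rw [hsup]
  rw [lintegral_iSup (f := fun (M : ℕ) x => (min (v x) M * ρ (Ici x)) ^ (r / (1 - r)))]
  · exact iSup_le key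
  · exact fun M => ((hv.measurable.min measurable_const).mul
      (antitone_measure_Ici ρ).measurable).pow_const _
  · intro M N h x
    simp only
    gcongr

/-! ### Reflected Hardy inequalities, and the removal of nonvanishing assumptions -/

theorem map_neg_Iic (ρ : Measure ℝ) (x : ℝ) : ρ.map Neg.neg (Iic x) = ρ (Ici (-x)) := by
  rw [Measure.map_apply measurable_neg measurableSet_Iic]
  simp

theorem map_neg_Ici (ρ : Measure ℝ) (x : ℝ) : ρ.map Neg.neg (Ici x) = ρ (Iic (-x)) := by
  rw [Measure.map_apply measurable_neg measurableSet_Ici]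
  simp

theorem lintegral_map_neg (ρ : Measure ℝ) (f : ℝ → ℝ≥0∞) :
    ∫⁻ x, f x ∂(ρ.map Neg.neg) = ∫⁻ x, f (-x) ∂ρ :=
  lintegral_map_equiv f (MeasurableEquiv.neg ℝ)

theorem hardy_one_le_mirror {ρ σ : Measure ℝ} [SFinite ρ] [SFinite σ] {r : ℝ} (hr : 1 ≤ r)
    {V : ℝ → ℝ≥0∞} (hV : Monotone V) {K : ℝ≥0∞}
    (hK : ∀ᵐ s ∂σ, ρ (Iic s) ≤ K * V s ^ r) (hσ : ∀ᵐ x ∂ρ, σ (Ici x) < ∞) :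
    ∫⁻ x, σ (Ici x) ^ r ∂ρ ≤ 2 ^ r * K * (∫⁻ s, V s ∂σ) ^ r := by
  have h := hardy_one_le (ρ := ρ.map Neg.neg) (σ := σ.map Neg.neg)
    hr (ψ := id) monotone_id (V := fun x => V (-x)) (fun a b hab => hV (neg_le_neg hab)) (K := K)
    (by
      refine ((MeasurableEquiv.neg ℝ).measurableEmbedding.ae_map_iff (μ := σ)).2
        (hK.mono fun s hs => ?_)
      have h1 : {x | MeasurableEquiv.neg ℝ s ≤ id x} = Ici (-s) := rfl
      rw [h1, map_neg_Ici]
      simpa using hs)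
    (by
      refine ((MeasurableEquiv.neg ℝ).measurableEmbedding.ae_map_iff (μ := ρ)).2
        (hσ.mono fun s hs => ?_)
      rw [map_neg_Iic]
      simpa using hs)
  simpa only [lintegral_map_neg, map_neg_Iic, id, neg_neg] using h

theorem hardy_lt_one_mirror {ρ σ : Measure ℝ} [SFinite ρ] [SFinite σ] {r : ℝ} (hr0 : 0 < r)
    (hr1 : r < 1) {V : ℝ → ℝ≥0∞} (hV : Monotone V)
    {A B : ℝ≥0∞} (hA : ∫⁻ x, ((V x)⁻¹ * ρ (Iic x)) ^ (r / (1 - r)) ∂ρ ≤ A)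
    (hB : ∫⁻ s, V s ∂σ ≤ B) (hA0 : A ≠ 0) (hB0 : B ≠ 0) (hBt : B ≠ ∞) :
    ∫⁻ x, σ (Ici x) ^ r ∂ρ ≤ 2 ^ (r / (1 - r) + 3) * A ^ (1 - r) * B ^ r := by
  have h := hardy_lt_one (ρ := ρ.map Neg.neg) (σ := σ.map Neg.neg)
    hr0 hr1 (ψ := id) monotone_id (V := fun x => V (-x)) (fun a b hab => hV (neg_le_neg hab))
    (A := A) (B := B) (by simpa only [lintegral_map_neg, map_neg_Ici, id, neg_neg] using hA)
    (by simpa only [lintegral_map_neg, neg_neg] using hB) hA0 hB0 hBt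
  simpa only [lintegral_map_neg, map_neg_Iic, id, neg_neg] using h

theorem hardy_lt_one_necessity_mirror {ρ : Measure ℝ} [SFinite ρ] {r : ℝ} (hr0 : 0 < r)
    (hr1 : r < 1) {v : ℝ → ℝ≥0∞} (hv : Antitone v) {K : ℝ≥0∞}
    (H : ∀ κ : Measure ℝ, IsFiniteMeasure κ → κ ≪ ρ → κ {x | v x = 0} = 0 →
      ∫⁻ x, (v x)⁻¹ ∂κ < ∞ → ∫⁻ x, κ (Ici x) ^ r ∂ρ ≤ K * (∫⁻ x, (v x)⁻¹ ∂κ) ^ r) :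
    ∫⁻ x, (v x * ρ (Iic x)) ^ (r / (1 - r)) ∂ρ ≤
      (2 ^ (r / (1 - r) + 2) * K) ^ (1 / (1 - r)) := by
  have h := hardy_lt_one_necessity (ρ := ρ.map Neg.neg) hr0 hr1
    (v := fun x => v (-x)) (fun a b hab => hv (neg_le_neg hab)) (K := K) (by
      intro κ hκ hκρ hκ0 hκB
      have hac : κ.map Neg.neg ≪ ρ := by
        have := hκρ.map (measurable_neg (G := ℝ))
        rwa [Measure.map_map measurable_neg measurable_neg,
          show (Neg.neg : ℝ → ℝ) ∘ Neg.neg = id from funext fun x => neg_neg x,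
          Measure.map_id] at this
      have h0 : κ.map Neg.neg {x | v x = 0} = 0 := by
        have hm : MeasurableSet {x | v x = 0} := hv.measurable (measurableSet_singleton 0)
        rw [Measure.map_apply measurable_neg hm]
        exact hκ0
      have := H (κ.map Neg.neg) (Measure.isFiniteMeasure_map _ _) hac h0
        (by rwa [lintegral_map_neg])
      simpa only [lintegral_map_neg, map_neg_Ici] using this)
  simpa only [lintegral_map_neg, map_neg_Ici, neg_neg] using h

theorem add_rpow_le_two_rpow {t : ℝ} (ht : 0 ≤ t) (a b : ℝ≥0∞) :
    (a + b) ^ t ≤ 2 ^ t * (a ^ t + b ^ t) := by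
  rcases le_total a b with h | h
  · calc (a + b) ^ t ≤ (2 * b) ^ t := by rw [two_mul]; gcongr
      _ = 2 ^ t * b ^ t := ENNReal.mul_rpow_of_nonneg _ _ ht
      _ ≤ _ := by gcongr; exact le_add_self
  · calc (a + b) ^ t ≤ (2 * a) ^ t := by rw [two_mul]; gcongr
      _ = 2 ^ t * a ^ t := ENNReal.mul_rpow_of_nonneg _ _ ht
      _ ≤ _ := by gcongr; exact le_self_add

/-- The scaling in `hardy_lt_one` excludes vanishing bounds; these are recovered by enlarging both
by `ε` and letting `ε` tend to 0. Finiteness makes the product continuous in the limit. -/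
theorem le_mul_rpow_of_forall_pos {L c A B : ℝ≥0∞} {s t : ℝ} (hs : 0 < s) (ht : 0 < t)
    (hc : c ≠ ∞) (hA : A ≠ ∞) (hB : B ≠ ∞)
    (h : ∀ ε : ℝ≥0∞, ε ≠ 0 → ε ≠ ∞ → L ≤ c * (A + ε) ^ s * (B + ε) ^ t) :
    L ≤ c * A ^ s * B ^ t := by
  have hA' : Filter.Tendsto (fun n : ℕ => A + ((n : ℝ≥0∞))⁻¹) Filter.atTop (nhds (A + 0)) :=
    tendsto_const_nhds.add ENNReal.tendsto_inv_nat_nhds_zero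
  have hB' : Filter.Tendsto (fun n : ℕ => B + ((n : ℝ≥0∞))⁻¹) Filter.atTop (nhds (B + 0)) :=
    tendsto_const_nhds.add ENNReal.tendsto_inv_nat_nhds_zero
  rw [add_zero] at hA' hB'
  have h1 := ENNReal.Tendsto.mul (ENNReal.Tendsto.const_mul
    ((ENNReal.continuous_rpow_const (y := s)).continuousAt.tendsto.comp hA') (Or.inr hc))
    (Or.inr (ENNReal.rpow_ne_top_of_nonneg ht.le hB))
    ((ENNReal.continuous_rpow_const (y := t)).continuousAt.tendsto.comp hB')
    (Or.inr (ENNReal.mul_ne_top hc (ENNReal.rpow_ne_top_of_nonneg hs.le hA)))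
  refine ge_of_tendsto h1 ((Filter.eventually_ge_atTop 1).mono fun n hn => ?_)
  exact h _ (by simp) (by simp; omega)

theorem hardy_lt_one_of_ne_top {ρ σ : Measure ℝ} [SFinite ρ] [SFinite σ] {r : ℝ} (hr0 : 0 < r)
    (hr1 : r < 1) {ψ : ℝ → ℝ} (hψ : Monotone ψ) {V : ℝ → ℝ≥0∞} (hV : Antitone V)
    {A B : ℝ≥0∞} (hA : ∫⁻ x, ((V (ψ x))⁻¹ * ρ (Ici x)) ^ (r / (1 - r)) ∂ρ ≤ A)
    (hB : ∫⁻ s, V s ∂σ ≤ B) (hAt : A ≠ ∞) (hBt : B ≠ ∞) :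
    ∫⁻ x, σ (Iic (ψ x)) ^ r ∂ρ ≤ 2 ^ (r / (1 - r) + 3) * A ^ (1 - r) * B ^ r := by
  have h1r : 0 < 1 - r := by linarith
  refine le_mul_rpow_of_forall_pos h1r hr0
    (ENNReal.rpow_ne_top_of_nonneg (by positivity) (by simp)) hAt hBt fun ε hε hεt => ?_
  exact hardy_lt_one hr0 hr1 hψ hV (hA.trans le_self_add) (hB.trans le_self_add)
    (by simp [hε]) (by simp [hε]) (by simp [hBt, hεt])

theorem hardy_lt_one_mirror_of_ne_top {ρ σ : Measure ℝ} [SFinite ρ] [SFinite σ] {r : ℝ}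
    (hr0 : 0 < r) (hr1 : r < 1) {V : ℝ → ℝ≥0∞} (hV : Monotone V)
    {A B : ℝ≥0∞} (hA : ∫⁻ x, ((V x)⁻¹ * ρ (Iic x)) ^ (r / (1 - r)) ∂ρ ≤ A)
    (hB : ∫⁻ s, V s ∂σ ≤ B) (hAt : A ≠ ∞) (hBt : B ≠ ∞) :
    ∫⁻ x, σ (Ici x) ^ r ∂ρ ≤ 2 ^ (r / (1 - r) + 3) * A ^ (1 - r) * B ^ r := by
  have h1r : 0 < 1 - r := by linarith
  refine le_mul_rpow_of_forall_pos h1r hr0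
    (ENNReal.rpow_ne_top_of_nonneg (by positivity) (by simp)) hAt hBt fun ε hε hεt => ?_
  exact hardy_lt_one_mirror hr0 hr1 hV (hA.trans le_self_add) (hB.trans le_self_add)
    (by simp [hε]) (by simp [hε]) (by simp [hBt, hεt])

/-! ### Discretization of quasi-concave functions -/

/-- A concave majorant of a quasi-concave function `h` on `(0, ∞)`. -/
noncomputable def concMaj (h : ℝ → ℝ) (z : ℝ) : ℝ := ⨅ s : Ioi (0 : ℝ), (1 + z / s) * h s

theorem concMaj_le {h : ℝ → ℝ} (hpos : ∀ z, 0 < z → 0 < h z) {z s : ℝ} (hz : 0 < z) (hs : 0 < s) :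
    concMaj h z ≤ (1 + z / s) * h s := by
  refine ciInf_le (f := fun s : Ioi (0 : ℝ) => (1 + z / s) * h s) ⟨0, ?_⟩ ⟨s, hs⟩
  rintro _ ⟨⟨t, ht⟩, rfl⟩
  have ht : 0 < t := ht
  have := hpos t ht
  positivity

theorem le_concMaj {h : ℝ → ℝ} {z c : ℝ} (hc : ∀ s, 0 < s → c ≤ (1 + z / s) * h s) :
    c ≤ concMaj h z := by
  have : Nonempty (Ioi (0 : ℝ)) := ⟨⟨1, mem_Ioi.2 one_pos⟩⟩
  exact le_ciInf fun s => hc s s.2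

/-- Abel summation: passing from `k` to `k + 1` affects only the indices above `k`, and the
resulting differences telescope to `2^k D (k + 1)`. -/
theorem grid_sum_eq {D : ℕ → ℝ} {L : ℕ} (hD : D (L + 1) = 0) {k : ℕ} (hk : k ≤ L) :
    ∑ i ∈ Finset.range (L + 1), (D i - D (i + 1)) * min (2 ^ i) (2 ^ k) =
      D 0 + ∑ j ∈ Finset.range k, 2 ^ j * D (j + 1) := by
  induction k with
  | zero =>
    have h1 : ∀ i ∈ Finset.range (L + 1), (D i - D (i + 1)) * min ((2 : ℝ) ^ i) (2 ^ 0) =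
        D i - D (i + 1) := fun i _ => by
      rw [pow_zero, min_eq_right (one_le_pow₀ (by norm_num)), mul_one]
    rw [Finset.sum_congr rfl h1, Finset.sum_range_sub', hD]
    simp
  | succ k ih =>
    rw [Finset.sum_range_succ _ k, ← add_assoc, ← ih (by omega), ← sub_eq_iff_eq_add',
      ← Finset.sum_sub_distrib]
    have h1 : ∀ i ∈ Finset.range (L + 1), (D i - D (i + 1)) * min ((2 : ℝ) ^ i) (2 ^ (k + 1)) -
        (D i - D (i + 1)) * min ((2 : ℝ) ^ i) (2 ^ k) =
        if k + 1 ≤ i then 2 ^ k * (D i - D (i + 1)) else 0 := fun i _ => by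
      split_ifs with hi
      · rw [min_eq_right (pow_le_pow_right₀ (by norm_num) hi),
          min_eq_right (pow_le_pow_right₀ (by norm_num) (by omega)), pow_succ]
        ring
      · rw [min_eq_left (pow_le_pow_right₀ (by norm_num) (by omega)),
          min_eq_left (pow_le_pow_right₀ (by norm_num) (by omega))]
        ring
    rw [Finset.sum_congr rfl h1, ← Finset.sum_filter]
    have h2 : (Finset.range (L + 1)).filter (fun i => k + 1 ≤ i) = Finset.Ico (k + 1) (L + 1) := by
      ext i; simp; omega
    rw [h2, ← Finset.mul_sum]
    congr 1
    have h3 := Finset.sum_Ico_sub D (show k + 1 ≤ L + 1 by omega)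
    rw [hD] at h3
    have h4 : ∑ i ∈ Finset.Ico (k + 1) (L + 1), (D i - D (i + 1)) =
        -∑ i ∈ Finset.Ico (k + 1) (L + 1), (D (i + 1) - D i) := by
      rw [← Finset.sum_neg_distrib]; exact Finset.sum_congr rfl fun i _ => by ring
    rw [h4, h3]; ring

/-- The majorant `concMaj h` is an infimum of affine functions, hence concave, and it lies between
`h` and `2h`. Its piecewise linear interpolation at the points `z₀ 2^i`, linear from the origin to
the first node and constant after the last one, is a positive combination of functions `min(1,
z/c)`. Doubling the argument at most doubles each of these, which controls the values between nodes.
-/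
theorem exists_grid {h : ℝ → ℝ} (hpos : ∀ z, 0 < z → 0 < h z)
    (hmono : ∀ x y, 0 < x → x ≤ y → h x ≤ h y)
    (hanti : ∀ x y, 0 < x → x ≤ y → h y * x ≤ h x * y) {z₀ : ℝ} (hz₀ : 0 < z₀) (L : ℕ) :
    ∃ m : ℕ → ℝ, (∀ i, 0 ≤ m i) ∧
      (∀ z, 0 < z → ∑ i ∈ Finset.range (L + 1), m i * min 1 (z / (z₀ * 2 ^ i)) ≤ 4 * h z) ∧
      (∀ z, z₀ ≤ z → z ≤ z₀ * 2 ^ L →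
        h z ≤ 2 * ∑ i ∈ Finset.range (L + 1), m i * min 1 (z / (z₀ * 2 ^ i))) := by
  have hle2 : ∀ z, 0 < z → concMaj h z ≤ 2 * h z := fun z hz => by
    have := concMaj_le hpos hz hz
    rw [div_self hz.ne'] at this
    linarith
  have hge : ∀ z, 0 < z → h z ≤ concMaj h z := fun z hz => le_concMaj fun s hs => by
    have hhs := hpos s hs
    rcases le_total z s with hzs | hzs
    · have h1 := hmono z s hz hzs
      have : 0 ≤ z / s * h s := by positivity
      linarith
    · have h1 := hanti s z hs hzs
      have h2 : h z ≤ z / s * h s := by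
        rw [div_mul_eq_mul_div, le_div_iff₀ hs]; linarith
      linarith
  set a : ℕ → ℝ := fun k => concMaj h (z₀ * 2 ^ k) with ha
  have hzp : ∀ k : ℕ, 0 < z₀ * 2 ^ k := fun k => by positivity
  have ha0 : ∀ k, 0 < a k := fun k => (hpos _ (hzp k)).trans_le (hge _ (hzp k))
  have hamono : ∀ k, a k ≤ a (k + 1) := fun k => le_concMaj fun s hs => by
    refine (concMaj_le hpos (hzp k) hs).trans ?_
    have := hpos s hs
    have : z₀ * 2 ^ k ≤ z₀ * 2 ^ (k + 1) := by
      rw [pow_succ]; have := hzp k; linarith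
    gcongr
  -- Concavity at the middle node, which is two thirds of the way towards the left one: `3 · 2^{k+1}
  -- = 2 · 2^k + 2^{k+2}`.
  have haff : ∀ k, 2 * a k + a (k + 2) ≤ 3 * a (k + 1) := fun k => by
    have : (2 * a k + a (k + 2)) / 3 ≤ a (k + 1) := le_concMaj fun s hs => by
      have h1 := concMaj_le hpos (hzp k) hs
      have h2 := concMaj_le hpos (hzp (k + 2)) hs
      rw [div_le_iff₀ (by norm_num)]
      calc 2 * a k + a (k + 2) ≤ 2 * ((1 + z₀ * 2 ^ k / s) * h s) +
            (1 + z₀ * 2 ^ (k + 2) / s) * h s := by linarith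
        _ = _ := by rw [pow_succ, pow_succ]; ring
    linarith
  have ha1 : a 1 ≤ 2 * a 0 := by
    have : a 1 / 2 ≤ a 0 := le_concMaj fun s hs => by
      have h2 := concMaj_le hpos (hzp 1) hs
      have h3 := hpos s hs
      rw [div_le_iff₀ (by norm_num)]
      calc a 1 ≤ (1 + z₀ * 2 ^ 1 / s) * h s := h2
        _ ≤ (1 + z₀ * 2 ^ 0 / s) * h s * 2 := by
          have : (1 + z₀ * 2 ^ 0 / s) * h s * 2 - (1 + z₀ * 2 ^ 1 / s) * h s = h s := by ring
          linarith
    linarith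
  -- The slopes of the interpolant in units of `1 / z₀`: `D 0` belongs to the segment starting at
  -- the origin, and the slope vanishes past the last node. Concavity makes them decrease, so that
  -- their differences are admissible masses.
  set D : ℕ → ℝ := fun k => match k with
    | 0 => a 0
    | j + 1 => if j + 1 ≤ L then (a (j + 1) - a j) / 2 ^ j else 0 with hDdef
  have hDL : D (L + 1) = 0 := by simp [hDdef]
  have hDs : ∀ j, D (j + 1) = if j + 1 ≤ L then (a (j + 1) - a j) / 2 ^ j else 0 := fun j => rfl
  have hD0 : D 0 = a 0 := rfl
  have hDanti : ∀ i, D (i + 1) ≤ D i := by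
    intro i
    cases i with
    | zero =>
      rw [hDs, hD0]
      split_ifs
      · simp; linarith
      · exact (ha0 0).le
    | succ j =>
      rw [hDs, hDs]
      by_cases h1 : j + 1 + 1 ≤ L
      · rw [if_pos h1, if_pos (by omega), div_le_div_iff₀ (by positivity) (by positivity), pow_succ]
        have := haff j
        have h2 : (0 : ℝ) < 2 ^ j := by positivity
        nlinarith
      · rw [if_neg h1]
        split_ifs
        · have := hamono j
          apply div_nonneg (by linarith) (by positivity)
        · exact le_rfl
  have hTa : ∀ k, k ≤ L → D 0 + ∑ j ∈ Finset.range k, 2 ^ j * D (j + 1) = a k := by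
    intro k
    induction k with
    | zero => simp [hD0]
    | succ k ih =>
      intro hk
      rw [Finset.sum_range_succ, ← add_assoc, ih (by omega), hDs, if_pos hk]
      field_simp
      ring
  set m : ℕ → ℝ := fun i => 2 ^ i * (D i - D (i + 1)) with hm
  have hm0 : ∀ i, 0 ≤ m i := fun i => mul_nonneg (by positivity) (by linarith [hDanti i])
  set H : ℝ → ℝ := fun z => ∑ i ∈ Finset.range (L + 1), m i * min 1 (z / (z₀ * 2 ^ i)) with hH
  have hHk : ∀ k, k ≤ L → H (z₀ * 2 ^ k) = a k := by
    intro k hk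
    rw [← hTa k hk, ← grid_sum_eq hDL hk]
    refine Finset.sum_congr rfl fun i _ => ?_
    rw [hm]
    simp only
    rw [mul_div_mul_left _ _ hz₀.ne', mul_comm ((2 : ℝ) ^ i), mul_assoc]
    congr 1
    rw [mul_min_of_nonneg _ _ (by positivity), mul_one, mul_div_cancel₀ _ (by positivity)]
  have hHmono : ∀ x y, x ≤ y → H x ≤ H y := fun x y hxy =>
    Finset.sum_le_sum fun i _ => mul_le_mul_of_nonneg_left
      (min_le_min le_rfl (div_le_div_of_nonneg_right hxy (hzp i).le)) (hm0 i)
  have hH2 : ∀ x, 0 < x → H (2 * x) ≤ 2 * H x := fun x hx => by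
    rw [hH]
    simp only
    rw [Finset.mul_sum]
    refine Finset.sum_le_sum fun i _ => ?_
    have h1 : min 1 (2 * x / (z₀ * 2 ^ i)) ≤ 2 * min 1 (x / (z₀ * 2 ^ i)) := by
      rw [mul_min_of_nonneg _ _ (by norm_num)]
      exact min_le_min (by norm_num) (by rw [mul_div_assoc])
    have := mul_le_mul_of_nonneg_left h1 (hm0 i)
    linarith
  have hk : ∀ z, z₀ ≤ z → z ≤ z₀ * 2 ^ L →
      ∃ k ≤ L, z₀ * 2 ^ k ≤ z ∧ z ≤ 2 * (z₀ * 2 ^ k) := by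
    intro z hz1 hz2
    obtain ⟨k, hk1, hk2⟩ := exists_nat_pow_near (x := z / z₀) (y := (2 : ℝ))
      (by rwa [le_div_iff₀ hz₀, one_mul]) (by norm_num)
    rw [le_div_iff₀ hz₀] at hk1
    rw [div_lt_iff₀ hz₀, pow_succ] at hk2
    refine ⟨k, ?_, by linarith, by linarith⟩
    have : (2 : ℝ) ^ k ≤ 2 ^ L := by
      have : 2 ^ k * z₀ ≤ 2 ^ L * z₀ := by linarith
      exact le_of_mul_le_mul_right this hz₀
    exact (pow_le_pow_iff_right₀ (by norm_num : (1 : ℝ) < 2)).1 this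
  refine ⟨m, hm0, fun z hz => ?_, fun z hz1 hz2 => ?_⟩
  · change H z ≤ 4 * h z
    have hhz := hpos z hz
    rcases lt_or_ge z z₀ with h1 | h1
    · have h2 : H z ≤ z / z₀ * H z₀ := by
        rw [hH]
        simp only
        rw [Finset.mul_sum]
        refine Finset.sum_le_sum fun i _ => ?_
        have h3 : z₀ / (z₀ * 2 ^ i) ≤ 1 := by
          rw [div_le_one (hzp i)]
          exact le_mul_of_one_le_right hz₀.le (one_le_pow₀ (by norm_num))
        rw [min_eq_right h3]
        have h4 : min 1 (z / (z₀ * 2 ^ i)) ≤ z / z₀ * (z₀ / (z₀ * 2 ^ i)) := by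
          rw [div_mul_div_cancel₀ hz₀.ne']
          exact min_le_right _ _
        have := mul_le_mul_of_nonneg_left h4 (hm0 i)
        linarith
      have h3 := hHk 0 (by omega)
      rw [pow_zero, mul_one] at h3
      have h4 : a 0 ≤ 2 * h z₀ := by simpa [ha] using hle2 z₀ hz₀
      have h5 := hanti z z₀ hz h1.le
      have h6 : z / z₀ * H z₀ ≤ 2 * h z := by
        rw [h3, div_mul_eq_mul_div, div_le_iff₀ hz₀]
        nlinarith
      linarith
    rcases le_or_gt z (z₀ * 2 ^ L) with h2 | h2
    · obtain ⟨k, hkL, hk1, hk2⟩ := hk z h1 h2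
      have h3 := hHmono _ _ hk2
      have h4 := hH2 _ (hzp k)
      rw [hHk k hkL] at h4
      have h5 : a k ≤ 2 * h (z₀ * 2 ^ k) := hle2 _ (hzp k)
      have h6 := hmono _ _ (hzp k) hk1
      linarith
    · have h3 : H z ≤ H (z₀ * 2 ^ L) := Finset.sum_le_sum fun i hi =>
        mul_le_mul_of_nonneg_left (by
          have : (1 : ℝ) ≤ z₀ * 2 ^ L / (z₀ * 2 ^ i) := by
            rw [le_div_iff₀ (hzp i), one_mul]
            have : i ≤ L := by simpa [Nat.lt_succ_iff] using hi
            gcongr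
            norm_num
          rw [min_eq_left this]
          exact min_le_left _ _) (hm0 i)
      rw [hHk L le_rfl] at h3
      have h5 : a L ≤ 2 * h (z₀ * 2 ^ L) := hle2 _ (hzp L)
      have h6 := hmono _ _ (hzp L) h2.le
      linarith
  · change h z ≤ 2 * H z
    obtain ⟨k, hkL, hk1, hk2⟩ := hk z hz1 hz2
    have h1 := hanti _ _ (hzp k) hk1
    have h2 := hge _ (hzp k)
    have h3 := hHmono _ _ hk1
    rw [hHk k hkL] at h3
    have h4 : h z ≤ 2 * h (z₀ * 2 ^ k) := by
      have h5 := hpos _ (hzp k)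
      have h6 := hzp k
      have h7 : h z * (z₀ * 2 ^ k) ≤ (2 * h (z₀ * 2 ^ k)) * (z₀ * 2 ^ k) := by nlinarith
      exact le_of_mul_le_mul_right h7 h6
    have h5 : concMaj h (z₀ * 2 ^ k) = a k := rfl
    linarith

/-! ### Rearrangements and the maximal function -/

variable {n : ℕ}

theorem rearr_antitone (g : EuclideanSpace ℝ (Fin n) → ℝ≥0∞) : Antitone (rearr g) := by
  intro a b hab
  refine sInf_le_sInf fun s hs => ⟨hs.1, hs.2.trans (ENNReal.ofReal_le_ofReal hab)⟩

theorem rearr_le {g : EuclideanSpace ℝ (Fin n) → ℝ≥0∞} {t : ℝ} {c : ℝ≥0∞}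
    (h : volume {x | c < g x} ≤ ENNReal.ofReal t) : rearr g t ≤ c := by
  refine le_of_forall_gt_imp_ge_of_dense fun s hs => sInf_le ⟨(zero_le).trans_lt hs, ?_⟩
  exact (measure_mono fun x hx => lt_trans hs hx).trans h

theorem measure_lt_le_of_rearr_lt {g : EuclideanSpace ℝ (Fin n) → ℝ≥0∞} {t : ℝ} {c : ℝ≥0∞}
    (h : rearr g t < c) : volume {x | c < g x} ≤ ENNReal.ofReal t := by
  obtain ⟨s, hs, hsc⟩ := sInf_lt_iff.1 h
  exact (measure_mono fun x hx => lt_trans hsc hx).trans hs.2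

theorem le_rearr {g : EuclideanSpace ℝ (Fin n) → ℝ≥0∞} {t : ℝ} {c : ℝ≥0∞}
    (h : ENNReal.ofReal t < volume {x | c < g x}) : c ≤ rearr g t := by
  by_contra hc
  exact absurd (measure_lt_le_of_rearr_lt (not_le.1 hc)) (not_le.2 h)

theorem lintegral_Ioo_antitone_le {φ : ℝ → ℝ≥0∞} (hφ : Antitone φ) {x y : ℝ} (hx : 0 < x)
    (hxy : x ≤ y) :
    ENNReal.ofReal x * ∫⁻ t in Ioo 0 y, φ t ≤ ENNReal.ofReal y * ∫⁻ t in Ioo 0 x, φ t := by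
  have h1 : ENNReal.ofReal x * φ x ≤ ∫⁻ t in Ioo 0 x, φ t := by
    calc ENNReal.ofReal x * φ x = ∫⁻ _ in Ioo 0 x, φ x := by
          rw [setLIntegral_const, Real.volume_Ioo, sub_zero, mul_comm]
      _ ≤ _ := setLIntegral_mono' measurableSet_Ioo fun t ht => hφ ht.2.le
  have h2 : ∫⁻ t in Ico x y, φ t ≤ φ x * ENNReal.ofReal (y - x) := by
    calc ∫⁻ t in Ico x y, φ t ≤ ∫⁻ _ in Ico x y, φ x :=
          setLIntegral_mono' measurableSet_Ico fun t ht => hφ ht.1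
      _ = _ := by rw [setLIntegral_const, Real.volume_Ico]
  have h3 : ∫⁻ t in Ioo 0 y, φ t ≤ (∫⁻ t in Ioo 0 x, φ t) + ∫⁻ t in Ico x y, φ t := by
    refine le_trans (lintegral_mono_set fun t ht => ?_) (lintegral_union_le _ _ _)
    rcases lt_or_ge t x with h | h
    · exact Or.inl ⟨ht.1, h⟩
    · exact Or.inr ⟨h, ht.2⟩
  calc ENNReal.ofReal x * ∫⁻ t in Ioo 0 y, φ t
      ≤ ENNReal.ofReal x * ((∫⁻ t in Ioo 0 x, φ t) + φ x * ENNReal.ofReal (y - x)) := by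
        gcongr; exact h3.trans (add_le_add le_rfl h2)
    _ = (ENNReal.ofReal x * ∫⁻ t in Ioo 0 x, φ t) +
        ENNReal.ofReal (y - x) * (ENNReal.ofReal x * φ x) := by ring
    _ ≤ (ENNReal.ofReal x * ∫⁻ t in Ioo 0 x, φ t) +
        ENNReal.ofReal (y - x) * ∫⁻ t in Ioo 0 x, φ t := by gcongr
    _ = _ := by
        rw [← add_mul, ← ENNReal.ofReal_add hx.le (by linarith)]
        congr 2; ring

theorem rearrAvg_mul (g : EuclideanSpace ℝ (Fin n) → ℝ≥0∞) {x : ℝ} (hx : 0 < x) :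
    ENNReal.ofReal x * rearrAvg g x = ∫⁻ t in Ioo 0 x, rearr g t := by
  rw [rearrAvg, ENNReal.mul_div_cancel (by simpa using hx) (by simp)]

theorem rearrAvg_antitone (g : EuclideanSpace ℝ (Fin n) → ℝ≥0∞) {x y : ℝ} (hx : 0 < x)
    (hxy : x ≤ y) : rearrAvg g y ≤ rearrAvg g x := by
  have h := lintegral_Ioo_antitone_le (rearr_antitone g) hx hxy
  rw [← rearrAvg_mul g hx, ← rearrAvg_mul g (hx.trans_le hxy), mul_left_comm] at h
  have h2 := (ENNReal.mul_le_mul_iff_right (a := ENNReal.ofReal y)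
    (by simpa using hx.trans_le hxy) (by simp)).1 h
  exact (ENNReal.mul_le_mul_iff_right (a := ENNReal.ofReal x) (by simpa using hx) (by simp)).1 h2

theorem rearrAvg_mul_mono (g : EuclideanSpace ℝ (Fin n) → ℝ≥0∞) {x y : ℝ} (hx : 0 < x)
    (hxy : x ≤ y) : ENNReal.ofReal x * rearrAvg g x ≤ ENNReal.ofReal y * rearrAvg g y := by
  rw [rearrAvg_mul g hx, rearrAvg_mul g (hx.trans_le hxy)]
  exact lintegral_mono_set (Ioo_subset_Ioo_right hxy)

theorem rearr_le_rearrAvg (g : EuclideanSpace ℝ (Fin n) → ℝ≥0∞) {t : ℝ} (ht : 0 < t) :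
    rearr g t ≤ rearrAvg g t := by
  rw [rearrAvg, ENNReal.le_div_iff_mul_le (by simp [ht]) (by simp)]
  calc rearr g t * ENNReal.ofReal t = ∫⁻ _ in Ioo 0 t, rearr g t := by
        rw [setLIntegral_const, Real.volume_Ioo, sub_zero]
    _ ≤ _ := setLIntegral_mono' measurableSet_Ioo fun s hs => rearr_antitone g hs.2.le

/-- The centred maximal function of a nonnegative function. -/
noncomputable def maximalE (g : EuclideanSpace ℝ (Fin n) → ℝ≥0∞) (x : EuclideanSpace ℝ (Fin n)) :
    ℝ≥0∞ :=
  ⨆ (r : ℝ) (_ : 0 < r), (∫⁻ y in Metric.ball x r, g y) / volume (Metric.ball x r)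

/-- The weak type (1,1) bound, from Vitali's covering lemma; the enlargement factor 5 of the radii
gives the constant `5^n`. -/
theorem measure_maximalE_le (hn : 1 ≤ n) (g : EuclideanSpace ℝ (Fin n) → ℝ≥0∞) {l : ℝ≥0∞}
    (hl0 : l ≠ 0) (hlt : l ≠ ∞) :
    l * volume {x | l < maximalE g x} ≤ 5 ^ n * ∫⁻ x, g x := by
  by_cases hg : ∫⁻ x, g x = ∞
  · rw [hg, ENNReal.mul_top (by simp)]; exact le_top
  set S := {x | l < maximalE g x}
  have hr : ∀ x, ∃ r : ℝ, x ∈ S →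
      0 < r ∧ l * volume (Metric.ball x r) < ∫⁻ y in Metric.ball x r, g y := by
    intro x
    by_cases hx : x ∈ S
    · obtain ⟨r, hr⟩ := lt_iSup_iff.1 (show l < maximalE g x from hx)
      obtain ⟨hr0, hr1⟩ := lt_iSup_iff.1 hr
      refine ⟨r, fun _ => ⟨hr0, ?_⟩⟩
      rwa [ENNReal.lt_div_iff_mul_lt (Or.inl (Metric.measure_ball_pos _ _ hr0).ne')
        (Or.inl measure_ball_lt_top.ne)] at hr1
    · exact ⟨0, fun h => absurd h hx⟩
  choose r hr using hr
  have : Nonempty (Fin n) := ⟨⟨0, hn⟩⟩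
  set κ := volume (Metric.ball (0 : EuclideanSpace ℝ (Fin n)) 1)
  have hκ0 : κ ≠ 0 := (Metric.measure_ball_pos _ _ one_pos).ne'
  have hκt : κ ≠ ∞ := measure_ball_lt_top.ne
  have hvol : ∀ (x : EuclideanSpace ℝ (Fin n)) (ρ : ℝ), 0 < ρ →
      volume (Metric.ball x ρ) = ENNReal.ofReal (ρ ^ n) * κ := fun x ρ hρ => by
    rw [Measure.addHaar_ball _ _ hρ.le, finrank_euclideanSpace_fin]
  -- Vitali's lemma needs bounded radii. A selected radius above 1 satisfies `r ≤ r^n`, and `r^n` is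
  -- controlled by the volume of the ball, hence by the integral of `g`.
  obtain ⟨R, hR⟩ : ∃ R : ℝ, ∀ x ∈ S, r x ≤ R := by
    refine ⟨max 1 ((∫⁻ x, g x) / (l * κ)).toReal, fun x hx => ?_⟩
    obtain ⟨h1, h2⟩ := hr x hx
    rcases le_total (r x) 1 with h | h
    · exact h.trans (le_max_left _ _)
    refine le_trans ?_ (le_max_right _ _)
    have h3 : ENNReal.ofReal (r x) ≤ (∫⁻ x, g x) / (l * κ) := by
      rw [ENNReal.le_div_iff_mul_le (Or.inl (mul_ne_zero hl0 hκ0))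
        (Or.inl (ENNReal.mul_ne_top hlt hκt))]
      calc ENNReal.ofReal (r x) * (l * κ) ≤ ENNReal.ofReal (r x ^ n) * (l * κ) := by
            gcongr; exact le_self_pow₀ h (by omega)
        _ = l * volume (Metric.ball x (r x)) := by rw [hvol _ _ h1]; ring
        _ ≤ ∫⁻ y in Metric.ball x (r x), g y := h2.le
        _ ≤ _ := setLIntegral_le_lintegral _ _
    exact (ENNReal.ofReal_le_iff_le_toReal
      (ENNReal.div_lt_top hg (mul_ne_zero hl0 hκ0)).ne).1 h3
  obtain ⟨u, huS, hdisj, hcov⟩ := Vitali.exists_disjoint_subfamily_covering_enlargement_ball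
    S (fun x => x) r R hR 5 (by norm_num)
  have huc : u.Countable := hdisj.countable_of_isOpen (fun _ _ => Metric.isOpen_ball)
    fun x hx => ⟨x, Metric.mem_ball_self (hr x (huS hx)).1⟩
  have hsub : S ⊆ ⋃ b ∈ u, Metric.ball b (5 * r b) := fun x hx => by
    obtain ⟨b, hb, hxb⟩ := hcov x hx
    exact mem_biUnion hb (hxb (Metric.mem_ball_self (hr x hx).1))
  have := huc.to_subtype
  calc l * volume S ≤ l * ∑' b : u, volume (Metric.ball (b : EuclideanSpace ℝ (Fin n)) (5 *
          r b)) := by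
        gcongr
        exact (measure_mono hsub).trans (measure_biUnion_le _ huc _)
    _ = ∑' b : u, 5 ^ n * (l * volume (Metric.ball (b : EuclideanSpace ℝ (Fin n)) (r b))) := by
        rw [← ENNReal.tsum_mul_left]
        refine tsum_congr fun b => ?_
        have h1 := (hr b (huS b.2)).1
        rw [hvol _ _ (by positivity), hvol _ _ h1, mul_pow,
          ENNReal.ofReal_mul (by positivity), ENNReal.ofReal_pow (by norm_num)]
        norm_num
        ring
    _ ≤ ∑' b : u, 5 ^ n * ∫⁻ y in Metric.ball (b : EuclideanSpace ℝ (Fin n)) (r b), g y := by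
        gcongr with b
        exact (hr b (huS b.2)).2.le
    _ = 5 ^ n * ∫⁻ y in ⋃ b ∈ u, Metric.ball b (r b), g y := by
        rw [ENNReal.tsum_mul_left, lintegral_biUnion huc (fun _ _ => measurableSet_ball) hdisj]
    _ ≤ _ := by gcongr; exact Measure.restrict_le_self

theorem maximalE_le_add (g : EuclideanSpace ℝ (Fin n) → ℝ≥0∞) (s : ℝ≥0∞)
    (x : EuclideanSpace ℝ (Fin n)) :
    maximalE g x ≤ s + maximalE (fun y => g y - s) x := by
  refine iSup₂_le fun r hr => ?_
  have h0 : volume (Metric.ball x r) ≠ 0 := (Metric.measure_ball_pos _ _ hr).ne'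
  have ht : volume (Metric.ball x r) ≠ ∞ := measure_ball_lt_top.ne
  calc (∫⁻ y in Metric.ball x r, g y) / volume (Metric.ball x r)
      ≤ (∫⁻ y in Metric.ball x r, (s + (g y - s))) / volume (Metric.ball x r) := by
        gcongr with y
        exact le_add_tsub
    _ = s + (∫⁻ y in Metric.ball x r, (g y - s)) / volume (Metric.ball x r) := by
        rw [lintegral_add_left measurable_const, setLIntegral_const, ENNReal.add_div,
          ENNReal.mul_div_cancel_right h0 ht]
    _ ≤ _ := by
        gcongr
        exact le_iSup₂ (f := fun (r : ℝ) (_ : 0 < r) =>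
          (∫⁻ y in Metric.ball x r, (g y - s)) / volume (Metric.ball x r)) r hr

theorem measure_ofReal_le (a : ℝ≥0∞) : volume (Ioi (0 : ℝ) ∩ {l | ENNReal.ofReal l ≤ a}) ≤ a := by
  by_cases ha : a = ∞
  · rw [ha]; exact le_top
  calc volume (Ioi (0 : ℝ) ∩ {l | ENNReal.ofReal l ≤ a}) ≤ volume (Ioc (0 : ℝ) a.toReal) :=
        measure_mono fun l hl => ⟨hl.1, (ENNReal.ofReal_le_iff_le_toReal ha).1 hl.2⟩
    _ = a := by rw [Real.volume_Ioc, sub_zero, ENNReal.ofReal_toReal ha]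

/-- Layer cake on both sides. With `s` the rearrangement at `t`, the set where `|f| - s > l` has
some measure `μ ≤ t`, and the rearrangement is at least `s + l` on `(0, μ)`; so the level sets of
the truncated function are no larger than those of the rearrangement on `(0, t)`. -/
theorem lintegral_sub_rearr_le {f : EuclideanSpace ℝ (Fin n) → ℝ} (hf : AEMeasurable f volume)
    {t : ℝ} (hs : rearr (fun x => ‖f x‖ₑ) t ≠ ∞) :
    ∫⁻ x, (‖f x‖ₑ - rearr (fun x => ‖f x‖ₑ) t) ≤ ∫⁻ y in Ioo 0 t, rearr (fun x => ‖f x‖ₑ) y := by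
  set g : EuclideanSpace ℝ (Fin n) → ℝ≥0∞ := fun x => ‖f x‖ₑ with hg
  set s := rearr g t
  have h1 : ∀ x, g x - s = ENNReal.ofReal (max (‖f x‖ - s.toReal) 0) := fun x => by
    rw [ENNReal.ofReal_max, ENNReal.ofReal_zero, max_eq_left zero_le,
      ENNReal.ofReal_sub _ ENNReal.toReal_nonneg, ENNReal.ofReal_toReal hs, ofReal_norm]
  rw [lintegral_congr h1, lintegral_eq_lintegral_meas_lt volume
    (f := fun x => max (‖f x‖ - s.toReal) 0) (Filter.Eventually.of_forall fun x => le_max_right _ _)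
    ((hf.norm.sub_const _).max aemeasurable_const)]
  have h2 : ∀ l ∈ Ioi (0 : ℝ), volume {x | l < max (‖f x‖ - s.toReal) 0} ≤
      volume.restrict (Ioo 0 t) {y | ENNReal.ofReal l ≤ rearr g y} := by
    intro l hl
    have hl : 0 < l := hl
    set μ := volume {x | l < max (‖f x‖ - s.toReal) 0} with hμ
    have hset : {x | l < max (‖f x‖ - s.toReal) 0} ⊆ {x | s + ENNReal.ofReal l < g x} := by
      intro x hx
      have hx : l < max (‖f x‖ - s.toReal) 0 := hx
      have hx' : s.toReal + l < ‖f x‖ := by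
        rcases lt_max_iff.1 hx with h | h
        · linarith
        · linarith
      change s + ENNReal.ofReal l < ‖f x‖ₑ
      rw [← ofReal_norm, ← ENNReal.ofReal_toReal hs,
        ← ENNReal.ofReal_add ENNReal.toReal_nonneg hl.le]
      exact (ENNReal.ofReal_lt_ofReal_iff (by have := @ENNReal.toReal_nonneg s; linarith)).2 hx'
    have hμt : μ ≤ ENNReal.ofReal t := (measure_mono hset).trans (measure_lt_le_of_rearr_lt
      (ENNReal.lt_add_right hs (by simpa using hl)))
    have hμtop : μ ≠ ∞ := ne_top_of_le_ne_top ENNReal.ofReal_ne_top hμt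
    have hμt' : μ.toReal ≤ t ∨ μ = 0 := by
      by_cases h0 : μ = 0
      · exact Or.inr h0
      · left
        refine ENNReal.toReal_le_of_le_ofReal ?_ hμt
        by_contra h
        rw [ENNReal.ofReal_of_nonpos (not_le.1 h).le] at hμt
        exact h0 (le_antisymm hμt zero_le)
    rcases hμt' with hμt' | h0
    swap
    · rw [h0]; exact zero_le
    have hm : MeasurableSet {y | ENNReal.ofReal l ≤ rearr g y} :=
      measurableSet_le measurable_const (rearr_antitone g).measurable
    rw [Measure.restrict_apply hm]
    calc μ = volume (Ioo 0 μ.toReal) := by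
          rw [Real.volume_Ioo, sub_zero, ENNReal.ofReal_toReal hμtop]
      _ ≤ _ := measure_mono fun y hy => by
          refine ⟨le_trans le_add_self (le_rearr (c := s + ENNReal.ofReal l) (lt_of_lt_of_le
            ((ENNReal.ofReal_lt_iff_lt_toReal hy.1.le hμtop).2 hy.2) (measure_mono hset))),
            hy.1, hy.2.trans_le hμt'⟩
  have hR : MeasurableSet {z : ℝ × ℝ | ENNReal.ofReal z.1 ≤ rearr g z.2} :=
    measurableSet_le (ENNReal.measurable_ofReal.comp measurable_fst)
      ((rearr_antitone g).measurable.comp measurable_snd)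
  have hsw := lintegral_setLIntegral_swap (ρ := volume.restrict (Ioi (0 : ℝ)))
    (σ := volume.restrict (Ioo 0 t)) (R := fun l y => ENNReal.ofReal l ≤ rearr g y) hR
    (measurable_const (a := (1 : ℝ≥0∞))) (measurable_const (a := (1 : ℝ≥0∞)))
  simp only [one_mul, setLIntegral_one] at hsw
  refine (setLIntegral_mono' measurableSet_Ioi h2).trans ?_
  rw [hsw]
  refine lintegral_mono fun y => ?_
  have hm : MeasurableSet {l | ENNReal.ofReal l ≤ rearr g y} :=
    measurableSet_le ENNReal.measurable_ofReal measurable_const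
  rw [Measure.restrict_apply hm, inter_comm]
  exact measure_ofReal_le _

/-- Subtract `s = f^*(t)` from `|f|`. The bounded part adds at most `s ≤ f^{**}(t)` to the maximal
function. The remainder has integral at most `t f^{**}(t)`, so by the weak type bound its maximal
function exceeds `5^n A` on a set of measure at most `t` as soon as `A > f^{**}(t)`. -/
theorem rearr_maximal_le (hn : 1 ≤ n) {f : EuclideanSpace ℝ (Fin n) → ℝ}
    (hf : AEMeasurable f volume) {t : ℝ} (ht : 0 < t) :
    rearr (maximal f) t ≤ (1 + 5 ^ n) * rearrAvg (fun x => ‖f x‖ₑ) t := by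
  set g : EuclideanSpace ℝ (Fin n) → ℝ≥0∞ := fun x => ‖f x‖ₑ with hg
  have h5 : (5 : ℝ≥0∞) ^ n ≠ 0 := by simp
  have h5t : (5 : ℝ≥0∞) ^ n ≠ ∞ := by simp
  have hC0 : (1 + 5 ^ n : ℝ≥0∞) ≠ 0 := by simp
  have hCt : (1 + 5 ^ n : ℝ≥0∞) ≠ ∞ := by simp
  rw [mul_comm, ← ENNReal.div_le_iff hC0 hCt]
  -- An arbitrary `A` above the average, rather than the average itself, guarantees the nonzero
  -- level that the weak type bound requires.
  refine le_of_forall_gt_imp_ge_of_dense fun A hA => ?_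
  rw [ENNReal.div_le_iff hC0 hCt]
  by_cases hAt : A = ∞
  · rw [hAt, ENNReal.top_mul hC0]; exact le_top
  have hA0 : A ≠ 0 := (zero_le.trans_lt hA).ne'
  set s := rearr g t with hs
  have hsA : s ≤ A := (rearr_le_rearrAvg g ht).trans hA.le
  have hst : s ≠ ∞ := ne_top_of_le_ne_top hAt hsA
  have h1 : volume {x | s + 5 ^ n * A < maximal f x} ≤ ENNReal.ofReal t := by
    have hsub : {x | s + 5 ^ n * A < maximal f x} ⊆
        {x | 5 ^ n * A < maximalE (fun y => g y - s) x} := fun x hx => by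
      have h2 : s + 5 ^ n * A < s + maximalE (fun y => g y - s) x :=
        lt_of_lt_of_le hx (maximalE_le_add g s x)
      exact lt_of_add_lt_add_left h2
    have h3 := measure_maximalE_le hn (fun y => g y - s) (mul_ne_zero h5 hA0)
      (ENNReal.mul_ne_top h5t hAt)
    have h4 : A * volume {x | 5 ^ n * A < maximalE (fun y => g y - s) x} ≤
        A * ENNReal.ofReal t := by
      rw [← ENNReal.mul_le_mul_iff_right h5 h5t, ← mul_assoc]
      refine h3.trans ?_
      gcongr
      refine (lintegral_sub_rearr_le hf hst).trans ?_
      rw [← rearrAvg_mul g ht, mul_comm]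
      gcongr
    exact (measure_mono hsub).trans ((ENNReal.mul_le_mul_iff_right hA0 hAt).1 h4)
  calc rearr (maximal f) t ≤ s + 5 ^ n * A := rearr_le h1
    _ ≤ A + 5 ^ n * A := by gcongr
    _ = A * (1 + 5 ^ n) := by ring

theorem rearrAvg_maximal_le (hn : 1 ≤ n) {f : EuclideanSpace ℝ (Fin n) → ℝ}
    (hf : AEMeasurable f volume) {x : ℝ} :
    rearrAvg (maximal f) x ≤
      (1 + 5 ^ n) * ((∫⁻ t in Ioo 0 x, rearrAvg (fun x => ‖f x‖ₑ) t) / ENNReal.ofReal x) := by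
  rw [rearrAvg, ← mul_div_assoc]
  gcongr
  rw [← lintegral_const_mul' _ _ (by simp)]
  exact setLIntegral_mono' measurableSet_Ioo fun t ht => rearr_maximal_le hn hf ht.1

end

/-! ### Radial step functions -/

section

variable {n : ℕ}

theorem exists_volume_ball_eq (hn : 1 ≤ n) : ∃ κ : ℝ, 0 < κ ∧
    (∀ (x : EuclideanSpace ℝ (Fin n)) (r : ℝ), 0 < r →
      volume (Metric.ball x r) = ENNReal.ofReal (κ * r ^ n)) ∧
    ∀ s : ℝ, 0 < s → volume {x : EuclideanSpace ℝ (Fin n) | κ * ‖x‖ ^ n < s} = ENNReal.ofReal s :=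
        by
  have : Nonempty (Fin n) := ⟨⟨0, hn⟩⟩
  set κ := volume (Metric.ball (0 : EuclideanSpace ℝ (Fin n)) 1)
  have hκ0 : κ ≠ 0 := (Metric.measure_ball_pos _ _ one_pos).ne'
  have hκt : κ ≠ ∞ := measure_ball_lt_top.ne
  have hκ : 0 < κ.toReal := ENNReal.toReal_pos hκ0 hκt
  have hvol : ∀ (x : EuclideanSpace ℝ (Fin n)) (r : ℝ), 0 < r →
      volume (Metric.ball x r) = ENNReal.ofReal (κ.toReal * r ^ n) := fun x r hr => by
    rw [Measure.addHaar_ball _ _ hr.le, finrank_euclideanSpace_fin, mul_comm κ.toReal,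
      ENNReal.ofReal_mul (by positivity), ENNReal.ofReal_toReal hκt]
  refine ⟨κ.toReal, hκ, hvol, fun s hs => ?_⟩
  have hn0 : n ≠ 0 := by omega
  set R : ℝ := (s / κ.toReal) ^ ((n : ℝ)⁻¹) with hR
  have hR0 : 0 < R := by positivity
  have hRn : κ.toReal * R ^ n = s := by
    rw [hR, Real.rpow_inv_natCast_pow (by positivity) hn0]; field_simp
  have hset : {x : EuclideanSpace ℝ (Fin n) | κ.toReal * ‖x‖ ^ n < s} = Metric.ball 0 R := by
    ext x
    rw [mem_ball_zero_iff, mem_ofPred_eq, ← hRn, mul_lt_mul_iff_right₀ hκ,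
      pow_lt_pow_iff_left₀ (norm_nonneg _) hR0.le hn0]
  rw [hset, hvol _ _ hR0, hRn]

/-- Radially decreasing step functions: an upper bound for the averaged rearrangement and a lower
bound for the rearrangement of the maximal function. -/
theorem exists_radial_step (hn : 1 ≤ n) (N : ℕ) {m s : ℕ → ℝ} (hm : ∀ i, 0 ≤ m i)
    (hs : ∀ i, 0 < s i) :
    ∃ f : EuclideanSpace ℝ (Fin n) → ℝ, AEMeasurable f volume ∧
      (∀ y, 0 < y → rearrAvg (fun x => ‖f x‖ₑ) y ≤
        ENNReal.ofReal ((∑ i ∈ Finset.range N, m i * min 1 (y / s i)) / y)) ∧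
      ∀ t, 0 < t → ENNReal.ofReal ((∑ i ∈ Finset.range N, m i * min 1 (t / s i)) / t) ≤
        2 ^ (n + 1) * rearr (maximal f) t := by
  obtain ⟨κ, hκ, hball, hlev⟩ := exists_volume_ball_eq hn
  have : Nonempty (Fin n) := ⟨⟨0, hn⟩⟩
  set φ : ℝ → ℝ := fun t => ∑ i ∈ Finset.range N, m i / s i * (if t < s i then 1 else 0) with hφ
  have hc : ∀ i, 0 ≤ m i / s i := fun i => div_nonneg (hm i) (hs i).le
  have hφ0 : ∀ t, 0 ≤ φ t := fun t => Finset.sum_nonneg fun i _ =>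
    mul_nonneg (hc i) (by split_ifs <;> norm_num)
  have hφa : Antitone φ := fun a b hab => Finset.sum_le_sum fun i _ =>
    mul_le_mul_of_nonneg_left (by
      split_ifs with h1 h2 h2
      · exact le_rfl
      · exact absurd (hab.trans_lt h1) h2
      · norm_num
      · exact le_rfl) (hc i)
  have hφE : ∀ t, ENNReal.ofReal (φ t) = ∑ i ∈ Finset.range N,
      ENNReal.ofReal (m i / s i) * (Iio (s i)).indicator 1 t := fun t => by
    rw [hφ, ENNReal.ofReal_sum_of_nonneg fun i _ =>
      mul_nonneg (hc i) (by split_ifs <;> norm_num)]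
    refine Finset.sum_congr rfl fun i _ => ?_
    rw [ENNReal.ofReal_mul (hc i)]
    by_cases h : t < s i <;> simp [h]
  set H : ℝ → ℝ := fun z => ∑ i ∈ Finset.range N, m i * min 1 (z / s i) with hH
  have hHE : ∀ y, 0 < y → ENNReal.ofReal (H y) = ∑ i ∈ Finset.range N,
      ENNReal.ofReal (m i / s i) * ENNReal.ofReal (min (s i) y) := fun y hy => by
    have hmin : ∀ i, 0 ≤ min 1 (y / s i) := fun i => le_min zero_le_one (div_pos hy (hs i)).le
    rw [hH, ENNReal.ofReal_sum_of_nonneg fun i _ => mul_nonneg (hm i) (hmin i)]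
    refine Finset.sum_congr rfl fun i _ => ?_
    rw [← ENNReal.ofReal_mul (hc i)]
    congr 1
    rw [div_mul_eq_mul_div, mul_div_assoc, ← min_div_div_right (hs i).le, div_self (hs i).ne']
  have hint : ∀ y, 0 < y → ∫⁻ t in Ioo 0 y, ENNReal.ofReal (φ t) = ENNReal.ofReal (H y) := by
    intro y hy
    simp_rw [hφE]
    rw [lintegral_finsetSum _ fun i _ =>
      (measurable_one.indicator measurableSet_Iio).const_mul _, hHE y hy]
    refine Finset.sum_congr rfl fun i _ => ?_
    rw [lintegral_const_mul _ (measurable_one.indicator measurableSet_Iio),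
      lintegral_indicator_one measurableSet_Iio, Measure.restrict_apply measurableSet_Iio,
      Iio_inter_Ioo, Real.volume_Ioo, sub_zero]
  set f : EuclideanSpace ℝ (Fin n) → ℝ := fun x => φ (κ * ‖x‖ ^ n) with hf
  have hfe : ∀ x, ‖f x‖ₑ = ENNReal.ofReal (φ (κ * ‖x‖ ^ n)) := fun x =>
    Real.enorm_of_nonneg (hφ0 _)
  have hNm : Measurable fun x : EuclideanSpace ℝ (Fin n) => κ * ‖x‖ ^ n :=
    (measurable_norm.pow_const n).const_mul κ
  refine ⟨f, (hφa.measurable.comp hNm).aemeasurable, fun y hy => ?_, fun t ht => ?_⟩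
  · have h1 : ∀ t ∈ Ioo 0 y, rearr (fun x => ‖f x‖ₑ) t ≤ ENNReal.ofReal (φ t) := fun t ht => by
      refine rearr_le ?_
      rw [← hlev t ht.1]
      refine measure_mono fun x hx => ?_
      by_contra h
      have h2 : t ≤ κ * ‖x‖ ^ n := not_lt.1 h
      have hx : ENNReal.ofReal (φ t) < ‖f x‖ₑ := hx
      rw [hfe] at hx
      exact absurd (ENNReal.ofReal_le_ofReal (hφa h2)) (not_le.2 hx)
    rw [rearrAvg, ENNReal.ofReal_div_of_pos hy, ← hint y hy]
    exact ENNReal.div_le_div_right (setLIntegral_mono' measurableSet_Ioo h1) _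
  · have hfm : ∀ i, MeasurableSet {x : EuclideanSpace ℝ (Fin n) | κ * ‖x‖ ^ n < s i} := fun i =>
      measurableSet_lt hNm measurable_const
    have hballint : ∀ R, 0 < R → ∫⁻ x in Metric.ball (0 : EuclideanSpace ℝ (Fin n)) R, ‖f x‖ₑ =
        ENNReal.ofReal (H (κ * R ^ n)) := by
      intro R hR
      have hy : 0 < κ * R ^ n := by positivity
      have hset : Metric.ball (0 : EuclideanSpace ℝ (Fin n)) R =
          {x | κ * ‖x‖ ^ n < κ * R ^ n} := by
        ext x
        rw [mem_ball_zero_iff, mem_ofPred_eq, mul_lt_mul_iff_right₀ hκ,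
          pow_lt_pow_iff_left₀ (norm_nonneg _) hR.le (by omega)]
      simp_rw [hfe, hφE]
      have hmeas : ∀ i, Measurable fun x : EuclideanSpace ℝ (Fin n) =>
          (Iio (s i)).indicator (1 : ℝ → ℝ≥0∞) (κ * ‖x‖ ^ n) := fun i =>
        (measurable_one.indicator measurableSet_Iio).comp hNm
      rw [lintegral_finsetSum _ fun i _ => (hmeas i).const_mul _, hHE _ hy]
      refine Finset.sum_congr rfl fun i _ => ?_
      rw [lintegral_const_mul _ (hmeas i)]
      congr 1
      have h1 : ∀ x : EuclideanSpace ℝ (Fin n), (Iio (s i)).indicator (1 : ℝ → ℝ≥0∞) (κ * ‖x‖ ^ n) =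
          {x : EuclideanSpace ℝ (Fin n) | κ * ‖x‖ ^ n < s i}.indicator 1 x := fun x => rfl
      simp_rw [h1]
      rw [lintegral_indicator_one (hfm i), Measure.restrict_apply (hfm i), hset,
        ← hlev _ (lt_min (hs i) hy)]
      congr 1
      ext x
      simp
    have hHmono : ∀ x y, x ≤ y → H x ≤ H y := fun x y hxy =>
      Finset.sum_le_sum fun i _ => mul_le_mul_of_nonneg_left
        (min_le_min le_rfl (div_le_div_of_nonneg_right hxy (hs i).le)) (hm i)
    have hHanti : ∀ x y, 0 < x → x ≤ y → H y / y ≤ H x / x := fun x y hx hxy => by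
      have hy := hx.trans_le hxy
      rw [hH]
      simp only
      rw [Finset.sum_div, Finset.sum_div]
      refine Finset.sum_le_sum fun i _ => ?_
      rw [mul_div_assoc, mul_div_assoc]
      refine mul_le_mul_of_nonneg_left ?_ (hm i)
      rw [← min_div_div_right hy.le, ← min_div_div_right hx.le]
      refine min_le_min (one_div_le_one_div_of_le hx hxy) (le_of_eq ?_)
      field_simp
    have hH0 : ∀ y, 0 < y → 0 ≤ H y := fun y hy => Finset.sum_nonneg fun i _ =>
      mul_nonneg (hm i) (le_min zero_le_one (div_pos hy (hs i)).le)
    -- The ball of radius `2‖x‖` about `x` contains the ball of radius `‖x‖` about the origin, at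
    -- the price of `2^n` in volume, and `H y / y` decreases. The range reaches up to `2 * t`, at
    -- the price of another factor 2, because `le_rearr` wants a set of measure strictly above `t`.
    have hmax : ∀ x : EuclideanSpace ℝ (Fin n), x ≠ 0 → κ * ‖x‖ ^ n < 2 * t →
        ENNReal.ofReal (H t / t / 2 ^ (n + 1)) ≤ maximal f x := by
      intro x hx hxt
      have hx0 : 0 < ‖x‖ := norm_pos_iff.2 hx
      have hy : 0 < κ * ‖x‖ ^ n := by positivity
      have h1 : ENNReal.ofReal (H (κ * ‖x‖ ^ n)) ≤ ∫⁻ y in Metric.ball x (2 * ‖x‖), ‖f y‖ₑ := by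
        rw [← hballint _ hx0]
        refine lintegral_mono_set (Metric.ball_subset_ball' ?_)
        rw [dist_comm, dist_zero_right]; linarith
      refine le_trans ?_ (le_iSup₂ (f := fun (r : ℝ) (_ : 0 < r) =>
        (∫⁻ y in Metric.ball x r, ‖f y‖ₑ) / volume (Metric.ball x r)) (2 * ‖x‖) (by linarith))
      rw [hball _ _ (by positivity)]
      refine le_trans ?_ (ENNReal.div_le_div_right h1 _)
      rw [← ENNReal.ofReal_div_of_pos (by positivity)]
      refine ENNReal.ofReal_le_ofReal ?_
      have h2 := hHanti _ _ hy hxt.le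
      have h3 := hHmono t (2 * t) (by linarith)
      have h4 : H t / t / 2 ≤ H (2 * t) / (2 * t) := by
        rw [div_div, mul_comm t]
        gcongr
      calc H t / t / 2 ^ (n + 1) = H t / t / 2 / 2 ^ n := by rw [pow_succ]; field_simp
        _ ≤ H (κ * ‖x‖ ^ n) / (κ * ‖x‖ ^ n) / 2 ^ n := by
            exact div_le_div_of_nonneg_right (h4.trans h2) (by positivity)
        _ = _ := by rw [mul_pow]; field_simp
    have hvol : ENNReal.ofReal t < volume ({x : EuclideanSpace ℝ (Fin n) | κ * ‖x‖ ^ n < 2 *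
        t} \ {0}) := by
      rw [measure_sdiff_null (measure_singleton _), hlev _ (by linarith)]
      exact (ENNReal.ofReal_lt_ofReal_iff (by linarith)).2 (by linarith)
    have hfin : ENNReal.ofReal (H t / t / 2 ^ (n + 1)) ≤ rearr (maximal f) t := by
      refine le_of_forall_lt fun c hc => ?_
      obtain ⟨d, hcd, hd⟩ := exists_between hc
      refine hcd.trans_le (le_rearr (hvol.trans_le (measure_mono fun x hx => ?_)))
      exact hd.trans_le (hmax x hx.2 hx.1)
    rw [ENNReal.ofReal_div_of_pos (by positivity)] at hfin
    rw [ENNReal.div_le_iff (by simp) (by simp), mul_comm, ENNReal.ofReal_pow (by norm_num)] at hfin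
    simpa using hfin

end

section

/-! ### The kernel representation -/

/-- The kernel `max(s, y)^{-p}`. -/
noncomputable def ker (p s y : ℝ) : ℝ≥0∞ := (ENNReal.ofReal (max s y) ^ p)⁻¹

/-- The function `y ↦ (∫ max(s, y)^{-p} dσ(s))^{1/p}`. -/
noncomputable def gKer (p : ℝ) (σ : Measure ℝ) (y : ℝ) : ℝ≥0∞ := (∫⁻ s, ker p s y ∂σ) ^ (1 / p)

variable {p q : ℝ} {u v : ℝ → ℝ≥0∞}

theorem measurable_ker_uncurry : Measurable fun z : ℝ × ℝ => ker p z.1 z.2 :=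
  ((ENNReal.measurable_ofReal.comp (measurable_fst.max measurable_snd)).pow_const p).inv

theorem measurable_ker_left (y : ℝ) : Measurable fun s => ker p s y :=
  ((ENNReal.measurable_ofReal.comp (measurable_id.max measurable_const)).pow_const p).inv

theorem ofReal_rpow_ne_zero {x : ℝ} (hx : 0 < x) (a : ℝ) : ENNReal.ofReal x ^ a ≠ 0 := by
  simp [ENNReal.rpow_eq_zero_iff, hx]

theorem ofReal_rpow_ne_top {x : ℝ} (hx : 0 < x) (a : ℝ) : ENNReal.ofReal x ^ a ≠ ∞ := by
  simp [ENNReal.rpow_eq_top_iff, hx]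

theorem ker_antitone_right (hp : 0 < p) {s x y : ℝ} (hxy : x ≤ y) : ker p s y ≤ ker p s x := by
  unfold ker; gcongr

theorem gKer_antitone (hp : 0 < p) (σ : Measure ℝ) : Antitone (gKer p σ) := fun x y hxy => by
  unfold gKer
  gcongr with s
  exact ker_antitone_right hp hxy

theorem measurable_gKer (hp : 0 < p) (σ : Measure ℝ) : Measurable (gKer p σ) :=
  (gKer_antitone hp σ).measurable

theorem gKer_rpow (hp : 0 < p) (σ : Measure ℝ) (y : ℝ) :
    gKer p σ y ^ p = ∫⁻ s, ker p s y ∂σ := by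
  rw [gKer, ← ENNReal.rpow_mul, one_div, inv_mul_cancel₀ hp.ne', ENNReal.rpow_one]

theorem rpow_mul_ker_mono (hp : 0 < p) {s x y : ℝ} (hx : 0 < x) (hxy : x ≤ y) :
    ENNReal.ofReal x ^ p * ker p s x ≤ ENNReal.ofReal y ^ p * ker p s y := by
  have hy := hx.trans_le hxy
  have hmx : 0 < max s x := lt_max_of_lt_right hx
  have hmy : 0 < max s y := lt_max_of_lt_right hy
  unfold ker
  rw [← div_eq_mul_inv, ← div_eq_mul_inv, ← ENNReal.div_rpow_of_nonneg _ _ hp.le,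
    ← ENNReal.div_rpow_of_nonneg _ _ hp.le, ← ENNReal.ofReal_div_of_pos hmx,
    ← ENNReal.ofReal_div_of_pos hmy]
  refine ENNReal.rpow_le_rpow (ENNReal.ofReal_le_ofReal ?_) hp.le
  rw [div_le_div_iff₀ hmx hmy]
  rcases le_total s x with h | h
  · rw [max_eq_right h, max_eq_right (h.trans hxy)]; nlinarith
  · rw [max_eq_left h]
    rcases le_total s y with h2 | h2
    · rw [max_eq_right h2]; nlinarith
    · rw [max_eq_left h2]; nlinarith

theorem mul_gKer (hp : 0 < p) (σ : Measure ℝ) (y : ℝ) :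
    ENNReal.ofReal y * gKer p σ y = (∫⁻ s, ENNReal.ofReal y ^ p * ker p s y ∂σ) ^ (1 / p) := by
  rw [lintegral_const_mul' _ _ (ENNReal.rpow_ne_top_of_nonneg hp.le (by simp)),
    ENNReal.mul_rpow_of_nonneg _ _ (by positivity), ← ENNReal.rpow_mul, mul_one_div_cancel hp.ne',
    ENNReal.rpow_one, gKer]

theorem mul_gKer_mono (hp : 0 < p) (σ : Measure ℝ) {x y : ℝ} (hx : 0 < x) (hxy : x ≤ y) :
    ENNReal.ofReal x * gKer p σ x ≤ ENNReal.ofReal y * gKer p σ y := by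
  rw [mul_gKer hp, mul_gKer hp]
  exact ENNReal.rpow_le_rpow (lintegral_mono fun s => rpow_mul_ker_mono hp hx hxy) (by positivity)

theorem bigV_antitone (hp : 0 < p) : Antitone (bigV p v) := fun x y hxy => by
  unfold bigV; gcongr

theorem ofReal_rpow_add_div_mono {a b c : ℝ≥0∞} (ha : a ≠ 0) (hb : b ≠ ∞)
    (hab : a ≤ b) : a / (c + a) ≤ b / (c + b) := by
  have hat : a ≠ ∞ := ne_top_of_le_ne_top hb hab
  have hb0 : b ≠ 0 := (pos_iff_ne_zero.2 ha |>.trans_le hab).ne'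
  have h : ∀ d : ℝ≥0∞, d ≠ 0 → d ≠ ∞ → d / (c + d) = (c / d + 1)⁻¹ := fun d h0 ht => by
    have : c + d = (c / d + 1) * d := by
      rw [add_mul, one_mul, ENNReal.div_mul_cancel h0 ht]
    rw [this, div_eq_mul_inv, ENNReal.mul_inv (Or.inr ht) (Or.inr h0), mul_left_comm,
      ENNReal.mul_inv_cancel h0 ht, mul_one]
  rw [h a ha hat, h b hb0 hb]
  gcongr

theorem rpow_mul_bigV_mono (hp : 0 < p) {x y : ℝ} (hx : 0 < x) (hxy : x ≤ y) :
    ENNReal.ofReal x ^ p * bigV p v x ≤ ENNReal.ofReal y ^ p * bigV p v y := by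
  unfold bigV
  rw [← lintegral_const_mul' _ _ (ofReal_rpow_ne_top hx p),
    ← lintegral_const_mul' _ _ (ofReal_rpow_ne_top (hx.trans_le hxy) p)]
  refine lintegral_mono fun t => ?_
  have := ofReal_rpow_add_div_mono (c := ENNReal.ofReal t ^ p) (ofReal_rpow_ne_zero hx p)
    (ofReal_rpow_ne_top (hx.trans_le hxy) p)
    (ENNReal.rpow_le_rpow (ENNReal.ofReal_le_ofReal hxy) hp.le)
  simp only
  rw [← mul_div_assoc, ← mul_div_assoc, mul_comm, mul_comm (ENNReal.ofReal y ^ p), mul_div_assoc,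
    mul_div_assoc]
  gcongr

/-- `max(s,y)^p ≤ y^p + s^p ≤ 2 max(s,y)^p`. Together with `ker_le_bigV` this identifies `V`, up to
a factor 2, with the kernel integrated against `v`, so that `∫ gKer^p v` is comparable to `∫ V dσ`.
-/
theorem bigV_le_ker {s : ℝ} :
    bigV p v s ≤ ∫⁻ y in Ioi 0, ker p s y * v y := by
  refine lintegral_mono fun y => ?_
  rw [div_eq_mul_inv, mul_comm]
  gcongr
  unfold ker
  refine ENNReal.inv_le_inv.2 ?_
  rcases le_total s y with h | h
  · rw [max_eq_right h]; exact le_self_add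
  · rw [max_eq_left h]; exact le_add_self

theorem ker_le_bigV (hp : 0 < p) {s : ℝ} :
    ∫⁻ y in Ioi 0, ker p s y * v y ≤ 2 * bigV p v s := by
  unfold bigV
  rw [← lintegral_const_mul' _ _ (by simp)]
  refine lintegral_mono fun y => ?_
  rw [div_eq_mul_inv, mul_left_comm, mul_comm]
  gcongr
  unfold ker
  rw [← ENNReal.inv_le_inv, inv_inv, ENNReal.mul_inv (by simp) (by simp), inv_inv,
    ENNReal.inv_mul_le_iff (by simp) (by simp), two_mul]
  gcongr
  · exact le_max_right _ _
  · exact le_max_left _ _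

theorem lintegral_gKer_rpow (hp : 0 < p) (hv : AEMeasurable v (volume.restrict (Ioi (0 : ℝ))))
    (σ : Measure ℝ) [SFinite σ] :
    ∫⁻ y in Ioi 0, gKer p σ y ^ p * v y = ∫⁻ s, (∫⁻ y in Ioi 0, ker p s y * v y) ∂σ := by
  rw [← lintegral_lintegral_swap (μ := volume.restrict (Ioi (0 : ℝ))) (ν := σ)
    (f := fun y s => ker p s y * v y)]
  · refine lintegral_congr fun y => ?_
    rw [gKer_rpow hp, lintegral_mul_const _ (measurable_ker_left y)]
  · exact (measurable_ker_uncurry.comp measurable_swap).aemeasurable.mul hv.comp_fst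

theorem lintegral_gKer_le (hp : 0 < p) (hv : AEMeasurable v (volume.restrict (Ioi (0 : ℝ))))
    (σ : Measure ℝ) [SFinite σ] :
    ∫⁻ y in Ioi 0, gKer p σ y ^ p * v y ≤ 2 * ∫⁻ s, bigV p v s ∂σ := by
  rw [lintegral_gKer_rpow hp hv, ← lintegral_const_mul' _ _ (by simp)]
  exact lintegral_mono fun s => ker_le_bigV (v := v) (s := s) hp

theorem le_lintegral_gKer (hp : 0 < p) (hv : AEMeasurable v (volume.restrict (Ioi (0 : ℝ))))
    (σ : Measure ℝ) [SFinite σ] :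
    ∫⁻ s, bigV p v s ∂σ ≤ ∫⁻ y in Ioi 0, gKer p σ y ^ p * v y := by
  rw [lintegral_gKer_rpow hp hv]
  exact lintegral_mono fun s => bigV_le_ker

/-- `V` decreases and `s^p V s` increases; the two cases of the maximum use one monotonicity each.
Integrated in `s`, this bounds `gKer` pointwise and shows that it is finite. -/
theorem ker_mul_le (hp : 0 < p) {s y : ℝ} (hy : 0 < y) :
    ker p s y * (ENNReal.ofReal y ^ p * bigV p v y) ≤ bigV p v s := by
  unfold ker
  rcases le_total s y with h | h
  · rw [max_eq_right h, ← mul_assoc, ENNReal.inv_mul_cancel (ofReal_rpow_ne_zero hy p)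
      (ofReal_rpow_ne_top hy p), one_mul]
    exact bigV_antitone hp h
  · have hs := hy.trans_le h
    rw [max_eq_left h]
    calc (ENNReal.ofReal s ^ p)⁻¹ * (ENNReal.ofReal y ^ p * bigV p v y)
        ≤ (ENNReal.ofReal s ^ p)⁻¹ * (ENNReal.ofReal s ^ p * bigV p v s) := by
          gcongr _ * ?_
          exact rpow_mul_bigV_mono hp hy h
      _ = _ := by
          rw [← mul_assoc, ENNReal.inv_mul_cancel (ofReal_rpow_ne_zero hs p)
            (ofReal_rpow_ne_top hs p), one_mul]

theorem gKer_rpow_mul_le (hp : 0 < p) (σ : Measure ℝ) {y : ℝ} (hy : 0 < y) :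
    gKer p σ y ^ p * (ENNReal.ofReal y ^ p * bigV p v y) ≤ ∫⁻ s, bigV p v s ∂σ := by
  rw [gKer_rpow hp, ← lintegral_mul_const _ (measurable_ker_left y)]
  exact lintegral_mono fun s => ker_mul_le hp hy

theorem gKer_ne_top (hp : 0 < p) {σ : Measure ℝ} {y : ℝ} (hy : 0 < y) (hV : bigV p v y ≠ 0)
    (hB : ∫⁻ s, bigV p v s ∂σ ≠ ∞) : gKer p σ y ≠ ∞ := by
  intro h
  have h1 := gKer_rpow_mul_le (v := v) hp σ hy
  rw [h, ENNReal.top_rpow_of_pos hp, ENNReal.top_mul (mul_ne_zero (ofReal_rpow_ne_zero hy p) hV)]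
    at h1
  exact hB (top_le_iff.1 h1)

theorem gKer_ne_zero (hp : 0 < p) {σ : Measure ℝ} (hσ : σ ≠ 0) (y : ℝ) : gKer p σ y ≠ 0 := by
  intro h
  have h1 := gKer_rpow hp σ y
  rw [h, ENNReal.zero_rpow_of_pos hp, eq_comm, lintegral_eq_zero_iff (measurable_ker_left y)] at h1
  have h2 : ∀ᵐ s ∂σ, False := h1.mono fun s hs => by
    have : ker p s y ≠ 0 := by
      unfold ker
      exact ENNReal.inv_ne_zero.2 (ENNReal.rpow_ne_top_of_nonneg hp.le (by simp))
    exact this hs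
  rw [Filter.eventually_false_iff_eq_bot, ae_eq_bot] at h2
  exact hσ h2

theorem aemeasurable_wt (hu : AEMeasurable u (volume.restrict (Ioi (0 : ℝ)))) :
    AEMeasurable (wt q u) (volume.restrict (Ioi (0 : ℝ))) :=
  ((ENNReal.measurable_ofReal.pow_const _).aemeasurable).mul hu

/-- Grid approximations are valid only on compact ranges; monotone convergence lets the inner
integral be restricted to `[2^{-N}, 2^N]`. -/
theorem lintegral_le_of_trunc (hq : 0 < q) {G w : ℝ → ℝ≥0∞} {D : ℝ≥0∞}
    (hw : AEMeasurable w (volume.restrict (Ioi (0 : ℝ))))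
    (h : ∀ N : ℕ, ∫⁻ x in Ioi 0,
      (∫⁻ y in Ioo 0 x ∩ Icc ((2 : ℝ) ^ N)⁻¹ (2 ^ N), G y) ^ q * w x ≤ D) :
    ∫⁻ x in Ioi 0, (∫⁻ y in Ioo 0 x, G y) ^ q * w x ≤ D := by
  have hmonoI : Monotone fun N : ℕ => Icc ((2 : ℝ) ^ N)⁻¹ (2 ^ N) := fun M N hMN => by
    refine Icc_subset_Icc ?_ (pow_le_pow_right₀ (by norm_num) hMN)
    exact inv_anti₀ (by positivity) (pow_le_pow_right₀ (by norm_num) hMN)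
  have h1 : ∀ x, (∫⁻ y in Ioo 0 x, G y) =
      ⨆ N : ℕ, ∫⁻ y in Ioo 0 x ∩ Icc ((2 : ℝ) ^ N)⁻¹ (2 ^ N), G y := fun x => by
    rw [← setLIntegral_iUnion_of_directed]
    · congr 2
      rw [← inter_iUnion, eq_comm, inter_eq_left]
      intro y hy
      obtain ⟨N, hN⟩ := pow_unbounded_of_one_lt (max y y⁻¹) (one_lt_two (α := ℝ))
      refine mem_iUnion.2 ⟨N, ?_, (le_max_left _ _).trans hN.le⟩
      exact inv_le_of_inv_le₀ hy.1 ((le_max_right _ _).trans hN.le)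
    · exact Monotone.directed_le fun M N hMN => inter_subset_inter_right _ (hmonoI hMN)
  have h2 : ∀ x, (∫⁻ y in Ioo 0 x, G y) ^ q * w x =
      ⨆ N : ℕ, (∫⁻ y in Ioo 0 x ∩ Icc ((2 : ℝ) ^ N)⁻¹ (2 ^ N), G y) ^ q * w x := fun x => by
    rw [h1, ← ENNReal.iSup_mul]
    congr 1
    exact (ENNReal.orderIsoRpow q hq).map_iSup _
  simp_rw [h2]
  rw [lintegral_iSup' (fun N => ?_)]
  · exact iSup_le h
  · refine Filter.Eventually.of_forall fun x M N hMN => ?_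
    simp only
    exact mul_le_mul' (ENNReal.rpow_le_rpow (lintegral_mono_set
      (inter_subset_inter_right _ (hmonoI hMN))) hq.le) le_rfl
  · refine AEMeasurable.mul (Measurable.aemeasurable (Measurable.pow_const (Monotone.measurable
      fun x y hxy => ?_) _)) hw
    exact lintegral_mono_set (inter_subset_inter_left _ (Ioo_subset_Ioo_right hxy))

end

/-! ### Lower bound for the norm: functions built from measures -/

section

variable {p q : ℝ}

theorem ofReal_four_eq : ENNReal.ofReal 4 = 4 := by norm_num

theorem lintegral_const_mul_rpow_mul {c : ℝ≥0∞} (hc : c ≠ ∞) (hq : 0 ≤ q) (s : Set ℝ)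
    (a w : ℝ → ℝ≥0∞) :
    ∫⁻ x in s, (c * a x) ^ q * w x = c ^ q * ∫⁻ x in s, a x ^ q * w x := by
  rw [← lintegral_const_mul' _ _ (ENNReal.rpow_ne_top_of_nonneg hq hc)]
  refine lintegral_congr fun x => ?_
  rw [ENNReal.mul_rpow_of_nonneg _ _ hq, mul_assoc]

theorem lintegral_div_rpow_mul (hq : 0 < q) (u a : ℝ → ℝ≥0∞) :
    ∫⁻ x in Ioi 0, (a x / ENNReal.ofReal x) ^ q * u x = ∫⁻ x in Ioi 0, a x ^ q * wt q u x := by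
  refine setLIntegral_congr_fun measurableSet_Ioi fun x hx => ?_
  have hx : 0 < x := hx
  simp only [wt]
  rw [ENNReal.div_rpow_of_nonneg _ _ hq.le, ENNReal.rpow_neg, div_eq_mul_inv, mul_assoc]

/-- Testing the maximal operator on the functions built from a measure. -/
theorem lintegral_gKer_le_maximalNorm {n : ℕ} (hn : 1 ≤ n) (hp : 0 < p) (hq : 0 < q) :
    ∃ C : ℝ≥0∞, C ≠ ∞ ∧ ∀ u v : ℝ → ℝ≥0∞,
      AEMeasurable u (volume.restrict (Ioi (0 : ℝ))) →
      AEMeasurable v (volume.restrict (Ioi (0 : ℝ))) →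
      (∀ z, 0 < z → bigV p v z ≠ 0) →
      ∀ (σ : Measure ℝ) [SFinite σ], ∫⁻ s, bigV p v s ∂σ ≠ ∞ →
        ∫⁻ x in Ioi 0, (∫⁻ y in Ioo 0 x, gKer p σ y) ^ q * wt q u x ≤
          C * maximalNorm n p q v u ^ q * (∫⁻ s, bigV p v s ∂σ) ^ (q / p) := by
  refine ⟨(2 ^ (n + 2)) ^ q * 4 ^ q * 2 ^ (q / p), ?_, ?_⟩
  · refine ENNReal.mul_ne_top (ENNReal.mul_ne_top ?_ ?_) ?_ <;>
      exact ENNReal.rpow_ne_top_of_nonneg (by positivity) (by simp)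
  intro u v hu hv hV0 σ _ hB
  set B := ∫⁻ s, bigV p v s ∂σ with hBdef
  by_cases hσ : σ = 0
  · simp [hσ, gKer, hq, hp]
  have hBpos : B ≠ 0 := by
    intro h
    have := gKer_rpow_mul_le (v := v) hp σ one_pos
    rw [← hBdef, h, nonpos_iff_eq_zero] at this
    simp [hV0 1 one_pos, gKer_ne_zero hp hσ, ENNReal.rpow_eq_zero_iff] at this
    exact absurd this.2 (not_lt.2 hp.le)
  by_cases hMt : maximalNorm n p q v u = ∞
  · rw [hMt, ENNReal.top_rpow_of_pos hq, ENNReal.mul_top, ENNReal.top_mul]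
    · exact le_top
    · simp [ENNReal.rpow_eq_zero_iff, hBpos, hB]
    · simp [ENNReal.rpow_eq_zero_iff]
  have hg0 : ∀ y, gKer p σ y ≠ 0 := gKer_ne_zero hp hσ
  have hgt : ∀ y, 0 < y → gKer p σ y ≠ ∞ := fun y hy => gKer_ne_top hp hy (hV0 y hy) hB
  -- `y * gKer p σ y` increases and `gKer p σ` decreases, so the grid lemma applies. The radial step
  -- function with the resulting masses has averaged rearrangement at most `4 gKer` everywhere, and
  -- the rearrangement of its maximal function is at least `2^{-(n+2)} gKer` on `[2^{-N}, 2^N]`.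
  set h : ℝ → ℝ := fun y => (ENNReal.ofReal y * gKer p σ y).toReal with hh
  have hft : ∀ y, 0 < y → ENNReal.ofReal y * gKer p σ y ≠ ∞ := fun y hy =>
    ENNReal.mul_ne_top (by simp) (hgt y hy)
  have hhE : ∀ y, 0 < y → ENNReal.ofReal (h y) = ENNReal.ofReal y * gKer p σ y := fun y hy =>
    ENNReal.ofReal_toReal (hft y hy)
  have hhE' : ∀ y, 0 < y → ENNReal.ofReal (h y / y) = gKer p σ y := fun y hy => by
    rw [ENNReal.ofReal_div_of_pos hy, hhE y hy, mul_comm, ENNReal.mul_div_cancel_right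
      (by simpa using hy) (by simp)]
  have hhr : ∀ y, 0 < y → h y = y * (gKer p σ y).toReal := fun y hy => by
    rw [hh]; simp only; rw [ENNReal.toReal_mul, ENNReal.toReal_ofReal hy.le]
  have hpos : ∀ y, 0 < y → 0 < h y := fun y hy => by
    rw [hhr y hy]; exact mul_pos hy (ENNReal.toReal_pos (hg0 y) (hgt y hy))
  have hmono : ∀ x y, 0 < x → x ≤ y → h x ≤ h y := fun x y hx hxy =>
    ENNReal.toReal_mono (hft y (hx.trans_le hxy)) (mul_gKer_mono hp σ hx hxy)
  have hanti : ∀ x y, 0 < x → x ≤ y → h y * x ≤ h x * y := fun x y hx hxy => by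
    have hy := hx.trans_le hxy
    rw [hhr x hx, hhr y hy]
    have := ENNReal.toReal_mono (hgt x hx) (gKer_antitone hp σ hxy)
    nlinarith [mul_le_mul_of_nonneg_left this (mul_pos hx hy).le]
  have hmain : ∀ N : ℕ, ∫⁻ x in Ioi 0,
      (∫⁻ y in Ioo 0 x ∩ Icc ((2 : ℝ) ^ N)⁻¹ (2 ^ N), gKer p σ y) ^ q * wt q u x ≤
      (2 ^ (n + 2)) ^ q * 4 ^ q * 2 ^ (q / p) * maximalNorm n p q v u ^ q * B ^ (q / p) := by
    intro N
    set z₀ : ℝ := ((2 : ℝ) ^ N)⁻¹ with hz₀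
    have hz₀p : 0 < z₀ := by positivity
    have hzL : z₀ * 2 ^ (2 * N) = 2 ^ N := by
      rw [hz₀, two_mul, pow_add]; field_simp
    obtain ⟨m, hm, hm1, hm2⟩ := exists_grid hpos hmono hanti hz₀p (2 * N)
    obtain ⟨f, hf, hf1, hf2⟩ := exists_radial_step hn (2 * N + 1) hm
      (s := fun i => z₀ * 2 ^ i) (fun i => by positivity)
    have hfup : ∀ y, 0 < y → rearrAvg (fun x => ‖f x‖ₑ) y ≤ 4 * gKer p σ y := fun y hy => by
      refine (hf1 y hy).trans ?_
      calc _ ≤ ENNReal.ofReal (4 * (h y / y)) := by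
            refine ENNReal.ofReal_le_ofReal ?_
            rw [← mul_div_assoc]
            exact div_le_div_of_nonneg_right (hm1 y hy) hy.le
        _ = _ := by rw [ENNReal.ofReal_mul (by norm_num), hhE' y hy, ofReal_four_eq]
    have hflow : ∀ y, 0 < y → y ∈ Icc z₀ (2 ^ N) →
        gKer p σ y ≤ 2 ^ (n + 2) * rearr (maximal f) y := fun y hy hyI => by
      have h1 := hm2 y hyI.1 (by rw [hzL]; exact hyI.2)
      calc gKer p σ y = ENNReal.ofReal (h y / y) := (hhE' y hy).symm
        _ ≤ 2 * ENNReal.ofReal ((∑ i ∈ Finset.range (2 * N + 1), m i * min 1 (y / (z₀ *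
            2 ^ i))) / y) := by
            rw [show (2 : ℝ≥0∞) = ENNReal.ofReal 2 by norm_num, ← ENNReal.ofReal_mul (by norm_num)]
            refine ENNReal.ofReal_le_ofReal ?_
            rw [← mul_div_assoc]
            exact div_le_div_of_nonneg_right h1 hy.le
        _ ≤ 2 * (2 ^ (n + 1) * rearr (maximal f) y) := by gcongr; exact hf2 y hy
        _ = _ := by ring
    have hI : ∫⁻ x in Ioi 0, rearrAvg (fun x => ‖f x‖ₑ) x ^ p * v x ≤ 4 ^ p * (2 * B) := by
      calc _ ≤ ∫⁻ x in Ioi 0, (4 * gKer p σ x) ^ p * v x :=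
            setLIntegral_mono' measurableSet_Ioi fun x hx => by gcongr; exact hfup x hx
        _ = 4 ^ p * ∫⁻ x in Ioi 0, gKer p σ x ^ p * v x :=
            lintegral_const_mul_rpow_mul (by simp) hp.le _ _ _
        _ ≤ _ := by gcongr; exact lintegral_gKer_le hp hv σ
    have hfn : gammaNorm p v (fun x => ‖f x‖ₑ) ≤ (4 ^ p * (2 * B)) ^ (1 / p) := by
      unfold gammaNorm; gcongr
    have hfnt : gammaNorm p v (fun x => ‖f x‖ₑ) ≠ ∞ := ne_top_of_le_ne_top
      (ENNReal.rpow_ne_top_of_nonneg (by positivity) (ENNReal.mul_ne_top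
        (ENNReal.rpow_ne_top_of_nonneg hp.le (by simp)) (ENNReal.mul_ne_top (by simp) hB))) hfn
    have hf0 : ¬ f =ᵐ[volume] 0 := by
      intro h0
      have h1 : ∀ x, maximal f x = 0 := fun x => by
        unfold maximal
        simp only [ENNReal.iSup_eq_zero]
        intro r hr
        have : ∫⁻ y in Metric.ball x r, ‖f y‖ₑ = 0 := by
          rw [lintegral_congr_ae (g := fun _ => 0)
            (ae_restrict_of_ae (h0.mono fun y hy => by simp [hy]))]
          simp
        rw [this, ENNReal.zero_div]
      have h2 : rearr (maximal f) 1 ≤ 0 := rearr_le (by simp [h1])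
      have h3 := hflow 1 one_pos ⟨by
        rw [hz₀]; exact inv_le_one_of_one_le₀ (one_le_pow₀ (by norm_num)),
            one_le_pow₀ (by norm_num)⟩
      rw [nonpos_iff_eq_zero.1 h2, mul_zero, nonpos_iff_eq_zero] at h3
      exact hg0 1 h3
    have hratio : gammaNorm q u (maximal f) ≤
        maximalNorm n p q v u * gammaNorm p v (fun x => ‖f x‖ₑ) := by
      rw [← ENNReal.div_le_iff_le_mul (Or.inr hMt) (Or.inl hfnt)]
      exact le_iSup₂_of_le f ⟨hf, hfnt.lt_top⟩ (le_iSup_of_le hf0 le_rfl)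
    have hMf : ∫⁻ x in Ioi 0, rearrAvg (maximal f) x ^ q * u x = gammaNorm q u (maximal f) ^ q := by
      rw [gammaNorm, ← ENNReal.rpow_mul, one_div, inv_mul_cancel₀ hq.ne', ENNReal.rpow_one]
    calc ∫⁻ x in Ioi 0, (∫⁻ y in Ioo 0 x ∩ Icc z₀ (2 ^ N), gKer p σ y) ^ q * wt q u x
        ≤ ∫⁻ x in Ioi 0, (2 ^ (n + 2) * ∫⁻ y in Ioo 0 x, rearr (maximal f) y) ^ q * wt q u x := by
          refine setLIntegral_mono' measurableSet_Ioi fun x hx => ?_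
          gcongr
          rw [← lintegral_const_mul' _ _ (by simp)]
          refine (setLIntegral_mono' (measurableSet_Ioo.inter measurableSet_Icc)
            fun y hy => hflow y hy.1.1 hy.2).trans (lintegral_mono_set inter_subset_left)
      _ = (2 ^ (n + 2)) ^ q * ∫⁻ x in Ioi 0, (∫⁻ y in Ioo 0 x, rearr (maximal f) y) ^ q *
          wt q u x :=
          lintegral_const_mul_rpow_mul (by simp) hq.le _ _ _
      _ = (2 ^ (n + 2)) ^ q * gammaNorm q u (maximal f) ^ q := by
          rw [← hMf, ← lintegral_div_rpow_mul hq]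
          rfl
      _ ≤ (2 ^ (n + 2)) ^ q * (maximalNorm n p q v u * (4 ^ p * (2 * B)) ^ (1 / p)) ^ q := by
          gcongr
          exact hratio.trans (by gcongr)
      _ = _ := by
          rw [ENNReal.mul_rpow_of_nonneg _ _ hq.le, ← ENNReal.rpow_mul,
            ENNReal.mul_rpow_of_nonneg _ _ (by positivity),
            ENNReal.mul_rpow_of_nonneg _ _ (by positivity), ← ENNReal.rpow_mul,
            show 1 / p * q = q / p by ring, mul_div_cancel₀ _ hp.ne']
          ring
  exact lintegral_le_of_trunc hq (aemeasurable_wt hu) hmain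

end

/-! ### Upper bound for the norm: reduction to finite measures -/

section

variable {n : ℕ} {p q : ℝ} {u v : ℝ → ℝ≥0∞}

/-- Since `g^{**}` decreases and `x g^{**}(x)` increases, `g^{**}(x)` is at least `y g^{**}(y) /
max(x,y)`; the `p`-th power is integrated against `v`. This gives finiteness of `g^{**}` when `V`
does not vanish, and forces `g^{**} = 0` when `V` is infinite and the norm finite. -/
theorem rearrAvg_rpow_mul_le (hp : 0 < p) (g : EuclideanSpace ℝ (Fin n) → ℝ≥0∞) {y : ℝ}
    (hy : 0 < y) :
    rearrAvg g y ^ p * (ENNReal.ofReal y ^ p * bigV p v y) ≤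
      ∫⁻ x in Ioi 0, rearrAvg g x ^ p * v x := by
  by_cases hg : rearrAvg g y = 0
  · rw [hg, ENNReal.zero_rpow_of_pos hp, zero_mul]; exact zero_le
  have hmain : ∀ x, 0 < x → rearrAvg g y ^ p * ENNReal.ofReal y ^ p * ker p y x ≤
      rearrAvg g x ^ p := by
    intro x hx
    unfold ker
    have hm : 0 < max y x := lt_max_of_lt_left hy
    rw [← div_eq_mul_inv, ENNReal.div_le_iff (ofReal_rpow_ne_zero hm p) (ofReal_rpow_ne_top hm p),
      ← ENNReal.mul_rpow_of_nonneg _ _ hp.le, ← ENNReal.mul_rpow_of_nonneg _ _ hp.le]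
    refine ENNReal.rpow_le_rpow ?_ hp.le
    rcases le_total x y with h | h
    · rw [max_eq_left h]; gcongr; exact rearrAvg_antitone g hx h
    · rw [max_eq_right h, mul_comm, mul_comm (rearrAvg g x)]; exact rearrAvg_mul_mono g hy h
  calc _ ≤ rearrAvg g y ^ p * ENNReal.ofReal y ^ p * ∫⁻ x in Ioi 0, ker p y x * v x := by
        rw [← mul_assoc]; gcongr; exact bigV_le_ker
    _ ≤ ∫⁻ x in Ioi 0, rearrAvg g y ^ p * ENNReal.ofReal y ^ p * (ker p y x * v x) :=
        lintegral_const_mul_le _ _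
    _ ≤ _ := setLIntegral_mono' measurableSet_Ioi fun x hx => by
        rw [← mul_assoc]; gcongr; exact hmain x hx

theorem ae_eq_zero_of_rearrAvg_eq_zero {g : EuclideanSpace ℝ (Fin n) → ℝ≥0∞} {y : ℝ} (hy : 0 < y)
    (h : rearrAvg g y = 0) : g =ᵐ[volume] 0 := by
  have h0 : ∀ t, 0 < t → rearr g t = 0 := by
    intro t ht
    refine nonpos_iff_eq_zero.1 ((rearr_le_rearrAvg g ht).trans ?_)
    rcases le_total t y with h1 | h1
    · have := rearrAvg_mul_mono g ht h1
      rw [h, mul_zero, nonpos_iff_eq_zero] at this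
      exact ((mul_eq_zero.1 this).resolve_left (by simpa using ht)).le
    · exact (rearrAvg_antitone g hy h1).trans h.le
  have h1 : ∀ k : ℕ, volume {x | ((k : ℝ≥0∞) + 1)⁻¹ < g x} = 0 := fun k => by
    refine nonpos_iff_eq_zero.1 (le_of_forall_gt_imp_ge_of_dense fun c hc => ?_)
    by_cases hct : c = ∞
    · simp [hct]
    · have := measure_lt_le_of_rearr_lt (g := g) (t := c.toReal) (c := ((k : ℝ≥0∞) + 1)⁻¹)
        (by rw [h0 _ (ENNReal.toReal_pos hc.ne' hct)]; simp)
      rwa [ENNReal.ofReal_toReal hct] at this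
  have h2 := measure_iUnion_null h1
  refine measure_mono_null (fun x hx => ?_) h2
  have hx : g x ≠ 0 := hx
  obtain ⟨k, hk⟩ := ENNReal.exists_inv_nat_lt hx
  exact mem_iUnion.2 ⟨k, (ENNReal.inv_le_inv.2 (by simp)).trans_lt hk⟩

theorem rpow_mul_ker_eq (hp : 0 < p) {s y : ℝ} (hs : 0 < s) (hy : 0 < y) :
    ENNReal.ofReal y ^ p * ker p s y = ENNReal.ofReal (min 1 (y ^ p / s ^ p)) := by
  have hm : 0 < max s y := lt_max_of_lt_left hs
  unfold ker
  rw [ENNReal.ofReal_rpow_of_pos hy, ENNReal.ofReal_rpow_of_pos hm, ← ENNReal.ofReal_inv_of_pos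
    (Real.rpow_pos_of_pos hm p), ← ENNReal.ofReal_mul (by positivity)]
  congr 1
  have hsp := Real.rpow_pos_of_pos hs p
  have hyp := Real.rpow_pos_of_pos hy p
  rcases le_total s y with h | h
  · rw [max_eq_right h, mul_inv_cancel₀ hyp.ne', min_eq_left]
    rw [le_div_iff₀ hsp, one_mul]; exact Real.rpow_le_rpow hs.le h hp.le
  · rw [max_eq_left h, ← div_eq_mul_inv, min_eq_right]
    rw [div_le_one hsp]; exact Real.rpow_le_rpow hy.le h hp.le

/-- The norm of the maximal operator is controlled by testing on finite measures. -/
theorem maximalNorm_le_of_measure (hn : 1 ≤ n) (hp : 0 < p) (hq : 0 < q) :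
    ∃ C : ℝ≥0∞, C ≠ ∞ ∧ ∀ u v : ℝ → ℝ≥0∞,
      AEMeasurable u (volume.restrict (Ioi (0 : ℝ))) →
      AEMeasurable v (volume.restrict (Ioi (0 : ℝ))) →
      (∀ z, 0 < z → bigV p v z ≠ 0) → ∀ K : ℝ≥0∞,
      (∀ (σ : Measure ℝ) [IsFiniteMeasure σ], σ (Iic 0) = 0 → ∫⁻ s, bigV p v s ∂σ ≠ ∞ →
        ∀ α : ℝ, 0 < α →
        ∫⁻ x in Ioi 0, (∫⁻ y in Ioo 0 x ∩ Ioi α, gKer p σ y) ^ q * wt q u x ≤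
          K ^ q * (∫⁻ s, bigV p v s ∂σ) ^ (q / p)) →
      maximalNorm n p q v u ≤ C * K := by
  refine ⟨(1 + 5 ^ n) * 8 ^ (1 / p), ?_, ?_⟩
  · exact ENNReal.mul_ne_top (by simp) (ENNReal.rpow_ne_top_of_nonneg (by positivity) (by simp))
  intro u v hu hv hV0 K hK
  refine iSup_le fun f => iSup_le fun hf => iSup_le fun hf0 => ?_
  refine ENNReal.div_le_of_le_mul ?_
  set g := rearrAvg (fun x => ‖f x‖ₑ) with hg
  set I := ∫⁻ x in Ioi 0, g x ^ p * v x with hI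
  have hIt : I ≠ ∞ := by
    intro h
    have := hf.2
    rw [gammaNorm, ← hg, ← hI, h, ENNReal.top_rpow_of_pos (by positivity)] at this
    exact lt_irrefl _ this
  have hgt : ∀ y, 0 < y → g y ≠ ∞ := fun y hy h => by
    have h1 := rearrAvg_rpow_mul_le (v := v) hp (fun x => ‖f x‖ₑ) hy
    rw [← hg, ← hI, h, ENNReal.top_rpow_of_pos hp,
      ENNReal.top_mul (mul_ne_zero (ofReal_rpow_ne_zero hy p) (hV0 y hy))] at h1
    exact hIt (top_le_iff.1 h1)
  have hg0 : ∀ y, 0 < y → g y ≠ 0 := fun y hy h =>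
    hf0 ((ae_eq_zero_of_rearrAvg_eq_zero hy h).mono fun x hx => enorm_eq_zero.1 hx)
  have hganti : ∀ x y, 0 < x → x ≤ y → (g y).toReal ≤ (g x).toReal := fun x y hx hxy =>
    ENNReal.toReal_mono (hgt x hx) (rearrAvg_antitone _ hx hxy)
  have hgmono : ∀ x y, 0 < x → x ≤ y → x * (g x).toReal ≤ y * (g y).toReal := fun x y hx hxy => by
    have hy := hx.trans_le hxy
    have := ENNReal.toReal_mono (ENNReal.mul_ne_top (by simp) (hgt y hy))
      (rearrAvg_mul_mono (fun x => ‖f x‖ₑ) hx hxy)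
    rwa [ENNReal.toReal_mul, ENNReal.toReal_mul, ENNReal.toReal_ofReal hx.le,
      ENNReal.toReal_ofReal hy.le] at this
  have hgp : ∀ y, 0 < y → 0 < (g y).toReal := fun y hy => ENNReal.toReal_pos (hg0 y hy) (hgt y hy)
  -- In the variable `z = y^p` the function `y^p g(y)^p` is quasi-concave, and `min(1, z / s^p) =
  -- y^p max(s,y)^{-p}`. The grid masses thus become atoms of `σ` at the points `(z₀ 2^i)^{1/p}`,
  -- and `gKer p σ` is comparable to `g` on the given range.
  set h : ℝ → ℝ := fun z => z * (g (z ^ (1 / p))).toReal ^ p with hh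
  have hpos : ∀ z, 0 < z → 0 < h z := fun z hz =>
    mul_pos hz (Real.rpow_pos_of_pos (hgp _ (Real.rpow_pos_of_pos hz _)) _)
  have hmono : ∀ x y, 0 < x → x ≤ y → h x ≤ h y := fun x y hx hxy => by
    have hy := hx.trans_le hxy
    have e : ∀ z, 0 < z → h z = (z ^ (1 / p) * (g (z ^ (1 / p))).toReal) ^ p := fun z hz => by
      rw [Real.mul_rpow (by positivity) ENNReal.toReal_nonneg, ← Real.rpow_mul hz.le,
        one_div_mul_cancel hp.ne', Real.rpow_one]
    rw [e x hx, e y hy]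
    exact Real.rpow_le_rpow (by positivity) (hgmono _ _ (by positivity)
      (Real.rpow_le_rpow hx.le hxy (by positivity))) hp.le
  have hanti : ∀ x y, 0 < x → x ≤ y → h y * x ≤ h x * y := fun x y hx hxy => by
    have hy := hx.trans_le hxy
    have := Real.rpow_le_rpow ENNReal.toReal_nonneg (hganti (x ^ (1 / p)) (y ^ (1 / p))
      (by positivity) (Real.rpow_le_rpow hx.le hxy (by positivity))) hp.le
    simp only [hh]
    nlinarith [mul_le_mul_of_nonneg_left this (mul_pos hx hy).le]
  have hhE : ∀ y, 0 < y → ENNReal.ofReal (h (y ^ p)) = ENNReal.ofReal y ^ p * g y ^ p :=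
    fun y hy => by
      simp only [hh]
      rw [← Real.rpow_mul hy.le, mul_one_div_cancel hp.ne', Real.rpow_one,
        ENNReal.ofReal_mul (by positivity), ENNReal.ofReal_rpow_of_pos hy,
        ← ENNReal.ofReal_rpow_of_nonneg ENNReal.toReal_nonneg hp.le,
            ENNReal.ofReal_toReal (hgt y hy)]
  have hmain : ∀ N : ℕ, ∫⁻ x in Ioi 0,
      (∫⁻ y in Ioo 0 x ∩ Icc ((2 : ℝ) ^ N)⁻¹ (2 ^ N), g y) ^ q * wt q u x ≤
      (8 ^ (1 / p) * K * I ^ (1 / p)) ^ q := by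
    intro N
    set z₀ : ℝ := (((2 : ℝ) ^ N)⁻¹) ^ p with hz₀
    have hz₀p : 0 < z₀ := by positivity
    obtain ⟨L, hL⟩ := pow_unbounded_of_one_lt (((2 : ℝ) ^ N) ^ p / z₀) (one_lt_two (α := ℝ))
    rw [div_lt_iff₀ hz₀p] at hL
    obtain ⟨m, hm, hm1, hm2⟩ := exists_grid hpos hmono hanti hz₀p L
    set s : ℕ → ℝ := fun i => (z₀ * 2 ^ i) ^ (1 / p) with hs
    have hsp : ∀ i, 0 < s i := fun i => by positivity
    set σ : Measure ℝ := ∑ i ∈ Finset.range (L + 1), ENNReal.ofReal (m i) • Measure.dirac (s i)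
      with hσ
    have hσf : IsFiniteMeasure σ := by
      refine ⟨?_⟩
      rw [hσ, Measure.finsetSum_apply, ENNReal.sum_lt_top]
      intro i _
      simp
    have hσ0 : σ (Iic 0) = 0 := by
      rw [hσ, Measure.finsetSum_apply, Finset.sum_eq_zero]
      intro i _
      simp [hsp i]
    have hσg : ∀ y, 0 < y → ENNReal.ofReal y ^ p * gKer p σ y ^ p =
        ENNReal.ofReal (∑ i ∈ Finset.range (L + 1), m i * min 1 (y ^ p / (z₀ * 2 ^ i))) := by
      intro y hy
      rw [gKer_rpow hp, hσ, lintegral_finsetSum_measure, Finset.mul_sum,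
        ENNReal.ofReal_sum_of_nonneg]
      · refine Finset.sum_congr rfl fun i _ => ?_
        rw [lintegral_smul_measure, lintegral_dirac, smul_eq_mul, mul_left_comm,
          rpow_mul_ker_eq hp (hsp i) hy, ENNReal.ofReal_mul (hm i)]
        congr 4
        rw [hs]; simp only
        rw [← Real.rpow_mul (by positivity), one_div_mul_cancel hp.ne', Real.rpow_one]
      · intro i _
        have := hm i
        positivity
    have hup : ∀ y, 0 < y → gKer p σ y ^ p ≤ 4 * g y ^ p := fun y hy => by
      rw [← ENNReal.mul_le_mul_iff_right (ofReal_rpow_ne_zero hy p) (ofReal_rpow_ne_top hy p),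
        hσg y hy, mul_left_comm, ← hhE y hy, ← ofReal_four_eq, ← ENNReal.ofReal_mul (by norm_num)]
      exact ENNReal.ofReal_le_ofReal (hm1 _ (by positivity))
    have hlow : ∀ y, y ∈ Icc ((2 : ℝ) ^ N)⁻¹ (2 ^ N) → g y ≤ 2 ^ (1 / p) * gKer p σ y :=
      fun y hy => by
        have hy0 : 0 < y := lt_of_lt_of_le (by positivity) hy.1
        rw [← ENNReal.rpow_le_rpow_iff hp, ENNReal.mul_rpow_of_nonneg _ _ hp.le,
          ← ENNReal.rpow_mul, one_div_mul_cancel hp.ne', ENNReal.rpow_one,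
          ← ENNReal.mul_le_mul_iff_right (ofReal_rpow_ne_zero hy0 p) (ofReal_rpow_ne_top hy0 p),
          mul_left_comm, hσg y hy0, ← hhE y hy0, show (2 : ℝ≥0∞) = ENNReal.ofReal 2 by norm_num,
          ← ENNReal.ofReal_mul (by norm_num)]
        refine ENNReal.ofReal_le_ofReal (hm2 _ (Real.rpow_le_rpow (by positivity) hy.1 hp.le) ?_)
        rw [mul_comm]
        exact (Real.rpow_le_rpow hy0.le hy.2 hp.le).trans hL.le
    have hVσ : ∫⁻ s, bigV p v s ∂σ ≤ 4 * I := by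
      refine (le_lintegral_gKer hp hv σ).trans ?_
      rw [hI, ← lintegral_const_mul' _ _ (by simp)]
      refine setLIntegral_mono' measurableSet_Ioi fun x hx => ?_
      rw [← mul_assoc]; gcongr; exact hup x hx
    have hVt : ∫⁻ s, bigV p v s ∂σ ≠ ∞ :=
      ne_top_of_le_ne_top (ENNReal.mul_ne_top (by simp) hIt) hVσ
    -- Any cut-off below the range `[2^{-N}, 2^N]` would serve.
    have hα : 0 < ((2 : ℝ) ^ N)⁻¹ / 2 := by positivity
    calc ∫⁻ x in Ioi 0, (∫⁻ y in Ioo 0 x ∩ Icc ((2 : ℝ) ^ N)⁻¹ (2 ^ N), g y) ^ q * wt q u x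
        ≤ ∫⁻ x in Ioi 0, (2 ^ (1 / p) *
            ∫⁻ y in Ioo 0 x ∩ Ioi (((2 : ℝ) ^ N)⁻¹ / 2), gKer p σ y) ^ q * wt q u x := by
          refine setLIntegral_mono' measurableSet_Ioi fun x hx => ?_
          gcongr
          rw [← lintegral_const_mul' _ _ (ENNReal.rpow_ne_top_of_nonneg (by positivity) (by simp))]
          refine (setLIntegral_mono' (measurableSet_Ioo.inter measurableSet_Icc)
            fun y hy => hlow y hy.2).trans (lintegral_mono_set ?_)
          exact inter_subset_inter_right _ fun y hy => (half_lt_self (by positivity)).trans_le hy.1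
      _ ≤ (2 ^ (1 / p)) ^ q * (K ^ q * (4 * I) ^ (q / p)) := by
          rw [lintegral_const_mul_rpow_mul (ENNReal.rpow_ne_top_of_nonneg (by positivity) (by simp))
            hq.le]
          gcongr
          refine (hK σ hσ0 hVt _ hα).trans ?_
          gcongr
      _ = _ := by
          rw [ENNReal.mul_rpow_of_nonneg _ _ hq.le, ENNReal.mul_rpow_of_nonneg _ _ hq.le,
            ← ENNReal.rpow_mul, ← ENNReal.rpow_mul, ← ENNReal.rpow_mul,
            show 1 / p * q = q / p by ring, show (8 : ℝ≥0∞) = 2 * 4 by norm_num,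
            ENNReal.mul_rpow_of_nonneg _ _ (by positivity : 0 ≤ q / p),
            ENNReal.mul_rpow_of_nonneg _ _ (by positivity : 0 ≤ q / p)]
          ring
  have hfin := lintegral_le_of_trunc hq (aemeasurable_wt hu) hmain
  have hgn : gammaNorm p v (fun x => ‖f x‖ₑ) = I ^ (1 / p) := rfl
  rw [hgn, ← ENNReal.rpow_le_rpow_iff hq]
  calc gammaNorm q u (maximal f) ^ q = ∫⁻ x in Ioi 0, rearrAvg (maximal f) x ^ q * u x := by
        rw [gammaNorm, ← ENNReal.rpow_mul, one_div, inv_mul_cancel₀ hq.ne', ENNReal.rpow_one]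
    _ ≤ ∫⁻ x in Ioi 0, ((1 + 5 ^ n) * ((∫⁻ t in Ioo 0 x, g t) / ENNReal.ofReal x)) ^ q * u x := by
        refine setLIntegral_mono' measurableSet_Ioi fun x hx => ?_
        gcongr
        exact rearrAvg_maximal_le hn hf.1
    _ = (1 + 5 ^ n) ^ q * ∫⁻ x in Ioi 0, (∫⁻ t in Ioo 0 x, g t) ^ q * wt q u x := by
        rw [lintegral_const_mul_rpow_mul (by simp) hq.le, lintegral_div_rpow_mul hq]
    _ ≤ (1 + 5 ^ n) ^ q * (8 ^ (1 / p) * K * I ^ (1 / p)) ^ q := by gcongr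
    _ = _ := by
        rw [← ENNReal.mul_rpow_of_nonneg _ _ hq.le]; congr 1; ring

end

section

variable {p q : ℝ} {u v : ℝ → ℝ≥0∞}

/-! ### Level sets of the tail function -/

/-- The last point where the tail function is at least `c`. -/
noncomputable def lev (q : ℝ) (u : ℝ → ℝ≥0∞) (c : ℝ≥0∞) : ℝ :=
  sSup {y : ℝ | 0 < y ∧ c ≤ tail q u y}

theorem zeta_eq_lev (x : ℝ) : zeta q u x = lev q u (tail q u x / 2) := rfl

theorem zetaInv_eq_lev (x : ℝ) : zetaInv q u x = lev q u (2 * tail q u x) := rfl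

theorem tail_antitone : Antitone (tail q u) := fun _ _ hxy =>
  lintegral_mono_set (Ioi_subset_Ioi hxy)

theorem lintegral_Ioc_add_tail {x y : ℝ} (hxy : x ≤ y) :
    (∫⁻ s in Ioc x y, wt q u s) + tail q u y = tail q u x := by
  rw [tail, tail, ← lintegral_union measurableSet_Ioi, Ioc_union_Ioi_eq_Ioi hxy]
  exact disjoint_left.2 fun z hz hz' => not_lt.2 hz.2 hz'

theorem tail_le_of_forall {x : ℝ} {c : ℝ≥0∞} (h : ∀ y, x < y → tail q u y ≤ c) :
    tail q u x ≤ c := by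
  have hI : Ioi x = ⋃ n : ℕ, Ioi (x + 1 / ((n : ℝ) + 1)) := by
    ext z
    simp only [mem_Ioi, mem_iUnion]
    constructor
    · intro hz
      obtain ⟨n, hn⟩ := exists_nat_one_div_lt (sub_pos.2 hz)
      exact ⟨n, by linarith⟩
    · rintro ⟨n, hn⟩
      have : (0 : ℝ) < 1 / ((n : ℝ) + 1) := by positivity
      linarith
  rw [tail, hI, setLIntegral_iUnion_of_directed]
  · refine iSup_le fun n => h _ ?_
    have : (0 : ℝ) < 1 / ((n : ℝ) + 1) := by positivity
    linarith
  · refine Monotone.directed_le fun m n hmn => Ioi_subset_Ioi ?_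
    have : 1 / ((n : ℝ) + 1) ≤ 1 / ((m : ℝ) + 1) := by
      apply one_div_le_one_div_of_le (by positivity)
      have : (m : ℝ) ≤ n := by exact_mod_cast hmn
      linarith
    linarith

theorem tail_pos (hU : ∀ t, 0 < t → 0 < tail q u t ∧ tail q u t < ∞) (t : ℝ) :
    0 < tail q u t :=
  (hU (max t 1) (by positivity)).1.trans_le (tail_antitone (le_max_left _ _))

theorem exists_tail_lt (hU : ∀ t, 0 < t → 0 < tail q u t ∧ tail q u t < ∞) {c : ℝ≥0∞}
    (hc : c ≠ 0) : ∃ y, 0 < y ∧ tail q u y < c := by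
  set ν := volume.withDensity (wt q u)
  have hν : ∀ t, ν (Ioi t) = tail q u t := fun t => withDensity_apply _ measurableSet_Ioi
  have h := tendsto_measure_iInter_atTop (μ := ν) (s := fun n : ℕ => Ioi (n : ℝ))
    (fun n => measurableSet_Ioi.nullMeasurableSet)
    (fun m n hmn => Ioi_subset_Ioi (by exact_mod_cast hmn))
    ⟨1, by rw [hν]; exact (hU _ (by norm_num)).2.ne⟩
  have hI : ⋂ n : ℕ, Ioi (n : ℝ) = ∅ := by
    refine eq_empty_of_forall_notMem fun x hx => ?_
    obtain ⟨n, hn⟩ := exists_nat_ge x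
    exact absurd (mem_iInter.1 hx n) (not_lt.2 hn)
  rw [hI, measure_empty] at h
  obtain ⟨n, hn, hn1⟩ := ((h.eventually (gt_mem_nhds (pos_iff_ne_zero.2 hc))).and
    (Filter.eventually_ge_atTop 1)).exists
  refine ⟨n, by exact_mod_cast hn1, ?_⟩
  rw [← hν]; exact hn

/-- Left continuity of `U` at positive points, from absolute continuity of the integral; this is
where finiteness of `U` at `y / 2` enters. -/
theorem le_tail_of_forall (hU : ∀ t, 0 < t → 0 < tail q u t ∧ tail q u t < ∞) {y : ℝ} (hy : 0 < y)
    {c : ℝ≥0∞} (h : ∀ z, 0 < z → z < y → c ≤ tail q u z) : c ≤ tail q u y := by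
  have h1 : Filter.Tendsto (fun z => ∫⁻ s in Ioc z y, wt q u s ∂(volume.restrict (Ioi (y / 2))))
      (nhdsWithin y (Iio y)) (nhds 0) := by
    refine tendsto_setLIntegral_zero (hU (y / 2) (by linarith)).2.ne ?_
    refine tendsto_of_tendsto_of_tendsto_of_le_of_le (g := fun _ => 0)
      (h := fun z => ENNReal.ofReal (y - z)) tendsto_const_nhds ?_ (fun _ => zero_le) fun z => ?_
    · have : Filter.Tendsto (fun z => ENNReal.ofReal (y - z)) (nhds y)
          (nhds (ENNReal.ofReal (y - y))) :=
        ENNReal.tendsto_ofReal (tendsto_const_nhds.sub Filter.tendsto_id)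
      rw [sub_self, ENNReal.ofReal_zero] at this
      exact this.mono_left nhdsWithin_le_nhds
    · exact (Measure.restrict_le_self _).trans (by rw [Real.volume_Ioc])
  refine ENNReal.le_of_forall_pos_le_add fun ε hε _ => ?_
  have hε' : (0 : ℝ≥0∞) < ε := by exact_mod_cast hε
  obtain ⟨z, hz, hz1, hz2⟩ := ((h1.eventually (gt_mem_nhds hε')).and
    ((eventually_nhdsWithin_of_forall fun z (hz : z < y) => hz).and
      (nhdsWithin_le_nhds (lt_mem_nhds (show y / 2 < y by linarith))))).exists
  have hz2 : y / 2 < z := hz2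
  have h2 := h z (by linarith) hz1
  rw [← lintegral_Ioc_add_tail hz1.le, add_comm] at h2
  refine h2.trans ?_
  gcongr
  rw [Measure.restrict_restrict measurableSet_Ioc] at hz
  refine le_trans (lintegral_mono_set ?_) hz.le
  exact fun s hs => ⟨hs, hz2.trans hs.1⟩

theorem lev_bddAbove (hU : ∀ t, 0 < t → 0 < tail q u t ∧ tail q u t < ∞) {c : ℝ≥0∞}
    (hc : c ≠ 0) : BddAbove {y : ℝ | 0 < y ∧ c ≤ tail q u y} := by
  obtain ⟨z, -, hz⟩ := exists_tail_lt hU hc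
  refine ⟨z, fun y hy => ?_⟩
  by_contra hzy
  exact absurd (hy.2.trans (tail_antitone (not_le.1 hzy).le)) (not_le.2 hz)

theorem lev_nonneg (c : ℝ≥0∞) : 0 ≤ lev q u c := Real.sSup_nonneg fun _ hy => hy.1.le

/-- By left continuity of the tail the supremum in `lev` is attained, so comparisons between points
and comparisons between levels can be exchanged. -/
theorem le_lev_iff (hU : ∀ t, 0 < t → 0 < tail q u t ∧ tail q u t < ∞) {c : ℝ≥0∞} (hc : c ≠ 0)
    {y : ℝ} (hy : 0 < y) : y ≤ lev q u c ↔ c ≤ tail q u y := by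
  refine ⟨fun h => le_tail_of_forall hU hy fun z hz hzy => ?_, fun h =>
    le_csSup (lev_bddAbove hU hc) ⟨hy, h⟩⟩
  have hne : {y : ℝ | 0 < y ∧ c ≤ tail q u y}.Nonempty := by
    by_contra hne
    rw [lev, not_nonempty_iff_eq_empty.1 hne, Real.sSup_empty] at h
    linarith
  obtain ⟨w, hw, hzw⟩ := exists_lt_of_lt_csSup hne (hzy.trans_le h)
  exact hw.2.trans (tail_antitone hzw.le)

theorem lev_lt_iff (hU : ∀ t, 0 < t → 0 < tail q u t ∧ tail q u t < ∞) {c : ℝ≥0∞} (hc : c ≠ 0)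
    {y : ℝ} (hy : 0 < y) : lev q u c < y ↔ tail q u y < c := by
  rw [← not_le, le_lev_iff hU hc hy, not_le]

theorem lev_antitone (hU : ∀ t, 0 < t → 0 < tail q u t ∧ tail q u t < ∞) {c d : ℝ≥0∞} (hc : c ≠ 0)
    (hcd : c ≤ d) : lev q u d ≤ lev q u c := by
  rcases (lev_nonneg (q := q) (u := u) d).eq_or_lt with h | h
  · rw [← h]; exact lev_nonneg c
  · rw [le_lev_iff hU hc h]
    refine hcd.trans ((le_lev_iff hU ?_ h).1 le_rfl)
    exact ((pos_iff_ne_zero.2 hc).trans_le hcd).ne'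

theorem tail_lev_le (hU : ∀ t, 0 < t → 0 < tail q u t ∧ tail q u t < ∞) {c : ℝ≥0∞} (hc : c ≠ 0) :
    tail q u (lev q u c) ≤ c :=
  tail_le_of_forall fun _ hy =>
    ((lev_lt_iff hU hc ((lev_nonneg c).trans_lt hy)).1 hy).le

theorem tail_lev (hU : ∀ t, 0 < t → 0 < tail q u t ∧ tail q u t < ∞) {c : ℝ≥0∞} (hc : c ≠ 0)
    (h : 0 < lev q u c) : tail q u (lev q u c) = c :=
  (tail_lev_le hU hc).antisymm ((le_lev_iff hU hc h).1 le_rfl)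

theorem le_zeta (hU : ∀ t, 0 < t → 0 < tail q u t ∧ tail q u t < ∞) {x : ℝ} (hx : 0 < x) :
    x ≤ zeta q u x := by
  rw [zeta_eq_lev, le_lev_iff hU (by simpa using (tail_pos hU x).ne') hx]
  exact ENNReal.half_le_self

theorem zeta2_eq (hU : ∀ t, 0 < t → 0 < tail q u t ∧ tail q u t < ∞) {x : ℝ} (hx : 0 < x) :
    zeta2 q u x = lev q u (tail q u x / 4) := by
  rw [zeta2, zeta_eq_lev (zeta q u x), zeta_eq_lev x, tail_lev hU (by simpa using
    (tail_pos hU x).ne') (hx.trans_le (le_zeta hU hx)), div_eq_mul_inv, div_eq_mul_inv,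
    div_eq_mul_inv, mul_assoc, ← ENNReal.mul_inv (by simp) (by simp)]
  norm_num

/-- Apart from composing the two doublings, there is a degenerate case: if `ζ^{-1}(x) = 0`, then `U`
is finite at the origin, so `2 U(0) ≤ U(y)` has no positive solution `y`, and both sides are 0. -/
theorem zetaInv2_eq (hU : ∀ t, 0 < t → 0 < tail q u t ∧ tail q u t < ∞) {x : ℝ} (hx : 0 < x) :
    zetaInv2 q u x = lev q u (4 * tail q u x) := by
  have h0 : 2 * tail q u x ≠ 0 := by simpa using (tail_pos hU x).ne'
  rcases (lev_nonneg (q := q) (u := u) (2 * tail q u x)).eq_or_lt with h | h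
  · have h1 : lev q u (4 * tail q u x) = 0 := by
      refine le_antisymm ((lev_antitone hU h0 ?_).trans h.symm.le) (lev_nonneg _)
      gcongr; norm_num
    rw [h1, zetaInv2, zetaInv_eq_lev (zetaInv q u x), zetaInv_eq_lev, ← h]
    refine le_antisymm (not_lt.1 fun hlt => ?_) (lev_nonneg _)
    have h2 := (le_lev_iff hU (by simpa using (tail_pos hU 0).ne') hlt).1 le_rfl
    have h3 := h2.trans (tail_antitone hlt.le)
    have h4 : tail q u 0 ≠ ∞ := by
      have := tail_lev_le hU h0
      rw [← h] at this
      exact ne_top_of_le_ne_top (ENNReal.mul_ne_top (by simp) (hU x hx).2.ne) this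
    rw [two_mul] at h3
    have h5 : tail q u 0 + tail q u 0 ≤ tail q u 0 + 0 := by rwa [add_zero]
    have h6 := (ENNReal.add_le_add_iff_left h4).1 h5
    exact absurd h6 (not_le.2 (tail_pos hU 0))
  · rw [zetaInv2, zetaInv_eq_lev (zetaInv q u x), zetaInv_eq_lev, tail_lev hU h0 h, ← mul_assoc]
    norm_num

/-- The ratio of the levels. -/
noncomputable def theta : ℝ≥0∞ := 2 ^ (1 / 3 : ℝ)

theorem theta_ne_zero : theta ≠ 0 := by simp [theta, ENNReal.rpow_eq_zero_iff]

theorem theta_ne_top : theta ≠ ∞ := ENNReal.rpow_ne_top_of_nonneg (by norm_num) (by simp)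

theorem theta_cube : theta ^ (3 : ℤ) = 2 := by
  rw [theta, ← ENNReal.rpow_intCast, ← ENNReal.rpow_mul]
  norm_num

/-- `(5/4)^3 < 2`. The margin is used twice: a block carries at least a quarter of its lower level,
and the decay `4/5` of the levels survives a growth by `9/8` in `geometric_hardy`. -/
theorem five_le_theta : 5 ≤ 4 * theta := by
  have h : (5 / 4 : ℝ≥0∞) ≤ theta := by
    rw [theta, one_div, ENNReal.le_rpow_inv_iff (by norm_num)]
    have : (5 / 4 : ℝ≥0∞) = ENNReal.ofReal (5 / 4) := by
      rw [ENNReal.ofReal_div_of_pos (by norm_num)]; norm_num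
    rw [this, ENNReal.ofReal_rpow_of_pos (by norm_num), show (2 : ℝ≥0∞) =
        ENNReal.ofReal 2 by norm_num]
    refine ENNReal.ofReal_le_ofReal ?_
    norm_num
  calc (5 : ℝ≥0∞) = 4 * (5 / 4) := (ENNReal.mul_div_cancel (by simp) (by simp)).symm
    _ ≤ _ := by gcongr

theorem one_lt_theta : 1 < theta := by
  rw [theta]; exact ENNReal.one_lt_rpow (by norm_num) (by norm_num)

theorem theta_le_two : theta ≤ 2 := by
  rw [theta]
  conv_rhs => rw [← ENNReal.rpow_one 2]
  exact ENNReal.rpow_le_rpow_of_exponent_le (by norm_num) (by norm_num)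

/-- The levels `τ_k = 2^{-k/3}`. -/
noncomputable def tau (k : ℤ) : ℝ≥0∞ := theta ^ (-k)

theorem tau_ne_zero (k : ℤ) : tau k ≠ 0 := (ENNReal.zpow_pos theta_ne_zero theta_ne_top _).ne'

theorem tau_ne_top (k : ℤ) : tau k ≠ ∞ := ENNReal.zpow_ne_top theta_ne_zero theta_ne_top _

theorem tau_sub_one (k : ℤ) : tau (k - 1) = theta * tau k := by
  rw [tau, tau, show -(k - 1) = 1 + -k by ring, ENNReal.zpow_add theta_ne_zero theta_ne_top,
    zpow_one]

theorem tau_sub_three (k : ℤ) : tau (k - 3) = 2 * tau k := by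
  rw [tau, tau, show -(k - 3) = 3 + -k by ring, ENNReal.zpow_add theta_ne_zero theta_ne_top,
    theta_cube]

theorem tau_antitone {j k : ℤ} (h : j ≤ k) : tau k ≤ tau j :=
  ENNReal.zpow_le_of_le one_lt_theta.le (by omega)

/-- The points where the tail function reaches the levels. -/
noncomputable def pt (q : ℝ) (u : ℝ → ℝ≥0∞) (k : ℤ) : ℝ := lev q u (tau k)

/-- The blocks between consecutive levels. -/
def block (q : ℝ) (u : ℝ → ℝ≥0∞) (k : ℤ) : Set ℝ := Ioc (pt q u (k - 1)) (pt q u k)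

theorem measurableSet_block (k : ℤ) : MeasurableSet (block q u k) := measurableSet_Ioc

theorem pt_nonneg (k : ℤ) : 0 ≤ pt q u k := lev_nonneg _

theorem pos_of_mem_block {k : ℤ} {x : ℝ} (hx : x ∈ block q u k) : 0 < x :=
  (pt_nonneg _).trans_lt hx.1

theorem pt_mono (hU : ∀ t, 0 < t → 0 < tail q u t ∧ tail q u t < ∞) : Monotone (pt q u) :=
  fun _ k h => lev_antitone hU (tau_ne_zero k) (tau_antitone h)

theorem mem_block_iff (hU : ∀ t, 0 < t → 0 < tail q u t ∧ tail q u t < ∞) {k : ℤ} {x : ℝ}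
    (hx : 0 < x) : x ∈ block q u k ↔ tau k ≤ tail q u x ∧ tail q u x < tau (k - 1) := by
  rw [block, mem_Ioc, pt, pt, lev_lt_iff hU (tau_ne_zero _) hx, le_lev_iff hU (tau_ne_zero _) hx,
    and_comm]

theorem iUnion_block (hU : ∀ t, 0 < t → 0 < tail q u t ∧ tail q u t < ∞) :
    ⋃ k, block q u k = Ioi 0 := by
  ext x
  refine ⟨fun h => ?_, fun hx => ?_⟩
  · obtain ⟨k, hk⟩ := mem_iUnion.1 h
    exact pos_of_mem_block hk
  · obtain ⟨n, hn⟩ := ENNReal.exists_mem_Ico_zpow (hU x hx).1.ne' (hU x hx).2.ne one_lt_theta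
      theta_ne_top
    refine mem_iUnion.2 ⟨-n, (mem_block_iff hU hx).2 ?_⟩
    rw [tau, tau, neg_neg, show -(-n - 1) = n + 1 by ring]
    exact hn

theorem pairwise_disjoint_block (hU : ∀ t, 0 < t → 0 < tail q u t ∧ tail q u t < ∞) :
    Pairwise (Function.onFun Disjoint (block q u)) := by
  have : ∀ j k : ℤ, j < k → Disjoint (block q u j) (block q u k) := fun j k h =>
    disjoint_left.2 fun x hx hx' =>
      absurd (hx'.1.trans_le hx.2) (not_lt.2 (pt_mono hU (by omega)))
  intro j k hjk
  rcases lt_or_gt_of_ne hjk with h | h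
  · exact this j k h
  · exact (this k j h).symm

theorem tsum_lintegral_block (hU : ∀ t, 0 < t → 0 < tail q u t ∧ tail q u t < ∞)
    (f : ℝ → ℝ≥0∞) : ∑' k, ∫⁻ x in block q u k, f x = ∫⁻ x in Ioi 0, f x := by
  rw [← iUnion_block hU, lintegral_iUnion measurableSet_block (pairwise_disjoint_block hU)]

theorem lintegral_block_le (hU : ∀ t, 0 < t → 0 < tail q u t ∧ tail q u t < ∞) (k : ℤ) :
    ∫⁻ x in block q u k, wt q u x ≤ 2 * tau k := by
  have h1 : ∫⁻ x in block q u k, wt q u x ≤ tail q u (pt q u (k - 1)) :=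
    lintegral_mono_set fun x hx => hx.1
  refine (h1.trans (tail_lev_le hU (tau_ne_zero _))).trans ?_
  rw [tau_sub_one]
  gcongr
  exact theta_le_two

/-- The block carries the difference of two levels, `(θ - 1) τ_k ≥ τ_k / 4`. If `U` is bounded near
the origin, high levels are not reached and the corresponding points are 0; positivity of `pt (k -
1)` ensures that both levels are attained. -/
theorem le_lintegral_block (hU : ∀ t, 0 < t → 0 < tail q u t ∧ tail q u t < ∞) {k : ℤ}
    (hk : 0 < pt q u (k - 1)) : tau k ≤ 4 * ∫⁻ x in block q u k, wt q u x := by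
  have hle := pt_mono hU (show k - 1 ≤ k by omega)
  have h := lintegral_Ioc_add_tail (q := q) (u := u) hle
  have e1 : tail q u (pt q u k) = tau k := tail_lev hU (tau_ne_zero _) (hk.trans_le hle)
  have e2 : tail q u (pt q u (k - 1)) = tau (k - 1) := tail_lev hU (tau_ne_zero _) hk
  rw [e1, e2, tau_sub_one] at h
  have h2 : 4 * tau k + tau k ≤ 4 * tau k + 4 * ∫⁻ x in block q u k, wt q u x := by
    calc 4 * tau k + tau k = 5 * tau k := by ring
      _ ≤ 4 * theta * tau k := by gcongr; exact five_le_theta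
      _ = 4 * ((∫⁻ x in block q u k, wt q u x) + tau k) := by rw [mul_assoc, ← h]; rfl
      _ = _ := by ring
  exact (ENNReal.add_le_add_iff_left (ENNReal.mul_ne_top (by simp) (tau_ne_top k))).1 h2

/-- Three levels make one halving, so `ζ` shifts indices by 3 up to the width of one block, and
`ζ^{-1}` by -3. Levels finer than halving leave room: for `x` in block `k + 1` the interval between
`pt (k - 2)` and `pt (k + 1)` lies inside `(ζ^{-1}(x), ζ(x))`. -/
theorem zeta_mem (hU : ∀ t, 0 < t → 0 < tail q u t ∧ tail q u t < ∞) {k : ℤ} {x : ℝ}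
    (hx : x ∈ block q u k) : zeta q u x ∈ Icc (pt q u (k + 2)) (pt q u (k + 3)) := by
  obtain ⟨h1, h2⟩ := (mem_block_iff hU (pos_of_mem_block hx)).1 hx
  have e1 : 2 * tau (k + 3) = tau k := by rw [← tau_sub_three]; congr 1; ring
  have e2 : 2 * tau (k + 2) = tau (k - 1) := by rw [← tau_sub_three]; congr 1; ring
  constructor
  · refine lev_antitone hU (by simpa using (tail_pos hU x).ne') ?_
    rw [ENNReal.div_le_iff (by simp) (by simp), mul_comm, e2]; exact h2.le
  · refine lev_antitone hU (tau_ne_zero _) ?_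
    rw [ENNReal.le_div_iff_mul_le (by simp) (by simp), mul_comm, e1]; exact h1

theorem zetaInv_mem (hU : ∀ t, 0 < t → 0 < tail q u t ∧ tail q u t < ∞) {k : ℤ} {x : ℝ}
    (hx : x ∈ block q u k) : zetaInv q u x ∈ Icc (pt q u (k - 4)) (pt q u (k - 3)) := by
  obtain ⟨h1, h2⟩ := (mem_block_iff hU (pos_of_mem_block hx)).1 hx
  have e1 : 2 * tau k = tau (k - 3) := (tau_sub_three k).symm
  have e2 : 2 * tau (k - 1) = tau (k - 4) := by rw [← tau_sub_three]; congr 1; ring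
  constructor
  · refine lev_antitone hU (by simpa using (tail_pos hU x).ne') ?_
    rw [← e2]; gcongr
  · refine lev_antitone hU (tau_ne_zero _) ?_
    rw [← e1]; gcongr

theorem zetaInv2_mem (hU : ∀ t, 0 < t → 0 < tail q u t ∧ tail q u t < ∞) {k : ℤ} {x : ℝ}
    (hx : x ∈ block q u k) : zetaInv2 q u x ∈ Icc (pt q u (k - 7)) (pt q u (k - 6)) := by
  have hx0 := pos_of_mem_block hx
  obtain ⟨h1, h2⟩ := (mem_block_iff hU hx0).1 hx
  have e1 : 4 * tau k = tau (k - 6) := by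
    rw [show k - 6 = k - 3 - 3 by ring, tau_sub_three, tau_sub_three, ← mul_assoc]; norm_num
  have e2 : 4 * tau (k - 1) = tau (k - 7) := by
    rw [show k - 7 = k - 1 - 3 - 3 by ring, tau_sub_three, tau_sub_three, ← mul_assoc]; norm_num
  rw [zetaInv2_eq hU hx0]
  constructor
  · refine lev_antitone hU (by simpa using (tail_pos hU x).ne') ?_
    rw [← e2]; gcongr
  · refine lev_antitone hU (tau_ne_zero _) ?_
    rw [← e1]; gcongr

/-! ### Local estimates -/

theorem measurable_ofReal_rpow_inv (p : ℝ) : Measurable fun s : ℝ => (ENNReal.ofReal s ^ p)⁻¹ :=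
  (ENNReal.measurable_ofReal.pow_const p).inv

theorem inv_rpow_rpow (hp : 0 < p) (a b : ℝ≥0∞) :
    ((a ^ p)⁻¹ * b) ^ (1 / p) = a⁻¹ * b ^ (1 / p) := by
  rw [ENNReal.mul_rpow_of_nonneg _ _ (by positivity), ENNReal.inv_rpow, ← ENNReal.rpow_mul,
    mul_one_div_cancel hp.ne', ENNReal.rpow_one]

/-- The kernel is `y^{-p}` for `s ≤ y` and `s^{-p}` for `s ≥ y`. So `gKer` is, up to constants, the
sum of a cumulative mass weighted by `1 / y` and a tail of `s^{-p} dμ`; `head_le_gKer` and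
`tail_le_gKer` are the converse bounds. -/
theorem gKer_le (hp : 0 < p) (μ : Measure ℝ) (y : ℝ) :
    gKer p μ y ≤ 2 ^ (1 / p) * ((ENNReal.ofReal y)⁻¹ * μ (Iic y) ^ (1 / p) +
      (∫⁻ s in Ici y, (ENNReal.ofReal s ^ p)⁻¹ ∂μ) ^ (1 / p)) := by
  rw [← inv_rpow_rpow hp]
  refine le_trans ?_ (add_rpow_le_two_rpow (by positivity) _ _)
  refine ENNReal.rpow_le_rpow ?_ (by positivity)
  calc ∫⁻ s, ker p s y ∂μ ≤ ∫⁻ s in Iic y ∪ Ici y, ker p s y ∂μ := by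
        rw [Iic_union_Ici, setLIntegral_univ]
    _ ≤ (∫⁻ s in Iic y, ker p s y ∂μ) + ∫⁻ s in Ici y, ker p s y ∂μ := lintegral_union_le _ _ _
    _ ≤ (∫⁻ _ in Iic y, (ENNReal.ofReal y ^ p)⁻¹ ∂μ) +
          ∫⁻ s in Ici y, (ENNReal.ofReal s ^ p)⁻¹ ∂μ := by
        refine add_le_add (setLIntegral_mono' measurableSet_Iic fun s hs => ?_)
          (setLIntegral_mono' measurableSet_Ici fun s hs => ?_)
        · rw [ker, max_eq_right hs]
        · rw [ker, max_eq_left hs]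
    _ = _ := by rw [setLIntegral_const]

theorem head_le_gKer (hp : 0 < p) (μ : Measure ℝ) (y : ℝ) :
    (ENNReal.ofReal y)⁻¹ * μ (Iic y) ^ (1 / p) ≤ gKer p μ y := by
  rw [← inv_rpow_rpow hp]
  refine ENNReal.rpow_le_rpow ?_ (by positivity)
  calc (ENNReal.ofReal y ^ p)⁻¹ * μ (Iic y) = ∫⁻ _ in Iic y, (ENNReal.ofReal y ^ p)⁻¹ ∂μ := by
        rw [setLIntegral_const]
    _ ≤ ∫⁻ s in Iic y, ker p s y ∂μ := setLIntegral_mono' measurableSet_Iic fun s hs => by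
        rw [ker, max_eq_right hs]
    _ ≤ _ := setLIntegral_le_lintegral _ _

theorem tail_le_gKer (hp : 0 < p) (μ : Measure ℝ) (y : ℝ) :
    (∫⁻ s in Ici y, (ENNReal.ofReal s ^ p)⁻¹ ∂μ) ^ (1 / p) ≤ gKer p μ y := by
  refine ENNReal.rpow_le_rpow ?_ (by positivity)
  refine le_trans (setLIntegral_mono' measurableSet_Ici fun s hs => ?_)
    (setLIntegral_le_lintegral _ _)
  rw [ker, max_eq_left hs]

theorem logRatio_of_pos {x y : ℝ} (hy : 0 < y) :
    logRatio x y = ENNReal.ofReal (Real.log (x / y)) := by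
  rw [logRatio, if_neg hy.ne']

theorem logRatio_mono {x x' y y' : ℝ} (hy : 0 ≤ y') (hyy : y' ≤ y) (hx : 0 < x) (hxx : x ≤ x') :
    logRatio x y ≤ logRatio x' y' := by
  rcases hy.eq_or_lt with h | h
  · rw [← h]; simp [logRatio]
  · have hy0 := h.trans_le hyy
    rw [logRatio_of_pos h, logRatio_of_pos hy0]
    refine ENNReal.ofReal_le_ofReal (Real.log_le_log (by positivity) ?_)
    exact div_le_div₀ (hx.le.trans hxx) hxx h hyy

theorem lintegral_inv_Ioo {a b : ℝ} (ha : 0 < a) (hab : a ≤ b) :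
    ∫⁻ y in Ioo a b, (ENNReal.ofReal y)⁻¹ = logRatio b a := by
  have hb := ha.trans_le hab
  rw [logRatio_of_pos ha, ← integral_inv_of_pos ha hb, intervalIntegral.integral_of_le hab,
    ← restrict_Ioo_eq_restrict_Ioc, ofReal_integral_eq_lintegral_ofReal]
  · refine setLIntegral_congr_fun measurableSet_Ioo fun y hy => ?_
    rw [ENNReal.ofReal_inv_of_pos (ha.trans hy.1)]
  · have : IntervalIntegrable (fun y : ℝ => y⁻¹) volume a b :=
      intervalIntegral.intervalIntegrable_inv (fun x hx => by
        rw [uIcc_of_le hab] at hx; exact (ha.trans_le hx.1).ne') continuousOn_id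
    rw [intervalIntegrable_iff_integrableOn_Ioc_of_le hab] at this
    exact this.mono_set Ioo_subset_Ioc_self
  · refine (ae_restrict_mem measurableSet_Ioo).mono fun y hy => ?_
    exact (inv_pos.2 (ha.trans hy.1)).le

/-- The local constant governing the averages from the right. -/
noncomputable def innerA (p : ℝ) (v : ℝ → ℝ≥0∞) (a b : ℝ) : ℝ≥0∞ :=
  if p ≤ 1 then ENNReal.ofReal (b - a) / (ENNReal.ofReal b * bigV p v b ^ (1 / p))
  else (∫⁻ t in Ioo a b, (ENNReal.ofReal (t - a) /
    (ENNReal.ofReal t ^ p * bigV p v t)) ^ (1 / (p - 1))) ^ ((p - 1) / p)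

/-- The local constant governing the logarithmic averages from the left. -/
noncomputable def innerB (p : ℝ) (v : ℝ → ℝ≥0∞) (a b : ℝ) : ℝ≥0∞ :=
  if p ≤ 1 then (⨆ (s : ℝ) (_ : s ∈ Ioo a b), logRatio b s ^ p / bigV p v s) ^ (1 / p)
  else (∫⁻ t in Ioo a b, (logRatio b t / bigV p v t) ^ (1 / (p - 1)) /
    ENNReal.ofReal t) ^ ((p - 1) / p)

theorem innerB_mono (hp : 0 < p) {a a' b b' : ℝ} (ha : 0 ≤ a') (haa : a' ≤ a) (hbb : b ≤ b') :
    innerB p v a b ≤ innerB p v a' b' := by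
  unfold innerB
  have hs : Ioo a b ⊆ Ioo a' b' := Ioo_subset_Ioo haa hbb
  split_ifs with h
  · refine ENNReal.rpow_le_rpow (iSup₂_le fun s hs' => ?_) (by positivity)
    refine le_iSup₂_of_le s (hs hs') ?_
    gcongr
    exact logRatio_mono (ha.trans (haa.trans hs'.1.le)) le_rfl
      (ha.trans_lt ((haa.trans_lt hs'.1).trans hs'.2)) hbb
  · have h1 : 0 < p - 1 := by linarith [not_le.1 h]
    refine ENNReal.rpow_le_rpow ?_ (by positivity)
    refine le_trans (setLIntegral_mono' measurableSet_Ioo fun s hs' => ?_) (lintegral_mono_set hs)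
    gcongr
    exact logRatio_mono (ha.trans (haa.trans hs'.1.le)) le_rfl
      (ha.trans_lt ((haa.trans_lt hs'.1).trans hs'.2)) hbb

theorem innerA_mono (hp : 0 < p) {a a' b b' : ℝ} (ha : 0 ≤ a') (haa : a' ≤ a) (hab : a < b)
    (hbb : b ≤ b') : innerA p v a b ≤ innerA p v a' b' := by
  unfold innerA
  have hb : 0 < b := (ha.trans haa).trans_lt hab
  have hb' : 0 < b' := hb.trans_le hbb
  split_ifs with h
  · have e : ∀ {c d : ℝ} {W : ℝ≥0∞}, 0 < d → ENNReal.ofReal c / (ENNReal.ofReal d * W) =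
        ENNReal.ofReal (c / d) / W := fun {c d W} hd => by
      rw [ENNReal.ofReal_div_of_pos hd, div_eq_mul_inv, ENNReal.mul_inv (by simp [hd]) (by simp),
        ← mul_assoc, div_eq_mul_inv, div_eq_mul_inv]
    rw [e hb, e hb']
    refine ENNReal.div_le_div (ENNReal.ofReal_le_ofReal ?_)
      (ENNReal.rpow_le_rpow (bigV_antitone hp hbb) (by positivity))
    rw [div_le_div_iff₀ hb hb']
    nlinarith [mul_le_mul_of_nonneg_left hbb (ha.trans haa), mul_le_mul_of_nonneg_left haa hb.le]
  · have h1 : 0 < p - 1 := by linarith [not_le.1 h]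
    refine ENNReal.rpow_le_rpow ?_ (by positivity)
    refine le_trans (lintegral_mono fun s => ?_) (lintegral_mono_set (Ioo_subset_Ioo haa hbb))
    gcongr

/-- The weight `s^p V(s)`. -/
noncomputable def powV (p : ℝ) (v : ℝ → ℝ≥0∞) (s : ℝ) : ℝ≥0∞ := ENNReal.ofReal s ^ p * bigV p v s

theorem powV_mono (hp : 0 < p) : Monotone (powV p v) := fun x y hxy => by
  rcases le_or_gt x 0 with h | h
  · rw [powV, ENNReal.ofReal_of_nonpos h, ENNReal.zero_rpow_of_pos hp, zero_mul]; exact zero_le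
  · exact rpow_mul_bigV_mono hp h hxy

theorem lintegral_powV_withDensity (hp : 0 < p) (μ : Measure ℝ) (hμ : μ (Iic 0) = 0) :
    ∫⁻ s, powV p v s ∂(μ.withDensity fun s => (ENNReal.ofReal s ^ p)⁻¹) =
      ∫⁻ s, bigV p v s ∂μ := by
  rw [lintegral_withDensity_eq_lintegral_mul μ (f := fun s => (ENNReal.ofReal s ^ p)⁻¹)
    (measurable_ofReal_rpow_inv p) (g := powV p v) (powV_mono hp).measurable]
  have : ∀ᵐ s ∂μ, 0 < s := by
    rw [ae_iff]; simp only [not_lt]; exact hμ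
  refine lintegral_congr_ae (this.mono fun s hs => ?_)
  simp only [Pi.mul_apply, powV]
  rw [← mul_assoc, ENNReal.inv_mul_cancel (ofReal_rpow_ne_zero hs p) (ofReal_rpow_ne_top hs p),
    one_mul]

theorem conj_exponent (h : 1 < p) : (1 / p) / (1 - 1 / p) = 1 / (p - 1) ∧
    1 - 1 / p = (p - 1) / p := by
  have hp : p ≠ 0 := by linarith
  have hp1 : p - 1 ≠ 0 := by linarith
  constructor
  · field_simp
  · field_simp

/-- The constant of the local estimates. -/
noncomputable def localC (p : ℝ) : ℝ≥0∞ := 2 ^ (1 / p) + 2 ^ (1 / p / (1 - 1 / p) + 3)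

theorem localC_ne_top (hp : 0 < p) : localC p ≠ ∞ := by
  refine ENNReal.add_ne_top.2 ⟨ENNReal.rpow_ne_top_of_nonneg (by positivity) (by simp), ?_⟩
  simp [ENNReal.rpow_eq_top_iff]

/-- The Hardy inequality with `r = 1/p`, `ψ = id`, weight `V` and `dρ = dy / y` on `(a, b)`. Here `ρ
[s, ∞) = log (b / s)`, the source of the logarithms in `innerB`. -/
theorem lintegral_head_le (hp : 0 < p) {a b : ℝ} (ha : 0 ≤ a)
    (hV : ∀ z, 0 < z → bigV p v z ≠ 0 ∧ bigV p v z ≠ ∞) (μ : Measure ℝ) [IsFiniteMeasure μ]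
    (hμ : μ (Ioc a b)ᶜ = 0) (hB : ∫⁻ s, bigV p v s ∂μ ≠ ∞) (hI : innerB p v a b ≠ ∞) :
    ∫⁻ y in Ioo a b, (ENNReal.ofReal y)⁻¹ * μ (Iic y) ^ (1 / p) ≤
      localC p * innerB p v a b *
        (∫⁻ s, bigV p v s ∂μ) ^ (1 / p) := by
  have hm : Measurable fun y : ℝ => (ENNReal.ofReal y)⁻¹ := ENNReal.measurable_ofReal.inv
  have hμ' : ∀ᵐ s ∂μ, s ∈ Ioc a b := by rw [ae_iff]; exact hμ
  set ρ : Measure ℝ := (volume.restrict (Ioo a b)).withDensity fun y => (ENNReal.ofReal y)⁻¹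
    with hρ
  have e1 : ∫⁻ y in Ioo a b, (ENNReal.ofReal y)⁻¹ * μ (Iic y) ^ (1 / p) =
      ∫⁻ y, μ (Iic (id y)) ^ (1 / p) ∂ρ := by
    rw [hρ, lintegral_withDensity_eq_lintegral_mul _ (f := fun y => (ENNReal.ofReal y)⁻¹) hm
      (g := fun y => μ (Iic (id y)) ^ (1 / p)) ((monotone_measure_Iic μ).measurable.pow_const _)]
    rfl
  have e2 : ∀ s, s ∈ Ioc a b → ρ (Ici s) = logRatio b s := fun s hs => by
    rw [hρ, withDensity_apply _ measurableSet_Ici, Measure.restrict_restrict measurableSet_Ici,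
      ← lintegral_inv_Ioo (ha.trans_lt hs.1) hs.2, setLIntegral_congr Ioo_ae_eq_Ico]
    congr 2
    ext y
    exact ⟨fun h => ⟨h.1, h.2.2⟩, fun h => ⟨h.1, hs.1.trans_le h.1, h.2⟩⟩
  rw [e1]
  rcases le_or_gt p 1 with h | h
  · have hr : 1 ≤ 1 / p := by rw [le_div_iff₀ hp]; linarith
    refine (hardy_one_le hr monotone_id (bigV_antitone (v := v) hp) (K := innerB p v a b)
      (hμ'.mono fun s hs => ?_) (Filter.Eventually.of_forall fun _ => measure_lt_top _ _)).trans ?_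
    · have hs0 := ha.trans_lt hs.1
      change ρ (Ici s) ≤ _
      rw [e2 s hs, innerB, if_pos h, ← ENNReal.mul_rpow_of_nonneg _ _ (by positivity), one_div,
        ENNReal.le_rpow_inv_iff hp, ← ENNReal.div_le_iff (hV s hs0).1 (hV s hs0).2]
      rcases hs.2.eq_or_lt with hsb | hsb
      · rw [hsb, logRatio_of_pos (hsb ▸ hs0), div_self (hsb ▸ hs0).ne', Real.log_one,
          ENNReal.ofReal_zero, ENNReal.zero_rpow_of_pos hp, ENNReal.zero_div]
        exact zero_le
      · exact le_iSup₂_of_le s ⟨hs.1, hsb⟩ le_rfl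
    · gcongr
      exact le_self_add
  · have hr1 : 1 / p < 1 := by rw [div_lt_one hp]; exact h
    have h1 : 0 < p - 1 := by linarith
    obtain ⟨c1, c2⟩ := conj_exponent h
    set A := ∫⁻ t in Ioo a b, (logRatio b t / bigV p v t) ^ (1 / (p - 1)) / ENNReal.ofReal t with hA
    have hIA : innerB p v a b = A ^ ((p - 1) / p) := by rw [innerB, if_neg (not_le.2 h)]
    have hAt : A ≠ ∞ := fun hAt => hI (by
      rw [hIA, hAt, ENNReal.top_rpow_of_pos (by positivity)])
    refine (hardy_lt_one_of_ne_top (by positivity) hr1 monotone_id (bigV_antitone (v := v) hp)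
      (A := A) (B := ∫⁻ s, bigV p v s ∂μ) ?_ le_rfl hAt hB).trans ?_
    · rw [hρ, lintegral_withDensity_eq_lintegral_mul _ (f := fun y => (ENNReal.ofReal y)⁻¹) hm
        (g := fun y => ((bigV p v (id y))⁻¹ * ρ (Ici y)) ^ (1 / p / (1 - 1 / p)))
        (((bigV_antitone hp).measurable.inv.mul (antitone_measure_Ici ρ).measurable).pow_const _)]
      refine le_of_eq (setLIntegral_congr_fun measurableSet_Ioo fun y hy => ?_)
      simp only [Pi.mul_apply, id]
      rw [e2 y ⟨hy.1, hy.2.le⟩, c1, ENNReal.div_eq_inv_mul, ENNReal.div_eq_inv_mul]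
    · rw [hIA, ← c2]
      gcongr
      exact le_add_self

/-- The mirrored Hardy inequality with `r = 1/p`: passing to `dσ = s^{-p} dμ` makes the inner
integral `σ [y, ∞)` and the weight the increasing function `s^p V(s)`. With `ρ` Lebesgue measure on
`(a, b)`, `ρ (-∞, s] = s - a`. -/
theorem lintegral_tail_le (hp : 0 < p) {a b : ℝ} (ha : 0 ≤ a) (hab : a < b)
    (hV : ∀ z, 0 < z → bigV p v z ≠ 0 ∧ bigV p v z ≠ ∞) (μ : Measure ℝ) [IsFiniteMeasure μ]
    (hμ : μ (Ioc a b)ᶜ = 0) (hB : ∫⁻ s, bigV p v s ∂μ ≠ ∞) (hI : innerA p v a b ≠ ∞) :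
    ∫⁻ y in Ioo a b, (∫⁻ s in Ici y, (ENNReal.ofReal s ^ p)⁻¹ ∂μ) ^ (1 / p) ≤
      localC p * innerA p v a b * (∫⁻ s, bigV p v s ∂μ) ^ (1 / p) := by
  have hb : 0 < b := ha.trans_lt hab
  have hμ' : ∀ᵐ s ∂μ, s ∈ Ioc a b := by rw [ae_iff]; exact hμ
  have hμ0 : μ (Iic 0) = 0 := measure_mono_null
    (t := (Ioc a b)ᶜ) (fun s hs hs' => absurd (ha.trans_lt hs'.1) (not_lt.2 hs)) hμ
  set σ : Measure ℝ := μ.withDensity fun s => (ENNReal.ofReal s ^ p)⁻¹ with hσ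
  have hσB : ∫⁻ s, powV p v s ∂σ = ∫⁻ s, bigV p v s ∂μ := lintegral_powV_withDensity hp μ hμ0
  have hσ' : ∀ᵐ s ∂σ, s ∈ Ioc a b := withDensity_absolutelyContinuous μ _ hμ'
  have e1 : ∀ y, ∫⁻ s in Ici y, (ENNReal.ofReal s ^ p)⁻¹ ∂μ = σ (Ici y) := fun y => by
    rw [hσ, withDensity_apply _ measurableSet_Ici]
  simp_rw [e1]
  set ρ : Measure ℝ := volume.restrict (Ioo a b) with hρ
  have e2 : ∀ s, s ∈ Ioc a b → ρ (Iic s) = ENNReal.ofReal (s - a) := fun s hs => by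
    rw [hρ, Measure.restrict_apply measurableSet_Iic]
    rcases hs.2.eq_or_lt with hsb | hsb
    · have : Iic s ∩ Ioo a b = Ioo a s := by
        ext y; exact ⟨fun h => ⟨h.2.1, hsb ▸ h.2.2⟩, fun h => ⟨h.2.le, h.1, hsb ▸ h.2⟩⟩
      rw [this, Real.volume_Ioo]
    · have : Iic s ∩ Ioo a b = Ioc a s := by
        ext y; exact ⟨fun h => ⟨h.2.1, h.1⟩, fun h => ⟨h.2, h.1, h.2.trans_lt hsb⟩⟩
      rw [this, Real.volume_Ioc]
  have hfin : ∀ᵐ x ∂ρ, σ (Ici x) < ∞ := by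
    refine (ae_restrict_mem measurableSet_Ioo).mono fun x hx => ?_
    have hx0 : 0 < x := ha.trans_lt hx.1
    rw [← e1]
    refine lt_of_le_of_lt (setLIntegral_mono' (g := fun _ => (ENNReal.ofReal x ^ p)⁻¹)
      measurableSet_Ici fun s hs => ?_) ?_
    · have hs : x ≤ s := hs
      gcongr
    · rw [setLIntegral_const]
      exact ENNReal.mul_lt_top (ENNReal.inv_lt_top.2 (pos_iff_ne_zero.2 (ofReal_rpow_ne_zero hx0 p)))
        (measure_lt_top _ _)
  rcases le_or_gt p 1 with h | h
  · have hr : 1 ≤ 1 / p := by rw [le_div_iff₀ hp]; linarith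
    refine (hardy_one_le_mirror hr (powV_mono (v := v) hp) (K := innerA p v a b)
      (hσ'.mono fun s hs => ?_) hfin).trans ?_
    · have hs0 := ha.trans_lt hs.1
      have hVs : powV p v s ^ (1 / p) = ENNReal.ofReal s * bigV p v s ^ (1 / p) := by
        rw [powV, ENNReal.mul_rpow_of_nonneg _ _ (by positivity), ← ENNReal.rpow_mul,
          mul_one_div_cancel hp.ne', ENNReal.rpow_one]
      have hVp : ∀ z, 0 < z → bigV p v z ^ (1 / p) ≠ 0 ∧ bigV p v z ^ (1 / p) ≠ ∞ := fun z hz => by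
        simp [ENNReal.rpow_eq_zero_iff, ENNReal.rpow_eq_top_iff, hV z hz]
      rw [e2 s hs, hVs]
      have hmono := innerA_mono (v := v) hp ha le_rfl hs.1 hs.2
      refine le_trans (le_of_eq ?_) (mul_le_mul' hmono le_rfl)
      rw [innerA, if_pos h, ENNReal.div_mul_cancel]
      · exact mul_ne_zero (by simpa using hs0) (hVp s hs0).1
      · exact ENNReal.mul_ne_top (by simp) (hVp s hs0).2
    · rw [hσB]
      gcongr
      exact le_self_add
  · have hr1 : 1 / p < 1 := by rw [div_lt_one hp]; exact h
    have h1 : 0 < p - 1 := by linarith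
    obtain ⟨c1, c2⟩ := conj_exponent h
    set A := ∫⁻ t in Ioo a b, (ENNReal.ofReal (t - a) /
      (ENNReal.ofReal t ^ p * bigV p v t)) ^ (1 / (p - 1)) with hA
    have hIA : innerA p v a b = A ^ ((p - 1) / p) := by rw [innerA, if_neg (not_le.2 h)]
    have hAt : A ≠ ∞ := fun hAt => hI (by
      rw [hIA, hAt, ENNReal.top_rpow_of_pos (by positivity)])
    refine (hardy_lt_one_mirror_of_ne_top (by positivity) hr1 (powV_mono (v := v) hp)
      (A := A) (B := ∫⁻ s, powV p v s ∂σ) ?_ le_rfl hAt (by rwa [hσB])).trans ?_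
    · refine le_of_eq (setLIntegral_congr_fun measurableSet_Ioo fun y hy => ?_)
      rw [e2 y ⟨hy.1, hy.2.le⟩, c1, ENNReal.div_eq_inv_mul, powV]
    · rw [hIA, ← c2, hσB]
      gcongr
      exact le_add_self

/-- The local upper estimate. -/
theorem lintegral_gKer_Ioo_le (hp : 0 < p) {a b : ℝ} (ha : 0 ≤ a) (hab : a < b)
    (hV : ∀ z, 0 < z → bigV p v z ≠ 0 ∧ bigV p v z ≠ ∞) (μ : Measure ℝ) [IsFiniteMeasure μ]
    (hμ : μ (Ioc a b)ᶜ = 0) (hB : ∫⁻ s, bigV p v s ∂μ ≠ ∞) :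
    ∫⁻ y in Ioo a b, gKer p μ y ≤
      2 ^ (1 / p) * localC p * (innerA p v a b + innerB p v a b) *
        (∫⁻ s, bigV p v s ∂μ) ^ (1 / p) := by
  have hμ' : ∀ᵐ s ∂μ, s ∈ Ioc a b := by rw [ae_iff]; exact hμ
  by_cases hμ0 : μ = 0
  · simp [hμ0, gKer, hp]
  have hB0 : ∫⁻ s, bigV p v s ∂μ ≠ 0 := by
    intro h
    rw [lintegral_eq_zero_iff (bigV_antitone hp).measurable] at h
    have : ∀ᵐ s ∂μ, False := by
      filter_upwards [h, hμ'] with s hs hs'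
      exact (hV s (ha.trans_lt hs'.1)).1 hs
    rw [Filter.eventually_false_iff_eq_bot, ae_eq_bot] at this
    exact hμ0 this
  by_cases hI : innerA p v a b + innerB p v a b = ∞
  · rw [hI, ENNReal.mul_top, ENNReal.top_mul]
    · exact le_top
    · simp [ENNReal.rpow_eq_zero_iff, hB0, hB]
    · refine mul_ne_zero (by simp [ENNReal.rpow_eq_zero_iff]) ?_
      simp [localC, ENNReal.rpow_eq_zero_iff]
  obtain ⟨hIA, hIB⟩ := ENNReal.add_ne_top.1 hI
  calc ∫⁻ y in Ioo a b, gKer p μ y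
      ≤ ∫⁻ y in Ioo a b, 2 ^ (1 / p) * ((ENNReal.ofReal y)⁻¹ * μ (Iic y) ^ (1 / p) +
          (∫⁻ s in Ici y, (ENNReal.ofReal s ^ p)⁻¹ ∂μ) ^ (1 / p)) :=
        lintegral_mono fun y => gKer_le hp μ y
    _ = 2 ^ (1 / p) * ((∫⁻ y in Ioo a b, (ENNReal.ofReal y)⁻¹ * μ (Iic y) ^ (1 / p)) +
          ∫⁻ y in Ioo a b, (∫⁻ s in Ici y, (ENNReal.ofReal s ^ p)⁻¹ ∂μ) ^ (1 / p)) := by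
        rw [lintegral_const_mul' _ _ (ENNReal.rpow_ne_top_of_nonneg (by positivity) (by simp)),
          lintegral_add_left]
        exact ENNReal.measurable_ofReal.inv.mul ((monotone_measure_Iic μ).measurable.pow_const _)
    _ ≤ 2 ^ (1 / p) * (localC p * innerB p v a b * (∫⁻ s, bigV p v s ∂μ) ^ (1 / p) +
          localC p * innerA p v a b * (∫⁻ s, bigV p v s ∂μ) ^ (1 / p)) := by
        gcongr
        · exact lintegral_head_le hp ha hV μ hμ hB hIB
        · exact lintegral_tail_le hp ha hab hV μ hμ hB hIA
    _ = _ := by ring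

/-- For `p ≤ 1` a unit mass at `b` produces the constant exactly. For `p > 1` only the tail part of
`gKer` is kept and the necessity part of the mirrored Hardy inequality applies, test measures being
transported by `μ = s^p κ`. -/
theorem innerA_le_of_measure (hp : 0 < p) {a b : ℝ} (ha : 0 ≤ a) (hab : a < b)
    (hV : ∀ z, 0 < z → bigV p v z ≠ 0 ∧ bigV p v z ≠ ∞) {K : ℝ≥0∞}
    (H : ∀ μ : Measure ℝ, IsFiniteMeasure μ → μ (Ioc a b)ᶜ = 0 → ∫⁻ s, bigV p v s ∂μ ≠ ∞ →
      ∫⁻ y in Ioo a b, gKer p μ y ≤ K * (∫⁻ s, bigV p v s ∂μ) ^ (1 / p)) :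
    innerA p v a b ≤ localC p * K := by
  have hb : 0 < b := ha.trans_lt hab
  rcases le_or_gt p 1 with h | h
  · have h1 := H (Measure.dirac b) inferInstance (by simp [hab]) (by simpa using (hV b hb).2)
    have hVp : bigV p v b ^ (1 / p) ≠ 0 ∧ bigV p v b ^ (1 / p) ≠ ∞ := by
      simp [ENNReal.rpow_eq_zero_iff, ENNReal.rpow_eq_top_iff, hV b hb]
    rw [lintegral_dirac] at h1
    rw [innerA, if_pos h]
    have h2 : ∫⁻ y in Ioo a b, gKer p (Measure.dirac b) y =
        ENNReal.ofReal (b - a) / ENNReal.ofReal b := by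
      rw [setLIntegral_congr_fun (g := fun _ => (ENNReal.ofReal b)⁻¹) measurableSet_Ioo
        fun y hy => ?_, setLIntegral_const, Real.volume_Ioo, mul_comm, div_eq_mul_inv]
      rw [gKer, lintegral_dirac, ker, max_eq_left hy.2.le, ENNReal.inv_rpow, ← ENNReal.rpow_mul,
        mul_one_div_cancel hp.ne', ENNReal.rpow_one]
    rw [h2] at h1
    have h3 : 1 ≤ localC p := le_add_of_le_of_nonneg (ENNReal.one_le_rpow (by norm_num)
      (by positivity)) zero_le
    calc ENNReal.ofReal (b - a) / (ENNReal.ofReal b * bigV p v b ^ (1 / p))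
        = ENNReal.ofReal (b - a) / ENNReal.ofReal b / bigV p v b ^ (1 / p) := by
          rw [div_eq_mul_inv, ENNReal.mul_inv (by simp [hb]) (by simp), ← mul_assoc,
            ← div_eq_mul_inv, ← div_eq_mul_inv]
      _ ≤ K := by rwa [ENNReal.div_le_iff hVp.1 hVp.2]
      _ = 1 * K := (one_mul K).symm
      _ ≤ _ := by gcongr
  · have hr1 : 1 / p < 1 := by rw [div_lt_one hp]; exact h
    have h1 : 0 < p - 1 := by linarith
    obtain ⟨c1, c2⟩ := conj_exponent h
    set ρ : Measure ℝ := volume.restrict (Ioo a b) with hρ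
    have hnec := hardy_lt_one_necessity_mirror (ρ := ρ) (r := 1 / p) (by positivity) hr1
      (v := fun x => (powV p v x)⁻¹) (fun x y hxy => ENNReal.inv_le_inv.2 (powV_mono hp hxy))
      (K := K) (fun κ hκ hκρ _ hκB => by
        simp only [inv_inv] at hκB ⊢
        have hm : Measurable fun s : ℝ => ENNReal.ofReal s ^ p :=
          ENNReal.measurable_ofReal.pow_const p
        have hae : ∀ᵐ s ∂κ, s ∈ Ioo a b := hκρ (ae_restrict_mem measurableSet_Ioo)
        set μ : Measure ℝ := κ.withDensity fun s => ENNReal.ofReal s ^ p with hμ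
        have hμf : IsFiniteMeasure μ := by
          refine ⟨?_⟩
          rw [hμ, withDensity_apply _ MeasurableSet.univ, setLIntegral_univ]
          refine lt_of_le_of_lt (lintegral_mono_ae (g := fun _ => ENNReal.ofReal b ^ p)
            (hae.mono fun s hs => ?_)) ?_
          · have := hs.2.le
            gcongr
          · rw [lintegral_const]
            exact ENNReal.mul_lt_top (ofReal_rpow_ne_top hb p).lt_top (measure_lt_top _ _)
        have hμc : μ (Ioc a b)ᶜ = 0 := by
          have : ∀ᵐ s ∂μ, s ∈ Ioc a b :=
            withDensity_absolutelyContinuous κ _ (hae.mono fun s hs => ⟨hs.1, hs.2.le⟩)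
          exact this
        have hμB : ∫⁻ s, bigV p v s ∂μ = ∫⁻ s, powV p v s ∂κ := by
          rw [hμ, lintegral_withDensity_eq_lintegral_mul κ (f := fun s => ENNReal.ofReal s ^ p) hm
            (g := bigV p v) (bigV_antitone hp).measurable]
          rfl
        refine le_trans ?_ ((H μ hμf hμc (by rw [hμB]; exact hκB.ne)).trans_eq (by rw [hμB]))
        refine setLIntegral_mono' measurableSet_Ioo fun x hx => le_trans ?_ (tail_le_gKer hp μ x)
        refine ENNReal.rpow_le_rpow (le_of_eq ?_) (by positivity)
        have hx0 : 0 < x := ha.trans_lt hx.1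
        rw [hμ, setLIntegral_withDensity_eq_setLIntegral_mul κ (f := fun s => ENNReal.ofReal s ^ p)
          hm (g := fun s => (ENNReal.ofReal s ^ p)⁻¹) (measurable_ofReal_rpow_inv p)
          measurableSet_Ici, ← setLIntegral_one]
        refine setLIntegral_congr_fun measurableSet_Ici fun s hs => ?_
        have hs0 : 0 < s := hx0.trans_le hs
        simp only [Pi.mul_apply]
        rw [ENNReal.mul_inv_cancel (ofReal_rpow_ne_zero hs0 p) (ofReal_rpow_ne_top hs0 p)])
    rw [c1, c2] at hnec
    have e : ∫⁻ x, ((powV p v x)⁻¹ * ρ (Iic x)) ^ (1 / (p - 1)) ∂ρ = ∫⁻ t in Ioo a b,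
        (ENNReal.ofReal (t - a) / (ENNReal.ofReal t ^ p * bigV p v t)) ^ (1 / (p - 1)) := by
      refine setLIntegral_congr_fun measurableSet_Ioo fun y hy => ?_
      have : Iic y ∩ Ioo a b = Ioc a y := by
        ext z; exact ⟨fun h => ⟨h.2.1, h.1⟩, fun h => ⟨h.2, h.1, h.2.trans_lt hy.2⟩⟩
      rw [hρ, Measure.restrict_apply measurableSet_Iic, this, Real.volume_Ioc,
        ENNReal.div_eq_inv_mul, powV]
    rw [e] at hnec
    rw [innerA, if_neg (not_le.2 h)]
    calc _ ≤ ((2 ^ (1 / (p - 1) + 2) * K) ^ (1 / ((p - 1) / p))) ^ ((p - 1) / p) := by gcongr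
      _ = 2 ^ (1 / (p - 1) + 2) * K := by
        rw [← ENNReal.rpow_mul, one_div_mul_cancel (by positivity), ENNReal.rpow_one]
      _ ≤ _ := by
        gcongr
        rw [localC, c2, ← c2, c1]
        refine le_trans (ENNReal.rpow_le_rpow_of_exponent_le (by norm_num) ?_) le_add_self
        linarith

/-- For `p ≤ 1` unit masses at the points `s` suffice, since their kernel integrates to at least
`log (b / s)`. For `p > 1` the head part of `gKer` and the necessity part of the Hardy inequality
are used. -/
theorem innerB_le_of_measure (hp : 0 < p) {a b : ℝ} (ha : 0 ≤ a)
    (hV : ∀ z, 0 < z → bigV p v z ≠ 0 ∧ bigV p v z ≠ ∞) {K : ℝ≥0∞}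
    (H : ∀ μ : Measure ℝ, IsFiniteMeasure μ → μ (Ioc a b)ᶜ = 0 → ∫⁻ s, bigV p v s ∂μ ≠ ∞ →
      ∫⁻ y in Ioo a b, gKer p μ y ≤ K * (∫⁻ s, bigV p v s ∂μ) ^ (1 / p)) :
    innerB p v a b ≤ localC p * K := by
  rcases le_or_gt p 1 with h | h
  · have h3 : 1 ≤ localC p := le_add_of_le_of_nonneg (ENNReal.one_le_rpow (by norm_num)
      (by positivity)) zero_le
    rw [innerB, if_pos h]
    refine le_trans ?_ (le_mul_of_one_le_left' h3)
    rw [one_div, ENNReal.rpow_inv_le_iff hp]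
    refine iSup₂_le fun s hs => ?_
    have hs0 : 0 < s := ha.trans_lt hs.1
    have h1 := H (Measure.dirac s) inferInstance (by simp [hs.1, hs.2.le])
      (by simpa using (hV s hs0).2)
    rw [lintegral_dirac] at h1
    have h2 : logRatio b s ≤ ∫⁻ y in Ioo a b, gKer p (Measure.dirac s) y := by
      rw [← lintegral_inv_Ioo hs0 hs.2.le]
      refine le_trans (setLIntegral_mono' measurableSet_Ioo fun y hy => ?_)
        (lintegral_mono_set (Ioo_subset_Ioo_left hs.1.le))
      rw [gKer, lintegral_dirac, ker, max_eq_right hy.1.le, ENNReal.inv_rpow, ← ENNReal.rpow_mul,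
        mul_one_div_cancel hp.ne', ENNReal.rpow_one]
    rw [ENNReal.div_le_iff (hV s hs0).1 (hV s hs0).2]
    calc logRatio b s ^ p ≤ (K * bigV p v s ^ (1 / p)) ^ p := by gcongr; exact h2.trans h1
      _ = _ := by
        rw [ENNReal.mul_rpow_of_nonneg _ _ hp.le, ← ENNReal.rpow_mul, one_div_mul_cancel hp.ne',
          ENNReal.rpow_one]
  · have hr1 : 1 / p < 1 := by rw [div_lt_one hp]; exact h
    have h1 : 0 < p - 1 := by linarith
    obtain ⟨c1, c2⟩ := conj_exponent h
    have hm : Measurable fun y : ℝ => (ENNReal.ofReal y)⁻¹ := ENNReal.measurable_ofReal.inv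
    set ρ : Measure ℝ := (volume.restrict (Ioo a b)).withDensity fun y => (ENNReal.ofReal y)⁻¹
      with hρ
    have hnec := hardy_lt_one_necessity (ρ := ρ) (r := 1 / p) (by positivity) hr1
      (v := fun x => (bigV p v x)⁻¹) (fun x y hxy => ENNReal.inv_le_inv.2 (bigV_antitone hp hxy))
      (K := K) (fun κ hκ hκρ _ hκB => by
        simp only [inv_inv] at hκB ⊢
        have hae : ∀ᵐ s ∂κ, s ∈ Ioo a b :=
          hκρ (withDensity_absolutelyContinuous _ _ (ae_restrict_mem measurableSet_Ioo))
        have hκc : κ (Ioc a b)ᶜ = 0 := by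
          have : ∀ᵐ s ∂κ, s ∈ Ioc a b := hae.mono fun s hs => ⟨hs.1, hs.2.le⟩
          exact this
        refine le_trans ?_ (H κ hκ hκc hκB.ne)
        rw [hρ, lintegral_withDensity_eq_lintegral_mul _ (f := fun y => (ENNReal.ofReal y)⁻¹) hm
          (g := fun y => κ (Iic y) ^ (1 / p)) ((monotone_measure_Iic κ).measurable.pow_const _)]
        exact lintegral_mono fun y => head_le_gKer hp κ y)
    rw [c1, c2] at hnec
    have e : ∫⁻ x, ((bigV p v x)⁻¹ * ρ (Ici x)) ^ (1 / (p - 1)) ∂ρ = ∫⁻ t in Ioo a b,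
        (logRatio b t / bigV p v t) ^ (1 / (p - 1)) / ENNReal.ofReal t := by
      nth_rw 2 [hρ]
      rw [lintegral_withDensity_eq_lintegral_mul _ (f := fun y => (ENNReal.ofReal y)⁻¹) hm
        (g := fun y => ((bigV p v y)⁻¹ * ρ (Ici y)) ^ (1 / (p - 1)))
        (((bigV_antitone hp).measurable.inv.mul (antitone_measure_Ici ρ).measurable).pow_const _)]
      refine setLIntegral_congr_fun measurableSet_Ioo fun y hy => ?_
      have : ρ (Ici y) = logRatio b y := by
        rw [hρ, withDensity_apply _ measurableSet_Ici, Measure.restrict_restrict measurableSet_Ici,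
          ← lintegral_inv_Ioo (ha.trans_lt hy.1) hy.2.le, setLIntegral_congr Ioo_ae_eq_Ico]
        congr 2
        ext z
        exact ⟨fun h => ⟨h.1, h.2.2⟩, fun h => ⟨h.1, hy.1.trans_le h.1, h.2⟩⟩
      simp only [Pi.mul_apply]
      rw [this, ENNReal.div_eq_inv_mul, ENNReal.div_eq_inv_mul]
    rw [e] at hnec
    rw [innerB, if_neg (not_le.2 h)]
    calc _ ≤ ((2 ^ (1 / (p - 1) + 2) * K) ^ (1 / ((p - 1) / p))) ^ ((p - 1) / p) := by gcongr
      _ = 2 ^ (1 / (p - 1) + 2) * K := by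
        rw [← ENNReal.rpow_mul, one_div_mul_cancel (by positivity), ENNReal.rpow_one]
      _ ≤ _ := by
        gcongr
        rw [localC, c1]
        refine le_trans (ENNReal.rpow_le_rpow_of_exponent_le (by norm_num) ?_) le_add_self
        linarith

/-! ### The second pair of constants in terms of the local constants -/

theorem div_mul_eq {b : ℝ≥0∞} (hb : b ≠ 0) (hb' : b ≠ ∞) (a W : ℝ≥0∞) :
    a / (b * W) = a * b⁻¹ * W⁻¹ := by
  rw [div_eq_mul_inv, ENNReal.mul_inv (Or.inl hb) (Or.inl hb'), mul_assoc]

/-- With left endpoint 0 the length cancels against the power: `(t / t^p)^{1/(p-1)} = 1 / t` for `p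
> 1`, and `(t - 0) / t = 1` for `p ≤ 1`. -/
theorem calA2_of_le (hpq : p ≤ q) :
    calA2 p q v u = ⨆ (t : ℝ) (_ : 0 < t), tail q u t ^ (1 / q) * innerA p v 0 t := by
  rw [calA2, if_pos hpq]
  split_ifs with h
  · refine iSup_congr fun t => iSup_congr fun ht => ?_
    rw [innerA, if_pos h, sub_zero, neg_div, ENNReal.rpow_neg,
      div_mul_eq (by simpa using ht) (by simp),
          ENNReal.mul_inv_cancel (by simpa using ht) (by simp), one_mul]
  · have h1 : 0 < p - 1 := by linarith [not_le.1 h]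
    refine iSup_congr fun t => iSup_congr fun ht => ?_
    rw [innerA, if_neg h]
    congr 2
    refine setLIntegral_congr_fun measurableSet_Ioo fun x hx => ?_
    have hx0 : 0 < x := hx.1
    have hx1 : ENNReal.ofReal x ≠ 0 := by simpa using hx0
    rw [sub_zero, ENNReal.div_rpow_of_nonneg _ _ (by positivity),
      ENNReal.mul_rpow_of_nonneg _ _ (by positivity), ← ENNReal.rpow_mul,
      div_mul_eq (ofReal_rpow_ne_zero hx0 _) (ofReal_rpow_ne_top hx0 _), div_eq_mul_inv,
      ← ENNReal.rpow_neg, ← ENNReal.rpow_neg, ← ENNReal.rpow_add _ _ hx1 (by simp),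
      ← ENNReal.rpow_neg_one (ENNReal.ofReal x), mul_comm]
    congr 2
    · field_simp; ring
    · rw [← neg_sub p 1]; field_simp

theorem bfA2_of_le (hp : 0 < p) (hpq : p ≤ q) :
    bfA2 p q v u = ⨆ (t : ℝ) (_ : 0 < t), tail q u t ^ (1 / q) * innerB p v 0 t := by
  rw [bfA2, if_pos hpq]
  split_ifs with h
  · refine iSup_congr fun t => iSup_congr fun ht => ?_
    rw [innerB, if_pos h]
    congr 1
    have e1 : ∀ X : ℝ → ℝ≥0∞, (⨆ (s : ℝ) (_ : s ∈ Ioo 0 t), X s) ^ (1 / p) =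
        ⨆ (s : ℝ) (_ : s ∈ Ioo 0 t), X s ^ (1 / p) := fun X => by
      refine ((ENNReal.orderIsoRpow (1 / p) (by positivity)).map_iSup _).trans ?_
      exact iSup_congr fun s => (ENNReal.orderIsoRpow (1 / p) (by positivity)).map_iSup _
    rw [e1]
    refine iSup_congr fun s => iSup_congr fun hs => ?_
    rw [ENNReal.div_rpow_of_nonneg _ _ (by positivity), ← ENNReal.rpow_mul,
      mul_one_div_cancel hp.ne', ENNReal.rpow_one, neg_div, ENNReal.rpow_neg,
      ENNReal.div_eq_inv_mul]
  · have h1 : 0 < p - 1 := by linarith [not_le.1 h]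
    refine iSup_congr fun t => iSup_congr fun ht => ?_
    rw [innerB, if_neg h]
    congr 2
    refine setLIntegral_congr_fun measurableSet_Ioo fun x hx => ?_
    rw [ENNReal.div_rpow_of_nonneg _ _ (by positivity), ENNReal.div_eq_inv_mul (a := _ ^ _),
      ← ENNReal.rpow_neg]
    congr 3
    rw [← neg_sub p 1]; field_simp

theorem calA2_of_lt (hp : 0 < p) (hq : 0 < q) (hpq : q < p) :
    calA2 p q v u = (∫⁻ x in Ioi (0 : ℝ), wt q u x * tail q u x ^ (q / (p - q)) *
      innerA p v (zetaInv q u x) (zeta q u x) ^ (p * q / (p - q))) ^ ((p - q) / (p * q)) := by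
  have hpq' : 0 < p - q := by linarith
  rw [calA2, if_neg (not_le.2 hpq)]
  split_ifs with h
  · simp only [innerA, if_pos h]
  · congr 1
    refine lintegral_congr fun x => ?_
    rw [innerA, if_neg h, ← ENNReal.rpow_mul]
    congr 2
    field_simp

theorem bfA2_of_lt (hp : 0 < p) (hq : 0 < q) (hpq : q < p) :
    bfA2 p q v u = (∫⁻ x in Ioi (0 : ℝ), wt q u x * tail q u x ^ (q / (p - q)) *
      innerB p v (zetaInv q u x) (zeta q u x) ^ (p * q / (p - q))) ^ ((p - q) / (p * q)) := by
  have hpq' : 0 < p - q := by linarith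
  rw [bfA2, if_neg (not_le.2 hpq)]
  split_ifs with h
  · simp only [innerB, if_pos h]
    congr 1
    refine lintegral_congr fun x => ?_
    rw [← ENNReal.rpow_mul]
    congr 2
    field_simp
  · congr 1
    refine lintegral_congr fun x => ?_
    rw [innerB, if_neg h, ← ENNReal.rpow_mul]
    congr 2
    field_simp

/-! ### A geometric Hardy inequality -/

/-- A constant `C` with `(a + b)^q ≤ (9/8) a^q + C b^q`. -/
noncomputable def splitC (q : ℝ) : ℝ≥0∞ :=
  ((ENNReal.ofReal ((9 / 8 : ℝ) ^ (1 / q) - 1))⁻¹ + 1) ^ q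

theorem splitC_ne_top (hq : 0 < q) : splitC q ≠ ∞ := by
  have h : 1 < (9 / 8 : ℝ) ^ (1 / q) := Real.one_lt_rpow (by norm_num) (by positivity)
  refine ENNReal.rpow_ne_top_of_nonneg hq.le (ENNReal.add_ne_top.2 ⟨?_, by simp⟩)
  simp only [ne_eq, ENNReal.inv_eq_top, ENNReal.ofReal_eq_zero, not_le]
  linarith

/-- Either `a + b ≤ (9/8)^{1/q} a`, or `a` is at most a fixed multiple of `b`. -/
theorem eight_mul_add_rpow_le (hq : 0 < q) (a b : ℝ≥0∞) :
    8 * (a + b) ^ q ≤ 9 * a ^ q + 8 * splitC q * b ^ q := by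
  have h1 : 1 < (9 / 8 : ℝ) ^ (1 / q) := Real.one_lt_rpow (by norm_num) (by positivity)
  set c : ℝ := (9 / 8 : ℝ) ^ (1 / q) with hc
  have hcq : 8 * ENNReal.ofReal c ^ q = 9 := by
    rw [ENNReal.ofReal_rpow_of_pos (by positivity), hc, ← Real.rpow_mul (by norm_num),
      one_div_mul_cancel hq.ne', Real.rpow_one, show (8 : ℝ≥0∞) = ENNReal.ofReal 8 by norm_num,
      ← ENNReal.ofReal_mul (by norm_num)]
    norm_num
  rcases le_or_gt (a + b) (ENNReal.ofReal c * a) with h | h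
  · calc 8 * (a + b) ^ q ≤ 8 * (ENNReal.ofReal c * a) ^ q := by gcongr
      _ = 9 * a ^ q := by rw [ENNReal.mul_rpow_of_nonneg _ _ hq.le, ← mul_assoc, hcq]
      _ ≤ _ := le_self_add
  · have hat : a ≠ ∞ := by
      rintro rfl
      rw [top_add] at h
      exact absurd h (by simp [ENNReal.mul_top, lt_trans one_pos h1])
    have h2 : ENNReal.ofReal (c - 1) * a ≤ b := by
      have h3 : a + ENNReal.ofReal (c - 1) * a ≤ a + b := by
        refine le_trans (le_of_eq ?_) h.le
        rw [show c = 1 + (c - 1) by ring, ENNReal.ofReal_add zero_le_one (by linarith),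
          ENNReal.ofReal_one, add_mul, one_mul]
        simp
      exact (ENNReal.add_le_add_iff_left hat).1 h3
    have h3 : a ≤ (ENNReal.ofReal (c - 1))⁻¹ * b := by
      rw [mul_comm, ← div_eq_mul_inv, ENNReal.le_div_iff_mul_le (by simp [h1]) (by simp), mul_comm]
      exact h2
    calc 8 * (a + b) ^ q ≤ 8 * (((ENNReal.ofReal (c - 1))⁻¹ + 1) * b) ^ q := by
          rw [add_mul, one_mul]; gcongr
      _ = 8 * splitC q * b ^ q := by
          rw [ENNReal.mul_rpow_of_nonneg _ _ hq.le, splitC, mul_assoc]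
      _ ≤ _ := le_add_self

/-- In one step `t` shrinks by `4/5` while `G^q` grows at most by the factor `9/8`, up to a multiple
of `b^q`, and `4/5 · 9/8 = 9/10 < 1`. The term `9 t_N G_N^q` stored on the left is what the next
step of the induction consumes. -/
theorem geometric_hardy (hq : 0 < q) {t G b : ℕ → ℝ≥0∞} (ht : ∀ n, 5 * t (n + 1) ≤ 4 * t n)
    (hG0 : G 0 = 0) (hG : ∀ n, G (n + 1) ≤ G n + b (n + 1)) (N : ℕ) :
    ∑ i ∈ Finset.range (N + 1), t i * G i ^ q + 9 * (t N * G N ^ q) ≤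
      10 * splitC q * ∑ i ∈ Finset.range (N + 1), t i * b i ^ q := by
  induction N with
  | zero => simp [hG0, hq]
  | succ n ih =>
    rw [Finset.sum_range_succ, Finset.sum_range_succ (fun i => t i * b i ^ q), mul_add]
    have h1 : 10 * (t (n + 1) * G (n + 1) ^ q) ≤
        9 * (t n * G n ^ q) + 10 * splitC q * (t (n + 1) * b (n + 1) ^ q) := by
      have h2 : 4 * (10 * (t (n + 1) * G (n + 1) ^ q)) ≤
          4 * (9 * (t n * G n ^ q) + 10 * splitC q * (t (n + 1) * b (n + 1) ^ q)) := by
        calc 4 * (10 * (t (n + 1) * G (n + 1) ^ q))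
            ≤ 5 * t (n + 1) * (8 * (G n + b (n + 1)) ^ q) := by
              rw [show (5 : ℝ≥0∞) * t (n + 1) * (8 * (G n + b (n + 1)) ^ q) =
                4 * (10 * (t (n + 1) * (G n + b (n + 1)) ^ q)) by ring]
              gcongr
              exact hG n
          _ ≤ 5 * t (n + 1) * (9 * G n ^ q + 8 * splitC q * b (n + 1) ^ q) := by
              gcongr _ * ?_
              exact eight_mul_add_rpow_le hq _ _
          _ = 5 * t (n + 1) * (9 * G n ^ q) + 4 * (10 * splitC q * (t (n + 1) * b (n + 1) ^ q)) :=
              by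
              ring
          _ ≤ 4 * t n * (9 * G n ^ q) + 4 * (10 * splitC q * (t (n + 1) * b (n + 1) ^ q)) := by
              exact add_le_add (mul_le_mul' (ht n) le_rfl) le_rfl
          _ = _ := by ring
      exact (ENNReal.mul_le_mul_iff_right (by simp) (by simp)).1 h2
    calc _ = ∑ i ∈ Finset.range (n + 1), t i * G i ^ q + 10 * (t (n + 1) * G (n + 1) ^ q) := by ring
      _ ≤ ∑ i ∈ Finset.range (n + 1), t i * G i ^ q + (9 * (t n * G n ^ q) +
          10 * splitC q * (t (n + 1) * b (n + 1) ^ q)) := by gcongr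
      _ ≤ _ := by rw [← add_assoc]; gcongr

theorem five_tau_le (k : ℤ) : 5 * tau (k + 1) ≤ 4 * tau k := by
  have h : tau k = theta * tau (k + 1) := by rw [← tau_sub_one]; congr 1; ring
  rw [h, ← mul_assoc]
  gcongr
  exact five_le_theta

theorem tsum_tau_le (hq : 0 < q) {G b : ℤ → ℝ≥0∞} {k₀ : ℤ} (hG0 : ∀ k, k ≤ k₀ → G k = 0)
    (hG : ∀ k, G (k + 1) ≤ G k + b (k + 1)) :
    ∑' k, tau k * G k ^ q ≤ 10 * splitC q * ∑' k, tau k * b k ^ q := by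
  have hinj : Function.Injective fun n : ℕ => k₀ + (n : ℤ) := fun m n h => by
    simpa using h
  rw [← hinj.tsum_eq (f := fun k => tau k * G k ^ q)]
  · refine ENNReal.tsum_le_of_sum_range_le fun n => ?_
    have h := geometric_hardy hq (t := fun n : ℕ => tau (k₀ + n)) (G := fun n : ℕ => G (k₀ + n))
      (b := fun n : ℕ => b (k₀ + n)) (fun n => by
        have := five_tau_le (k₀ + n)
        push_cast
        rwa [← add_assoc]) (hG0 _ (by simp)) (fun n => by
        have := hG (k₀ + n)
        push_cast
        rwa [← add_assoc]) n
    calc ∑ i ∈ Finset.range n, tau (k₀ + i) * G (k₀ + i) ^ q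
        ≤ ∑ i ∈ Finset.range (n + 1), tau (k₀ + i) * G (k₀ + i) ^ q :=
          Finset.sum_le_sum_of_subset (Finset.range_mono (by omega))
      _ ≤ _ := le_self_add.trans h
      _ ≤ _ := by
          gcongr
          refine (ENNReal.sum_le_tsum _).trans ?_
          exact ENNReal.tsum_comp_le_tsum_of_injective hinj (fun k => tau k * b k ^ q)
  · intro k hk
    by_contra hk'
    refine hk ?_
    simp only
    rw [hG0 k, ENNReal.zero_rpow_of_pos hq, mul_zero]
    by_contra hlt
    exact hk' ⟨(k - k₀).toNat, by simp only; rw [Int.toNat_of_nonneg (by omega)]; ring⟩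

/-- On block `k` the inner integral is at most the one up to `pt k`, and the block has weight at
most `2 τ_k`; the rest is `geometric_hardy`. The cut-off `α` makes the integrals vanish for small
`k`, which gives the recursion a start, and it does not enter the constant. -/
theorem lintegral_rpow_mul_wt_le (hq : 0 < q)
    (hu : AEMeasurable u (volume.restrict (Ioi (0 : ℝ))))
    (hU : ∀ t, 0 < t → 0 < tail q u t ∧ tail q u t < ∞) (g : ℝ → ℝ≥0∞) {α : ℝ} (hα : 0 < α) :
    ∫⁻ x in Ioi 0, (∫⁻ y in Ioo 0 x ∩ Ioi α, g y) ^ q * wt q u x ≤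
      20 * splitC q * ∑' k : ℤ,
        tau k * (∫⁻ y in Ioo (pt q u (k - 1)) (pt q u k) ∩ Ioi α, g y) ^ q := by
  set G : ℤ → ℝ≥0∞ := fun k => ∫⁻ y in Ioo 0 (pt q u k) ∩ Ioi α, g y with hGdef
  set b : ℤ → ℝ≥0∞ := fun k => ∫⁻ y in Ioo (pt q u (k - 1)) (pt q u k) ∩ Ioi α, g y with hbdef
  obtain ⟨j, hj⟩ := mem_iUnion.1 ((iUnion_block hU).symm ▸ (mem_Ioi.2 hα) : α ∈ ⋃ k, block q u k)
  have hG0 : ∀ k, k ≤ j - 1 → G k = 0 := fun k hk => by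
    have : Ioo 0 (pt q u k) ∩ Ioi α = ∅ := by
      refine eq_empty_of_forall_notMem fun y hy => ?_
      have := pt_mono hU hk
      have h1 := hj.1
      have h2 := hy.1.2
      have h3 : α < y := hy.2
      linarith
    simp [hGdef, this]
  have hG : ∀ k, G (k + 1) ≤ G k + b (k + 1) := fun k => by
    refine le_trans ?_ (lintegral_union_le _ _ _)
    rw [add_sub_cancel_right]
    have h1 : (Ioo 0 (pt q u (k + 1)) ∩ Ioi α) ⊆
        insert (pt q u k) (Ioo 0 (pt q u k) ∩ Ioi α ∪ Ioo (pt q u k) (pt q u (k + 1)) ∩ Ioi α) := by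
      intro y hy
      rcases lt_trichotomy y (pt q u k) with h | h | h
      · exact Or.inr (Or.inl ⟨⟨hy.1.1, h⟩, hy.2⟩)
      · exact Or.inl h
      · exact Or.inr (Or.inr ⟨⟨h, hy.1.2⟩, hy.2⟩)
    refine (lintegral_mono_set h1).trans_eq (setLIntegral_congr ?_)
    exact insert_ae_eq_self _ _
  calc _ = ∑' k, ∫⁻ x in block q u k, (∫⁻ y in Ioo 0 x ∩ Ioi α, g y) ^ q * wt q u x :=
        (tsum_lintegral_block hU _).symm
    _ ≤ ∑' k, 2 * (tau k * G k ^ q) := by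
        refine ENNReal.tsum_le_tsum fun k => ?_
        calc ∫⁻ x in block q u k, (∫⁻ y in Ioo 0 x ∩ Ioi α, g y) ^ q * wt q u x
            ≤ ∫⁻ x in block q u k, G k ^ q * wt q u x := by
              refine setLIntegral_mono' (measurableSet_block k) fun x hx => ?_
              refine mul_le_mul' (ENNReal.rpow_le_rpow (lintegral_mono_set ?_) hq.le) le_rfl
              exact inter_subset_inter_left _ (Ioo_subset_Ioo_right hx.2)
          _ ≤ _ := by
              rw [lintegral_const_mul'' _ ((aemeasurable_wt hu).mono_measure
                (Measure.restrict_mono (fun x hx => pos_of_mem_block hx) le_rfl)), mul_comm,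
                ← mul_assoc]
              gcongr
              exact lintegral_block_le hU k
    _ ≤ _ := by
        rw [ENNReal.tsum_mul_left, show (20 : ℝ≥0∞) = 2 * 10 by norm_num, mul_assoc, mul_assoc]
        gcongr
        rw [← mul_assoc]
        exact tsum_tau_le hq hG0 hG

/-! ### The global Hardy inequalities -/

theorem ratio_exponent (hp : 0 < p) (hpq : q < p) :
    q / p / (1 - q / p) = q / (p - q) ∧ 1 - q / p = (p - q) / p := by
  have : p - q ≠ 0 := by linarith
  constructor <;> field_simp

/-- An increasing function on the line which agrees with `ζ^{-2}` on `(0, ∞)`. -/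
noncomputable def psi (q : ℝ) (u : ℝ → ℝ≥0∞) (x : ℝ) : ℝ := lev q u (4 * tail q u x)

theorem psi_mono (hU : ∀ t, 0 < t → 0 < tail q u t ∧ tail q u t < ∞) : Monotone (psi q u) :=
  fun x y hxy => lev_antitone hU (by simpa using (tail_pos hU y).ne')
    (by gcongr; exact tail_antitone hxy)

theorem psi_nonneg (x : ℝ) : 0 ≤ psi q u x := lev_nonneg _

theorem aemeasurable_logWt (hu : AEMeasurable u (volume.restrict (Ioi (0 : ℝ))))
    (hU : ∀ t, 0 < t → 0 < tail q u t ∧ tail q u t < ∞) :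
    AEMeasurable (logWt q u) (volume.restrict (Ioi (0 : ℝ))) := by
  have h1 : Measurable fun x => logRatio x (psi q u x) := by
    unfold logRatio
    refine Measurable.ite ((psi_mono hU).measurable (measurableSet_singleton 0)) measurable_const ?_
    exact ENNReal.measurable_ofReal.comp
      (Real.measurable_log.comp (measurable_id.div (psi_mono hU).measurable))
  refine ((aemeasurable_wt (q := q) hu).mul (h1.pow_const q).aemeasurable).congr ?_
  refine (ae_restrict_mem measurableSet_Ioi).mono fun x hx => ?_
  simp only [Pi.mul_apply]
  rw [logWt, zetaInv2_eq hU hx, psi]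

/-- The set `{y > 0 : s ≤ ζ^{-2}(y)}` is the half-line from `ζ^2(s)` up to a null set. -/
theorem le_psi_ae (hu : AEMeasurable u (volume.restrict (Ioi (0 : ℝ))))
    (hU : ∀ t, 0 < t → 0 < tail q u t ∧ tail q u t < ∞) {s : ℝ} (hs : 0 < s) :
    ∫⁻ x in {x | s ≤ psi q u x} ∩ Ioi 0, logWt q u x ≤ ∫⁻ x in Ioi (zeta2 q u s), logWt q u x := by
  have hU0 : ∀ t, tail q u t / 4 ≠ 0 := fun t => by simpa using (tail_pos hU t).ne'
  have hz0 : 0 < zeta2 q u s := by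
    rw [zeta2]
    exact hs.trans_le ((le_zeta hU hs).trans (le_zeta hU (hs.trans_le (le_zeta hU hs))))
  set z := zeta2 q u s with hz
  have hzU : tail q u z = tail q u s / 4 := by
    rw [hz, zeta2_eq hU hs] at hz0 ⊢
    exact tail_lev hU (hU0 s) hz0
  -- The part of the set not contained in `Ioi z`. On it `U` is at most `U z`, and together with
  -- `Ioi z` it forms an upper set; so the weight carried by `E` is zero and `U` is flat there.
  set E := {x | s ≤ psi q u x} ∩ Ioc 0 z with hE
  have hEm : MeasurableSet E :=
    (measurableSet_le measurable_const (psi_mono hU).measurable).inter measurableSet_Ioc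
  have hnull : ∫⁻ x in E, wt q u x = 0 := by
    have h0 : ∀ x ∈ E, tail q u x ≤ tail q u z := fun x hx => by
      have h1 := (le_lev_iff hU (by simpa using (tail_pos hU x).ne') hs).1 hx.1
      rw [hzU, ENNReal.le_div_iff_mul_le (by simp) (by simp), mul_comm]
      exact h1
    rcases E.eq_empty_or_nonempty with he | ⟨w, hw⟩
    · simp [he]
    set ν : Measure ℝ := volume.withDensity (wt q u)
    have hν : ∀ t, ν (Ioi t) = tail q u t := fun t => withDensity_apply _ measurableSet_Ioi
    have h1 : ν (E ∪ Ioi z) ≤ tail q u z := by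
      refine measure_upperSet_le (fun x y hxy hx => ?_) fun x hx => ?_
      · rcases hx with hx | hx
        · rcases le_or_gt y z with hy | hy
          · exact Or.inl ⟨le_trans hx.1 (psi_mono hU hxy), hx.2.1.trans_le hxy, hy⟩
          · exact Or.inr hy
        · exact Or.inr (lt_of_lt_of_le hx hxy)
      · have hIci : ν (Ici x) = tail q u x := by
          rw [← hν]
          exact (measure_congr (μ := ν) ((withDensity_absolutelyContinuous volume
            (wt q u)).ae_le (Ioi_ae_eq_Ici (a := x)))).symm
        rw [hIci]
        rcases hx with hx | hx
        · exact h0 x hx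
        · exact tail_antitone (le_of_lt hx)
    have hdisj : Disjoint E (Ioi z) := disjoint_left.2 fun y hy hy' => not_lt.2 hy.2.2 hy'
    rw [measure_union hdisj measurableSet_Ioi, hν] at h1
    have h2 : ν E + tail q u z ≤ 0 + tail q u z := by rwa [zero_add]
    have h3 := (ENNReal.add_le_add_iff_right (hU z hz0).2.ne).1 h2
    rw [← withDensity_apply _ hEm]
    exact nonpos_iff_eq_zero.1 h3
  have hnull' : ∫⁻ x in E, logWt q u x = 0 := by
    have hm : AEMeasurable (wt q u) (volume.restrict E) := (aemeasurable_wt hu).mono_measure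
      (Measure.restrict_mono (fun x hx => hx.2.1) le_rfl)
    rw [lintegral_eq_zero_iff' hm] at hnull
    rw [lintegral_congr_ae (g := fun _ => 0) (hnull.mono fun x hx => ?_)]
    · simp
    · rw [logWt, hx]; simp
  calc _ ≤ ∫⁻ x in E ∪ Ioi z, logWt q u x := by
        refine lintegral_mono_set fun x hx => ?_
        rcases le_or_gt x z with h | h
        · exact Or.inl ⟨hx.1, hx.2, h⟩
        · exact Or.inr h
    _ ≤ _ := (lintegral_union_le _ _ _).trans (by rw [hnull', zero_add])

/-- The constant of the global Hardy inequalities. -/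
noncomputable def hardyC (p q : ℝ) : ℝ≥0∞ := 2 ^ (q / p) + 2 ^ (q / p / (1 - q / p) + 3)

theorem hardyC_ne_top (hp : 0 < p) (hq : 0 < q) : hardyC p q ≠ ∞ := by
  refine ENNReal.add_ne_top.2 ⟨ENNReal.rpow_ne_top_of_nonneg (by positivity) (by simp), ?_⟩
  simp [ENNReal.rpow_eq_top_iff]

theorem ae_pos_of_measure_Iic {σ : Measure ℝ} (h : σ (Iic 0) = 0) : ∀ᵐ s ∂σ, 0 < s := by
  rw [ae_iff]; simp only [not_lt]; exact h

theorem le_mul_of_rpow_div_le {a b K : ℝ≥0∞} (hp : 0 < p) (hq : 0 < q) (hb : b ≠ 0) (hb' : b ≠ ∞)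
    (h : a ^ (p / q) / b ≤ K ^ p) : a ≤ K ^ q * b ^ (q / p) := by
  rw [ENNReal.div_le_iff hb hb'] at h
  have h2 : (a ^ (p / q)) ^ (q / p) ≤ (K ^ p * b) ^ (q / p) :=
    ENNReal.rpow_le_rpow h (by positivity)
  rwa [← ENNReal.rpow_mul, show p / q * (q / p) = 1 by field_simp, ENNReal.rpow_one,
    ENNReal.mul_rpow_of_nonneg _ _ (by positivity), ← ENNReal.rpow_mul,
    show p * (q / p) = q by field_simp] at h2

/-- The Hardy inequality with `r = q/p`, `ψ = ζ^{-2}`, weight `V` and `ρ` of density `logWt`. For `p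
≤ q` the set `{s ≤ ζ^{-2}}` is essentially the half-line from `ζ^2(s)`, which gives the supremum in
`bfA0`; for `q < p` the integral condition is the one defining `bfA0`. -/
theorem lintegral_logWt_le (hp : 0 < p) (hq : 0 < q)
    (hu : AEMeasurable u (volume.restrict (Ioi (0 : ℝ))))
    (hU : ∀ t, 0 < t → 0 < tail q u t ∧ tail q u t < ∞)
    (hV : ∀ z, 0 < z → bigV p v z ≠ 0 ∧ bigV p v z ≠ ∞) {K : ℝ≥0∞} (hKt : K ≠ ∞)
    (hK : bfA0 p q v u ≤ K) (σ : Measure ℝ) [IsFiniteMeasure σ] (hσ : σ (Iic 0) = 0)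
    (hB : ∫⁻ s, bigV p v s ∂σ ≠ ∞) :
    ∫⁻ x in Ioi 0, σ (Iic (zetaInv2 q u x)) ^ (q / p) * logWt q u x ≤
      hardyC p q * K ^ q * (∫⁻ s, bigV p v s ∂σ) ^ (q / p) := by
  set ρ : Measure ℝ := (volume.restrict (Ioi 0)).withDensity (logWt q u) with hρ
  have hlw := aemeasurable_logWt hu hU
  have e1 : ∫⁻ x in Ioi 0, σ (Iic (zetaInv2 q u x)) ^ (q / p) * logWt q u x =
      ∫⁻ x, σ (Iic (psi q u x)) ^ (q / p) ∂ρ := by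
    rw [hρ, lintegral_withDensity_eq_lintegral_mul₀ (f := logWt q u) hlw
      (g := fun x => σ (Iic (psi q u x)) ^ (q / p))
      ((((monotone_measure_Iic σ).comp (psi_mono hU)).measurable.pow_const _).aemeasurable)]
    refine setLIntegral_congr_fun measurableSet_Ioi fun x hx => ?_
    simp only [Pi.mul_apply]
    rw [zetaInv2_eq hU hx, psi, mul_comm]
  rw [e1]
  rcases le_or_gt p q with h | h
  · have hr : 1 ≤ q / p := by rwa [le_div_iff₀ hp, one_mul]
    refine (hardy_one_le hr (psi_mono hU) (bigV_antitone (v := v) hp) (K := K ^ q)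
      ((ae_pos_of_measure_Iic hσ).mono fun s hs => ?_)
      (Filter.Eventually.of_forall fun _ => measure_lt_top _ _)).trans ?_
    · have hm : MeasurableSet {x | s ≤ psi q u x} :=
        measurableSet_le measurable_const (psi_mono hU).measurable
      rw [hρ, withDensity_apply _ hm, Measure.restrict_restrict hm]
      refine (le_psi_ae hu hU hs).trans (le_mul_of_rpow_div_le hp hq (hV s hs).1 (hV s hs).2 ?_)
      rw [bfA0, if_pos h, one_div, ENNReal.rpow_inv_le_iff hp] at hK
      exact (le_iSup₂ (f := fun (t : ℝ) (_ : 0 < t) =>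
        (∫⁻ x in Ioi (zeta2 q u t), logWt q u x) ^ (p / q) / bigV p v t) s hs).trans hK
    · gcongr
      exact le_self_add
  · have hr1 : q / p < 1 := by rwa [div_lt_one hp]
    have hpq : 0 < p - q := by linarith
    obtain ⟨c1, c2⟩ := ratio_exponent hp h
    rw [bfA0, if_neg (not_le.2 h), ← ENNReal.rpow_mul] at hK
    set A := ∫⁻ x in Ioi (0 : ℝ),
      ((∫⁻ s in Ioi x, logWt q u s) / bigV p v (zetaInv2 q u x)) ^ (q / (p - q)) * logWt q u x
      with hA
    have hAt : A ≠ ∞ := by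
      intro hAt
      rw [hAt, ENNReal.top_rpow_of_pos (by positivity), top_le_iff] at hK
      exact hKt hK
    refine (hardy_lt_one_of_ne_top (by positivity) hr1 (psi_mono hU) (bigV_antitone (v := v) hp)
      (A := A) ?_ le_rfl hAt hB).trans ?_
    · rw [hρ, lintegral_withDensity_eq_lintegral_mul₀ (f := logWt q u) hlw
        (g := fun x => ((bigV p v (psi q u x))⁻¹ * ρ (Ici x)) ^ (q / p / (1 - q / p)))
        (((((bigV_antitone hp).comp_monotone (psi_mono hU)).measurable.inv.mul
          (antitone_measure_Ici ρ).measurable).pow_const _).aemeasurable)]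
      refine le_of_eq (setLIntegral_congr_fun measurableSet_Ioi fun x hx => ?_)
      have hx : 0 < x := hx
      have : ρ (Ici x) = ∫⁻ s in Ioi x, logWt q u s := by
        rw [hρ, withDensity_apply _ measurableSet_Ici, Measure.restrict_restrict measurableSet_Ici,
          inter_eq_left.2 (show Ici x ⊆ Ioi 0 from fun y hy => hx.trans_le hy),
              setLIntegral_congr Ioi_ae_eq_Ici]
      simp only [Pi.mul_apply]
      rw [this, c1, ENNReal.div_eq_inv_mul, zetaInv2_eq hU hx, psi, mul_comm]
    · have hAK : A ^ (1 - q / p) ≤ K ^ q := by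
        rw [c2]
        calc A ^ ((p - q) / p) = (A ^ ((p - q) / q * (1 / p))) ^ q := by
              rw [← ENNReal.rpow_mul]; congr 1; field_simp
          _ ≤ _ := by gcongr
      gcongr
      exact le_add_self

/-- The mirrored Hardy inequality with `r = q/p`, `ρ` of density `u`, the increasing weight `s^p
V(s)` and the measure `s^{-p} dσ`; its condition is `calA0`. -/
theorem lintegral_tail_rpow_le (hp : 0 < p) (hq : 0 < q)
    (hu : AEMeasurable u (volume.restrict (Ioi (0 : ℝ))))
    (hV : ∀ z, 0 < z → bigV p v z ≠ 0 ∧ bigV p v z ≠ ∞) {K : ℝ≥0∞} (hKt : K ≠ ∞)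
    (hK : calA0 p q v u ≤ K) (σ : Measure ℝ) [IsFiniteMeasure σ] (hσ : σ (Iic 0) = 0)
    (hB : ∫⁻ s, bigV p v s ∂σ ≠ ∞) :
    ∫⁻ x in Ioi 0, (∫⁻ s in Ici x, (ENNReal.ofReal s ^ p)⁻¹ ∂σ) ^ (q / p) * u x ≤
      hardyC p q * K ^ q * (∫⁻ s, bigV p v s ∂σ) ^ (q / p) := by
  set ρ : Measure ℝ := (volume.restrict (Ioi 0)).withDensity u with hρ
  set σ' : Measure ℝ := σ.withDensity fun s => (ENNReal.ofReal s ^ p)⁻¹ with hσ'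
  have hσB : ∫⁻ s, powV p v s ∂σ' = ∫⁻ s, bigV p v s ∂σ := lintegral_powV_withDensity hp σ hσ
  have hσ'0 : ∀ᵐ s ∂σ', 0 < s := withDensity_absolutelyContinuous σ _ (ae_pos_of_measure_Iic hσ)
  have e0 : ∀ y, ∫⁻ s in Ici y, (ENNReal.ofReal s ^ p)⁻¹ ∂σ = σ' (Ici y) := fun y => by
    rw [hσ', withDensity_apply _ measurableSet_Ici]
  simp_rw [e0]
  have e1 : ∫⁻ x in Ioi 0, σ' (Ici x) ^ (q / p) * u x = ∫⁻ x, σ' (Ici x) ^ (q / p) ∂ρ := by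
    rw [hρ, lintegral_withDensity_eq_lintegral_mul₀ (f := u) hu
      (g := fun x => σ' (Ici x) ^ (q / p))
      (((antitone_measure_Ici σ').measurable.pow_const _).aemeasurable)]
    simp only [Pi.mul_apply, mul_comm]
  have e2 : ∀ s, 0 < s → ρ (Iic s) = ∫⁻ x in Ioo 0 s, u x := fun s hs => by
    rw [hρ, withDensity_apply _ measurableSet_Iic, Measure.restrict_restrict measurableSet_Iic,
      Iic_inter_Ioi, setLIntegral_congr Ioo_ae_eq_Ioc]
  have hPV : ∀ s, 0 < s → powV p v s ≠ 0 ∧ powV p v s ≠ ∞ := fun s hs =>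
    ⟨mul_ne_zero (ofReal_rpow_ne_zero hs p) (hV s hs).1,
      ENNReal.mul_ne_top (ofReal_rpow_ne_top hs p) (hV s hs).2⟩
  rw [e1]
  rcases le_or_gt p q with h | h
  · have hr : 1 ≤ q / p := by rwa [le_div_iff₀ hp, one_mul]
    have hfin : ∀ᵐ x ∂ρ, σ' (Ici x) < ∞ := by
      refine withDensity_absolutelyContinuous _ _ ((ae_restrict_mem measurableSet_Ioi).mono
        fun x hx => ?_)
      have hx0 : 0 < x := hx
      rw [← e0]
      refine lt_of_le_of_lt (setLIntegral_mono' (g := fun _ => (ENNReal.ofReal x ^ p)⁻¹)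
        measurableSet_Ici fun s hs => ?_) ?_
      · have hs : x ≤ s := hs
        gcongr
      · rw [setLIntegral_const]
        exact ENNReal.mul_lt_top (ENNReal.inv_lt_top.2
          (pos_iff_ne_zero.2 (ofReal_rpow_ne_zero hx0 p))) (measure_lt_top _ _)
    refine (hardy_one_le_mirror hr (powV_mono (v := v) hp) (K := K ^ q)
      (hσ'0.mono fun s hs => ?_) hfin).trans ?_
    · rw [e2 s hs]
      refine le_mul_of_rpow_div_le hp hq (hPV s hs).1 (hPV s hs).2 ?_
      rw [calA0, if_pos h, one_div, ENNReal.rpow_inv_le_iff hp] at hK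
      exact (le_iSup₂ (f := fun (t : ℝ) (_ : 0 < t) =>
        (∫⁻ x in Ioo 0 t, u x) ^ (p / q) / (ENNReal.ofReal t ^ p * bigV p v t)) s hs).trans hK
    · rw [hσB]
      gcongr
      exact le_self_add
  · have hr1 : q / p < 1 := by rwa [div_lt_one hp]
    have hpq : 0 < p - q := by linarith
    obtain ⟨c1, c2⟩ := ratio_exponent hp h
    rw [calA0, if_neg (not_le.2 h), ← ENNReal.rpow_mul] at hK
    set A := ∫⁻ t in Ioi (0 : ℝ),
      (ENNReal.ofReal t ^ p * bigV p v t) ^ (q / (q - p)) *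
        (∫⁻ x in Ioo 0 t, u x) ^ (q / (p - q)) * u t with hA
    have hAt : A ≠ ∞ := by
      intro hAt
      rw [hAt, ENNReal.top_rpow_of_pos (by positivity), top_le_iff] at hK
      exact hKt hK
    refine (hardy_lt_one_mirror_of_ne_top (by positivity) hr1 (powV_mono (v := v) hp)
      (A := A) ?_ le_rfl hAt (by rwa [hσB])).trans ?_
    · rw [hρ, lintegral_withDensity_eq_lintegral_mul₀ (f := u) hu
        (g := fun x => ((powV p v x)⁻¹ * ρ (Iic x)) ^ (q / p / (1 - q / p)))
        ((((powV_mono hp).measurable.inv.mul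
          (monotone_measure_Iic ρ).measurable).pow_const _).aemeasurable)]
      refine le_of_eq (setLIntegral_congr_fun measurableSet_Ioi fun x hx => ?_)
      have hx : 0 < x := hx
      simp only [Pi.mul_apply]
      rw [e2 x hx, c1, ENNReal.mul_rpow_of_nonneg _ _ (by positivity), ENNReal.inv_rpow,
        ← ENNReal.rpow_neg, powV, mul_comm, ← neg_sub p q, div_neg]
    · have hAK : A ^ (1 - q / p) ≤ K ^ q := by
        rw [c2]
        calc A ^ ((p - q) / p) = (A ^ ((p - q) / q * (1 / p))) ^ q := by
              rw [← ENNReal.rpow_mul]; congr 1; field_simp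
          _ ≤ _ := by gcongr
      rw [hσB]
      gcongr
      exact le_add_self

/-! ### Sums over blocks -/

/-- For `y` in `(c, d)`, mass left of `a` sees the kernel `y^{-p}`, whose root integrates to a
logarithm; mass right of `b` sees `s^{-p}`, constant in `y`; the rest stays as a local term. -/
theorem lintegral_Ioo_gKer_le (hp : 0 < p) (σ : Measure ℝ) (hσ : σ (Iic 0) = 0) {a b c d : ℝ}
    (hac : a ≤ c) (hc : 0 ≤ c) (hdb : d ≤ b) :
    ∫⁻ y in Ioo c d, gKer p σ y ≤ 2 ^ (1 / p) * (2 ^ (1 / p) *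
      (logRatio d c * σ (Iic a) ^ (1 / p) + ∫⁻ y in Ioo a b, gKer p (σ.restrict (Ioc a b)) y) +
        ENNReal.ofReal (d - c) * (∫⁻ s in Ioi b, (ENNReal.ofReal s ^ p)⁻¹ ∂σ) ^ (1 / p)) := by
  set R := ∫⁻ s in Ioi b, (ENNReal.ofReal s ^ p)⁻¹ ∂σ with hR
  have h2 : (2 : ℝ≥0∞) ^ (1 / p) ≠ ∞ := ENNReal.rpow_ne_top_of_nonneg (by positivity) (by simp)
  have hpt : ∀ y ∈ Ioo c d, gKer p σ y ≤ 2 ^ (1 / p) * (2 ^ (1 / p) *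
      ((ENNReal.ofReal y)⁻¹ * σ (Iic a) ^ (1 / p) + gKer p (σ.restrict (Ioc a b)) y) +
        R ^ (1 / p)) := by
    intro y hy
    have h1 : ∫⁻ s, ker p s y ∂σ ≤ ((ENNReal.ofReal y ^ p)⁻¹ * σ (Iic a) +
        ∫⁻ s in Ioc a b, ker p s y ∂σ) + R := by
      calc ∫⁻ s, ker p s y ∂σ ≤ ∫⁻ s in (Iic a ∪ Ioc a b) ∪ Ioi b, ker p s y ∂σ := by
            rw [← setLIntegral_univ]
            refine lintegral_mono_set fun s _ => ?_
            rcases le_or_gt s a with h | h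
            · exact Or.inl (Or.inl h)
            · rcases le_or_gt s b with h' | h'
              · exact Or.inl (Or.inr ⟨h, h'⟩)
              · exact Or.inr h'
        _ ≤ ((∫⁻ s in Iic a, ker p s y ∂σ) + ∫⁻ s in Ioc a b, ker p s y ∂σ) +
              ∫⁻ s in Ioi b, ker p s y ∂σ :=
            (lintegral_union_le _ _ _).trans (by gcongr; exact lintegral_union_le _ _ _)
        _ ≤ _ := by
            refine add_le_add (add_le_add ?_ le_rfl) ?_
            · rw [← setLIntegral_const]
              refine setLIntegral_mono' measurableSet_Iic fun s hs => ?_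
              have hs : s ≤ a := hs
              rw [ker, max_eq_right (hs.trans (hac.trans hy.1.le))]
            · refine setLIntegral_mono' measurableSet_Ioi fun s hs => ?_
              have hs : b < s := hs
              rw [ker, max_eq_left ((hy.2.le.trans hdb).trans hs.le)]
    calc gKer p σ y ≤ (((ENNReal.ofReal y ^ p)⁻¹ * σ (Iic a) +
          ∫⁻ s in Ioc a b, ker p s y ∂σ) + R) ^ (1 / p) := ENNReal.rpow_le_rpow h1 (by positivity)
      _ ≤ 2 ^ (1 / p) * (((ENNReal.ofReal y ^ p)⁻¹ * σ (Iic a) +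
          ∫⁻ s in Ioc a b, ker p s y ∂σ) ^ (1 / p) + R ^ (1 / p)) :=
          add_rpow_le_two_rpow (by positivity) _ _
      _ ≤ _ := by
          gcongr
          rw [← inv_rpow_rpow hp]
          exact add_rpow_le_two_rpow (by positivity) _ _
  have hI1 : ∫⁻ y in Ioo c d, (ENNReal.ofReal y)⁻¹ * σ (Iic a) ^ (1 / p) ≤
      logRatio d c * σ (Iic a) ^ (1 / p) := by
    -- If `c = 0`, the logarithm is infinite but its coefficient vanishes, `σ` having no mass on
    -- `Iic 0`.
    rcases hc.eq_or_lt with h | h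
    · have : σ (Iic a) = 0 := measure_mono_null (Iic_subset_Iic.2 (hac.trans h.symm.le)) hσ
      rw [this, ENNReal.zero_rpow_of_pos (by positivity)]
      simp
    · rcases le_total c d with hcd | hcd
      · rw [lintegral_mul_const (f :=
          fun y => (ENNReal.ofReal y)⁻¹) _ ENNReal.measurable_ofReal.inv,
          lintegral_inv_Ioo h hcd]
      · simp [Ioo_eq_empty (not_lt.2 hcd)]
  calc _ ≤ ∫⁻ y in Ioo c d, 2 ^ (1 / p) * (2 ^ (1 / p) *
      ((ENNReal.ofReal y)⁻¹ * σ (Iic a) ^ (1 / p) + gKer p (σ.restrict (Ioc a b)) y) +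
        R ^ (1 / p)) := setLIntegral_mono' measurableSet_Ioo hpt
    _ = 2 ^ (1 / p) * (2 ^ (1 / p) * ((∫⁻ y in Ioo c d, (ENNReal.ofReal y)⁻¹ *
        σ (Iic a) ^ (1 / p)) +
          ∫⁻ y in Ioo c d, gKer p (σ.restrict (Ioc a b)) y) + R ^ (1 / p) *
              ENNReal.ofReal (d - c)) := by
        rw [lintegral_const_mul' _ _ h2, lintegral_add_right _ measurable_const,
            lintegral_const_mul' _ _ h2,
          lintegral_add_right _ (measurable_gKer hp _), setLIntegral_const, Real.volume_Ioo]
    _ ≤ _ := by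
        rw [mul_comm (R ^ (1 / p))]
        gcongr

theorem tau_le_two_mul (k : ℤ) : tau k ≤ 2 * tau (k + 1) := by
  have h : tau k = theta * tau (k + 1) := by rw [← tau_sub_one]; congr 1; ring
  rw [h]
  gcongr
  exact theta_le_two

theorem tau_le_four_mul (k : ℤ) : tau k ≤ 4 * tau (k + 5) := by
  have h1 : tau (k + 3) = 2 * tau (k + 6) := by rw [← tau_sub_three]; congr 1; ring
  have h2 : tau k = 2 * tau (k + 3) := by rw [← tau_sub_three]; congr 1; ring
  rw [h2, h1, ← mul_assoc]
  norm_num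
  gcongr
  exact tau_antitone (by omega)

/-- The shift by 5 is chosen so that, for `x` in block `k + 5`, `ζ^{-2}(x)` lies between `pt (k -
2)` and `pt (k - 1)` while `x > pt k`; both factors on the left are then dominated pointwise. The
constant is `4 · 4`, from `τ_k ≤ 4 τ_{k+5}` and the lower bound for the weight of a block. -/
theorem left_block_le (hp : 0 < p) (hq : 0 < q)
    (hU : ∀ t, 0 < t → 0 < tail q u t ∧ tail q u t < ∞) (σ : Measure ℝ) (hσ : σ (Iic 0) = 0)
    (k : ℤ) :
    tau k * (logRatio (pt q u k) (pt q u (k - 1)) ^ q * σ (Iic (pt q u (k - 2))) ^ (q / p)) ≤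
      16 * ∫⁻ x in block q u (k + 5), σ (Iic (zetaInv2 q u x)) ^ (q / p) * logWt q u x := by
  have hmono := pt_mono hU
  rcases (pt_nonneg (q := q) (u := u) (k - 1)).eq_or_lt with h | h
  · have h1 := hmono (show k - 2 ≤ k - 1 by omega)
    have : σ (Iic (pt q u (k - 2))) = 0 :=
      measure_mono_null (Iic_subset_Iic.2 (h1.trans h.symm.le)) hσ
    rw [this, ENNReal.zero_rpow_of_pos (by positivity), mul_zero, mul_zero]
    exact zero_le
  · have h4 : 0 < pt q u (k + 5 - 1) := h.trans_le (hmono (by omega))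
    set X := logRatio (pt q u k) (pt q u (k - 1)) ^ q * σ (Iic (pt q u (k - 2))) ^ (q / p) with hX
    calc tau k * X ≤ 4 * (4 * ∫⁻ x in block q u (k + 5), wt q u x) * X := by
          gcongr
          exact (tau_le_four_mul k).trans (by gcongr; exact le_lintegral_block hU h4)
      _ = 16 * (X * ∫⁻ x in block q u (k + 5), wt q u x) := by ring
      _ ≤ 16 * ∫⁻ x in block q u (k + 5), X * wt q u x := by
          gcongr; exact lintegral_const_mul_le _ _
      _ ≤ _ := by
          gcongr 16 * ?_
          refine setLIntegral_mono' (measurableSet_block _) fun x hx => ?_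
          obtain ⟨h1, h2⟩ := zetaInv2_mem hU hx
          have e1 : pt q u (k - 2) ≤ zetaInv2 q u x := by
            rwa [show k - 2 = k + 5 - 7 by ring]
          have e2 : zetaInv2 q u x ≤ pt q u (k - 1) := by
            rwa [show k - 1 = k + 5 - 6 by ring]
          have e3 : pt q u k ≤ x := (hmono (by omega)).trans hx.1.le
          have e4 : 0 < pt q u k := h.trans_le (hmono (by omega))
          have h5 : logRatio (pt q u k) (pt q u (k - 1)) ≤ logRatio x (zetaInv2 q u x) :=
            logRatio_mono ((pt_nonneg _).trans e1) e2 e4 e3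
          rw [hX, logWt]
          calc _ ≤ logRatio x (zetaInv2 q u x) ^ q * σ (Iic (zetaInv2 q u x)) ^ (q / p) *
                  wt q u x := by
                gcongr
            _ = _ := by ring

/-- For `x` in block `k + 1` the length of block `k` is at most `x`, the half-line beyond `pt (k +
1)` lies in `Ici x`, and `x^q` times the weight is `u`. -/
theorem right_block_le (hp : 0 < p) (hq : 0 < q)
    (hU : ∀ t, 0 < t → 0 < tail q u t ∧ tail q u t < ∞) (σ : Measure ℝ) (k : ℤ) :
    tau k * (ENNReal.ofReal (pt q u k - pt q u (k - 1)) ^ q *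
        (∫⁻ s in Ioi (pt q u (k + 1)), (ENNReal.ofReal s ^ p)⁻¹ ∂σ) ^ (q / p)) ≤
      8 * ∫⁻ x in block q u (k + 1),
        (∫⁻ s in Ici x, (ENNReal.ofReal s ^ p)⁻¹ ∂σ) ^ (q / p) * u x := by
  have hmono := pt_mono hU
  rcases (pt_nonneg (q := q) (u := u) k).eq_or_lt with h | h
  · have h1 : pt q u k - pt q u (k - 1) ≤ 0 := by
      rw [← h]; linarith [pt_nonneg (q := q) (u := u) (k - 1)]
    rw [ENNReal.ofReal_of_nonpos h1, ENNReal.zero_rpow_of_pos hq, zero_mul, mul_zero]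
    exact zero_le
  · have h4 : 0 < pt q u (k + 1 - 1) := by rwa [add_sub_cancel_right]
    set R := (∫⁻ s in Ioi (pt q u (k + 1)), (ENNReal.ofReal s ^ p)⁻¹ ∂σ) ^ (q / p) with hR
    calc _ ≤ 2 * (4 * ∫⁻ x in block q u (k + 1), wt q u x) *
          (ENNReal.ofReal (pt q u k) ^ q * R) := by
          gcongr
          · exact (tau_le_two_mul k).trans (by gcongr; exact le_lintegral_block hU h4)
          · linarith [pt_nonneg (q := q) (u := u) (k - 1)]
      _ = 8 * (ENNReal.ofReal (pt q u k) ^ q * R * ∫⁻ x in block q u (k + 1), wt q u x) := by ring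
      _ ≤ 8 * ∫⁻ x in block q u (k + 1), ENNReal.ofReal (pt q u k) ^ q * R * wt q u x := by
          gcongr; exact lintegral_const_mul_le _ _
      _ ≤ _ := by
          gcongr 8 * ?_
          refine setLIntegral_mono' (measurableSet_block _) fun x hx => ?_
          have hx0 : 0 < x := pos_of_mem_block hx
          have h5 : pt q u k ≤ x := by have := hx.1.le; rwa [add_sub_cancel_right] at this
          have h6 : R ≤ (∫⁻ s in Ici x, (ENNReal.ofReal s ^ p)⁻¹ ∂σ) ^ (q / p) :=
            ENNReal.rpow_le_rpow (lintegral_mono_set fun s hs => hx.2.trans (le_of_lt hs))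
              (by positivity)
          calc _ ≤ ENNReal.ofReal x ^ q * (∫⁻ s in Ici x, (ENNReal.ofReal s ^ p)⁻¹ ∂σ) ^ (q / p) *
                wt q u x := by gcongr
            _ = (∫⁻ s in Ici x, (ENNReal.ofReal s ^ p)⁻¹ ∂σ) ^ (q / p) * u x *
                (ENNReal.ofReal x ^ q * ENNReal.ofReal x ^ (-q)) := by rw [wt]; ring
            _ = _ := by
                rw [ENNReal.rpow_neg, ENNReal.mul_inv_cancel (ofReal_rpow_ne_zero hx0 q)
                  (ofReal_rpow_ne_top hx0 q), mul_one]

theorem tsum_setLIntegral_Ioc_le (hU : ∀ t, 0 < t → 0 < tail q u t ∧ tail q u t < ∞)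
    (σ : Measure ℝ) (f : ℝ → ℝ≥0∞) :
    ∑' k : ℤ, ∫⁻ s in Ioc (pt q u (k - 2)) (pt q u (k + 1)), f s ∂σ ≤ 3 * ∫⁻ s, f s ∂σ := by
  set β : ℤ → ℝ≥0∞ := fun k => ∫⁻ s in block q u k, f s ∂σ with hβ
  have h1 : ∑' k, β k ≤ ∫⁻ s, f s ∂σ := by
    rw [hβ, ← lintegral_iUnion measurableSet_block (pairwise_disjoint_block hU)]
    exact setLIntegral_le_lintegral _ _
  have h2 : ∀ k : ℤ, ∫⁻ s in Ioc (pt q u (k - 2)) (pt q u (k + 1)), f s ∂σ ≤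
      β (k + -1) + β k + β (k + 1) := fun k => by
    calc _ ≤ ∫⁻ s in (block q u (k + -1) ∪ block q u k) ∪ block q u (k + 1), f s ∂σ := by
          refine lintegral_mono_set fun s hs => ?_
          have e : k - 1 - 1 = k - 2 := by ring
          simp only [block, mem_union, mem_Ioc, add_sub_cancel_right, ← sub_eq_add_neg, e]
          rcases le_or_gt s (pt q u (k - 1)) with h | h
          · exact Or.inl (Or.inl ⟨hs.1, h⟩)
          · rcases le_or_gt s (pt q u k) with h' | h'
            · exact Or.inl (Or.inr ⟨h, h'⟩)
            · exact Or.inr ⟨h', hs.2⟩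
      _ ≤ _ := (lintegral_union_le _ _ _).trans (by gcongr; exact lintegral_union_le _ _ _)
  have hsh : ∀ j : ℤ, ∑' k, β (k + j) = ∑' k, β k := fun j => (Equiv.addRight j).tsum_eq β
  calc _ ≤ ∑' k : ℤ, (β (k + -1) + β k + β (k + 1)) := ENNReal.tsum_le_tsum h2
    _ = 3 * ∑' k, β k := by
        rw [ENNReal.tsum_add, ENNReal.tsum_add, hsh, hsh]; ring
    _ ≤ _ := by gcongr

theorem tsum_rpow_le {ι : Type*} {r : ℝ} (hr : 1 ≤ r) (β : ι → ℝ≥0∞) :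
    ∑' k, β k ^ r ≤ (∑' k, β k) ^ r := by
  have e : r = 1 + (r - 1) := by ring
  have h : ∀ k, β k ^ r ≤ β k * (∑' k, β k) ^ (r - 1) := fun k => by
    conv_lhs => rw [e]
    rw [ENNReal.rpow_add_of_nonneg _ _ zero_le_one (by linarith), ENNReal.rpow_one]
    gcongr
    exact ENNReal.le_tsum k
  refine (ENNReal.tsum_le_tsum h).trans ?_
  rw [ENNReal.tsum_mul_right]
  conv_rhs => rw [e]
  rw [ENNReal.rpow_add_of_nonneg _ _ zero_le_one (by linarith), ENNReal.rpow_one]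

theorem tsum_rpow_mul_rpow_le {ι : Type*} {r : ℝ} (hr0 : 0 < r) (hr1 : r < 1) (a β : ι → ℝ≥0∞) :
    ∑' k, a k ^ (1 - r) * β k ^ r ≤ (∑' k, a k) ^ (1 - r) * (∑' k, β k) ^ r := by
  have h1r : 0 < 1 - r := by linarith
  have hconj : (1 / (1 - r)).HolderConjugate (1 / r) := by
    rw [Real.holderConjugate_iff]
    constructor
    · rw [lt_div_iff₀ h1r]; linarith
    · simp
  rw [ENNReal.tsum_eq_iSup_sum]
  refine iSup_le fun s => ?_
  have := ENNReal.inner_le_Lp_mul_Lq s (fun k => a k ^ (1 - r)) (fun k => β k ^ r) hconj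
  simp only [← ENNReal.rpow_mul, mul_one_div_cancel h1r.ne', mul_one_div_cancel hr0.ne',
    ENNReal.rpow_one, one_div_one_div] at this
  refine this.trans ?_
  gcongr <;> exact ENNReal.sum_le_tsum s

/-- The constant in the sum of the local terms. -/
noncomputable def localSumC (p q : ℝ) : ℝ≥0∞ :=
  2 * 3 ^ (q / p) + (8 * 2 ^ (q / (p - q))) ^ ((p - q) / p) * 3 ^ (q / p)

theorem localSumC_ne_top (hp : 0 < p) (hq : 0 < q) : localSumC p q ≠ ∞ := by
  have h3 : (3 : ℝ≥0∞) ^ (q / p) ≠ ∞ := ENNReal.rpow_ne_top_of_nonneg (by positivity) (by simp)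
  refine ENNReal.add_ne_top.2 ⟨ENNReal.mul_ne_top (by simp) h3, ENNReal.mul_ne_top ?_ h3⟩
  simp [ENNReal.rpow_eq_top_iff, ENNReal.mul_eq_top, ENNReal.rpow_eq_zero_iff]

/-- The windows overlap three times, so the local integrals `β k` sum to at most three times the
total. For `p ≤ q` the coefficients are uniformly bounded and `∑ β^{q/p} ≤ (∑ β)^{q/p}`. For `q < p`
Hölder is used: the `p/(p-q)`-th power of the `k`-th coefficient is controlled by the part of the
integral in `h₂` over block `k + 1`, where the window fits in `(ζ^{-1}(x), ζ(x))`. The function `X`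
stands for `innerA` and `innerB`. -/
theorem tsum_local_le (hp : 0 < p) (hq : 0 < q)
    (hU : ∀ t, 0 < t → 0 < tail q u t ∧ tail q u t < ∞) {X : ℝ → ℝ → ℝ≥0∞}
    (hX : ∀ a a' b b', 0 ≤ a' → a' ≤ a → a < b → b ≤ b' → X a b ≤ X a' b') {K : ℝ≥0∞}
    (h₁ : p ≤ q → ∀ t, 0 < t → tail q u t ^ (1 / q) * X 0 t ≤ K)
    (h₂ : q < p → ∫⁻ x in Ioi 0, wt q u x * tail q u x ^ (q / (p - q)) *
      X (zetaInv q u x) (zeta q u x) ^ (p * q / (p - q)) ≤ K ^ (p * q / (p - q)))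
    {σ : Measure ℝ} {f : ℝ → ℝ≥0∞} {N : ℤ → ℝ≥0∞}
    (hN : ∀ k, 0 < pt q u k → pt q u (k - 2) < pt q u (k + 1) →
      N k ≤ tau k * X (pt q u (k - 2)) (pt q u (k + 1)) ^ q *
        (∫⁻ s in Ioc (pt q u (k - 2)) (pt q u (k + 1)), f s ∂σ) ^ (q / p))
    (hN0 : ∀ k, ¬(0 < pt q u k ∧ pt q u (k - 2) < pt q u (k + 1)) → N k = 0) :
    ∑' k, N k ≤ localSumC p q * K ^ q * (∫⁻ s, f s ∂σ) ^ (q / p) := by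
  have hmono := pt_mono hU
  set β : ℤ → ℝ≥0∞ := fun k => ∫⁻ s in Ioc (pt q u (k - 2)) (pt q u (k + 1)), f s ∂σ with hβ
  have hβ3 : ∑' k, β k ≤ 3 * ∫⁻ s, f s ∂σ := tsum_setLIntegral_Ioc_le hU σ f
  rcases le_or_gt p q with h | h
  · have hr : 1 ≤ q / p := by rwa [le_div_iff₀ hp, one_mul]
    have hterm : ∀ k, N k ≤ 2 * K ^ q * β k ^ (q / p) := fun k => by
      by_cases hk : 0 < pt q u k ∧ pt q u (k - 2) < pt q u (k + 1)
      · refine (hN k hk.1 hk.2).trans ?_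
        gcongr ?_ * _
        have hk1 : 0 < pt q u (k + 1) := hk.1.trans_le (hmono (by omega))
        have h3 := ENNReal.rpow_le_rpow (h₁ h _ hk1) hq.le
        rw [ENNReal.mul_rpow_of_nonneg _ _ hq.le, ← ENNReal.rpow_mul, one_div_mul_cancel hq.ne',
          ENNReal.rpow_one, show tail q u (pt q u (k + 1)) = tau (k + 1) from
          tail_lev hU (tau_ne_zero _) hk1] at h3
        calc _ ≤ 2 * tau (k + 1) * X 0 (pt q u (k + 1)) ^ q := by
              gcongr
              · exact tau_le_two_mul k
              · exact hX _ _ _ _ le_rfl (pt_nonneg _) hk.2 le_rfl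
          _ ≤ _ := by rw [mul_assoc]; gcongr
      · rw [hN0 k hk]; exact zero_le
    calc ∑' k, N k ≤ ∑' k, 2 * K ^ q * β k ^ (q / p) := ENNReal.tsum_le_tsum hterm
      _ ≤ 2 * K ^ q * (3 * ∫⁻ s, f s ∂σ) ^ (q / p) := by
          rw [ENNReal.tsum_mul_left]
          gcongr
          exact (tsum_rpow_le hr β).trans (by gcongr)
      _ = 2 * 3 ^ (q / p) * K ^ q * (∫⁻ s, f s ∂σ) ^ (q / p) := by
          rw [ENNReal.mul_rpow_of_nonneg _ _ (by positivity)]; ring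
      _ ≤ _ := by gcongr; exact le_self_add
  · have hr1 : q / p < 1 := by rwa [div_lt_one hp]
    have hpq : 0 < p - q := by linarith
    obtain ⟨-, c2⟩ := ratio_exponent hp h
    set F : ℝ → ℝ≥0∞ := fun x => wt q u x * tail q u x ^ (q / (p - q)) *
      X (zetaInv q u x) (zeta q u x) ^ (p * q / (p - q)) with hF
    set D : ℝ≥0∞ := 8 * 2 ^ (q / (p - q)) with hD
    set a : ℤ → ℝ≥0∞ := fun k => D * ∫⁻ x in block q u (k + 1), F x with ha
    have hasum : ∑' k, a k ≤ D * K ^ (p * q / (p - q)) := by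
      rw [ha, ENNReal.tsum_mul_left]
      gcongr
      have hsh := (Equiv.addRight (1 : ℤ)).tsum_eq (fun k => ∫⁻ x in block q u k, F x)
      simp only [Equiv.coe_addRight] at hsh
      rw [hsh, tsum_lintegral_block hU]
      exact h₂ h
    have hterm : ∀ k, N k ≤ a k ^ (1 - q / p) * β k ^ (q / p) := fun k => by
      by_cases hk : 0 < pt q u k ∧ pt q u (k - 2) < pt q u (k + 1)
      · refine (hN k hk.1 hk.2).trans ?_
        gcongr ?_ * _
        set Y := X (pt q u (k - 2)) (pt q u (k + 1)) with hY
        have e1 : tau k ^ (p / (p - q)) = tau k * tau k ^ (q / (p - q)) := by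
          rw [show p / (p - q) = 1 + q / (p - q) by field_simp; ring,
            ENNReal.rpow_add_of_nonneg _ _ zero_le_one (by positivity), ENNReal.rpow_one]
        have key : (tau k * Y ^ q) ^ (p / (p - q)) ≤ a k := by
          calc (tau k * Y ^ q) ^ (p / (p - q))
              = tau k * (tau k ^ (q / (p - q)) * Y ^ (p * q / (p - q))) := by
                rw [ENNReal.mul_rpow_of_nonneg _ _ (by positivity), e1, ← ENNReal.rpow_mul,
                    mul_assoc]
                congr 3; ring
            _ ≤ 2 * (4 * ∫⁻ x in block q u (k + 1), wt q u x) *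
                  (tau k ^ (q / (p - q)) * Y ^ (p * q / (p - q))) := by
                gcongr
                refine (tau_le_two_mul k).trans (mul_le_mul' le_rfl (le_lintegral_block hU ?_))
                rw [add_sub_cancel_right]; exact hk.1
            _ = 8 * (tau k ^ (q / (p - q)) * Y ^ (p * q / (p - q)) *
                  ∫⁻ x in block q u (k + 1), wt q u x) := by ring
            _ ≤ 8 * ∫⁻ x in block q u (k + 1),
                  tau k ^ (q / (p - q)) * Y ^ (p * q / (p - q)) * wt q u x := by
                gcongr; exact lintegral_const_mul_le _ _
            _ ≤ 8 * ∫⁻ x in block q u (k + 1), 2 ^ (q / (p - q)) * F x := by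
                gcongr 8 * ?_
                refine setLIntegral_mono' (measurableSet_block _) fun x hx => ?_
                obtain ⟨h1, -⟩ := (mem_block_iff hU (pos_of_mem_block hx)).1 hx
                have h2 : tau k ≤ 2 * tail q u x := (tau_le_two_mul k).trans (by gcongr)
                have h3 : Y ≤ X (zetaInv q u x) (zeta q u x) := by
                  refine hX _ _ _ _ (lev_nonneg _) ?_ hk.2 ?_
                  · have := (zetaInv_mem hU hx).2
                    rwa [show k + 1 - 3 = k - 2 by ring] at this
                  · exact (hmono (by omega)).trans (zeta_mem hU hx).1
                calc _ ≤ (2 * tail q u x) ^ (q / (p - q)) *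
                      X (zetaInv q u x) (zeta q u x) ^ (p * q / (p - q)) * wt q u x := by gcongr
                  _ = _ := by
                      rw [ENNReal.mul_rpow_of_nonneg _ _ (by positivity), hF]; ring
            _ = _ := by
                rw [lintegral_const_mul' _ _ (ENNReal.rpow_ne_top_of_nonneg (by positivity)
                  (by simp)), ha, hD]
                ring
        calc tau k * Y ^ q = ((tau k * Y ^ q) ^ (p / (p - q))) ^ (1 - q / p) := by
              rw [c2, ← ENNReal.rpow_mul, show p / (p - q) * ((p - q) / p) = 1 by field_simp,
                ENNReal.rpow_one]
          _ ≤ _ := ENNReal.rpow_le_rpow key (by linarith)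
      · rw [hN0 k hk]; exact zero_le
    calc ∑' k, N k ≤ ∑' k, a k ^ (1 - q / p) * β k ^ (q / p) := ENNReal.tsum_le_tsum hterm
      _ ≤ (∑' k, a k) ^ (1 - q / p) * (∑' k, β k) ^ (q / p) :=
          tsum_rpow_mul_rpow_le (by positivity) hr1 a β
      _ ≤ (D * K ^ (p * q / (p - q))) ^ (1 - q / p) * (3 * ∫⁻ s, f s ∂σ) ^ (q / p) := by
          have : 0 ≤ 1 - q / p := by linarith
          gcongr
      _ = D ^ ((p - q) / p) * 3 ^ (q / p) * K ^ q * (∫⁻ s, f s ∂σ) ^ (q / p) := by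
          rw [c2, ENNReal.mul_rpow_of_nonneg D _ (by positivity),
            ENNReal.mul_rpow_of_nonneg 3 _ (by positivity), ← ENNReal.rpow_mul K,
            show p * q / (p - q) * ((p - q) / p) = q by field_simp]
          ring
      _ ≤ _ := by gcongr; exact le_add_self

/-! ### Sufficiency -/

theorem tsum_lintegral_block_add (hU : ∀ t, 0 < t → 0 < tail q u t ∧ tail q u t < ∞)
    (f : ℝ → ℝ≥0∞) (j : ℤ) :
    ∑' k, ∫⁻ x in block q u (k + j), f x = ∫⁻ x in Ioi 0, f x := by
  have hsh := (Equiv.addRight j).tsum_eq (fun k => ∫⁻ x in block q u k, f x)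
  simp only [Equiv.coe_addRight] at hsh
  rw [hsh, tsum_lintegral_block hU]

/-- The constant in the local part of the sufficiency. -/
noncomputable def midC (p q : ℝ) : ℝ≥0∞ := (2 ^ (1 / p) * localC p) ^ q * 2 ^ q

/-- The window is block `k` with one block on either side. This gap leaves room to compare the two
outer contributions with integrals over the shifted blocks `k + 5` and `k + 1`. -/
theorem block_rpow_le (hp : 0 < p) (hq : 0 < q)
    (hU : ∀ t, 0 < t → 0 < tail q u t ∧ tail q u t < ∞)
    (hV : ∀ z, 0 < z → bigV p v z ≠ 0 ∧ bigV p v z ≠ ∞)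
    (σ : Measure ℝ) [IsFiniteMeasure σ] (hσ : σ (Iic 0) = 0)
    (hB : ∫⁻ s, bigV p v s ∂σ ≠ ∞) (k : ℤ) :
    tau k * (∫⁻ y in Ioo (pt q u (k - 1)) (pt q u k), gKer p σ y) ^ q ≤
      (2 ^ (1 / p)) ^ q * 2 ^ q * ((2 ^ (1 / p)) ^ q * 2 ^ q *
        (16 * (∫⁻ x in block q u (k + 5), σ (Iic (zetaInv2 q u x)) ^ (q / p) * logWt q u x) +
          midC p q * (tau k * innerA p v (pt q u (k - 2)) (pt q u (k + 1)) ^ q *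
            (∫⁻ s in Ioc (pt q u (k - 2)) (pt q u (k + 1)), bigV p v s ∂σ) ^ (q / p) +
            tau k * innerB p v (pt q u (k - 2)) (pt q u (k + 1)) ^ q *
            (∫⁻ s in Ioc (pt q u (k - 2)) (pt q u (k + 1)), bigV p v s ∂σ) ^ (q / p))) +
        8 * ∫⁻ x in block q u (k + 1),
          (∫⁻ s in Ici x, (ENNReal.ofReal s ^ p)⁻¹ ∂σ) ^ (q / p) * u x) := by
  have hmono := pt_mono hU
  set a := pt q u (k - 2) with ha
  set b := pt q u (k + 1) with hb
  set S := σ (Iic a) with hS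
  set R := ∫⁻ s in Ioi b, (ENNReal.ofReal s ^ p)⁻¹ ∂σ with hR
  set B := ∫⁻ s in Ioc a b, bigV p v s ∂σ with hBk
  set M := ∫⁻ y in Ioo a b, gKer p (σ.restrict (Ioc a b)) y with hM
  have hMle : M ^ q ≤ midC p q * (innerA p v a b ^ q * B ^ (q / p) + innerB p v a b ^ q *
      B ^ (q / p)) := by
    rcases le_or_gt b a with hab | hab
    · simp [hM, Ioo_eq_empty (not_lt.2 hab), hq]
    have h1 := lintegral_gKer_Ioo_le hp (pt_nonneg _) hab hV (σ.restrict (Ioc a b))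
      (by rw [Measure.restrict_apply measurableSet_Ioc.compl, compl_inter_self, measure_empty])
      (ne_top_of_le_ne_top hB (setLIntegral_le_lintegral _ _))
    calc M ^ q ≤ (2 ^ (1 / p) * localC p * (innerA p v a b + innerB p v a b) * B ^ (1 / p)) ^ q :=
          ENNReal.rpow_le_rpow h1 hq.le
      _ = (2 ^ (1 / p) * localC p) ^ q * (innerA p v a b + innerB p v a b) ^ q * B ^ (q / p) := by
          rw [ENNReal.mul_rpow_of_nonneg _ _ hq.le, ENNReal.mul_rpow_of_nonneg _ _ hq.le,
            ← ENNReal.rpow_mul B]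
          congr 2; ring
      _ ≤ (2 ^ (1 / p) * localC p) ^ q * (2 ^ q * (innerA p v a b ^ q + innerB p v a b ^ q)) *
            B ^ (q / p) := by
          gcongr
          exact add_rpow_le_two_rpow hq.le _ _
      _ = _ := by rw [midC]; ring
  have hb := lintegral_Ioo_gKer_le hp σ hσ (a := a) (b := b) (c := pt q u (k - 1)) (d := pt q u k)
    (hmono (by omega)) (pt_nonneg _) (hmono (by omega))
  have hL := left_block_le hp hq hU σ hσ k
  have hRb := right_block_le hp hq hU σ k
  set L := logRatio (pt q u k) (pt q u (k - 1)) with hLdef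
  set W := ENNReal.ofReal (pt q u k - pt q u (k - 1)) with hW
  have hexp : ∀ c : ℝ≥0∞, (c ^ (1 / p)) ^ q = c ^ (q / p) := fun c => by
    rw [← ENNReal.rpow_mul]; congr 1; ring
  calc _ ≤ tau k * (2 ^ (1 / p) * (2 ^ (1 / p) * (L * S ^ (1 / p) + M) + W * R ^ (1 / p))) ^ q := by
        gcongr
    _ ≤ tau k * ((2 ^ (1 / p)) ^ q * (2 ^ q * ((2 ^ (1 / p)) ^ q *
          (2 ^ q * (L ^ q * S ^ (q / p) + M ^ q)) + W ^ q * R ^ (q / p)))) := by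
        rw [ENNReal.mul_rpow_of_nonneg _ _ hq.le]
        gcongr _ * (_ * ?_)
        refine (add_rpow_le_two_rpow hq.le _ _).trans ?_
        rw [ENNReal.mul_rpow_of_nonneg _ _ hq.le, ENNReal.mul_rpow_of_nonneg W _ hq.le, hexp R]
        gcongr _ * (_ * ?_ + _)
        refine (add_rpow_le_two_rpow hq.le _ _).trans ?_
        rw [ENNReal.mul_rpow_of_nonneg L _ hq.le, hexp]
    _ = (2 ^ (1 / p)) ^ q * 2 ^ q * ((2 ^ (1 / p)) ^ q * 2 ^ q *
          (tau k * (L ^ q * S ^ (q / p)) + tau k * M ^ q) + tau k * (W ^ q * R ^ (q / p))) := by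
              ring
    _ ≤ (2 ^ (1 / p)) ^ q * 2 ^ q * ((2 ^ (1 / p)) ^ q * 2 ^ q *
          (16 * (∫⁻ x in block q u (k + 5), σ (Iic (zetaInv2 q u x)) ^ (q / p) * logWt q u x) +
            tau k * (midC p q * (innerA p v a b ^ q * B ^ (q / p) + innerB p v a b ^ q *
                B ^ (q / p)))) +
          8 * ∫⁻ x in block q u (k + 1),
            (∫⁻ s in Ici x, (ENNReal.ofReal s ^ p)⁻¹ ∂σ) ^ (q / p) * u x) := by
        gcongr
    _ = _ := by ring

theorem exists_sufficiency_const (hp : 0 < p) (hq : 0 < q) :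
    ∃ C : ℝ≥0∞, C ≠ ∞ ∧ ∀ u v : ℝ → ℝ≥0∞,
      AEMeasurable u (volume.restrict (Ioi (0 : ℝ))) →
      (∀ t, 0 < t → 0 < tail q u t ∧ tail q u t < ∞) →
      (∀ z, 0 < z → bigV p v z ≠ 0 ∧ bigV p v z ≠ ∞) → ∀ K : ℝ≥0∞, K ≠ ∞ →
      calA0 p q v u ≤ K → bfA0 p q v u ≤ K → calA2 p q v u ≤ K → bfA2 p q v u ≤ K →
      ∀ (σ : Measure ℝ) [IsFiniteMeasure σ], σ (Iic 0) = 0 → ∫⁻ s, bigV p v s ∂σ ≠ ∞ →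
        ∀ α : ℝ, 0 < α →
        ∫⁻ x in Ioi 0, (∫⁻ y in Ioo 0 x ∩ Ioi α, gKer p σ y) ^ q * wt q u x ≤
          (C * K) ^ q * (∫⁻ s, bigV p v s ∂σ) ^ (q / p) := by
  set s : ℝ≥0∞ := (2 ^ (1 / p)) ^ q * 2 ^ q with hs
  set D : ℝ≥0∞ := 20 * splitC q * (s * (s * (16 * hardyC p q + midC p q * (2 * localSumC p q)) +
    8 * hardyC p q)) with hD
  have h2 : ∀ t : ℝ, 0 ≤ t → (2 : ℝ≥0∞) ^ t ≠ ∞ := fun t ht =>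
    ENNReal.rpow_ne_top_of_nonneg ht (by simp)
  have hst : s ≠ ∞ := ENNReal.mul_ne_top (ENNReal.rpow_ne_top_of_nonneg hq.le
    (h2 _ (by positivity))) (h2 _ hq.le)
  have hmt : midC p q ≠ ∞ := ENNReal.mul_ne_top (ENNReal.rpow_ne_top_of_nonneg hq.le
    (ENNReal.mul_ne_top (h2 _ (by positivity)) (localC_ne_top hp))) (h2 _ hq.le)
  have hht := hardyC_ne_top hp hq
  have hlt := localSumC_ne_top hp hq
  have hsp := splitC_ne_top hq
  have hDt : D ≠ ∞ := by
    refine ENNReal.mul_ne_top (ENNReal.mul_ne_top (by simp) hsp) (ENNReal.mul_ne_top hst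
      (ENNReal.add_ne_top.2 ⟨ENNReal.mul_ne_top hst (ENNReal.add_ne_top.2
        ⟨ENNReal.mul_ne_top (by simp) hht, ENNReal.mul_ne_top hmt
          (ENNReal.mul_ne_top (by simp) hlt)⟩), ENNReal.mul_ne_top (by simp) hht⟩))
  refine ⟨D ^ (1 / q), ENNReal.rpow_ne_top_of_nonneg (by positivity) hDt, ?_⟩
  intro u v hu hU hV K hKt hA0 hB0 hA2 hB2 σ _ hσ hB α hα
  set B := ∫⁻ s, bigV p v s ∂σ with hBdef
  set P := K ^ q * B ^ (q / p) with hP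
  have hmono := pt_mono hU
  set NA : ℤ → ℝ≥0∞ := fun k => open Classical in
    if 0 < pt q u k ∧ pt q u (k - 2) < pt q u (k + 1) then
    tau k * innerA p v (pt q u (k - 2)) (pt q u (k + 1)) ^ q *
      (∫⁻ s in Ioc (pt q u (k - 2)) (pt q u (k + 1)), bigV p v s ∂σ) ^ (q / p) else 0 with hNA
  set NB : ℤ → ℝ≥0∞ := fun k => open Classical in
    if 0 < pt q u k ∧ pt q u (k - 2) < pt q u (k + 1) then
    tau k * innerB p v (pt q u (k - 2)) (pt q u (k + 1)) ^ q *
      (∫⁻ s in Ioc (pt q u (k - 2)) (pt q u (k + 1)), bigV p v s ∂σ) ^ (q / p) else 0 with hNB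
  have hexp : q < p → 0 < (p - q) / (p * q) := fun h => by
    have : 0 < p - q := by linarith
    positivity
  have hpow : q < p → ∀ X : ℝ≥0∞, X ^ ((p - q) / (p * q)) ≤ K → X ≤ K ^ (p * q / (p - q)) :=
    fun h X hX => by
      have h0 : 0 < p - q := by linarith
      calc X = (X ^ ((p - q) / (p * q))) ^ (p * q / (p - q)) := by
            rw [← ENNReal.rpow_mul, show (p - q) / (p * q) * (p * q / (p - q)) = 1 by field_simp,
              ENNReal.rpow_one]
        _ ≤ _ := by gcongr
  have hsA : ∑' k, NA k ≤ localSumC p q * P := by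
    rw [hP, ← mul_assoc]
    refine tsum_local_le hp hq hU (X := innerA p v)
      (fun a a' b b' h1 h2 h3 h4 => innerA_mono hp h1 h2 h3 h4) (fun h t ht => ?_) (fun h => ?_)
      (fun k h1 h2 => ?_) (fun k hk => ?_)
    · rw [calA2_of_le h] at hA2
      exact (le_iSup₂ (f := fun t (_ : 0 < t) => tail q u t ^ (1 / q) *
          innerA p v 0 t) t ht).trans hA2
    · rw [calA2_of_lt hp hq h] at hA2
      exact hpow h _ hA2
    · rw [hNA]; simp only; rw [if_pos ⟨h1, h2⟩]
    · rw [hNA]; simp only; rw [if_neg hk]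
  have hsB : ∑' k, NB k ≤ localSumC p q * P := by
    rw [hP, ← mul_assoc]
    refine tsum_local_le hp hq hU (X := innerB p v)
      (fun a a' b b' h1 h2 h3 h4 => innerB_mono hp h1 h2 h4) (fun h t ht => ?_) (fun h => ?_)
      (fun k h1 h2 => ?_) (fun k hk => ?_)
    · rw [bfA2_of_le hp h] at hB2
      exact (le_iSup₂ (f := fun t (_ : 0 < t) => tail q u t ^ (1 / q) *
          innerB p v 0 t) t ht).trans hB2
    · rw [bfA2_of_lt hp hq h] at hB2
      exact hpow h _ hB2
    · rw [hNB]; simp only; rw [if_pos ⟨h1, h2⟩]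
    · rw [hNB]; simp only; rw [if_neg hk]
  set FL : ℤ → ℝ≥0∞ := fun k =>
    ∫⁻ x in block q u (k + 5), σ (Iic (zetaInv2 q u x)) ^ (q / p) * logWt q u x with hFL
  set FR : ℤ → ℝ≥0∞ := fun k => ∫⁻ x in block q u (k + 1),
    (∫⁻ s in Ici x, (ENNReal.ofReal s ^ p)⁻¹ ∂σ) ^ (q / p) * u x with hFR
  have hsL : ∑' k, FL k ≤ hardyC p q * P := by
    rw [hFL, tsum_lintegral_block_add hU, hP, ← mul_assoc]
    exact lintegral_logWt_le hp hq hu hU hV hKt hB0 σ hσ hB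
  have hsR : ∑' k, FR k ≤ hardyC p q * P := by
    rw [hFR, tsum_lintegral_block_add hU, hP, ← mul_assoc]
    exact lintegral_tail_rpow_le hp hq hu hV hKt hA0 σ hσ hB
  have hterm : ∀ k : ℤ, tau k * (∫⁻ y in Ioo (pt q u (k - 1)) (pt q u k) ∩ Ioi α, gKer p σ y) ^ q ≤
      s * (s * (16 * FL k + midC p q * (NA k + NB k)) + 8 * FR k) := fun k => by
    have h0 : (∫⁻ y in Ioo (pt q u (k - 1)) (pt q u k) ∩ Ioi α, gKer p σ y) ≤
        ∫⁻ y in Ioo (pt q u (k - 1)) (pt q u k), gKer p σ y := lintegral_mono_set inter_subset_left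
    by_cases hk : 0 < pt q u k ∧ pt q u (k - 2) < pt q u (k + 1)
    · refine le_trans ?_ ((block_rpow_le hp hq hU hV σ hσ hB k).trans_eq ?_)
      · gcongr
      · rw [hNA, hNB]; simp only; rw [if_pos hk, if_pos hk]
    · have hle : pt q u k ≤ pt q u (k - 1) := by
        rcases not_and_or.1 hk with h | h
        · exact (not_lt.1 h).trans (pt_nonneg _)
        · exact (hmono (by omega)).trans ((not_lt.1 h).trans (hmono (by omega)))
      rw [Ioo_eq_empty (not_lt.2 hle)]
      simp [hq]
  calc _ ≤ 20 * splitC q * ∑' k : ℤ,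
        tau k * (∫⁻ y in Ioo (pt q u (k - 1)) (pt q u k) ∩ Ioi α, gKer p σ y) ^ q :=
        lintegral_rpow_mul_wt_le hq hu hU _ hα
    _ ≤ 20 * splitC q * ∑' k : ℤ, s * (s * (16 * FL k + midC p q * (NA k + NB k)) + 8 * FR k) := by
        gcongr _ * ?_
        exact ENNReal.tsum_le_tsum hterm
    _ = 20 * splitC q * (s * (s * (16 * ∑' k, FL k + midC p q * (∑' k, NA k + ∑' k, NB k)) +
          8 * ∑' k, FR k)) := by
        simp only [ENNReal.tsum_mul_left, ENNReal.tsum_add]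
    _ ≤ 20 * splitC q * (s * (s * (16 * (hardyC p q * P) + midC p q *
          (localSumC p q * P + localSumC p q * P)) + 8 * (hardyC p q * P))) := by
        gcongr
    _ = D * P := by rw [hD]; ring
    _ = _ := by
        rw [ENNReal.mul_rpow_of_nonneg _ _ hq.le, ← ENNReal.rpow_mul, one_div_mul_cancel hq.ne',
          ENNReal.rpow_one]
        exact (mul_assoc _ _ _).symm

/-! ### Necessity -/

/-- The inequality obtained by testing the maximal operator on the functions `gKer p σ`. -/
def TestBound (p q : ℝ) (v u : ℝ → ℝ≥0∞) (Q : ℝ≥0∞) : Prop :=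
  ∀ (σ : Measure ℝ) [SFinite σ], ∫⁻ s, bigV p v s ∂σ ≠ ∞ →
    ∫⁻ x in Ioi 0, (∫⁻ y in Ioo 0 x, gKer p σ y) ^ q * wt q u x ≤
      Q * (∫⁻ s, bigV p v s ∂σ) ^ (q / p)

/-- `gKer` decreases, hence `x gKer(x) ≤ ∫_0^x gKer`. -/
theorem TestBound.lintegral_gKer_rpow_le {Q : ℝ≥0∞} (hp : 0 < p) (hq : 0 < q)
    (H : TestBound p q v u Q) (σ : Measure ℝ) [SFinite σ] (hB : ∫⁻ s, bigV p v s ∂σ ≠ ∞) :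
    ∫⁻ x in Ioi 0, gKer p σ x ^ q * u x ≤ Q * (∫⁻ s, bigV p v s ∂σ) ^ (q / p) := by
  refine le_trans (setLIntegral_mono' measurableSet_Ioi fun x hx => ?_) (H σ hB)
  have hx : 0 < x := hx
  have h1 : ENNReal.ofReal x * gKer p σ x ≤ ∫⁻ y in Ioo 0 x, gKer p σ y := by
    calc ENNReal.ofReal x * gKer p σ x = ∫⁻ _ in Ioo 0 x, gKer p σ x := by
          rw [setLIntegral_const, Real.volume_Ioo, sub_zero, mul_comm]
      _ ≤ _ := setLIntegral_mono' measurableSet_Ioo fun y hy => gKer_antitone hp σ hy.2.le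
  calc gKer p σ x ^ q * u x = (ENNReal.ofReal x * gKer p σ x) ^ q * wt q u x := by
        rw [ENNReal.mul_rpow_of_nonneg _ _ hq.le, wt, ENNReal.rpow_neg]
        calc _ = gKer p σ x ^ q * u x * (ENNReal.ofReal x ^ q * (ENNReal.ofReal x ^ q)⁻¹) := by
              rw [ENNReal.mul_inv_cancel (ofReal_rpow_ne_zero hx q) (ofReal_rpow_ne_top hx q),
                mul_one]
          _ = _ := by ring
    _ ≤ _ := by gcongr

theorem rpow_div_le_of_le_mul {a b Q : ℝ≥0∞} (hp : 0 < p) (hq : 0 < q)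
    (h : a ≤ Q * b ^ (q / p)) : a ^ (p / q) / b ≤ (Q ^ (1 / q)) ^ p := by
  refine ENNReal.div_le_of_le_mul ?_
  have h2 : a ^ (p / q) ≤ (Q * b ^ (q / p)) ^ (p / q) := ENNReal.rpow_le_rpow h (by positivity)
  have h3 : Q ^ (p / q) = (Q ^ (1 / q)) ^ p := by rw [← ENNReal.rpow_mul]; congr 1; ring
  rwa [ENNReal.mul_rpow_of_nonneg _ _ (by positivity), ← ENNReal.rpow_mul b,
    show q / p * (p / q) = 1 by field_simp, ENNReal.rpow_one, h3] at h2

/-- The constant of the necessity part of the Hardy inequalities. -/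
noncomputable def necC (p q : ℝ) : ℝ≥0∞ := 1 + (2 ^ (q / (p - q) + 2)) ^ (1 / q)

theorem necC_ne_top (hq : 0 < q) : necC p q ≠ ∞ := by
  refine ENNReal.add_ne_top.2 ⟨by simp, ENNReal.rpow_ne_top_of_nonneg (by positivity) ?_⟩
  simp [ENNReal.rpow_eq_top_iff]

theorem rpow_le_necC_mul (hp : 0 < p) (hq : 0 < q) (hpq : q < p) {A Q : ℝ≥0∞}
    (h : A ≤ (2 ^ (q / (p - q) + 2) * Q) ^ (1 / ((p - q) / p))) :
    A ^ ((p - q) / q * (1 / p)) ≤ necC p q * Q ^ (1 / q) := by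
  have hpq' : 0 < p - q := by linarith
  calc A ^ ((p - q) / q * (1 / p))
      ≤ ((2 ^ (q / (p - q) + 2) * Q) ^ (1 / ((p - q) / p))) ^ ((p - q) / q * (1 / p)) := by gcongr
    _ = (2 ^ (q / (p - q) + 2)) ^ (1 / q) * Q ^ (1 / q) := by
        rw [← ENNReal.rpow_mul, ← ENNReal.mul_rpow_of_nonneg _ _ (by positivity)]
        congr 1
        field_simp
    _ ≤ _ := by gcongr; exact le_add_self

/-- Only the part of `gKer p μ` coming from `s ≥ x` is kept. With `μ = s^p κ` this is the mirrored
Hardy inequality for `κ`, with `ρ` of density `u`, whose necessary condition is `calA0`; for `p ≤ q`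
point masses suffice. -/
theorem calA0_le (hp : 0 < p) (hq : 0 < q) (hu : AEMeasurable u (volume.restrict (Ioi (0 : ℝ))))
    (hV : ∀ z, 0 < z → bigV p v z ≠ 0 ∧ bigV p v z ≠ ∞) {Q : ℝ≥0∞}
    (H : TestBound p q v u Q) : calA0 p q v u ≤ necC p q * Q ^ (1 / q) := by
  rcases le_or_gt p q with h | h
  · refine le_trans ?_ (le_mul_of_one_le_left' le_self_add)
    rw [calA0, if_pos h, one_div, ENNReal.rpow_inv_le_iff hp]
    refine iSup₂_le fun t ht => rpow_div_le_of_le_mul hp hq ?_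
    have h1 := H.lintegral_gKer_rpow_le hp hq (Measure.dirac t)
      (by rw [lintegral_dirac]; exact (hV t ht).2)
    rw [lintegral_dirac] at h1
    have h2 : (ENNReal.ofReal t ^ q)⁻¹ * ∫⁻ x in Ioo 0 t, u x ≤ Q * bigV p v t ^ (q / p) := by
      refine le_trans ?_ h1
      refine (lintegral_const_mul_le _ _).trans (le_trans (setLIntegral_mono' measurableSet_Ioo
        fun y hy => ?_) (lintegral_mono_set (t := Ioi 0) fun y hy => hy.1))
      gcongr
      rw [gKer, lintegral_dirac, ker, max_eq_left hy.2.le, ENNReal.inv_rpow, ← ENNReal.rpow_mul,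
        mul_one_div_cancel hp.ne', ENNReal.rpow_one, ENNReal.inv_rpow]
    rw [ENNReal.inv_mul_le_iff (ofReal_rpow_ne_zero ht q) (ofReal_rpow_ne_top ht q)] at h2
    refine h2.trans_eq ?_
    rw [ENNReal.mul_rpow_of_nonneg _ _ (by positivity), ← ENNReal.rpow_mul,
      show p * (q / p) = q by field_simp]
    ring
  · have hr1 : q / p < 1 := by rwa [div_lt_one hp]
    have hpq : 0 < p - q := by linarith
    obtain ⟨c1, c2⟩ := ratio_exponent hp h
    rw [calA0, if_neg (not_le.2 h), ← ENNReal.rpow_mul]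
    refine rpow_le_necC_mul hp hq h ?_
    set ρ : Measure ℝ := (volume.restrict (Ioi 0)).withDensity u with hρ
    have hnec := hardy_lt_one_necessity_mirror (ρ := ρ) (r := q / p) (by positivity) hr1
      (v := fun x => (powV p v x)⁻¹) (fun x y hxy => ENNReal.inv_le_inv.2 (powV_mono hp hxy))
      (K := Q) (fun κ hκ hκρ _ hκB => by
        simp only [inv_inv] at hκB ⊢
        have hm : Measurable fun s : ℝ => ENNReal.ofReal s ^ p :=
          ENNReal.measurable_ofReal.pow_const p
        set μ : Measure ℝ := κ.withDensity fun s => ENNReal.ofReal s ^ p with hμ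
        have hμB : ∫⁻ s, bigV p v s ∂μ = ∫⁻ s, powV p v s ∂κ := by
          rw [hμ, lintegral_withDensity_eq_lintegral_mul κ (f := fun s => ENNReal.ofReal s ^ p) hm
            (g := bigV p v) (bigV_antitone hp).measurable]
          rfl
        have h1 := H.lintegral_gKer_rpow_le hp hq μ (by rw [hμB]; exact hκB.ne)
        rw [hμB] at h1
        refine le_trans ?_ h1
        rw [hρ, lintegral_withDensity_eq_lintegral_mul₀ (f := u) hu
          (g := fun x => κ (Ici x) ^ (q / p))
          (((antitone_measure_Ici κ).measurable.pow_const _).aemeasurable)]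
        refine setLIntegral_mono' measurableSet_Ioi fun x hx => ?_
        have hx0 : 0 < x := hx
        simp only [Pi.mul_apply]
        rw [mul_comm]
        gcongr
        have h2 : κ (Ici x) ^ (1 / p) ≤ gKer p μ x := by
          refine le_trans (ENNReal.rpow_le_rpow (le_of_eq ?_) (by positivity))
            (tail_le_gKer hp μ x)
          rw [hμ, setLIntegral_withDensity_eq_setLIntegral_mul κ (f :=
              fun s => ENNReal.ofReal s ^ p)
            hm (g := fun s => (ENNReal.ofReal s ^ p)⁻¹) (measurable_ofReal_rpow_inv p)
            measurableSet_Ici, ← setLIntegral_one]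
          refine setLIntegral_congr_fun measurableSet_Ici fun s hs => ?_
          have hs0 : 0 < s := hx0.trans_le hs
          simp only [Pi.mul_apply]
          rw [ENNReal.mul_inv_cancel (ofReal_rpow_ne_zero hs0 p) (ofReal_rpow_ne_top hs0 p)]
        calc κ (Ici x) ^ (q / p) = (κ (Ici x) ^ (1 / p)) ^ q := by
              rw [← ENNReal.rpow_mul]; congr 1; ring
          _ ≤ _ := by gcongr)
    rw [c1, c2] at hnec
    refine le_trans (le_of_eq ?_) hnec
    rw [hρ, lintegral_withDensity_eq_lintegral_mul₀ (f := u) hu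
      (g := fun x => ((powV p v x)⁻¹ * ρ (Iic x)) ^ (q / (p - q)))
      ((((powV_mono hp).measurable.inv.mul
        (monotone_measure_Iic ρ).measurable).pow_const _).aemeasurable)]
    refine setLIntegral_congr_fun measurableSet_Ioi fun x hx => ?_
    have : ρ (Iic x) = ∫⁻ y in Ioo 0 x, u y := by
      rw [hρ, withDensity_apply _ measurableSet_Iic, Measure.restrict_restrict measurableSet_Iic,
        Iic_inter_Ioi, setLIntegral_congr Ioo_ae_eq_Ioc]
    simp only [Pi.mul_apply]
    rw [this, ENNReal.mul_rpow_of_nonneg (powV p v x)⁻¹ _ (by positivity), ENNReal.inv_rpow,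
      ← ENNReal.rpow_neg, powV, ← neg_sub p q, div_neg, mul_comm (u x)]

theorem psi_le (hU : ∀ t, 0 < t → 0 < tail q u t ∧ tail q u t < ∞) {x : ℝ} (hx : 0 < x) :
    psi q u x ≤ x := by
  rw [psi]
  by_contra hlt
  have hlt := not_le.1 hlt
  have h1 := (le_lev_iff hU (by simpa using (tail_pos hU x).ne') (hx.trans hlt)).1 le_rfl
  have h2 := h1.trans (tail_antitone hlt.le)
  have h3 : 1 * tail q u x < 4 * tail q u x :=
    (ENNReal.mul_lt_mul_iff_left (hU x hx).1.ne' (hU x hx).2.ne).2 (by norm_num)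
  rw [one_mul] at h3
  exact absurd h2 (not_le.2 h3)

/-- For `y` between `ζ^{-2}(x)` and `x`, `gKer` is at least `1 / y` times a power of the mass of
`Iic (ζ^{-2}(x))`; integrating `dy / y` gives the logarithm in `logWt`. -/
theorem TestBound.lintegral_logWt_le {Q : ℝ≥0∞} (hp : 0 < p) (hq : 0 < q)
    (hU : ∀ t, 0 < t → 0 < tail q u t ∧ tail q u t < ∞)
    (H : TestBound p q v u Q) (σ : Measure ℝ) [SFinite σ] (hσ : σ (Iic 0) = 0)
    (hB : ∫⁻ s, bigV p v s ∂σ ≠ ∞) :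
    ∫⁻ x in Ioi 0, σ (Iic (psi q u x)) ^ (q / p) * logWt q u x ≤
      Q * (∫⁻ s, bigV p v s ∂σ) ^ (q / p) := by
  refine le_trans (setLIntegral_mono' measurableSet_Ioi fun x hx => ?_) (H σ hB)
  have hx : 0 < x := hx
  rcases (psi_nonneg (q := q) (u := u) x).eq_or_lt with h | h
  · rw [← h, hσ, ENNReal.zero_rpow_of_pos (by positivity), zero_mul]; exact zero_le
  have h1 : logRatio x (psi q u x) * σ (Iic (psi q u x)) ^ (1 / p) ≤
      ∫⁻ y in Ioo 0 x, gKer p σ y := by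
    rw [← lintegral_inv_Ioo h (psi_le hU hx),
      ← lintegral_mul_const (f := fun y => (ENNReal.ofReal y)⁻¹) _ ENNReal.measurable_ofReal.inv]
    refine le_trans (setLIntegral_mono' measurableSet_Ioo fun y hy => ?_)
      (lintegral_mono_set (Ioo_subset_Ioo_left h.le))
    refine le_trans ?_ (head_le_gKer hp σ y)
    have := hy.1.le
    gcongr
  calc σ (Iic (psi q u x)) ^ (q / p) * logWt q u x
      = (logRatio x (psi q u x) * σ (Iic (psi q u x)) ^ (1 / p)) ^ q * wt q u x := by
        rw [ENNReal.mul_rpow_of_nonneg _ _ hq.le, ← ENNReal.rpow_mul, logWt, zetaInv2_eq hU hx, psi,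
          show 1 / p * q = q / p by ring]
        ring
    _ ≤ _ := by gcongr

/-- Otherwise unit masses at `s ↓ 0` would have bounded cost, while their `gKer` integrates over
`(0, 1)` to at least `log (1 / s)`. In `bfA0_le` this keeps measures transported by `ζ^{-2}` off the
origin. -/
theorem TestBound.bigV_zero {Q : ℝ≥0∞} (hp : 0 < p) (hq : 0 < q) (hQ : Q ≠ ∞)
    (hU : ∀ t, 0 < t → 0 < tail q u t ∧ tail q u t < ∞)
    (H : TestBound p q v u Q) : bigV p v 0 = ∞ := by
  by_contra hV0
  set D := Q * bigV p v 0 ^ (q / p) with hD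
  have hDt : D ≠ ∞ := ENNReal.mul_ne_top hQ (ENNReal.rpow_ne_top_of_nonneg (by positivity) hV0)
  have hU1 := hU 1 one_pos
  have key : ∀ s : ℝ, 0 < s → s ≤ 1 → ENNReal.ofReal (Real.log (1 / s)) ≤
      (D / tail q u 1) ^ (1 / q) := by
    intro s hs hs1
    have hVs : bigV p v s ≤ bigV p v 0 := bigV_antitone hp hs.le
    have h1 := H (Measure.dirac s) (by
      rw [lintegral_dirac]; exact ne_top_of_le_ne_top hV0 hVs)
    rw [lintegral_dirac] at h1
    rw [one_div q, ENNReal.le_rpow_inv_iff hq, ENNReal.le_div_iff_mul_le (Or.inl hU1.1.ne')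
      (Or.inl hU1.2.ne)]
    calc ENNReal.ofReal (Real.log (1 / s)) ^ q * tail q u 1
        ≤ ∫⁻ x in Ioi 1, ENNReal.ofReal (Real.log (1 / s)) ^ q * wt q u x :=
          lintegral_const_mul_le _ _
      _ ≤ ∫⁻ x in Ioi 1, (∫⁻ y in Ioo 0 x, gKer p (Measure.dirac s) y) ^ q * wt q u x := by
          refine setLIntegral_mono' measurableSet_Ioi fun x hx => ?_
          have hx : 1 < x := hx
          gcongr
          rw [← logRatio_of_pos hs, ← lintegral_inv_Ioo hs hs1]
          refine le_trans (setLIntegral_mono' measurableSet_Ioo fun y hy => ?_)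
            (lintegral_mono_set (Ioo_subset_Ioo hs.le hx.le))
          rw [gKer, lintegral_dirac, ker, max_eq_right hy.1.le, ENNReal.inv_rpow,
            ← ENNReal.rpow_mul, mul_one_div_cancel hp.ne', ENNReal.rpow_one]
      _ ≤ _ := lintegral_mono_set (Ioi_subset_Ioi zero_le_one)
      _ ≤ _ := h1.trans (mul_le_mul' le_rfl (ENNReal.rpow_le_rpow hVs (by positivity)))
  set T := (D / tail q u 1) ^ (1 / q) with hT
  have hTt : T ≠ ∞ := ENNReal.rpow_ne_top_of_nonneg (by positivity)
    (ENNReal.div_ne_top hDt hU1.1.ne')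
  have h2 := key (Real.exp (-(T.toReal + 1))) (Real.exp_pos _)
    (Real.exp_le_one_iff.2 (by linarith [ENNReal.toReal_nonneg (a := T)]))
  rw [one_div, ← Real.exp_neg, neg_neg, Real.log_exp, ENNReal.ofReal_le_iff_le_toReal hTt] at h2
  linarith

theorem bfA0_le (hp : 0 < p) (hq : 0 < q) (hu : AEMeasurable u (volume.restrict (Ioi (0 : ℝ))))
    (hU : ∀ t, 0 < t → 0 < tail q u t ∧ tail q u t < ∞)
    (hV : ∀ z, 0 < z → bigV p v z ≠ 0 ∧ bigV p v z ≠ ∞) {Q : ℝ≥0∞} (hQ : Q ≠ ∞)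
    (H : TestBound p q v u Q) : bfA0 p q v u ≤ necC p q * Q ^ (1 / q) := by
  rcases le_or_gt p q with h | h
  · refine le_trans ?_ (le_mul_of_one_le_left' le_self_add)
    rw [bfA0, if_pos h, one_div, ENNReal.rpow_inv_le_iff hp]
    refine iSup₂_le fun t ht => rpow_div_le_of_le_mul hp hq ?_
    have h1 := H.lintegral_logWt_le hp hq hU (Measure.dirac t) (by simp [ht])
      (by rw [lintegral_dirac]; exact (hV t ht).2)
    rw [lintegral_dirac] at h1
    refine le_trans ?_ h1
    have hz0 : 0 ≤ zeta2 q u t := by rw [zeta2_eq hU ht]; exact lev_nonneg _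
    refine le_trans (setLIntegral_mono' measurableSet_Ioi fun x hx => ?_)
      (lintegral_mono_set (Ioi_subset_Ioi hz0))
    have hx0 : 0 < x := hz0.trans_lt hx
    have htx : t ≤ psi q u x := by
      rw [psi, le_lev_iff hU (by simpa using (tail_pos hU x).ne') ht, mul_comm]
      have hx : zeta2 q u t < x := hx
      rw [zeta2_eq hU ht, lev_lt_iff hU (by simpa using (tail_pos hU t).ne') hx0] at hx
      exact (ENNReal.le_div_iff_mul_le (by simp) (by simp)).1 hx.le
    simp [htx]
  · have hr1 : q / p < 1 := by rwa [div_lt_one hp]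
    have hpq : 0 < p - q := by linarith
    obtain ⟨c1, c2⟩ := ratio_exponent hp h
    have hV0 := H.bigV_zero hp hq hQ hU
    have hlw := aemeasurable_logWt hu hU
    have hpm := (psi_mono hU).measurable
    rw [bfA0, if_neg (not_le.2 h), ← ENNReal.rpow_mul]
    refine rpow_le_necC_mul hp hq h ?_
    set ρ : Measure ℝ := (volume.restrict (Ioi 0)).withDensity (logWt q u) with hρ
    have hnec := hardy_lt_one_necessity (ρ := ρ) (r := q / p) (by positivity) hr1
      (v := fun x => (bigV p v (psi q u x))⁻¹) (fun x y hxy => ENNReal.inv_le_inv.2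
        (bigV_antitone hp (psi_mono hU hxy)))
      (K := Q) (fun κ hκ hκρ hκ0 hκB => by
        simp only [inv_inv] at hκB ⊢
        -- The Hardy inequality for `κ` composed with `ζ^{-2}` is tested on the image measure. It
        -- has no mass on `Iic 0`: where `ζ^{-2} = 0` the weight `1 / V` vanishes, and `κ` is null
        -- there.
        set μ : Measure ℝ := κ.map (psi q u) with hμ
        have hμB : ∫⁻ s, bigV p v s ∂μ = ∫⁻ x, bigV p v (psi q u x) ∂κ := by
          rw [hμ, lintegral_map (bigV_antitone hp).measurable hpm]
        have hμ0 : μ (Iic 0) = 0 := by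
          rw [hμ, Measure.map_apply hpm measurableSet_Iic]
          refine measure_mono_null (fun x hx => ?_) hκ0
          have hx : psi q u x ≤ 0 := hx
          have : psi q u x = 0 := le_antisymm hx (psi_nonneg x)
          simp [this, hV0]
        have hμf : IsFiniteMeasure μ := Measure.isFiniteMeasure_map κ _
        have h1 := H.lintegral_logWt_le hp hq hU μ hμ0 (by rw [hμB]; exact hκB.ne)
        rw [hμB] at h1
        refine le_trans ?_ h1
        rw [hρ, lintegral_withDensity_eq_lintegral_mul₀ (f := logWt q u) hlw
          (g := fun x => κ (Iic x) ^ (q / p))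
          (((monotone_measure_Iic κ).measurable.pow_const _).aemeasurable)]
        refine lintegral_mono fun x => ?_
        simp only [Pi.mul_apply]
        rw [mul_comm, hμ, Measure.map_apply hpm measurableSet_Iic]
        gcongr
        exact fun y hy => psi_mono hU hy)
    rw [c1, c2] at hnec
    refine le_trans (le_of_eq ?_) hnec
    rw [hρ, lintegral_withDensity_eq_lintegral_mul₀ (f := logWt q u) hlw
      (g := fun x => ((bigV p v (psi q u x))⁻¹ * ρ (Ici x)) ^ (q / (p - q)))
      (((((bigV_antitone hp).comp_monotone (psi_mono hU)).measurable.inv.mul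
        (antitone_measure_Ici ρ).measurable).pow_const _).aemeasurable)]
    refine setLIntegral_congr_fun measurableSet_Ioi fun x hx => ?_
    have hx : 0 < x := hx
    have : ρ (Ici x) = ∫⁻ s in Ioi x, logWt q u s := by
      rw [hρ, withDensity_apply _ measurableSet_Ici, Measure.restrict_restrict measurableSet_Ici,
        inter_eq_left.2 (show Ici x ⊆ Ioi 0 from fun y hy => hx.trans_le hy),
        setLIntegral_congr Ioi_ae_eq_Ici]
    simp only [Pi.mul_apply]
    rw [this, ENNReal.div_eq_inv_mul, zetaInv2_eq hU hx, psi, mul_comm (logWt q u x)]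

/-! ### Necessity of the second pair of constants -/

/-- The inequality `∫_a^b gKer p μ ≤ K (∫ V dμ)^{1/p}` for finite measures `μ` on `(a, b]`. -/
def LocalBound (p : ℝ) (v : ℝ → ℝ≥0∞) (a b : ℝ) (K : ℝ≥0∞) : Prop :=
  ∀ μ : Measure ℝ, IsFiniteMeasure μ → μ (Ioc a b)ᶜ = 0 → ∫⁻ s, bigV p v s ∂μ ≠ ∞ →
    ∫⁻ y in Ioo a b, gKer p μ y ≤ K * (∫⁻ s, bigV p v s ∂μ) ^ (1 / p)

/-- A function of intervals that is monotone and dominated by the best constant in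
`LocalBound`. -/
structure IsLocalConst (p : ℝ) (v : ℝ → ℝ≥0∞) (X : ℝ → ℝ → ℝ≥0∞) : Prop where
  mono : ∀ {a a' b b' : ℝ}, 0 ≤ a' → a' ≤ a → a < b → b ≤ b' → X a b ≤ X a' b'
  le : ∀ {a b : ℝ} {K : ℝ≥0∞}, 0 ≤ a → a < b → LocalBound p v a b K → X a b ≤ localC p * K

theorem isLocalConst_innerA (hp : 0 < p) (hV : ∀ z, 0 < z → bigV p v z ≠ 0 ∧ bigV p v z ≠ ∞) :
    IsLocalConst p v (innerA p v) :=
  ⟨fun ha haa hab hbb => innerA_mono hp ha haa hab hbb,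
    fun ha hab H => innerA_le_of_measure hp ha hab hV H⟩

theorem isLocalConst_innerB (hp : 0 < p) (hV : ∀ z, 0 < z → bigV p v z ≠ 0 ∧ bigV p v z ≠ ∞) :
    IsLocalConst p v (innerB p v) :=
  ⟨fun ha haa _ hbb => innerB_mono hp ha haa hbb, fun ha _ H => innerB_le_of_measure hp ha hV H⟩

theorem localC_ne_zero (hp : 0 < p) : localC p ≠ 0 := by
  have h : 1 ≤ localC p := le_add_of_le_of_nonneg (ENNReal.one_le_rpow (by norm_num)
    (by positivity)) zero_le
  exact (one_pos.trans_le h).ne'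

theorem gKer_smul (hp : 0 < p) (c : ℝ≥0∞) (μ : Measure ℝ) (y : ℝ) :
    gKer p (c • μ) y = c ^ (1 / p) * gKer p μ y := by
  rw [gKer, gKer, lintegral_smul_measure, smul_eq_mul,
      ENNReal.mul_rpow_of_nonneg _ _ (by positivity)]

theorem gKer_mono_measure (hp : 0 < p) {μ ν : Measure ℝ} (h : μ ≤ ν) (y : ℝ) :
    gKer p μ y ≤ gKer p ν y :=
  ENNReal.rpow_le_rpow (lintegral_mono' h le_rfl) (by positivity)

/-- For `x > b` the inner integral contains all of `(a, b)`, so the left side of the tested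
inequality is at least `(∫_a^b gKer)^q U(b)`. -/
theorem TestBound.localBound {Q : ℝ≥0∞} (hp : 0 < p) (hq : 0 < q)
    (hU : ∀ t, 0 < t → 0 < tail q u t ∧ tail q u t < ∞) (H : TestBound p q v u Q) {a b : ℝ}
    (ha : 0 ≤ a) (hab : a < b) : LocalBound p v a b ((Q / tail q u b) ^ (1 / q)) := by
  intro μ _ _ hB
  have hb : 0 < b := ha.trans_lt hab
  have h1 : (∫⁻ y in Ioo a b, gKer p μ y) ^ q * tail q u b ≤
      Q * (∫⁻ s, bigV p v s ∂μ) ^ (q / p) := by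
    refine le_trans ?_ (H μ hB)
    refine (lintegral_const_mul_le _ _).trans (le_trans (setLIntegral_mono' measurableSet_Ioi
      fun x hx => ?_) (lintegral_mono_set (Ioi_subset_Ioi hb.le)))
    have hx : b < x := hx
    exact mul_le_mul' (ENNReal.rpow_le_rpow
      (lintegral_mono_set (Ioo_subset_Ioo ha hx.le)) hq.le) le_rfl
  have h2 : (∫⁻ y in Ioo a b, gKer p μ y) ^ q ≤
      Q / tail q u b * (∫⁻ s, bigV p v s ∂μ) ^ (q / p) := by
    rw [← ENNReal.mul_div_right_comm]
    exact (ENNReal.le_div_iff_mul_le (Or.inl (hU b hb).1.ne') (Or.inl (hU b hb).2.ne)).2 h1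
  calc ∫⁻ y in Ioo a b, gKer p μ y = ((∫⁻ y in Ioo a b, gKer p μ y) ^ q) ^ (1 / q) := by
        rw [← ENNReal.rpow_mul, mul_one_div_cancel hq.ne', ENNReal.rpow_one]
    _ ≤ (Q / tail q u b * (∫⁻ s, bigV p v s ∂μ) ^ (q / p)) ^ (1 / q) :=
        ENNReal.rpow_le_rpow h2 (by positivity)
    _ = _ := by
        rw [ENNReal.mul_rpow_of_nonneg _ _ (by positivity), ← ENNReal.rpow_mul,
          show q / p * (1 / q) = 1 / p by field_simp]

theorem TestBound.ne_top {Q : ℝ≥0∞} (hp : 0 < p) (hq : 0 < q) (hQ : Q ≠ ∞)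
    (hU : ∀ t, 0 < t → 0 < tail q u t ∧ tail q u t < ∞) (H : TestBound p q v u Q)
    {X : ℝ → ℝ → ℝ≥0∞} (hX : IsLocalConst p v X) {a b : ℝ} (ha : 0 ≤ a) (hab : a < b) :
    X a b ≠ ∞ :=
  ne_top_of_le_ne_top (ENNReal.mul_ne_top (localC_ne_top hp)
    (ENNReal.rpow_ne_top_of_nonneg (by positivity) (ENNReal.div_ne_top hQ (tail_pos hU _).ne')))
    (hX.le ha hab (H.localBound hp hq hU ha hab))

theorem TestBound.iSup_tail_mul_le {Q : ℝ≥0∞} (hp : 0 < p) (hq : 0 < q)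
    (hU : ∀ t, 0 < t → 0 < tail q u t ∧ tail q u t < ∞) (H : TestBound p q v u Q)
    {X : ℝ → ℝ → ℝ≥0∞} (hX : IsLocalConst p v X) :
    ⨆ (t : ℝ) (_ : 0 < t), tail q u t ^ (1 / q) * X 0 t ≤ localC p * Q ^ (1 / q) := by
  refine iSup₂_le fun t ht => ?_
  calc tail q u t ^ (1 / q) * X 0 t
      ≤ tail q u t ^ (1 / q) * (localC p * (Q / tail q u t) ^ (1 / q)) := by
        gcongr
        exact hX.le le_rfl ht (H.localBound hp hq hU le_rfl ht)
    _ = localC p * (tail q u t * (Q / tail q u t)) ^ (1 / q) := by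
        rw [ENNReal.mul_rpow_of_nonneg _ _ (by positivity)]; ring
    _ = _ := by rw [ENNReal.mul_div_cancel (hU t ht).1.ne' (hU t ht).2.ne]

/-- If every measure of cost at most 1 fell short, homogeneity would give the local bound with
constant `X a b / (2 localC)`, hence `X a b ≤ X a b / 2`, impossible for a finite nonzero value. -/
theorem IsLocalConst.exists_measure (hp : 0 < p)
    (hV : ∀ z, 0 < z → bigV p v z ≠ 0 ∧ bigV p v z ≠ ∞) {X : ℝ → ℝ → ℝ≥0∞}
    (hX : IsLocalConst p v X) {a b : ℝ} (ha : 0 ≤ a) (hab : a < b) (hXt : X a b ≠ ∞) :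
    ∃ μ : Measure ℝ, IsFiniteMeasure μ ∧ ∫⁻ s, bigV p v s ∂μ ≤ 1 ∧
      X a b / (2 * localC p) ≤ ∫⁻ y in Ioo a b, gKer p μ y := by
  by_contra! hcon
  have hX0 : X a b ≠ 0 := fun h => by
    have := hcon 0 inferInstance (by simp)
    rw [h, ENNReal.zero_div] at this
    exact not_lt_zero this
  have hlb : LocalBound p v a b (X a b / (2 * localC p)) := by
    intro μ hμ hμ0 hB
    by_cases hB0 : ∫⁻ s, bigV p v s ∂μ = 0
    · have hμz : μ = 0 := by
        rw [lintegral_eq_zero_iff (bigV_antitone hp).measurable] at hB0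
        rw [← Measure.measure_univ_eq_zero, ← union_compl_self (Ioc a b)]
        refine measure_union_null (measure_mono_null (fun s hs => ?_) (ae_iff.1 hB0)) hμ0
        exact (hV s (ha.trans_lt hs.1)).1
      have : ∀ y, gKer p μ y = 0 := fun y => by
        rw [gKer, hμz, lintegral_zero_measure, ENNReal.zero_rpow_of_pos (by positivity)]
      simp [this]
    · set B := ∫⁻ s, bigV p v s ∂μ with hBdef
      have h1 := hcon (B⁻¹ • μ) (μ.smul_finite (ENNReal.inv_ne_top.2 hB0)) (by
        rw [lintegral_smul_measure, smul_eq_mul, ← hBdef, ENNReal.inv_mul_cancel hB0 hB])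
      simp only [gKer_smul hp] at h1
      rw [lintegral_const_mul _ (measurable_gKer hp μ), ENNReal.inv_rpow] at h1
      have hBp : B ^ (1 / p) ≠ 0 ∧ B ^ (1 / p) ≠ ∞ := by
        simp [ENNReal.rpow_eq_zero_iff, ENNReal.rpow_eq_top_iff, hB0, hB, hp, hp.not_gt]
      rw [mul_comm]
      exact (ENNReal.inv_mul_le_iff hBp.1 hBp.2).1 h1.le
  have h2 := hX.le ha hab hlb
  have h3 : localC p * (X a b / (2 * localC p)) = X a b / 2 := by
    rw [div_eq_mul_inv, ENNReal.mul_inv (by simp) (by simp), div_eq_mul_inv]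
    calc _ = X a b * 2⁻¹ * (localC p * (localC p)⁻¹) := by ring
      _ = _ := by rw [ENNReal.mul_inv_cancel (localC_ne_zero hp) (localC_ne_top hp), mul_one]
  rw [h3] at h2
  exact absurd (ENNReal.half_lt_self hX0 hXt) (not_lt.2 h2)

theorem le_rpow_of_le_mul_rpow {r : ℝ} (hr1 : r < 1) {S D : ℝ≥0∞} (hS : S ≠ ∞) (h : S ≤ D * S ^ r) :
    S ≤ D ^ (1 / (1 - r)) := by
  have h1 : 0 < 1 - r := by linarith
  rcases eq_or_ne S 0 with rfl | hS0
  · exact zero_le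
  rw [one_div, ENNReal.le_rpow_inv_iff h1, ENNReal.rpow_sub _ _ hS0 hS, ENNReal.rpow_one]
  exact ENNReal.div_le_of_le_mul h

/-- Nearly extremal local measures of cost at most 1 are superposed with weights solving `a_k = τ_k
(a_k^{1/p} K_k)^q`. The total cost is at most `∑ a_k`. On block `k + 4`, which lies to the right of
the `k`-th window, the inner integral is at least `a_k^{1/p} K_k`, so the left side is at least `∑
a_k / 16`. Thus `∑ a_k ≤ 16 Q (∑ a_k)^{q/p}`, and since `F` is finite the sum can be divided out. -/
theorem TestBound.sum_le {Q : ℝ≥0∞} (hp : 0 < p) (hq : 0 < q) (hpq : q < p) (hQ : Q ≠ ∞)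
    (hU : ∀ t, 0 < t → 0 < tail q u t ∧ tail q u t < ∞)
    (hV : ∀ z, 0 < z → bigV p v z ≠ 0 ∧ bigV p v z ≠ ∞) (H : TestBound p q v u Q)
    {X : ℝ → ℝ → ℝ≥0∞} (hX : IsLocalConst p v X) (F : Finset ℤ)
    (hF : ∀ k ∈ F, (block q u k).Nonempty) :
    ∑ k ∈ F, (tau k * (X (pt q u (k - 4)) (pt q u (k + 3)) / (2 *
        localC p)) ^ q) ^ (1 / (1 - q / p))
      ≤ (16 * Q) ^ (1 / (1 - q / p)) := by
  have hr0 : 0 < q / p := by positivity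
  have hr1 : q / p < 1 := by rwa [div_lt_one hp]
  have hr : 0 < 1 - q / p := by linarith
  have hpq' : 0 < p - q := by linarith
  have hlt : ∀ k ∈ F, pt q u (k - 4) < pt q u (k + 3) := fun k hk => by
    obtain ⟨x, hx⟩ := hF k hk
    exact (pt_mono hU (show k - 4 ≤ k - 1 by omega)).trans_lt
      ((hx.1.trans_le hx.2).trans_le (pt_mono hU (by omega)))
  have hXt : ∀ k ∈ F, X (pt q u (k - 4)) (pt q u (k + 3)) ≠ ∞ :=
      fun k hk => H.ne_top hp hq hQ hU hX (pt_nonneg _) (hlt k hk)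
  set K : ℤ → ℝ≥0∞ := fun k => X (pt q u (k - 4)) (pt q u (k + 3)) / (2 * localC p) with hK
  have hKt : ∀ k ∈ F, K k ≠ ∞ := fun k hk =>
    ENNReal.div_ne_top (hXt k hk) (mul_ne_zero two_ne_zero (localC_ne_zero hp))
  have hex : ∀ k, ∃ μ : Measure ℝ, IsFiniteMeasure μ ∧ ∫⁻ s, bigV p v s ∂μ ≤ 1 ∧
      (k ∈ F → K k ≤ ∫⁻ y in Ioo (pt q u (k - 4)) (pt q u (k + 3)), gKer p μ y) := fun k => by
    by_cases hk : k ∈ F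
    · obtain ⟨μ, h1, h2, h3⟩ := hX.exists_measure hp hV (pt_nonneg _) (hlt k hk) (hXt k hk)
      exact ⟨μ, h1, h2, fun _ => h3⟩
    · exact ⟨0, inferInstance, by simp, fun h => absurd h hk⟩
  choose μ hμf hμV hμK using hex
  set a : ℤ → ℝ≥0∞ := fun k => (tau k * K k ^ q) ^ (1 / (1 - q / p)) with ha
  have hat : ∀ k ∈ F, a k ≠ ∞ := fun k hk => ENNReal.rpow_ne_top_of_nonneg (by positivity)
    (ENNReal.mul_ne_top (tau_ne_top k) (ENNReal.rpow_ne_top_of_nonneg hq.le (hKt k hk)))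
  set σ : Measure ℝ := ∑ k ∈ F, a k • μ k with hσ
  have hσB : ∫⁻ s, bigV p v s ∂σ ≤ ∑ k ∈ F, a k := by
    rw [hσ, lintegral_finsetSum_measure]
    refine Finset.sum_le_sum fun k _ => ?_
    rw [lintegral_smul_measure, smul_eq_mul]
    exact mul_le_of_le_one_right' (hμV k)
  have hSt : ∑ k ∈ F, a k ≠ ∞ := ENNReal.sum_ne_top.2 hat
  have hσB' := ne_top_of_le_ne_top hSt hσB
  have hσs : SFinite σ := Finset.sum_induction _ (fun ν : Measure ℝ => SFinite ν)
    (fun _ _ _ _ => inferInstance) inferInstance fun _ _ => inferInstance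
  refine le_rpow_of_le_mul_rpow hr1 hSt ?_
  calc ∑ k ∈ F, a k ≤ ∑ k ∈ F, 16 * ∫⁻ x in block q u (k + 4),
        (∫⁻ y in Ioo 0 x, gKer p σ y) ^ q * wt q u x := by
        refine Finset.sum_le_sum fun k hk => ?_
        obtain ⟨x₀, hx₀⟩ := hF k hk
        have hpos : 0 < pt q u (k + 4 - 1) :=
          (pos_of_mem_block hx₀).trans_le (hx₀.2.trans (pt_mono hU (by omega)))
        have hτ : tau k ≤ 16 * ∫⁻ x in block q u (k + 4), wt q u x := by
          calc tau k ≤ 4 * tau (k + 4) :=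
                (tau_le_four_mul k).trans (mul_le_mul' le_rfl (tau_antitone (by omega)))
            _ ≤ 4 * (4 * ∫⁻ x in block q u (k + 4), wt q u x) := by
                gcongr; exact le_lintegral_block hU hpos
            _ = _ := by rw [← mul_assoc]; norm_num
        have hak : a k = tau k * (a k ^ (1 / p) * K k) ^ q := by
          rw [ENNReal.mul_rpow_of_nonneg _ _ hq.le, ← ENNReal.rpow_mul, one_div_mul_eq_div,
            mul_left_comm]
          change (tau k * K k ^ q) ^ (1 / (1 - q / p)) =
            ((tau k * K k ^ q) ^ (1 / (1 - q / p))) ^ (q / p) * (tau k * K k ^ q)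
          rw [← ENNReal.rpow_mul]
          nth_rewrite 3 [← ENNReal.rpow_one (tau k * K k ^ q)]
          rw [← ENNReal.rpow_add_of_nonneg _ _ (by positivity) zero_le_one]
          congr 1
          field_simp
          ring
        calc a k = tau k * (a k ^ (1 / p) * K k) ^ q := hak
          _ ≤ 16 * (∫⁻ x in block q u (k + 4), wt q u x) * (a k ^ (1 / p) * K k) ^ q := by gcongr
          _ = 16 * ((a k ^ (1 / p) * K k) ^ q * ∫⁻ x in block q u (k + 4), wt q u x) := by ring
          _ ≤ _ := by
            refine mul_le_mul' le_rfl ((lintegral_const_mul_le _ _).trans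
              (setLIntegral_mono' (measurableSet_block _) fun x hx => ?_))
            refine mul_le_mul' (ENNReal.rpow_le_rpow ?_ hq.le) le_rfl
            have hx1 : pt q u (k + 3) < x := by
              have := hx.1; rwa [show k + 4 - 1 = k + 3 by ring] at this
            calc a k ^ (1 / p) * K k
                ≤ a k ^ (1 / p) * ∫⁻ y in Ioo (pt q u (k - 4)) (pt q u (k + 3)), gKer p (μ k) y :=
                  mul_le_mul' le_rfl (hμK k hk)
              _ ≤ ∫⁻ y in Ioo (pt q u (k - 4)) (pt q u (k + 3)), gKer p σ y := by
                  refine (lintegral_const_mul_le _ _).trans (lintegral_mono fun y => ?_)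
                  rw [← gKer_smul hp]
                  exact gKer_mono_measure hp
                    (Finset.single_le_sum (f :=
                        fun k => a k • μ k) (fun _ _ => Measure.zero_le _) hk) y
              _ ≤ _ := lintegral_mono_set (Ioo_subset_Ioo (pt_nonneg _) hx1.le)
    _ = 16 * ∑ k ∈ F, ∫⁻ x in block q u (k + 4),
        (∫⁻ y in Ioo 0 x, gKer p σ y) ^ q * wt q u x := by rw [Finset.mul_sum]
    _ ≤ 16 * ∫⁻ x in Ioi 0, (∫⁻ y in Ioo 0 x, gKer p σ y) ^ q * wt q u x := by
        rw [← tsum_lintegral_block_add hU _ 4]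
        exact mul_le_mul' le_rfl (ENNReal.sum_le_tsum F)
    _ ≤ 16 * (Q * (∑ k ∈ F, a k) ^ (q / p)) := by
        refine mul_le_mul' le_rfl ((H σ hσB').trans (mul_le_mul' le_rfl ?_))
        exact ENNReal.rpow_le_rpow hσB hr0.le
    _ = _ := by rw [mul_assoc]

/-- The constant of the necessity part for the second pair of constants. -/
noncomputable def necD (p q : ℝ) : ℝ≥0∞ :=
  (2 ^ (q / (p - q)) * (2 * localC p) ^ (p * q / (p - q)) * 2) ^ ((p - q) / (p * q)) * 16 ^ (1 / q)

theorem necD_ne_top (hp : 0 < p) (hq : 0 < q) (hpq : q < p) : necD p q ≠ ∞ := by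
  have : 0 < p - q := by linarith
  refine ENNReal.mul_ne_top (ENNReal.rpow_ne_top_of_nonneg (by positivity)
    (ENNReal.mul_ne_top (ENNReal.mul_ne_top ?_ ?_) (by simp))) ?_
  · exact ENNReal.rpow_ne_top_of_nonneg (by positivity) (by simp)
  · exact ENNReal.rpow_ne_top_of_nonneg (by positivity)
      (ENNReal.mul_ne_top (by simp) (localC_ne_top hp))
  · exact ENNReal.rpow_ne_top_of_nonneg (by positivity) (by simp)

/-- For `x` in block `k` the interval `(ζ^{-1}(x), ζ(x))` lies in the window from `pt (k - 4)` to
`pt (k + 3)` and `U(x)` is comparable to `τ_k`, so the integral over the block is at most a constant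
times the `k`-th term of `TestBound.sum_le`. -/
theorem TestBound.lintegral_local_le {Q : ℝ≥0∞} (hp : 0 < p) (hq : 0 < q) (hpq : q < p)
    (hQ : Q ≠ ∞) (hU : ∀ t, 0 < t → 0 < tail q u t ∧ tail q u t < ∞)
    (hV : ∀ z, 0 < z → bigV p v z ≠ 0 ∧ bigV p v z ≠ ∞) (H : TestBound p q v u Q)
    {X : ℝ → ℝ → ℝ≥0∞} (hX : IsLocalConst p v X) :
    (∫⁻ x in Ioi (0 : ℝ), wt q u x * tail q u x ^ (q / (p - q)) *
      X (zetaInv q u x) (zeta q u x) ^ (p * q / (p - q))) ^ ((p - q) / (p * q)) ≤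
      necD p q * Q ^ (1 / q) := by
  have hpq' : 0 < p - q := by linarith
  set D : ℝ≥0∞ := 2 ^ (q / (p - q)) * (2 * localC p) ^ (p * q / (p - q)) * 2 with hD
  set e : ℝ := 1 / (1 - q / p) with he
  have he' : e = p / (p - q) := by rw [he, (ratio_exponent hp hpq).2, one_div_div]
  set a : ℤ → ℝ≥0∞ := fun k =>
    (tau k * (X (pt q u (k - 4)) (pt q u (k + 3)) / (2 * localC p)) ^ q) ^ e with ha
  classical
  have hblock : ∀ k, ∫⁻ x in block q u k, wt q u x * tail q u x ^ (q / (p - q)) *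
      X (zetaInv q u x) (zeta q u x) ^ (p * q / (p - q)) ≤
      D * if (block q u k).Nonempty then a k else 0 := fun k => by
    split_ifs with hne
    · set Y := X (pt q u (k - 4)) (pt q u (k + 3)) with hY
      calc _ ≤ ∫⁻ x in block q u k, wt q u x * ((2 * tau k) ^ (q / (p - q)) *
            Y ^ (p * q / (p - q))) := by
            refine setLIntegral_mono' (measurableSet_block k) fun x hx => ?_
            have hx0 := pos_of_mem_block hx
            rw [mul_assoc]
            refine mul_le_mul' le_rfl (mul_le_mul' (ENNReal.rpow_le_rpow ?_ (by positivity))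
              (ENNReal.rpow_le_rpow ?_ (by positivity)))
            · refine ((mem_block_iff hU hx0).1 hx).2.le.trans ?_
              have := tau_le_two_mul (k - 1)
              rwa [sub_add_cancel] at this
            · refine hX.mono (pt_nonneg _) (zetaInv_mem hU hx).1 ?_ (zeta_mem hU hx).2
              exact ((zetaInv_mem hU hx).2.trans (pt_mono hU (by omega))).trans_lt
                (hx.1.trans_le (le_zeta hU hx0))
        _ = (∫⁻ x in block q u k, wt q u x) * ((2 * tau k) ^ (q / (p - q)) *
            Y ^ (p * q / (p - q))) := by
            obtain ⟨x, hx⟩ := hne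
            have hab : pt q u (k - 4) < pt q u (k + 3) :=
              (pt_mono hU (show k - 4 ≤ k - 1 by omega)).trans_lt
                ((hx.1.trans_le hx.2).trans_le (pt_mono hU (by omega)))
            exact lintegral_mul_const' _ _ (ENNReal.mul_ne_top
              (ENNReal.rpow_ne_top_of_nonneg (by positivity)
                (ENNReal.mul_ne_top (by simp) (tau_ne_top k)))
              (ENNReal.rpow_ne_top_of_nonneg (by positivity)
                (H.ne_top hp hq hQ hU hX (pt_nonneg _) hab)))
        _ ≤ 2 * tau k * ((2 * tau k) ^ (q / (p - q)) * Y ^ (p * q / (p - q))) := by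
            gcongr; exact lintegral_block_le hU k
        _ = D * a k := by
            have hYe : Y = (2 * localC p) * (Y / (2 * localC p)) := by
              rw [ENNReal.mul_div_cancel (mul_ne_zero two_ne_zero (localC_ne_zero hp))
                (ENNReal.mul_ne_top (by simp) (localC_ne_top hp))]
            have h1 : tau k ^ (p / (p - q)) = tau k * tau k ^ (q / (p - q)) := by
              rw [show p / (p - q) = 1 + q / (p - q) by field_simp; ring,
                ENNReal.rpow_add _ _ (tau_ne_zero k) (tau_ne_top k), ENNReal.rpow_one]
            rw [ha]
            simp only [← hY]
            rw [ENNReal.mul_rpow_of_nonneg (tau k) _ (by rw [he']; positivity), he', h1,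
              ← ENNReal.rpow_mul, show q * (p / (p - q)) = p * q / (p - q) by ring,
              ENNReal.mul_rpow_of_nonneg _ _ (by positivity)]
            nth_rewrite 1 [hYe]
            rw [ENNReal.mul_rpow_of_nonneg (2 * localC p) _ (by positivity), hD]
            ring
    · rw [not_nonempty_iff_eq_empty.1 hne]; simp
  have hsum : ∫⁻ x in Ioi (0 : ℝ), wt q u x * tail q u x ^ (q / (p - q)) *
      X (zetaInv q u x) (zeta q u x) ^ (p * q / (p - q)) ≤ D * (16 * Q) ^ e := by
    rw [← tsum_lintegral_block hU]
    refine (ENNReal.tsum_le_tsum hblock).trans ?_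
    rw [ENNReal.tsum_mul_left]
    refine mul_le_mul' le_rfl ?_
    rw [ENNReal.tsum_eq_iSup_sum]
    refine iSup_le fun F => ?_
    rw [← Finset.sum_filter]
    exact H.sum_le hp hq hpq hQ hU hV hX _ fun k hk => (Finset.mem_filter.1 hk).2
  refine (ENNReal.rpow_le_rpow hsum (by positivity)).trans_eq ?_
  rw [ENNReal.mul_rpow_of_nonneg D _ (by positivity), ← ENNReal.rpow_mul (16 * Q), he',
    show p / (p - q) * ((p - q) / (p * q)) = 1 / q by field_simp,
    ENNReal.mul_rpow_of_nonneg 16 _ (by positivity), necD, mul_assoc]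

end

section

variable {n : ℕ} {p q : ℝ} {u v : ℝ → ℝ≥0∞}

/-! ### Degenerate weights and the theorem -/

theorem bigV_eq_top (hp : 0 < p) {z : ℝ} (hz : 0 < z) (h : bigV p v z = ∞) (y : ℝ) :
    bigV p v y = ∞ := by
  rcases le_total y z with hyz | hyz
  · exact top_le_iff.1 (h ▸ bigV_antitone hp hyz)
  · have h1 := rpow_mul_bigV_mono (v := v) hp hz hyz
    rw [h, ENNReal.mul_top (ofReal_rpow_ne_zero hz p), top_le_iff, ENNReal.mul_eq_top] at h1
    rcases h1 with h1 | h1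
    · exact h1.2
    · exact absurd h1.1 (ofReal_rpow_ne_top (hz.trans_le hyz) p)

theorem ae_eq_zero_of_bigV_eq_zero (hp : 0 < p)
    (hv : AEMeasurable v (volume.restrict (Ioi (0 : ℝ)))) {z : ℝ} (h : bigV p v z = 0) :
    v =ᵐ[volume.restrict (Ioi (0 : ℝ))] 0 := by
  have hm : AEMeasurable (fun y => v y / (ENNReal.ofReal y ^ p + ENNReal.ofReal z ^ p))
      (volume.restrict (Ioi (0 : ℝ))) :=
    hv.div ((ENNReal.measurable_ofReal.pow_const p).add_const _).aemeasurable
  rw [bigV, lintegral_eq_zero_iff' hm] at h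
  refine h.mono fun y hy => (ENNReal.div_eq_zero_iff.1 hy).resolve_right ?_
  exact ENNReal.add_ne_top.2 ⟨ENNReal.rpow_ne_top_of_nonneg hp.le (by simp),
    ENNReal.rpow_ne_top_of_nonneg hp.le (by simp)⟩

theorem maximalNorm_eq_zero (hp : 0 < p) (hV : bigV p v 1 = ∞) : maximalNorm n p q v u = 0 := by
  refine nonpos_iff_eq_zero.1 (iSup_le fun f => iSup₂_le fun hf hf0 => absurd ?_ hf0)
  have h1 := rearrAvg_rpow_mul_le (v := v) hp (fun x => ‖f x‖ₑ) one_pos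
  refine (ae_eq_zero_of_rearrAvg_eq_zero one_pos ?_).mono fun x hx => enorm_eq_zero.1 hx
  by_contra hne
  rw [hV, ENNReal.ofReal_one, ENNReal.one_rpow, one_mul, ENNReal.mul_top
    (by simp [ENNReal.rpow_eq_zero_iff, hne, hp.not_gt]), top_le_iff] at h1
  have h2 := hf.2
  rw [gammaNorm, h1, ENNReal.top_rpow_of_pos (by positivity)] at h2
  exact lt_irrefl _ h2

theorem calA0_eq_zero (hp : 0 < p) (hq : 0 < q) (hV : ∀ y, bigV p v y = ∞) :
    calA0 p q v u = 0 := by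
  rw [calA0]
  split_ifs with h
  · have : ∀ t : ℝ, 0 < t → (∫⁻ x in Ioo 0 t, u x) ^ (p / q) /
        (ENNReal.ofReal t ^ p * bigV p v t) = 0 := fun t ht => by
      rw [hV, ENNReal.mul_top (ofReal_rpow_ne_zero ht p), ENNReal.div_top]
    rw [ENNReal.rpow_eq_zero_iff]
    exact Or.inl ⟨nonpos_iff_eq_zero.1 (iSup₂_le fun t ht => (this t ht).le), by positivity⟩
  · have hpq : 0 < p - q := by linarith [not_le.1 h]
    rw [← ENNReal.rpow_mul, setLIntegral_congr_fun (g :=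
        fun _ => 0) measurableSet_Ioi fun t ht => ?_,
      lintegral_zero, ENNReal.zero_rpow_of_pos (by positivity)]
    have hneg : q / (q - p) < 0 := div_neg_of_pos_of_neg hq (by linarith)
    rw [hV, ENNReal.mul_top (ofReal_rpow_ne_zero ht p), ENNReal.top_rpow_of_neg hneg, zero_mul,
      zero_mul]

theorem bfA0_eq_zero (hp : 0 < p) (hq : 0 < q) (hV : ∀ y, bigV p v y = ∞) :
    bfA0 p q v u = 0 := by
  rw [bfA0]
  split_ifs with h
  · simp [hV, hp]
  · have hpq : 0 < p - q := by linarith [not_le.1 h]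
    have h1 : 0 < q / (p - q) := by positivity
    have h2 : 0 < (p - q) / q := by positivity
    simp [hV, h1, h2, hp]

theorem innerA_eq_zero (hp : 0 < p) (hV : ∀ y, bigV p v y = ∞) {a b : ℝ} (ha : 0 ≤ a) (hb : 0 < b) :
    innerA p v a b = 0 := by
  rw [innerA]
  split_ifs with h
  · rw [hV, ENNReal.top_rpow_of_pos (by positivity), ENNReal.mul_top (by simpa using hb),
      ENNReal.div_top]
  · have h1 : 0 < p - 1 := by linarith [not_le.1 h]
    rw [setLIntegral_congr_fun (g := fun _ => 0) measurableSet_Ioo fun t ht => ?_,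
      lintegral_zero, ENNReal.zero_rpow_of_pos (by positivity)]
    rw [hV, ENNReal.mul_top (ofReal_rpow_ne_zero (ha.trans_lt ht.1) p), ENNReal.div_top,
      ENNReal.zero_rpow_of_pos (by positivity)]

theorem innerB_eq_zero (hp : 0 < p) (hV : ∀ y, bigV p v y = ∞) (a b : ℝ) :
    innerB p v a b = 0 := by
  rw [innerB]
  split_ifs with h
  · simp [hV, hp]
  · have h1 : 0 < p - 1 := by linarith [not_le.1 h]
    have h2 : 0 < (p - 1) / p := by positivity
    simp [hV, h1, h2]

theorem calA2_eq_zero (hp : 0 < p) (hq : 0 < q)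
    (hU : ∀ t, 0 < t → 0 < tail q u t ∧ tail q u t < ∞) (hV : ∀ y, bigV p v y = ∞) :
    calA2 p q v u = 0 := by
  rcases le_or_gt p q with h | h
  · rw [calA2_of_le h]
    refine nonpos_iff_eq_zero.1 (iSup₂_le fun t ht => ?_)
    rw [innerA_eq_zero hp hV le_rfl ht, mul_zero]
  · have hpq : 0 < p - q := by linarith
    rw [calA2_of_lt hp hq h, setLIntegral_congr_fun (g := fun _ => 0) measurableSet_Ioi
      fun t ht => ?_, lintegral_zero, ENNReal.zero_rpow_of_pos (by positivity)]
    have ht : 0 < t := ht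
    rw [innerA_eq_zero hp hV (by rw [zetaInv_eq_lev]; exact lev_nonneg _) (ht.trans_le (le_zeta hU ht)),
      ENNReal.zero_rpow_of_pos (by positivity), mul_zero]

theorem bfA2_eq_zero (hp : 0 < p) (hq : 0 < q) (hV : ∀ y, bigV p v y = ∞) :
    bfA2 p q v u = 0 := by
  rcases le_or_gt p q with h | h
  · rw [bfA2_of_le hp h]
    refine nonpos_iff_eq_zero.1 (iSup₂_le fun t ht => ?_)
    rw [innerB_eq_zero hp hV, mul_zero]
  · have hpq : 0 < p - q := by linarith
    rw [bfA2_of_lt hp hq h]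
    simp only [innerB_eq_zero hp hV]
    rw [ENNReal.zero_rpow_of_pos (by positivity)]
    simp only [mul_zero, lintegral_zero]
    rw [ENNReal.zero_rpow_of_pos (by positivity)]

theorem innerA_eq_top (hp : 0 < p) (hV : ∀ y, 0 < y → bigV p v y = 0) {a b : ℝ} (ha : 0 ≤ a)
    (hab : a < b) : innerA p v a b = ∞ := by
  rw [innerA]
  split_ifs with h
  · rw [hV b (ha.trans_lt hab), ENNReal.zero_rpow_of_pos (by positivity), mul_zero,
      ENNReal.div_zero (by simpa using hab)]
  · have h1 : 0 < p - 1 := by linarith [not_le.1 h]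
    rw [setLIntegral_congr_fun (g := fun _ => ∞) measurableSet_Ioo fun t ht => ?_,
      setLIntegral_const, Real.volume_Ioo, ENNReal.top_mul (by simpa using hab),
      ENNReal.top_rpow_of_pos (by positivity)]
    rw [hV t (ha.trans_lt ht.1), mul_zero, ENNReal.div_zero (by simpa using ht.1),
      ENNReal.top_rpow_of_pos (by positivity)]

theorem not_ae_eq_zero (hU : ∀ t, 0 < t → 0 < tail q u t ∧ tail q u t < ∞) :
    ¬ u =ᵐ[volume.restrict (Ioi (0 : ℝ))] 0 := fun h => by
  refine (hU 1 one_pos).1.ne' ?_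
  have h1 : u =ᵐ[volume.restrict (Ioi (1 : ℝ))] 0 :=
    ae_restrict_of_ae_restrict_of_subset (Ioi_subset_Ioi zero_le_one) h
  rw [tail, lintegral_congr_ae (g := 0) (h1.mono fun x hx => by simp [wt, hx])]
  simp

theorem calA2_eq_top (hp : 0 < p) (hq : 0 < q) (hu : AEMeasurable u (volume.restrict (Ioi (0 : ℝ))))
    (hU : ∀ t, 0 < t → 0 < tail q u t ∧ tail q u t < ∞) (hV : ∀ y, 0 < y → bigV p v y = 0) :
    calA2 p q v u = ∞ := by
  rcases le_or_gt p q with h | h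
  · rw [calA2_of_le h]
    refine top_le_iff.1 (le_iSup₂_of_le 1 one_pos ?_)
    rw [innerA_eq_top hp hV le_rfl one_pos, ENNReal.mul_top]
    simp [ENNReal.rpow_eq_zero_iff, (hU 1 one_pos).1.ne', hq.le]
  · have hpq : 0 < p - q := by linarith
    rw [calA2_of_lt hp hq h, setLIntegral_congr_fun (g := fun x => wt q u x *
      tail q u x ^ (q / (p - q)) * ∞) measurableSet_Ioi fun t ht => ?_]
    · have hm : AEMeasurable (fun x => wt q u x * tail q u x ^ (q / (p - q)))
          (volume.restrict (Ioi (0 : ℝ))) :=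
        (aemeasurable_wt hu).mul (tail_antitone.measurable.pow_const _).aemeasurable
      rw [lintegral_mul_const'' _ hm, ENNReal.mul_top, ENNReal.top_rpow_of_pos (by positivity)]
      rw [Ne, lintegral_eq_zero_iff' hm]
      refine fun h0 => not_ae_eq_zero hU ?_
      filter_upwards [h0, ae_restrict_mem measurableSet_Ioi] with x hx hx0
      have h1 := hU x hx0
      have hx : wt q u x * tail q u x ^ (q / (p - q)) = 0 := hx
      have h2 : wt q u x = 0 := (mul_eq_zero.1 hx).resolve_right
        (by simp [ENNReal.rpow_eq_zero_iff, h1.1.ne', h1.2.ne])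
      refine (mul_eq_zero.1 h2).resolve_left ?_
      exact ofReal_rpow_ne_zero hx0 _
    · have ht : 0 < t := ht
      obtain ⟨k, hk⟩ := mem_iUnion.1 ((iUnion_block hU).symm ▸ ht : t ∈ ⋃ k, block q u k)
      have hlt : zetaInv q u t < zeta q u t :=
        ((zetaInv_mem hU hk).2.trans (pt_mono hU (by omega))).trans_lt
          (hk.1.trans_le (le_zeta hU ht))
      rw [innerA_eq_top hp hV (by rw [zetaInv_eq_lev]; exact lev_nonneg _) hlt,
        ENNReal.top_rpow_of_pos (by positivity)]

theorem maximalNorm_eq_top (hp : 0 < p) (hq : 0 < q)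
    (hu : AEMeasurable u (volume.restrict (Ioi (0 : ℝ))))
    (hU : ∀ t, 0 < t → 0 < tail q u t ∧ tail q u t < ∞)
    (hv : v =ᵐ[volume.restrict (Ioi (0 : ℝ))] 0) : maximalNorm n p q v u = ∞ := by
  have hnorm : gammaNorm p v (fun _ : EuclideanSpace ℝ (Fin n) => ‖(1 : ℝ)‖ₑ) = 0 := by
    rw [gammaNorm, lintegral_congr_ae (g := 0) (hv.mono fun x hx => by simp [hx])]
    simp [hp]
  have hM : ∀ x : EuclideanSpace ℝ (Fin n), maximal (fun _ => 1) x ≠ 0 := fun x => by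
    refine (one_pos.trans_le (le_iSup₂_of_le (f := fun (r : ℝ) (_ : 0 < r) =>
      (∫⁻ y in Metric.ball x r, ‖(1 : ℝ)‖ₑ) / volume (Metric.ball x r)) 1 one_pos ?_)).ne'
    rw [enorm_one, setLIntegral_one, ENNReal.div_self (Metric.measure_ball_pos _ _ one_pos).ne'
      measure_ball_lt_top.ne]
  have hnz : ¬ (maximal fun _ : EuclideanSpace ℝ (Fin n) => (1 : ℝ)) =ᵐ[volume] 0 := fun h => by
    obtain ⟨x, hx⟩ := h.exists
    exact hM x hx
  have hgz : gammaNorm q u (maximal fun _ : EuclideanSpace ℝ (Fin n) => (1 : ℝ)) ≠ 0 := fun h => by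
    rw [gammaNorm, ENNReal.rpow_eq_zero_iff_of_pos (by positivity), lintegral_eq_zero_iff'] at h
    · refine not_ae_eq_zero hU ?_
      filter_upwards [h, ae_restrict_mem measurableSet_Ioi] with x hx hx0
      refine (mul_eq_zero.1 hx).resolve_left fun h0 => hnz ?_
      exact ae_eq_zero_of_rearrAvg_eq_zero hx0 ((ENNReal.rpow_eq_zero_iff_of_pos hq).1 h0)
    · refine AEMeasurable.mul ?_ hu
      have : AEMeasurable (rearrAvg (maximal fun _ : EuclideanSpace ℝ (Fin n) => (1 : ℝ)))
          (volume.restrict (Ioi (0 : ℝ))) :=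
        aemeasurable_restrict_of_antitoneOn measurableSet_Ioi
          fun x hx y _ hxy => rearrAvg_antitone _ hx hxy
      exact this.pow_const _
  refine top_le_iff.1 (le_iSup_of_le (fun _ => 1) (le_iSup₂_of_le ⟨aemeasurable_const, ?_⟩ ?_ ?_))
  · rw [hnorm]; exact ENNReal.zero_lt_top
  · intro h
    obtain ⟨x, hx⟩ := h.exists
    exact one_ne_zero hx
  · rw [hnorm, ENNReal.div_zero hgz]

theorem exists_necessity_const (hp : 0 < p) (hq : 0 < q) :
    ∃ E : ℝ≥0∞, E ≠ ∞ ∧ ∀ u v : ℝ → ℝ≥0∞,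
      AEMeasurable u (volume.restrict (Ioi (0 : ℝ))) →
      (∀ t, 0 < t → 0 < tail q u t ∧ tail q u t < ∞) →
      (∀ z, 0 < z → bigV p v z ≠ 0 ∧ bigV p v z ≠ ∞) → ∀ Q : ℝ≥0∞, Q ≠ ∞ →
      TestBound p q v u Q →
        calA0 p q v u + calA2 p q v u + bfA0 p q v u + bfA2 p q v u ≤ E * Q ^ (1 / q) := by
  have h2 : ∃ D : ℝ≥0∞, D ≠ ∞ ∧ ∀ u v : ℝ → ℝ≥0∞,
      (∀ t, 0 < t → 0 < tail q u t ∧ tail q u t < ∞) →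
      (∀ z, 0 < z → bigV p v z ≠ 0 ∧ bigV p v z ≠ ∞) → ∀ Q : ℝ≥0∞, Q ≠ ∞ →
      TestBound p q v u Q →
        calA2 p q v u ≤ D * Q ^ (1 / q) ∧ bfA2 p q v u ≤ D * Q ^ (1 / q) := by
    rcases le_or_gt p q with h | h
    · refine ⟨localC p, localC_ne_top hp, fun u v hU hV Q hQ H => ⟨?_, ?_⟩⟩
      · rw [calA2_of_le h]; exact H.iSup_tail_mul_le hp hq hU (isLocalConst_innerA hp hV)
      · rw [bfA2_of_le hp h]; exact H.iSup_tail_mul_le hp hq hU (isLocalConst_innerB hp hV)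
    · refine ⟨necD p q, necD_ne_top hp hq h, fun u v hU hV Q hQ H => ⟨?_, ?_⟩⟩
      · rw [calA2_of_lt hp hq h]
        exact H.lintegral_local_le hp hq h hQ hU hV (isLocalConst_innerA hp hV)
      · rw [bfA2_of_lt hp hq h]
        exact H.lintegral_local_le hp hq h hQ hU hV (isLocalConst_innerB hp hV)
  obtain ⟨D, hD, H2⟩ := h2
  refine ⟨2 * (necC p q + D), ENNReal.mul_ne_top (by simp)
    (ENNReal.add_ne_top.2 ⟨necC_ne_top hq, hD⟩), fun u v hu hU hV Q hQ H => ?_⟩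
  calc _ ≤ necC p q * Q ^ (1 / q) + D * Q ^ (1 / q) + necC p q * Q ^ (1 / q) + D * Q ^ (1 / q) :=
        add_le_add (add_le_add (add_le_add (calA0_le hp hq hu hV H) (H2 u v hU hV Q hQ H).1)
          (bfA0_le hp hq hu hU hV hQ H)) (H2 u v hU hV Q hQ H).2
    _ = _ := by ring

/-- The equivalence of `maximalNorm` with the sum of the four constants, in `ℝ≥0∞`. -/
theorem exists_equivalence_const (hn : 1 ≤ n) (hp : 0 < p) (hq : 0 < q) :
    ∃ L C : ℝ≥0∞, L ≠ ∞ ∧ C ≠ ∞ ∧ C ≠ 0 ∧ ∀ u v : ℝ → ℝ≥0∞,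
      AEMeasurable u (volume.restrict (Ioi (0 : ℝ))) →
      AEMeasurable v (volume.restrict (Ioi (0 : ℝ))) →
      (∀ t, 0 < t → 0 < tail q u t ∧ tail q u t < ∞) →
        calA0 p q v u + calA2 p q v u + bfA0 p q v u + bfA2 p q v u ≤
          L * maximalNorm n p q v u ∧
        maximalNorm n p q v u ≤
          C * (calA0 p q v u + calA2 p q v u + bfA0 p q v u + bfA2 p q v u) := by
  obtain ⟨C₁, hC₁, H₁⟩ := lintegral_gKer_le_maximalNorm (n := n) hn hp hq
  obtain ⟨C₂, hC₂, H₂⟩ := maximalNorm_le_of_measure (n := n) hn hp hq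
  obtain ⟨C₃, hC₃, H₃⟩ := exists_sufficiency_const hp hq
  obtain ⟨E, hE, H₄⟩ := exists_necessity_const hp hq
  refine ⟨E * C₁ ^ (1 / q) + 1, C₂ * C₃ + 1,
    ENNReal.add_ne_top.2 ⟨ENNReal.mul_ne_top hE
      (ENNReal.rpow_ne_top_of_nonneg (by positivity) hC₁), by simp⟩,
    ENNReal.add_ne_top.2 ⟨ENNReal.mul_ne_top hC₂ hC₃, by simp⟩, by simp,
    fun u v hu hv hU => ?_⟩
  -- If `V` is infinite at one positive point, it is infinite everywhere. A finite norm then forces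
  -- `f = 0`, so the supremum runs over an empty family, and the four constants vanish because `V`
  -- stands in their denominators.
  by_cases hVt : ∃ z, 0 < z ∧ bigV p v z = ∞
  · obtain ⟨z, hz, hVz⟩ := hVt
    have hV := bigV_eq_top hp hz hVz
    rw [maximalNorm_eq_zero hp (hV 1), calA0_eq_zero hp hq hV, bfA0_eq_zero hp hq hV,
      calA2_eq_zero hp hq hU hV, bfA2_eq_zero hp hq hV]
    simp
  -- If `V` vanishes at a positive point, then `v = 0` almost everywhere. The function 1 has norm
  -- zero while its maximal function has nonzero norm, so the operator norm is infinite, and so is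
  -- `calA2`.
  by_cases hV0 : ∃ z, 0 < z ∧ bigV p v z = 0
  · obtain ⟨z, hz, hVz⟩ := hV0
    have hv0 := ae_eq_zero_of_bigV_eq_zero hp hv hVz
    have hV : ∀ y, 0 < y → bigV p v y = 0 := fun y _ => by
      rw [bigV, lintegral_congr_ae (g := 0) (hv0.mono fun x hx => by simp [hx])]
      simp
    rw [maximalNorm_eq_top hp hq hu hU hv0, calA2_eq_top hp hq hu hU hV]
    simp
  push Not at hVt hV0
  have hV : ∀ z, 0 < z → bigV p v z ≠ 0 ∧ bigV p v z ≠ ∞ := fun z hz => ⟨hV0 z hz, hVt z hz⟩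
  constructor
  · rcases eq_or_ne (maximalNorm n p q v u) ∞ with hN | hN
    · rw [hN, ENNReal.mul_top (by simp)]; exact le_top
    · refine (H₄ u v hu hU hV (C₁ * maximalNorm n p q v u ^ q)
        (ENNReal.mul_ne_top hC₁ (ENNReal.rpow_ne_top_of_nonneg hq.le hN))
        (fun σ _ hB => H₁ u v hu hv hV0 σ hB)).trans ?_
      rw [ENNReal.mul_rpow_of_nonneg _ _ (by positivity), ← ENNReal.rpow_mul,
        mul_one_div_cancel hq.ne', ENNReal.rpow_one, ← mul_assoc]
      exact mul_le_mul' le_self_add le_rfl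
  · set K := calA0 p q v u + calA2 p q v u + bfA0 p q v u + bfA2 p q v u with hK
    rcases eq_or_ne K ∞ with hKt | hKt
    · rw [hKt, ENNReal.mul_top (by simp)]; exact le_top
    · have h1 := H₂ u v hu hv hV0 (C₃ * K) (H₃ u v hu hU hV K hKt
        (le_self_add.trans (le_self_add.trans le_self_add)) (le_add_self.trans le_self_add)
        (le_add_self.trans (le_self_add.trans le_self_add)) le_add_self)
      refine h1.trans ?_
      rw [← mul_assoc]
      exact mul_le_mul' le_self_add le_rfl

end

end GammaMaximal

theorem theorem6p1 (n : ℕ) (hn : 1 ≤ n) (p q : ℝ) (hp : 0 < p) (hq : 0 < q) :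
    ∃ c C : ℝ, 0 < c ∧ 0 < C ∧
      ∀ u v : ℝ → ℝ≥0∞,
        AEMeasurable u (volume.restrict (Ioi (0 : ℝ))) →
        AEMeasurable v (volume.restrict (Ioi (0 : ℝ))) →
        (∀ t : ℝ, 0 < t → 0 < GammaMaximal.tail q u t ∧ GammaMaximal.tail q u t < ∞) →
        ENNReal.ofReal c *
            (GammaMaximal.calA0 p q v u + GammaMaximal.calA2 p q v u +
              GammaMaximal.bfA0 p q v u + GammaMaximal.bfA2 p q v u)
          ≤ GammaMaximal.maximalNorm n p q v u ∧
        GammaMaximal.maximalNorm n p q v u ≤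
          ENNReal.ofReal C *
            (GammaMaximal.calA0 p q v u + GammaMaximal.calA2 p q v u +
              GammaMaximal.bfA0 p q v u + GammaMaximal.bfA2 p q v u) := by
  obtain ⟨L, C, hL, hC, hC0, H⟩ := GammaMaximal.exists_equivalence_const (n := n) hn hp hq
  have hL' : 0 < L.toReal + 1 := by positivity
  -- The summand 1 keeps the constant invertible in case `L` is zero.
  refine ⟨(L.toReal + 1)⁻¹, C.toReal, inv_pos.2 hL', ENNReal.toReal_pos hC0 hC,
    fun u v hu hv hU => ⟨?_, ?_⟩⟩
  · rw [ENNReal.ofReal_inv_of_pos hL', ENNReal.inv_mul_le_iff (by simpa using hL') (by simp)]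
    refine (H u v hu hv hU).1.trans (mul_le_mul' ?_ le_rfl)
    rw [ENNReal.ofReal_add ENNReal.toReal_nonneg zero_le_one, ENNReal.ofReal_toReal hL]
    exact le_self_add
  · rw [ENNReal.ofReal_toReal hC]
    exact (H u v hu hv hU).2
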